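/- Let $\Bbbk$ be a commutative ring. Operads are non-symmetric differential graded operads over $\Bbbk$, with partial compositions $\circ_i$ and differential of degree $-1$. Let $\mathcal X$ be the surjection operad: $\mathcal X(n)_k$ ($n\ge 1$) is free on the sequences $u=(u(1),\dots,u(n+k))$ with set of values exactly $\{1,\dots,n\}$ and $u(i)\ne u(i+1)$. The relative degree of $(u(a),\dots,u(b))$ in $u$ is the number of $a\le i<b$ such that $u(i)$ is not the last occurrence of its value in $u$. For $v\in\mathcal X(m)_l$ written $v=(v_0,t,v_1,\dots,t,v_r)$ with $r$ occurrences of $t$, and $u\in\mathcal X(n)_k$, $$v\circ_t u=\sum_{1=j_0\le\dots\le j_r=n+k}\pm(\beta v_0,\alpha u_1,\beta v_1,\dots,\alpha u_r,\beta v_r),$$ where $u_p=(u(j_{p-1}),\dots,u(j_p))$, $\alpha(s)=s+t-1$, $\beta(s)=s$ for $s<t$ and $\beta(s)=s+n-1$ for $s>t$, and the sign is the Koszul sign of $v_1,\dots,v_r,u_1,\dots,u_r\mapsto u_1,v_1,\dots,u_r,v_r$, with $u_p$ in its relative degree in $u$ and $v_q$ in the relative degree of $(t,v_q,t)$ (of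 $(t,v_r)$ if $q=r$) in $v$. The differential is $\delta u=\sum_i(-1)^{r_i}(u(1),\dots,\widehat{u(i)},\dots,u(n+k))$, over the $i$ such that $u(i)$ is not the only occurrence of its value, sequences with equal neighbours being zero; $r_i$ is the relative degree of $(u(1),\dots,u(i))$ if $u(i)$ is not a last occurrence, and of $(u(1),\dots,u(j+1))$ if $u(i)$ is a last occurrence and $u(j)$ the penultimate one. The cacti operad $\mathcal C\subset\mathcal X$ is the suboperad spanned by the cacti, that is, the sequences without a subsequence $(i,j,i,j)$, $i\ne j$. For a cactus $u\in\mathcal C(n)_k$ with $u^{-1}(n)=\{i\}$ put $$u^\square=\sum_{j<i}(-1)^{k+|u|_j}\,\mathring u_j,\qquad u^\blacksquare=-\sum_{j>i}(-1)^{k+|u|_j}\,\mathring u_j,$$ where $\mathring u_j$ is obtained from $u$ by replacing $u(j)$ with $(u(j),n+1,u(j))$ and $|u|_j$ is the relative degree of $(u(1),\dots,u(j))$ in $u$; extend both operations linearly to the span of these cacti. Let $\mathcal A^{(2)}_\infty$, the operad of homotopy matching dialgebras, be the free graded operad on generators $m_\xi$ of arity $n$ and degree $n-2$, for $\xi\in\{\square,\blacksquare\}^{n-1}$,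 $n\ge2$, with the differential $$\partial m_\xi=\sum_{p+q-1=n,\;p,q\ge2}\;\sum_{i=1}^{p}\;\sum_{\xi'\circ_i\xi''=\xi}(-1)^{i-1+q(p-i)}\,m_{\xi'}\circ_i m_{\xi''},$$ where $\xi'\in\{\square,\blacksquare\}^{p-1}$, $\xi''\in\{\square,\blacksquare\}^{q-1}$ and $\xi'\circ_i\xi''=(\xi'_1,\dots,\xi'_{i-1},\xi''_1,\dots,\xi''_{q-1},\xi'_i,\dots,\xi'_{p-1})$. Let $\mathcal A_\infty$ be the free graded operad on $m_n$ of arity $n$ and degree $n-2$, $n\ge2$, with $\partial m_n=\sum_{p+q-1=n,\;p,q\ge2}\sum_{i=1}^p(-1)^{i-1+q(p-i)}m_p\circ_i m_q$. **Theorem.** $\mathcal A^{(2)}_\infty$, $\mathcal A_\infty$ and $\mathcal C$ are dg operads, and there is a unique morphism of dg operads $\mu:\mathcal A^{(2)}_\infty\to\mathcal C$ such that $$\mu(m_\square)=(2,1),\quad \mu(m_\blacksquare)=(1,2),\quad \mu(m_{\xi\square})=\mu(m_\xi)^\square,\quad \mu(m_{\xi\blacksquare})=\mu(m_\xi)^\blacksquare$$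 for all strings $\xi$ of length $n-1\ge1$; here each $\mu(m_\xi)$ lies in the span of the cacti of arity $n$ in which $n$ occurs exactly once. Moreover there is a morphism of dg operads $\varphi:\mathcal A_\infty\to\mathcal A^{(2)}_\infty$ with $\varphi(m_n)=\sum_{\xi\in\{\square,\blacksquare\}^{n-1}}m_\xi$ for $n\ge2$, and the composite $\psi=\mu\varphi:\mathcal A_\infty\to\mathcal C$ satisfies $\psi(m_2)=(2,1)+(1,2)$ and, for suitable signs and all $n\ge3$, $$\psi(m_n)=\sum_{u\in\mathcal C'_n}(-1)^{p(u)}u,$$ where $\mathcal C'_n$ is the set of cacti $u\in\mathcal C(n)_{n-2}$ without a subsequence $(i,j,i)$ such that $j=i+1$ or $j<i$. -/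

import Mathlib

universe u

/-! ## Differential graded (non-symmetric) operads -/

/-- The underlying data of a (non-symmetric) dg operad over `𝕜`: graded modules `obj n d`
(arity `n`, degree `d`), a map `diff` of degree `-1`, partial compositions `∘_i` and a unit.
The target arity `r = m + n - 1` and the target degree are variables with an equation, so that no
transport along equalities of indices is needed. The axioms are in `IsDGOperad`. -/
structure DGOperadData (𝕜 : Type u) [CommRing 𝕜] where
  obj : ℕ → ℤ → Type u
  [addCommGroup : ∀ n d, AddCommGroup (obj n d)]
  [module : ∀ n d, Module 𝕜 (obj n d)]
  diff : ∀ {n : ℕ} {d e : ℤ}, e + 1 = d → obj n d →ₗ[𝕜] obj n e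
  circ : ∀ {m n r : ℕ} {a b c : ℤ} (i : ℕ), 1 ≤ i ∧ i ≤ m → r + 1 = m + n → c = a + b →
    obj m a →ₗ[𝕜] obj n b →ₗ[𝕜] obj r c
  one : obj 1 0

attribute [instance] DGOperadData.addCommGroup DGOperadData.module

/-- The axioms of a (non-symmetric) dg operad. -/
structure IsDGOperad {𝕜 : Type u} [CommRing 𝕜] (O : DGOperadData 𝕜) : Prop where
  /-- `(x ∘_i y) ∘_j z = (-1)^{|y||z|} (x ∘_j z) ∘_{i+l-1} y` for `j < i`, `z` of arity `l`. -/
  circ_parallel : ∀ {m n l r r' s : ℕ} {a b c ab ac abc : ℤ} {i j k : ℕ}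
    (_ : j < i) (_ : k + 1 = i + l)
    (hi : 1 ≤ i ∧ i ≤ m) (hj : 1 ≤ j ∧ j ≤ r) (hj' : 1 ≤ j ∧ j ≤ m) (hk : 1 ≤ k ∧ k ≤ r')
    (hr : r + 1 = m + n) (hs : s + 1 = r + l) (hr' : r' + 1 = m + l) (hs' : s + 1 = r' + n)
    (hab : ab = a + b) (habc : abc = ab + c) (hac : ac = a + c) (habc' : abc = ac + b)
    (x : O.obj m a) (y : O.obj n b) (z : O.obj l c),
    O.circ j hj hs habc (O.circ i hi hr hab x y) z =
      Int.negOnePow (b * c) • O.circ k hk hs' habc' (O.circ j hj' hr' hac x z) y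
  /-- `(x ∘_i y) ∘_j z = x ∘_i (y ∘_{j-i+1} z)` for `i ≤ j < i + n`, `y` of arity `n`. -/
  circ_sequential : ∀ {m n l r r' s : ℕ} {a b c ab bc abc : ℤ} {i j k : ℕ}
    (_ : i ≤ j) (_ : j < i + n) (_ : k + i = j + 1)
    (hi : 1 ≤ i ∧ i ≤ m) (hj : 1 ≤ j ∧ j ≤ r) (hk : 1 ≤ k ∧ k ≤ n)
    (hr : r + 1 = m + n) (hs : s + 1 = r + l) (hr' : r' + 1 = n + l) (hs' : s + 1 = m + r')
    (hab : ab = a + b) (habc : abc = ab + c) (hbc : bc = b + c) (habc' : abc = a + bc)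
    (x : O.obj m a) (y : O.obj n b) (z : O.obj l c),
    O.circ j hj hs habc (O.circ i hi hr hab x y) z =
      O.circ i hi hs' habc' x (O.circ k hk hr' hbc y z)
  one_circ : ∀ {n : ℕ} {d : ℤ} (hi : 1 ≤ 1 ∧ 1 ≤ 1) (hr : n + 1 = 1 + n) (hd : d = 0 + d)
    (x : O.obj n d), O.circ 1 hi hr hd O.one x = x
  circ_one : ∀ {n : ℕ} {d : ℤ} {i : ℕ} (hi : 1 ≤ i ∧ i ≤ n) (hr : n + 1 = n + 1)
    (hd : d = d + 0) (x : O.obj n d), O.circ i hi hr hd x O.one = x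
  diff_diff : ∀ {n : ℕ} {d e f : ℤ} (he : e + 1 = d) (hf : f + 1 = e) (x : O.obj n d),
    O.diff hf (O.diff he x) = 0
  /-- `∂(x ∘_i y) = ∂x ∘_i y + (-1)^{|x|} x ∘_i ∂y`. -/
  diff_circ : ∀ {m n r : ℕ} {a b c a' b' c' : ℤ} {i : ℕ} (hi : 1 ≤ i ∧ i ≤ m)
    (hr : r + 1 = m + n) (hc : c = a + b) (ha' : a' + 1 = a) (hb' : b' + 1 = b)
    (hc' : c' + 1 = c) (h₁ : c' = a' + b) (h₂ : c' = a + b')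
    (x : O.obj m a) (y : O.obj n b),
    O.diff hc' (O.circ i hi hr hc x y) =
      O.circ i hi hr h₁ (O.diff ha' x) y +
        Int.negOnePow a • O.circ i hi hr h₂ x (O.diff hb' y)

/-- Morphisms of dg operads: degree-preserving linear maps compatible with the differentials, the
partial compositions and the units. -/
@[ext]
structure DGOperadHom {𝕜 : Type u} [CommRing 𝕜] (O P : DGOperadData 𝕜) where
  map : ∀ {n : ℕ} {d : ℤ}, O.obj n d →ₗ[𝕜] P.obj n d
  map_diff : ∀ {n : ℕ} {d e : ℤ} (h : e + 1 = d) (x : O.obj n d),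
    map (O.diff h x) = P.diff h (map x)
  map_circ : ∀ {m n r : ℕ} {a b c : ℤ} (i : ℕ) (hi : 1 ≤ i ∧ i ≤ m) (hr : r + 1 = m + n)
    (hc : c = a + b) (x : O.obj m a) (y : O.obj n b),
    map (O.circ i hi hr hc x y) = P.circ i hi hr hc (map x) (map y)
  map_one : map O.one = P.one

/-- Composition of morphisms of dg operads. -/
def DGOperadHom.comp {𝕜 : Type u} [CommRing 𝕜] {O P Q : DGOperadData 𝕜}
    (g : DGOperadHom P Q) (f : DGOperadHom O P) : DGOperadHom O Q where
  map := g.map ∘ₗ f.map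
  map_diff h x := by simp [f.map_diff, g.map_diff]
  map_circ i hi hr hc x y := by simp [f.map_circ, g.map_circ]
  map_one := by simp [f.map_one, g.map_one]

/-- A suboperad: submodules closed under the differential and the compositions, containing
the unit. -/
structure SubDGOperad {𝕜 : Type u} [CommRing 𝕜] (O : DGOperadData 𝕜) where
  carrier : ∀ (n : ℕ) (d : ℤ), Submodule 𝕜 (O.obj n d)
  diff_mem : ∀ {n : ℕ} {d e : ℤ} (h : e + 1 = d) (x : O.obj n d), x ∈ carrier n d →
    O.diff h x ∈ carrier n e
  circ_mem : ∀ {m n r : ℕ} {a b c : ℤ} (i : ℕ) (hi : 1 ≤ i ∧ i ≤ m) (hr : r + 1 = m + n)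
    (hc : c = a + b) (x : O.obj m a) (y : O.obj n b), x ∈ carrier m a → y ∈ carrier n b →
    O.circ i hi hr hc x y ∈ carrier r c
  one_mem : O.one ∈ carrier 1 0

/-- The operad structure of a suboperad, restricted from the ambient one. -/
def SubDGOperad.toData {𝕜 : Type u} [CommRing 𝕜] {O : DGOperadData 𝕜} (S : SubDGOperad O) :
    DGOperadData 𝕜 where
  obj n d := S.carrier n d
  diff h := (O.diff h).restrict (fun x hx => S.diff_mem h x hx)
  circ i hi hr hc := LinearMap.mk₂ 𝕜
    (fun x y => ⟨O.circ i hi hr hc x y, S.circ_mem i hi hr hc x y x.2 y.2⟩)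
    (fun x x' y => Subtype.ext (by simp)) (fun t x y => Subtype.ext (by simp))
    (fun x y y' => Subtype.ext (by simp)) (fun t x y => Subtype.ext (by simp))
  one := ⟨O.one, S.one_mem⟩

/-! ## Quasi-free operads -/

/-- Formal operadic expressions in generators `g ∈ G n d` of arity `n` and degree `d`. -/
inductive OpExpr (𝕜 : Type u) (G : ℕ → ℤ → Type) : ℕ → ℤ → Type u
  | gen {n : ℕ} {d : ℤ} (g : G n d) : OpExpr 𝕜 G n d
  | one : OpExpr 𝕜 G 1 0
  | zero {n : ℕ} {d : ℤ} : OpExpr 𝕜 G n d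
  | add {n : ℕ} {d : ℤ} (x y : OpExpr 𝕜 G n d) : OpExpr 𝕜 G n d
  | smul {n : ℕ} {d : ℤ} (t : 𝕜) (x : OpExpr 𝕜 G n d) : OpExpr 𝕜 G n d
  | circ {m n r : ℕ} {a b c : ℤ} (i : ℕ) (hi : 1 ≤ i ∧ i ≤ m) (hr : r + 1 = m + n)
      (hc : c = a + b) (x : OpExpr 𝕜 G m a) (y : OpExpr 𝕜 G n b) : OpExpr 𝕜 G r c

namespace OpExpr

/-- The relations between formal expressions that are forced by the axioms of a graded operad:
those of a module, bilinearity of the compositions, the operadic relations, the unit relations;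
and closure under the operations. -/
inductive Rel (𝕜 : Type u) [CommRing 𝕜] (G : ℕ → ℤ → Type) :
    ∀ {n : ℕ} {d : ℤ}, OpExpr 𝕜 G n d → OpExpr 𝕜 G n d → Prop
  | add_comm {n : ℕ} {d : ℤ} (x y : OpExpr 𝕜 G n d) : Rel 𝕜 G (add x y) (add y x)
  | add_assoc {n : ℕ} {d : ℤ} (x y z : OpExpr 𝕜 G n d) :
      Rel 𝕜 G (add (add x y) z) (add x (add y z))
  | zero_add {n : ℕ} {d : ℤ} (x : OpExpr 𝕜 G n d) : Rel 𝕜 G (add zero x) x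
  | one_smul {n : ℕ} {d : ℤ} (x : OpExpr 𝕜 G n d) : Rel 𝕜 G (smul 1 x) x
  | mul_smul {n : ℕ} {d : ℤ} (s t : 𝕜) (x : OpExpr 𝕜 G n d) :
      Rel 𝕜 G (smul (s * t) x) (smul s (smul t x))
  | smul_add {n : ℕ} {d : ℤ} (t : 𝕜) (x y : OpExpr 𝕜 G n d) :
      Rel 𝕜 G (smul t (add x y)) (add (smul t x) (smul t y))
  | add_smul {n : ℕ} {d : ℤ} (s t : 𝕜) (x : OpExpr 𝕜 G n d) :
      Rel 𝕜 G (smul (s + t) x) (add (smul s x) (smul t x))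
  | smul_zero {n : ℕ} {d : ℤ} (t : 𝕜) : Rel 𝕜 G (smul t (zero : OpExpr 𝕜 G n d)) zero
  | zero_smul {n : ℕ} {d : ℤ} (x : OpExpr 𝕜 G n d) : Rel 𝕜 G (smul 0 x) zero
  | circ_add_left {m n r : ℕ} {a b c : ℤ} (i : ℕ) (hi : 1 ≤ i ∧ i ≤ m) (hr : r + 1 = m + n)
      (hc : c = a + b) (x x' : OpExpr 𝕜 G m a) (y : OpExpr 𝕜 G n b) :
      Rel 𝕜 G (circ i hi hr hc (add x x') y) (add (circ i hi hr hc x y) (circ i hi hr hc x' y))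
  | circ_add_right {m n r : ℕ} {a b c : ℤ} (i : ℕ) (hi : 1 ≤ i ∧ i ≤ m) (hr : r + 1 = m + n)
      (hc : c = a + b) (x : OpExpr 𝕜 G m a) (y y' : OpExpr 𝕜 G n b) :
      Rel 𝕜 G (circ i hi hr hc x (add y y')) (add (circ i hi hr hc x y) (circ i hi hr hc x y'))
  | circ_smul_left {m n r : ℕ} {a b c : ℤ} (i : ℕ) (hi : 1 ≤ i ∧ i ≤ m) (hr : r + 1 = m + n)
      (hc : c = a + b) (t : 𝕜) (x : OpExpr 𝕜 G m a) (y : OpExpr 𝕜 G n b) :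
      Rel 𝕜 G (circ i hi hr hc (smul t x) y) (smul t (circ i hi hr hc x y))
  | circ_smul_right {m n r : ℕ} {a b c : ℤ} (i : ℕ) (hi : 1 ≤ i ∧ i ≤ m) (hr : r + 1 = m + n)
      (hc : c = a + b) (t : 𝕜) (x : OpExpr 𝕜 G m a) (y : OpExpr 𝕜 G n b) :
      Rel 𝕜 G (circ i hi hr hc x (smul t y)) (smul t (circ i hi hr hc x y))
  | parallel {m n l r r' s : ℕ} {a b c ab ac abc : ℤ} {i j k : ℕ}
      (hji : j < i) (hkl : k + 1 = i + l)
      (hi : 1 ≤ i ∧ i ≤ m) (hj : 1 ≤ j ∧ j ≤ r) (hj' : 1 ≤ j ∧ j ≤ m) (hk : 1 ≤ k ∧ k ≤ r')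
      (hr : r + 1 = m + n) (hs : s + 1 = r + l) (hr' : r' + 1 = m + l) (hs' : s + 1 = r' + n)
      (hab : ab = a + b) (habc : abc = ab + c) (hac : ac = a + c) (habc' : abc = ac + b)
      (x : OpExpr 𝕜 G m a) (y : OpExpr 𝕜 G n b) (z : OpExpr 𝕜 G l c) :
      Rel 𝕜 G (circ j hj hs habc (circ i hi hr hab x y) z)
        (smul (((Int.negOnePow (b * c) : ℤˣ) : ℤ) : 𝕜)
          (circ k hk hs' habc' (circ j hj' hr' hac x z) y))
  | sequential {m n l r r' s : ℕ} {a b c ab bc abc : ℤ} {i j k : ℕ}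
      (hij : i ≤ j) (hjn : j < i + n) (hki : k + i = j + 1)
      (hi : 1 ≤ i ∧ i ≤ m) (hj : 1 ≤ j ∧ j ≤ r) (hk : 1 ≤ k ∧ k ≤ n)
      (hr : r + 1 = m + n) (hs : s + 1 = r + l) (hr' : r' + 1 = n + l) (hs' : s + 1 = m + r')
      (hab : ab = a + b) (habc : abc = ab + c) (hbc : bc = b + c) (habc' : abc = a + bc)
      (x : OpExpr 𝕜 G m a) (y : OpExpr 𝕜 G n b) (z : OpExpr 𝕜 G l c) :
      Rel 𝕜 G (circ j hj hs habc (circ i hi hr hab x y) z)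
        (circ i hi hs' habc' x (circ k hk hr' hbc y z))
  | one_circ {n : ℕ} {d : ℤ} (hi : 1 ≤ 1 ∧ 1 ≤ 1) (hr : n + 1 = 1 + n) (hd : d = 0 + d)
      (x : OpExpr 𝕜 G n d) : Rel 𝕜 G (circ 1 hi hr hd one x) x
  | circ_one {n : ℕ} {d : ℤ} {i : ℕ} (hi : 1 ≤ i ∧ i ≤ n) (hr : n + 1 = n + 1)
      (hd : d = d + 0) (x : OpExpr 𝕜 G n d) : Rel 𝕜 G (circ i hi hr hd x one) x
  | congr_add_left {n : ℕ} {d : ℤ} (x x' y : OpExpr 𝕜 G n d) (h : Rel 𝕜 G x x') :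
      Rel 𝕜 G (add x y) (add x' y)
  | congr_add_right {n : ℕ} {d : ℤ} (x y y' : OpExpr 𝕜 G n d) (h : Rel 𝕜 G y y') :
      Rel 𝕜 G (add x y) (add x y')
  | congr_smul {n : ℕ} {d : ℤ} (t : 𝕜) (x x' : OpExpr 𝕜 G n d) (h : Rel 𝕜 G x x') :
      Rel 𝕜 G (smul t x) (smul t x')
  | congr_circ_left {m n r : ℕ} {a b c : ℤ} (i : ℕ) (hi : 1 ≤ i ∧ i ≤ m) (hr : r + 1 = m + n)
      (hc : c = a + b) (x x' : OpExpr 𝕜 G m a) (y : OpExpr 𝕜 G n b) (h : Rel 𝕜 G x x') :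
      Rel 𝕜 G (circ i hi hr hc x y) (circ i hi hr hc x' y)
  | congr_circ_right {m n r : ℕ} {a b c : ℤ} (i : ℕ) (hi : 1 ≤ i ∧ i ≤ m) (hr : r + 1 = m + n)
      (hc : c = a + b) (x : OpExpr 𝕜 G m a) (y y' : OpExpr 𝕜 G n b) (h : Rel 𝕜 G y y') :
      Rel 𝕜 G (circ i hi hr hc x y) (circ i hi hr hc x y')

end OpExpr

/-- The free graded operad on `G`: formal expressions modulo the axioms of a graded operad.
This is its arity `n`, degree `d` component. -/
def FreeOp (𝕜 : Type u) [CommRing 𝕜] (G : ℕ → ℤ → Type) (n : ℕ) (d : ℤ) : Type u :=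
  Quot (OpExpr.Rel 𝕜 G (n := n) (d := d))

namespace FreeOp

/-- The class of a formal expression. -/
def mk {𝕜 : Type u} [CommRing 𝕜] {G : ℕ → ℤ → Type} {n : ℕ} {d : ℤ} (x : OpExpr 𝕜 G n d) :
    FreeOp 𝕜 G n d := Quot.mk _ x

/-- The generators of the free operad. -/
def gen (𝕜 : Type u) [CommRing 𝕜] {G : ℕ → ℤ → Type} {n : ℕ} {d : ℤ} (g : G n d) :
    FreeOp 𝕜 G n d := mk (.gen g)

instance {𝕜 : Type u} [CommRing 𝕜] {G : ℕ → ℤ → Type} {n : ℕ} {d : ℤ} :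
    Add (FreeOp 𝕜 G n d) where
  add := Quot.map₂ .add (fun x y y' h => .congr_add_right x y y' h)
    (fun x x' y h => .congr_add_left x x' y h)

instance {𝕜 : Type u} [CommRing 𝕜] {G : ℕ → ℤ → Type} {n : ℕ} {d : ℤ} :
    Zero (FreeOp 𝕜 G n d) where
  zero := mk .zero

instance {𝕜 : Type u} [CommRing 𝕜] {G : ℕ → ℤ → Type} {n : ℕ} {d : ℤ} :
    Neg (FreeOp 𝕜 G n d) where
  neg := Quot.map (.smul (-1)) (fun x x' h => .congr_smul (-1) x x' h)

instance {𝕜 : Type u} [CommRing 𝕜] {G : ℕ → ℤ → Type} {n : ℕ} {d : ℤ} :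
    AddCommGroup (FreeOp 𝕜 G n d) where
  add_assoc := by rintro ⟨x⟩ ⟨y⟩ ⟨z⟩; exact Quot.sound (.add_assoc x y z)
  add_comm := by rintro ⟨x⟩ ⟨y⟩; exact Quot.sound (.add_comm x y)
  zero_add := by rintro ⟨x⟩; exact Quot.sound (.zero_add x)
  add_zero := by
    rintro ⟨x⟩
    exact (Quot.sound (.add_comm x .zero)).trans (Quot.sound (.zero_add x))
  neg_add_cancel := by
    rintro ⟨x⟩
    change mk (.add (.smul (-1) x) x) = mk .zero
    have h1 : mk (.add (.smul (-1) x) x) = mk (.add (.smul (-1) x) (.smul 1 x)) :=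
      (Quot.sound (.congr_add_right _ _ _ (.one_smul x))).symm
    have h2 : mk (.add (.smul (-1) x) (.smul 1 x)) = mk (.smul (-1 + 1) x) :=
      (Quot.sound (.add_smul (-1) 1 x)).symm
    rw [h1, h2, neg_add_cancel]
    exact Quot.sound (.zero_smul x)
  nsmul := nsmulRec
  zsmul := zsmulRec

instance {𝕜 : Type u} [CommRing 𝕜] {G : ℕ → ℤ → Type} {n : ℕ} {d : ℤ} :
    Module 𝕜 (FreeOp 𝕜 G n d) where
  smul t := Quot.map (.smul t) (fun x x' h => .congr_smul t x x' h)
  one_smul := by rintro ⟨x⟩; exact Quot.sound (.one_smul x)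
  mul_smul := by rintro s t ⟨x⟩; exact Quot.sound (.mul_smul s t x)
  smul_zero := fun t => Quot.sound (.smul_zero t)
  smul_add := by rintro t ⟨x⟩ ⟨y⟩; exact Quot.sound (.smul_add t x y)
  add_smul := by rintro s t ⟨x⟩; exact Quot.sound (.add_smul s t x)
  zero_smul := by rintro ⟨x⟩; exact Quot.sound (.zero_smul x)

/-- The partial compositions of the free operad. -/
def circ {𝕜 : Type u} [CommRing 𝕜] {G : ℕ → ℤ → Type} {m n r : ℕ} {a b c : ℤ} (i : ℕ)
    (hi : 1 ≤ i ∧ i ≤ m) (hr : r + 1 = m + n) (hc : c = a + b) :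
    FreeOp 𝕜 G m a →ₗ[𝕜] FreeOp 𝕜 G n b →ₗ[𝕜] FreeOp 𝕜 G r c :=
  LinearMap.mk₂ 𝕜
    (Quot.map₂ (.circ i hi hr hc) (fun x y y' h => .congr_circ_right i hi hr hc x y y' h)
      (fun x x' y h => .congr_circ_left i hi hr hc x x' y h))
    (by rintro ⟨x⟩ ⟨x'⟩ ⟨y⟩; exact Quot.sound (.circ_add_left i hi hr hc x x' y))
    (by rintro t ⟨x⟩ ⟨y⟩; exact Quot.sound (.circ_smul_left i hi hr hc t x y))
    (by rintro ⟨x⟩ ⟨y⟩ ⟨y'⟩; exact Quot.sound (.circ_add_right i hi hr hc x y y'))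
    (by rintro t ⟨x⟩ ⟨y⟩; exact Quot.sound (.circ_smul_right i hi hr hc t x y))

/-- The derivation of degree `-1` on formal expressions with prescribed values `dg` on the
generators: `∂(x ∘_i y) = ∂x ∘_i y + (-1)^{|x|} x ∘_i ∂y`. -/
def diffExpr {𝕜 : Type u} [CommRing 𝕜] {G : ℕ → ℤ → Type}
    (dg : ∀ {n : ℕ} {d e : ℤ}, e + 1 = d → G n d → FreeOp 𝕜 G n e) :
    ∀ {n : ℕ} {d : ℤ}, OpExpr 𝕜 G n d → ∀ e : ℤ, e + 1 = d → FreeOp 𝕜 G n e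
  | _, _, .gen g, _, h => dg h g
  | _, _, .one, _, _ => 0
  | _, _, .zero, _, _ => 0
  | _, _, .add x y, e, h => diffExpr dg x e h + diffExpr dg y e h
  | _, _, .smul t x, e, h => t • diffExpr dg x e h
  | _, _, .circ (a := a) (b := b) i hi hr hc x y, _, h =>
      circ i hi hr (by omega) (diffExpr dg x (a - 1) (by omega)) (mk y) +
        Int.negOnePow a • circ i hi hr (by omega) (mk x) (diffExpr dg y (b - 1) (by omega))

theorem mk_add {𝕜 : Type u} [CommRing 𝕜] {G : ℕ → ℤ → Type} {n : ℕ} {d : ℤ}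
    (x y : OpExpr 𝕜 G n d) : mk (.add x y) = mk x + mk y := rfl

theorem mk_smul {𝕜 : Type u} [CommRing 𝕜] {G : ℕ → ℤ → Type} {n : ℕ} {d : ℤ} (t : 𝕜)
    (x : OpExpr 𝕜 G n d) : mk (.smul t x) = t • mk x := rfl

theorem mk_zero {𝕜 : Type u} [CommRing 𝕜] {G : ℕ → ℤ → Type} {n : ℕ} {d : ℤ} :
    mk (.zero : OpExpr 𝕜 G n d) = 0 := rfl

theorem mk_circ {𝕜 : Type u} [CommRing 𝕜] {G : ℕ → ℤ → Type} {m n r : ℕ} {a b c : ℤ} (i : ℕ)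
    (hi : 1 ≤ i ∧ i ≤ m) (hr : r + 1 = m + n) (hc : c = a + b)
    (x : OpExpr 𝕜 G m a) (y : OpExpr 𝕜 G n b) :
    mk (.circ i hi hr hc x y) = circ i hi hr hc (mk x) (mk y) := rfl

theorem units_smul_eq {𝕜 : Type u} [CommRing 𝕜] {M : Type*} [AddCommGroup M] [Module 𝕜 M]
    (s : ℤˣ) (x : M) : (((s : ℤ) : 𝕜)) • x = s • x := by
  rcases Int.units_eq_one_or s with rfl | rfl <;> simp

theorem circ_parallel {𝕜 : Type u} [CommRing 𝕜] {G : ℕ → ℤ → Type}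
    {m n l r r' s : ℕ} {a b c ab ac abc : ℤ} {i j k : ℕ}
    (hji : j < i) (hkl : k + 1 = i + l)
    (hi : 1 ≤ i ∧ i ≤ m) (hj : 1 ≤ j ∧ j ≤ r) (hj' : 1 ≤ j ∧ j ≤ m) (hk : 1 ≤ k ∧ k ≤ r')
    (hr : r + 1 = m + n) (hs : s + 1 = r + l) (hr' : r' + 1 = m + l) (hs' : s + 1 = r' + n)
    (hab : ab = a + b) (habc : abc = ab + c) (hac : ac = a + c) (habc' : abc = ac + b)
    (x : FreeOp 𝕜 G m a) (y : FreeOp 𝕜 G n b) (z : FreeOp 𝕜 G l c) :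
    circ j hj hs habc (circ i hi hr hab x y) z =
      Int.negOnePow (b * c) • circ k hk hs' habc' (circ j hj' hr' hac x z) y := by
  rcases x with ⟨x⟩; rcases y with ⟨y⟩; rcases z with ⟨z⟩
  rw [← units_smul_eq (𝕜 := 𝕜)]
  exact Quot.sound (.parallel hji hkl hi hj hj' hk hr hs hr' hs' hab habc hac habc' x y z)

theorem circ_sequential {𝕜 : Type u} [CommRing 𝕜] {G : ℕ → ℤ → Type}
    {m n l r r' s : ℕ} {a b c ab bc abc : ℤ} {i j k : ℕ}
    (hij : i ≤ j) (hjn : j < i + n) (hki : k + i = j + 1)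
    (hi : 1 ≤ i ∧ i ≤ m) (hj : 1 ≤ j ∧ j ≤ r) (hk : 1 ≤ k ∧ k ≤ n)
    (hr : r + 1 = m + n) (hs : s + 1 = r + l) (hr' : r' + 1 = n + l) (hs' : s + 1 = m + r')
    (hab : ab = a + b) (habc : abc = ab + c) (hbc : bc = b + c) (habc' : abc = a + bc)
    (x : FreeOp 𝕜 G m a) (y : FreeOp 𝕜 G n b) (z : FreeOp 𝕜 G l c) :
    circ j hj hs habc (circ i hi hr hab x y) z =
      circ i hi hs' habc' x (circ k hk hr' hbc y z) := by
  rcases x with ⟨x⟩; rcases y with ⟨y⟩; rcases z with ⟨z⟩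
  exact Quot.sound (.sequential hij hjn hki hi hj hk hr hs hr' hs' hab habc hbc habc' x y z)

theorem one_circ {𝕜 : Type u} [CommRing 𝕜] {G : ℕ → ℤ → Type} {n : ℕ} {d e : ℤ}
    (hi : 1 ≤ 1 ∧ 1 ≤ 1) (hr : n + 1 = 1 + n) (hd : d = 0 + e) (he : e = d)
    (x : FreeOp 𝕜 G n e) : circ 1 hi hr hd (mk .one) x = he ▸ x := by
  subst he
  rcases x with ⟨x⟩
  exact Quot.sound (.one_circ hi hr hd x)

theorem circ_one {𝕜 : Type u} [CommRing 𝕜] {G : ℕ → ℤ → Type} {n : ℕ} {d e : ℤ} {i : ℕ}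
    (hi : 1 ≤ i ∧ i ≤ n) (hr : n + 1 = n + 1) (hd : d = e + 0) (he : e = d)
    (x : FreeOp 𝕜 G n e) : circ i hi hr hd x (mk .one) = he ▸ x := by
  subst he
  rcases x with ⟨x⟩
  exact Quot.sound (.circ_one hi hr hd x)

theorem diffExpr_rel {𝕜 : Type u} [CommRing 𝕜] {G : ℕ → ℤ → Type}
    (dg : ∀ {n : ℕ} {d e : ℤ}, e + 1 = d → G n d → FreeOp 𝕜 G n e) {n : ℕ} {d : ℤ}
    {x y : OpExpr 𝕜 G n d} (hxy : OpExpr.Rel 𝕜 G x y) :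
    ∀ (e : ℤ) (h : e + 1 = d), diffExpr dg x e h = diffExpr dg y e h := by
  induction hxy with
  | add_comm x y => intro e h; simp only [diffExpr]; abel
  | add_assoc x y z => intro e h; simp only [diffExpr]; abel
  | zero_add x => intro e h; simp only [diffExpr]; abel
  | one_smul x => intro e h; simp only [diffExpr, _root_.one_smul]
  | mul_smul s t x => intro e h; simp only [diffExpr, SemigroupAction.mul_smul]
  | smul_add t x y => intro e h; simp only [diffExpr, _root_.smul_add]
  | add_smul s t x => intro e h; simp only [diffExpr, _root_.add_smul]
  | smul_zero t => intro e h; simp only [diffExpr, _root_.smul_zero]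
  | zero_smul x => intro e h; simp only [diffExpr, _root_.zero_smul]
  | circ_add_left i hi hr hc x x' y =>
    intro e h
    simp only [diffExpr, mk_add, map_add, LinearMap.add_apply, _root_.smul_add]; abel
  | circ_add_right i hi hr hc x y y' =>
    intro e h
    simp only [diffExpr, mk_add, map_add, _root_.smul_add]; abel
  | circ_smul_left i hi hr hc t x y =>
    intro e h
    simp only [diffExpr, mk_smul, map_smul, LinearMap.smul_apply, _root_.smul_add]
    rw [smul_comm t]
  | circ_smul_right i hi hr hc t x y =>
    intro e h
    simp only [diffExpr, mk_smul, map_smul, _root_.smul_add]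
    rw [smul_comm t]
  | @parallel m n l r r' s a b c ab ac abc i j k hji hkl hi hj hj' hk hr hs hr' hs' hab habc
      hac habc' x y z =>
    intro e h
    subst hab hac
    have h1 := circ_parallel hji hkl hi hj hj' hk hr hs hr' hs'
      (ab := a + b - 1) (abc := e) (ac := a + c - 1)
      (by omega) (by omega) (by omega) (by omega) (diffExpr dg x (a - 1) (by omega)) (mk y) (mk z)
    have h2 := circ_parallel hji hkl hi hj hj' hk hr hs hr' hs'
      (ab := a + b - 1) (abc := e) (ac := a + c)
      (by omega) (by omega) (by omega) (by omega) (mk x) (diffExpr dg y (b - 1) (by omega)) (mk z)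
    have h3 := circ_parallel hji hkl hi hj hj' hk hr hs hr' hs'
      (ab := a + b) (abc := e) (ac := a + c - 1)
      (by omega) (by omega) (by omega) (by omega) (mk x) (mk y) (diffExpr dg z (c - 1) (by omega))
    have s2 : Int.negOnePow a * Int.negOnePow ((b - 1) * c) =
        Int.negOnePow (b * c) * Int.negOnePow (a + c) := by
      rw [← Int.negOnePow_add, ← Int.negOnePow_add, Int.negOnePow_eq_iff]
      exact ⟨-c, by ring⟩
    have s3 : Int.negOnePow (a + b) * Int.negOnePow (b * (c - 1)) =
        Int.negOnePow (b * c) * Int.negOnePow a := by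
      rw [← Int.negOnePow_add, ← Int.negOnePow_add, Int.negOnePow_eq_iff]
      exact ⟨0, by ring⟩
    simp only [diffExpr, mk_circ, map_add, LinearMap.add_apply, _root_.smul_add, units_smul_eq,
      Units.smul_def, map_zsmul, LinearMap.smul_apply]
    simp only [← Units.smul_def]
    rw [h1, h2, h3, smul_smul, smul_smul, smul_smul, smul_smul, s2, s3]
    abel
  | @sequential m n l r r' s a b c ab bc abc i j k hij hjn hki hi hj hk hr hs hr' hs' hab habc
      hbc habc' x y z =>
    intro e h
    subst hab hbc
    have h1 := circ_sequential hij hjn hki hi hj hk hr hs hr' hs'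
      (ab := a + b - 1) (abc := e) (bc := b + c)
      (by omega) (by omega) (by omega) (by omega) (diffExpr dg x (a - 1) (by omega)) (mk y) (mk z)
    have h2 := circ_sequential hij hjn hki hi hj hk hr hs hr' hs'
      (ab := a + b - 1) (abc := e) (bc := b + c - 1)
      (by omega) (by omega) (by omega) (by omega) (mk x) (diffExpr dg y (b - 1) (by omega)) (mk z)
    have h3 := circ_sequential hij hjn hki hi hj hk hr hs hr' hs'
      (ab := a + b) (abc := e) (bc := b + c - 1)
      (by omega) (by omega) (by omega) (by omega) (mk x) (mk y) (diffExpr dg z (c - 1) (by omega))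
    simp only [diffExpr, mk_circ, map_add, LinearMap.add_apply, _root_.smul_add,
      Units.smul_def, map_zsmul, LinearMap.smul_apply]
    simp only [← Units.smul_def]
    rw [h1, h2, h3, smul_smul, Int.negOnePow_add]
    abel
  | @one_circ n d hi hr hd x =>
    intro e h
    simp only [diffExpr, map_zero, LinearMap.zero_apply, Int.negOnePow_zero]
    rw [one_circ _ _ _ (show d - 1 = e by omega)]
    obtain rfl : e = d - 1 := by omega
    simp
  | @circ_one n d i hi hr hd x =>
    intro e h
    simp only [diffExpr, map_zero]
    rw [circ_one _ _ _ (show d - 1 = e by omega)]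
    obtain rfl : e = d - 1 := by omega
    simp
  | congr_add_left x x' y h ih => intro e he; simp only [diffExpr, ih]
  | congr_add_right x y y' h ih => intro e he; simp only [diffExpr, ih]
  | congr_smul t x x' h ih => intro e he; simp only [diffExpr, ih]
  | congr_circ_left i hi hr hc x x' y h ih =>
    intro e he
    have : mk x = mk x' := Quot.sound h
    simp only [diffExpr, ih, this]
  | congr_circ_right i hi hr hc x y y' h ih =>
    intro e he
    have : mk y = mk y' := Quot.sound h
    simp only [diffExpr, ih, this]

end FreeOp

/-- The quasi-free operad on generators `G` whose differential is the unique derivation with the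
prescribed values `dg` on the generators. -/
def quasiFree (𝕜 : Type u) [CommRing 𝕜] (G : ℕ → ℤ → Type)
    (dg : ∀ {n : ℕ} {d e : ℤ}, e + 1 = d → G n d → FreeOp 𝕜 G n e) : DGOperadData 𝕜 where
  obj n d := FreeOp 𝕜 G n d
  diff {n d e} h :=
    { toFun := Quot.lift (fun x => FreeOp.diffExpr dg x e h)
        (fun _ _ hxy => FreeOp.diffExpr_rel dg hxy e h)
      map_add' := by rintro ⟨x⟩ ⟨y⟩; rfl
      map_smul' := by rintro t ⟨x⟩; rfl }
  circ := FreeOp.circ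
  one := FreeOp.mk .one

/-! ## Homotopy associative algebras and homotopy matching dialgebras -/

/-- `ξ` is a string of length `n - 1`, `n ≥ 2`, and `d = n - 2`. -/
def IsStr {Γ : Type} (ξ : List Γ) (n : ℕ) (d : ℤ) : Prop :=
  2 ≤ n ∧ ξ.length + 1 = n ∧ d = n - 2

/-- The generators `m_ξ`, of arity `n ≥ 2` and degree `n - 2`, for strings `ξ ∈ Γ^{n-1}`. -/
def StrGen (Γ : Type) (n : ℕ) (d : ℤ) : Type := {ξ : List Γ // IsStr ξ n d}

/-- `ξ' ∘_i ξ'' = (ξ'_1, …, ξ'_{i-1}, ξ''_1, …, ξ''_{q-1}, ξ'_i, …, ξ'_{p-1})`. -/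
def strComp {Γ : Type} (i : ℕ) (ξ' ξ'' : List Γ) : List Γ :=
  ξ'.take (i - 1) ++ ξ'' ++ ξ'.drop (i - 1)

/-- The block of length `q - 1` of `ξ` starting at position `i`. -/
def strInner {Γ : Type} (i q : ℕ) (ξ : List Γ) : List Γ := (ξ.drop (i - 1)).take (q - 1)

/-- What remains of `ξ` after removing the block of length `q - 1` starting at position `i`. -/
def strOuter {Γ : Type} (i q : ℕ) (ξ : List Γ) : List Γ :=
  ξ.take (i - 1) ++ ξ.drop (i - 1 + (q - 1))

/-- For given `p, q, i`, a string `ξ` of length `p + q - 2` has exactly one decomposition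
`ξ = ξ' ∘_i ξ''` into strings of lengths `p - 1` and `q - 1`. -/
theorem strComp_eq_iff {Γ : Type} {p q i : ℕ} (hi : 1 ≤ i) (hip : i ≤ p) (ξ ξ' ξ'' : List Γ)
    (hξ : ξ.length = (p - 1) + (q - 1)) (h' : ξ'.length = p - 1) (h'' : ξ''.length = q - 1) :
    strComp i ξ' ξ'' = ξ ↔ ξ' = strOuter i q ξ ∧ ξ'' = strInner i q ξ := by
  have hl : (ξ.take (i - 1)).length = i - 1 := by simp; omega
  have hi' : (ξ'.take (i - 1)).length = i - 1 := by simp; omega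
  unfold strComp strOuter strInner
  constructor
  · rintro rfl
    rw [List.append_assoc]
    constructor
    · rw [List.take_append_of_le_length hi'.ge, List.drop_append, List.drop_eq_nil_of_le (by omega),
        hi', List.nil_append, show i - 1 + (q - 1) - (i - 1) = ξ''.length by omega, List.drop_left,
        List.take_of_length_le hi'.le, List.take_append_drop]
    · rw [List.drop_append_of_le_length hi'.ge, List.drop_eq_nil_of_le hi'.le, List.nil_append,
        List.take_append_of_le_length h''.ge, List.take_of_length_le h''.le]
  · rintro ⟨rfl, rfl⟩
    rw [List.take_append_of_le_length hl.ge, List.take_of_length_le hl.le,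
      List.drop_append_of_le_length hl.ge, List.drop_eq_nil_of_le hl.le, List.nil_append,
      List.append_assoc, ← List.drop_drop, List.take_append_drop, List.take_append_drop]

theorem isStr_outer {Γ : Type} {ξ : List Γ} {n p q i : ℕ} {d : ℤ} (h : IsStr ξ n d)
    (hpq : 1 ≤ i ∧ i ≤ p ∧ 2 ≤ p ∧ 2 ≤ q ∧ p + q = n + 1) :
    IsStr (strOuter i q ξ) p (p - 2) := by
  obtain ⟨h1, h2, h3⟩ := h
  refine ⟨by omega, ?_, rfl⟩
  simp only [strOuter, List.length_append, List.length_take, List.length_drop]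
  omega

theorem isStr_inner {Γ : Type} {ξ : List Γ} {n p q i : ℕ} {d : ℤ} (h : IsStr ξ n d)
    (hpq : 1 ≤ i ∧ i ≤ p ∧ 2 ≤ p ∧ 2 ≤ q ∧ p + q = n + 1) :
    IsStr (strInner i q ξ) q (q - 2) := by
  obtain ⟨h1, h2, h3⟩ := h
  refine ⟨by omega, ?_, rfl⟩
  simp only [strInner, List.length_take, List.length_drop]
  omega

/-- The generator `m_ξ` as an element of the free operad. -/
def mGen (𝕜 : Type u) [CommRing 𝕜] {Γ : Type} (ξ : List Γ) {n : ℕ} {d : ℤ} (h : IsStr ξ n d) :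
    FreeOp 𝕜 (StrGen Γ) n d := FreeOp.gen 𝕜 ⟨ξ, h⟩

/-- `∂ m_ξ = ∑ (-1)^{i-1} (-1)^{q(p-i)} m_{ξ'} ∘_i m_{ξ''}`, the sum over `p, q ≥ 2` with
`p + q - 1 = n`, over `1 ≤ i ≤ p`, and over the decompositions `ξ' ∘_i ξ'' = ξ`. -/
def mBoundary (𝕜 : Type u) [CommRing 𝕜] {Γ : Type} {n : ℕ} {d e : ℤ} (he : e + 1 = d)
    (ξ : StrGen Γ n d) : FreeOp 𝕜 (StrGen Γ) n e :=
  ∑ i ∈ Finset.Icc 1 n, ∑ p ∈ Finset.Icc 2 n, ∑ q ∈ Finset.Icc 2 n,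
    if h : 1 ≤ i ∧ i ≤ p ∧ 2 ≤ p ∧ 2 ≤ q ∧ p + q = n + 1 then
      ((-1 : ℤ) ^ (i - 1) * (-1) ^ (q * (p - i))) •
        FreeOp.circ i ⟨h.1, h.2.1⟩ (by omega)
          (by have := ξ.2.2.2; omega)
          (mGen 𝕜 (strOuter i q ξ.1) (isStr_outer ξ.2 h))
          (mGen 𝕜 (strInner i q ξ.1) (isStr_inner ξ.2 h))
    else 0

/-- The quasi-free operad on the `m_ξ`, for strings `ξ` in the alphabet `Γ`. -/
def strOperad (𝕜 : Type u) [CommRing 𝕜] (Γ : Type) : DGOperadData 𝕜 :=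
  quasiFree 𝕜 (StrGen Γ) (mBoundary 𝕜)

/-- The two symbols `□` and `■`. -/
inductive Symb
  | white
  | black
  deriving DecidableEq

instance : Fintype Symb := ⟨{Symb.white, Symb.black}, fun s => by cases s <;> simp⟩

/-- The operad of homotopy matching dialgebras. -/
def matchingInfty (𝕜 : Type u) [CommRing 𝕜] : DGOperadData 𝕜 := strOperad 𝕜 Symb

/-- The operad of homotopy associative algebras: over a one-letter alphabet there is exactly one
generator `m_n` for each `n ≥ 2`, of degree `n - 2`, and the differential reads
`∂ m_n = ∑ (-1)^{i-1} (-1)^{q(p-i)} m_p ∘_i m_q`. -/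
def assocInfty (𝕜 : Type u) [CommRing 𝕜] : DGOperadData 𝕜 := strOperad 𝕜 Unit

/-- The generator `m_ξ` of the operad of homotopy matching dialgebras. -/
def mXi (𝕜 : Type u) [CommRing 𝕜] (ξ : List Symb) {n : ℕ} {d : ℤ} (h : IsStr ξ n d) :
    (matchingInfty 𝕜).obj n d := mGen 𝕜 ξ h

/-- The generator `m_n` of the operad of homotopy associative algebras. -/
def mN (𝕜 : Type u) [CommRing 𝕜] {n : ℕ} (h : 2 ≤ n) : (assocInfty 𝕜).obj n (n - 2) :=
  mGen 𝕜 (List.replicate (n - 1) ()) ⟨h, by simp only [List.length_replicate]; omega, rfl⟩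

theorem isStr_singleton (s : Symb) : IsStr [s] 2 0 := ⟨le_rfl, rfl, rfl⟩

theorem isStr_append {ξ : List Symb} {n : ℕ} {d : ℤ} (h : IsStr ξ n d) (s : Symb) :
    IsStr (ξ ++ [s]) (n + 1) (d + 1) := by
  obtain ⟨h1, h2, h3⟩ := h
  refine ⟨by omega, by simp only [List.length_append, List.length_singleton]; omega, ?_⟩
  push_cast; omega

theorem isStr_ofFn {n : ℕ} (h : 2 ≤ n) (ξ : Fin (n - 1) → Symb) :
    IsStr (List.ofFn ξ) n (n - 2) :=
  ⟨h, by simp only [List.length_ofFn]; omega, rfl⟩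

/-! ## The surjection operad -/

/-- The sequence of values `u = (u(1), …, u(n + k))` of a non-degenerate surjection
`{1, …, n + k} → {1, …, n}`, where `n ≥ 1`: no two consecutive values agree. -/
def IsSurj (n : ℕ) (k : ℤ) (u : List ℕ) : Prop :=
  1 ≤ n ∧ (u.length : ℤ) = n + k ∧ (∀ x, x ∈ u ↔ 1 ≤ x ∧ x ≤ n) ∧ u.IsChain (· ≠ ·)

/-- The non-degenerate surjections of arity `n` and degree `k`. -/
def Surj (n : ℕ) (k : ℤ) : Type := {u : List ℕ // IsSurj n k u}

/-- `X(n)_k`, the free module on the non-degenerate surjections. -/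
abbrev SurjMod (𝕜 : Type u) [CommRing 𝕜] (n : ℕ) (k : ℤ) : Type u := Surj n k →₀ 𝕜

open Classical in
/-- The basis element of `X(n)_k` given by a sequence `w`; it is `0` if `w` is not (the sequence
of values of) a non-degenerate surjection. -/
noncomputable def ofWord (𝕜 : Type u) [CommRing 𝕜] (n : ℕ) (k : ℤ) (w : List ℕ) :
    SurjMod 𝕜 n k :=
  if h : IsSurj n k w then Finsupp.single ⟨w, h⟩ 1 else 0

/-- The relative degree of the subsequence `(u(a), …, u(b))` of `u`: the number of `a ≤ i < b` such
that `u(i)` is not the last occurrence of its value in `u`. Here and below positions in lists are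
counted from `0`. -/
def relDeg (u : List ℕ) (a b : ℕ) : ℕ :=
  ((Finset.Ico a b).filter fun i => ∃ i' ∈ Finset.Ioo i u.length, u[i]? = u[i']?).card

/-- The position of the penultimate occurrence of a value whose last occurrence is at `i`. -/
def prevPos (u : List ℕ) (i : ℕ) : ℕ :=
  ((Finset.range i).filter fun j => u[j]? = u[i]?).sup id

/-- The exponent `r_i` in the differential: the relative degree of the part of `u` up to
position `i` if `u(i)` is not the last occurrence of a value, and up to the position after the
penultimate occurrence otherwise. -/
def diffExp (u : List ℕ) (i : ℕ) : ℕ :=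
  if ∃ i' ∈ Finset.Ioo i u.length, u[i]? = u[i']? then relDeg u 0 i
  else relDeg u 0 (prevPos u i + 1)

/-- `δ u = ∑_i (-1)^{r_i} (u(1), …, û(i), …)`, over the `i` for which `u(i)` is not the only
occurrence of a value (and degenerate sequences being zero). -/
noncomputable def surjDiffWord (𝕜 : Type u) [CommRing 𝕜] (n : ℕ) (e : ℤ) (u : List ℕ) :
    SurjMod 𝕜 n e :=
  ∑ i ∈ (Finset.range u.length).filter fun i =>
      ∃ i' ∈ Finset.range u.length, i' ≠ i ∧ u[i]? = u[i']?,
    (-1 : ℤ) ^ diffExp u i • ofWord 𝕜 n e (u.eraseIdx i)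

/-- The piece `(u(a), …, u(b))` of `u`, both ends included. -/
def piece (u : List ℕ) (a b : ℕ) : List ℕ := (u.drop a).take (b + 1 - a)

/-- The sequences of cutting positions `1 = j_0 ≤ j_1 ≤ … ≤ j_r = L` (here counted from `0`). -/
def cuts (r L : ℕ) : Finset (Fin (r + 1) → Fin L) :=
  Finset.univ.filter fun j =>
    (j 0 : ℕ) = 0 ∧ (j (Fin.last r) : ℕ) + 1 = L ∧ ∀ p : Fin r, j p.castSucc ≤ j p.succ

/-- The pieces `u_1, …, u_r` of `u`, where `u_p = (u(j_{p-1}), …, u(j_p))`. -/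
def pieces (u : List ℕ) {r L : ℕ} (j : Fin (r + 1) → Fin L) : List (List ℕ) :=
  List.ofFn fun p : Fin r => piece u (j p.castSucc) (j p.succ)

/-- The relabelling `α(s) = s + t - 1`. -/
def relabelIn (t s : ℕ) : ℕ := s + t - 1

/-- The relabelling `β(s) = s` for `s < t` and `β(s) = s + n - 1` for `s > t`. -/
def relabelOut (t n s : ℕ) : ℕ := if s < t then s else s + n - 1

/-- The sequence `(β v_0, α u_1, β v_1, …, α u_r, β v_r)`: the successive occurrences of `t` in `v`
are replaced by `α u_1, …, α u_r`, and every other value is relabelled by `β`. -/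
def substWord (t n : ℕ) : List ℕ → List (List ℕ) → List ℕ
  | [], _ => []
  | s :: v, us =>
    if s = t then (us.headD []).map (relabelIn t) ++ substWord t n v us.tail
    else relabelOut t n s :: substWord t n v us

/-- The position of the `q`-th occurrence of `t` in `v` (`q = 0, …, r - 1`); for `q ≥ r` the last
position of `v`. -/
def occPos (v : List ℕ) (t q : ℕ) : ℕ :=
  ((List.range v.length).filter fun i => v[i]? = some t).getD q (v.length - 1)

/-- The exponent of the Koszul sign of `v_1, …, v_r, u_1, …, u_r ↦ u_1, v_1, …, u_r, v_r`: the sum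
of `|u_p| |v_q|` over `p ≤ q`, where `|u_p|` is the relative degree of `u_p` in `u`, and `|v_q|` is
the relative degree in `v` of `(t, v_q, t)`, or of `(t, v_r)` for `q = r`. -/
def koszulExp (v u : List ℕ) (t : ℕ) {r L : ℕ} (j : Fin (r + 1) → Fin L) : ℕ :=
  ∑ p : Fin r, ∑ q : Fin r, if p ≤ q then
    relDeg u (j p.castSucc) (j p.succ) * relDeg v (occPos v t q) (occPos v t (q + 1)) else 0

/-- The composite `v ∘_t u` of two basis elements, `n` being the arity of `u`. -/
noncomputable def surjCircWord (𝕜 : Type u) [CommRing 𝕜] (n s : ℕ) (c : ℤ) (t : ℕ)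
    (v u : List ℕ) : SurjMod 𝕜 s c :=
  ∑ j ∈ cuts (v.count t) u.length,
    (-1 : ℤ) ^ koszulExp v u t j • ofWord 𝕜 s c (substWord t n v (pieces u j))

/-- The surjection operad. -/
noncomputable def surjOperad (𝕜 : Type u) [CommRing 𝕜] : DGOperadData 𝕜 where
  obj n k := SurjMod 𝕜 n k
  diff {n d e} _ := Finsupp.linearCombination 𝕜 fun u : Surj n d => surjDiffWord 𝕜 n e u.1
  circ {m n s a b c} t _ _ _ :=
    Finsupp.linearCombination 𝕜 fun v : Surj m a =>
      Finsupp.linearCombination 𝕜 fun u : Surj n b => surjCircWord 𝕜 n s c t v.1 u.1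
  one := ofWord 𝕜 1 0 [1]

/-! ## Cacti -/

/-- A cactus has no subsequence `(i, j, i, j)` with `i ≠ j`. -/
def IsCactus (u : List ℕ) : Prop := ∀ i j : ℕ, i ≠ j → ¬ [i, j, i, j].Sublist u

theorem ofWord_mem_supported (𝕜 : Type u) [CommRing 𝕜] (n : ℕ) (k : ℤ) (w : List ℕ)
    (hw : IsCactus w) :
    ofWord 𝕜 n k w ∈ Finsupp.supported 𝕜 𝕜 {u : Surj n k | IsCactus u.1} := by
  unfold ofWord
  split_ifs with h
  · exact Finsupp.single_mem_supported 𝕜 1 hw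
  · exact Submodule.zero_mem _

theorem linearCombination_mem {𝕜 : Type u} [CommRing 𝕜] {α M : Type*} [AddCommGroup M]
    [Module 𝕜 M] (f : α → M) (A : Set α) (S : Submodule 𝕜 M) (hf : ∀ a ∈ A, f a ∈ S)
    (x : α →₀ 𝕜) (hx : x ∈ Finsupp.supported 𝕜 𝕜 A) :
    Finsupp.linearCombination 𝕜 f x ∈ S := by
  rw [Finsupp.linearCombination_apply]
  exact Submodule.sum_mem _ fun a ha => S.smul_mem _ (hf a (hx ha))

theorem IsCactus.sublist {u w : List ℕ} (hu : IsCactus u) (h : w.Sublist u) : IsCactus w :=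
  fun i j hij hw => hu i j hij (hw.trans h)

theorem sublist_of_dup {p A B : List ℕ} {x : ℕ} (hp : p.IsChain (· ≠ ·))
    (h : p.Sublist ((A ++ [x]) ++ (x :: B))) : p.Sublist (A ++ (x :: B)) := by
  obtain ⟨p₁, p₂, rfl, h₁, h₂⟩ := List.sublist_append_iff.1 h
  obtain ⟨a, b, rfl, ha, hb⟩ := List.sublist_append_iff.1 h₁
  rcases b with _ | ⟨y, b⟩
  · rw [List.append_nil]
    exact ha.append h₂
  · have hy : y :: b = [x] := by
      have := hb.length_le
      have hb' : b = [] := List.eq_nil_of_length_eq_zero (by simpa using this)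
      subst hb'
      simpa using hb
    rw [hy] at hp ⊢
    rcases p₂ with _ | ⟨z, p₂⟩
    · rw [List.append_nil]
      exact ha.append (List.singleton_sublist.2 (by simp))
    · by_cases hz : z = x
      · subst hz
        rw [List.append_assoc] at hp
        have := (List.isChain_append.1 hp).2.1
        simp at this
      · have h₃ : (z :: p₂).Sublist B := by
          cases h₂ with
          | cons _ h => exact h
          | cons_cons _ h => exact absurd rfl hz
        rw [List.append_assoc]
        exact ha.append (by simpa using h₃)

theorem sublist_flatten_pieces {u : List ℕ} : ∀ {r L : ℕ} (_ : u.length = L)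
    (j : Fin (r + 1) → Fin L) (_ : ∀ p : Fin r, j p.castSucc ≤ j p.succ) {p : List ℕ}
    (_ : p.IsChain (· ≠ ·)) (_ : p.Sublist (pieces u j).flatten), p.Sublist (u.drop (j 0)) := by
  intro r
  induction r with
  | zero => intro L hL j hj p hp h; simp [pieces] at h; simp [h]
  | succ r ih =>
    intro L hL j hj p hp h
    have hj' : pieces u j = piece u (j 0) (j 1) :: pieces u (fun q : Fin (r + 1) => j q.succ) := by
      simp only [pieces, List.ofFn_succ]
      rfl
    rw [hj', List.flatten_cons] at h
    obtain ⟨p₁, p₂, rfl, h₁, h₂⟩ := List.sublist_append_iff.1 h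
    have h₃ := ih hL (fun q : Fin (r + 1) => j q.succ) (fun q => by
      simpa using hj q.succ) (List.isChain_append.1 hp).2.1 h₂
    have h01 : j 0 ≤ j 1 := by simpa using hj 0
    have h01' : (j 0 : ℕ) ≤ j 1 := h01
    have hlt : (j 1 : ℕ) < u.length := hL ▸ (j 1).2
    have e1 : u.drop (j 1 : ℕ) = u[(j 1 : ℕ)] :: u.drop ((j 1 : ℕ) + 1) :=
      List.drop_eq_getElem_cons hlt
    have e2 : piece u (j 0) (j 1) =
        (u.drop (j 0 : ℕ)).take ((j 1 : ℕ) - j 0) ++ [u[(j 1 : ℕ)]] := by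
      unfold piece
      rw [show (j 1 : ℕ) + 1 - j 0 = ((j 1 : ℕ) - j 0) + 1 by omega]
      rw [List.take_succ_eq_append_getElem (by simp; omega)]
      congr 2
      simp only [List.getElem_drop]
      congr 1
      omega
    have e3 : u.drop (j 0 : ℕ) =
        (u.drop (j 0 : ℕ)).take ((j 1 : ℕ) - j 0) ++ u.drop (j 1 : ℕ) := by
      conv_lhs => rw [← List.take_append_drop ((j 1 : ℕ) - j 0) (u.drop (j 0 : ℕ))]
      rw [List.drop_drop, show (j 0 : ℕ) + ((j 1 : ℕ) - j 0) = j 1 by omega]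
    have h₄ : (p₁ ++ p₂).Sublist (piece u (j 0) (j 1) ++ u.drop (j 1 : ℕ)) := h₁.append h₃
    rw [e3, e1]
    rw [e2, e1] at h₄
    exact sublist_of_dup hp h₄

theorem sublist_expand {f : ℕ → ℕ} {t n : ℕ} : ∀ (v : List ℕ) (us : List (List ℕ)),
    (∀ w ∈ us, ∀ x ∈ w, f (relabelIn t x) = t) →
    (∀ s ∈ v, s ≠ t → f (relabelOut t n s) = s) → ∀ {p : List ℕ}, p.IsChain (· ≠ ·) →
    p.Sublist ((substWord t n v us).map f) → p.Sublist v := by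
  intro v
  induction v with
  | nil => intro us _ _ p _ h; simpa [substWord] using h
  | cons s v ih =>
    intro us hus hv p hp h
    have hv' : ∀ s' ∈ v, s' ≠ t → f (relabelOut t n s') = s' :=
      fun s' hs' => hv s' (List.mem_cons_of_mem _ hs')
    unfold substWord at h
    split_ifs at h with hs
    · rw [List.map_append] at h
      obtain ⟨p₁, p₂, rfl, h₁, h₂⟩ := List.sublist_append_iff.1 h
      have h₃ := ih us.tail (fun w hw => hus w (List.mem_of_mem_tail hw)) hv'
        (List.isChain_append.1 hp).2.1 h₂
      have hall : ∀ x ∈ p₁, x = t := by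
        intro x hx
        have := h₁.subset hx
        simp only [List.map_map, List.mem_map, Function.comp] at this
        obtain ⟨y, hy, rfl⟩ := this
        rcases us with _ | ⟨w, us⟩
        · simp at hy
        · exact hus w (by simp) y (by simpa using hy)
      rcases p₁ with _ | ⟨x, _ | ⟨y, p₁⟩⟩
      · exact h₃.cons _
      · have := hall x (by simp)
        subst hs
        subst this
        exact h₃.cons_cons _
      · have hx := hall x (by simp)
        have hy := hall y (by simp)
        have := (List.isChain_cons_cons.1 hp).1
        exact absurd (hx.trans hy.symm) this
    · rw [List.map_cons, hv s (by simp) hs] at h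
      rcases p with _ | ⟨x, p⟩
      · simp
      · cases h with
        | cons _ h => exact (ih us hus hv' hp h).cons _
        | cons_cons _ h =>
          exact (ih us hus hv' (List.isChain_cons.1 hp).2 h).cons_cons _

theorem filter_substWord {P : ℕ → Bool} {t n : ℕ} : ∀ (v : List ℕ) (us : List (List ℕ)),
    (∀ w ∈ us, ∀ x ∈ w, P (relabelIn t x) = true) →
    (∀ s ∈ v, s ≠ t → P (relabelOut t n s) = false) →
    ((substWord t n v us).filter P).Sublist (us.flatten.map (relabelIn t)) := by
  intro v
  induction v with
  | nil => intro us _ _; simp [substWord]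
  | cons s v ih =>
    intro us hus hv
    have hv' : ∀ s' ∈ v, s' ≠ t → P (relabelOut t n s') = false :=
      fun s' hs' => hv s' (List.mem_cons_of_mem _ hs')
    unfold substWord
    split_ifs with hs
    · rcases us with _ | ⟨w, us⟩
      · simpa using ih [] (by simp) hv'
      · simp only [List.headD_cons, List.tail_cons, List.filter_append, List.flatten_cons,
          List.map_append]
        exact List.filter_sublist.append
          (ih us (fun w' hw' => hus w' (List.mem_cons_of_mem _ hw')) hv')
    · rw [List.filter_cons_of_neg (by simp [hv s (by simp) hs])]
      exact ih us hus hv'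

theorem isCactus_substWord {m n : ℕ} {a b : ℤ} {v u : List ℕ} (hv : IsSurj m a v)
    (hu : IsSurj n b u) (hv' : IsCactus v) (hu' : IsCactus u) {t : ℕ} (ht : 1 ≤ t)
    {r L : ℕ} (hL : u.length = L) (j : Fin (r + 1) → Fin L)
    (hj : ∀ p : Fin r, j p.castSucc ≤ j p.succ) :
    IsCactus (substWord t n v (pieces u j)) := by
  intro x y hxy hsub
  have hn : 1 ≤ n := hu.1
  have hpc : ∀ w ∈ pieces u j, ∀ z ∈ w, 1 ≤ z ∧ z ≤ n := by
    intro w hw z hz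
    simp only [pieces, List.mem_ofFn] at hw
    obtain ⟨q, rfl⟩ := hw
    exact (hu.2.2.1 z).1 (List.mem_of_mem_drop (List.mem_of_mem_take hz))
  have hchain : ∀ {c d : ℕ}, c ≠ d → [c, d, c, d].IsChain (· ≠ ·) := by
    intro c d h
    simp [h, h.symm]
  by_cases hin : (t ≤ x ∧ x < t + n) ∧ (t ≤ y ∧ y < t + n)
  · have h1 : [x, y, x, y].Sublist (((pieces u j).flatten).map (relabelIn t)) := by
      refine List.Sublist.trans ?_ (filter_substWord (P := fun z => decide (t ≤ z ∧ z < t + n))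
        (n := n) v (pieces u j) ?_ ?_)
      · have h2 := hsub.filter (fun z => decide (t ≤ z ∧ z < t + n))
        simpa [List.filter_cons, hin.1, hin.2] using h2
      · intro w hw z hz
        have := hpc w hw z hz
        refine decide_eq_true ?_
        simp only [relabelIn]
        omega
      · intro s hs hst
        refine decide_eq_false ?_
        simp only [relabelOut]
        split_ifs <;> omega
    have h2 := h1.map (fun z => z + 1 - t)
    have h3 : (((pieces u j).flatten).map (relabelIn t)).map (fun z => z + 1 - t) =
        (pieces u j).flatten := by
      rw [List.map_map]
      conv_rhs => rw [← List.map_id (pieces u j).flatten]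
      apply List.map_congr_left
      intro z hz
      obtain ⟨w, hw, hz⟩ := List.mem_flatten.1 hz
      have := hpc w hw z hz
      simp only [Function.comp, relabelIn, id]
      omega
    rw [h3] at h2
    have hne : x + 1 - t ≠ y + 1 - t := by omega
    have h4 := sublist_flatten_pieces hL j hj (hchain hne) (by simpa using h2)
    exact hu' _ _ hne (h4.trans (List.drop_sublist _ _))
  · let f : ℕ → ℕ := fun z => if z < t then z else if z < t + n then t else z + 1 - n
    have hne : f x ≠ f y := by
      simp only [f]
      split_ifs <;> omega
    have h2 := hsub.map f
    refine hv' _ _ hne (sublist_expand (f := f) (n := n) v (pieces u j) ?_ ?_ (hchain hne) h2)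
    · intro w hw z hz
      have := hpc w hw z hz
      simp only [relabelIn, f]
      split_ifs <;> omega
    · intro s hs hst
      have := (hv.2.2.1 s).1 hs
      simp only [relabelOut, f]
      split_ifs <;> omega

/-- The suboperad `F_2 X` of the surjection operad, spanned by the cacti. -/
noncomputable def cactusSub (𝕜 : Type u) [CommRing 𝕜] : SubDGOperad (surjOperad 𝕜) where
  carrier n k := Finsupp.supported 𝕜 𝕜 {u : Surj n k | IsCactus u.1}
  diff_mem {n d e} h x hx := by
    refine linearCombination_mem (fun u : Surj n d => surjDiffWord 𝕜 n e u.1)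
      {u : Surj n d | IsCactus u.1}
      (Finsupp.supported 𝕜 𝕜 {u : Surj n e | IsCactus u.1}) (fun u hu => ?_) x hx
    refine Submodule.sum_mem _ fun i _ => zsmul_mem ?_ _
    exact ofWord_mem_supported 𝕜 n e _ (IsCactus.sublist hu (List.eraseIdx_sublist ..))
  circ_mem {m n s a b c} t ht hs hc x y hx hy := by
    have key : ∀ v : Surj m a, IsCactus v.1 →
        Finsupp.linearCombination 𝕜 (fun u : Surj n b => surjCircWord 𝕜 n s c t v.1 u.1) y ∈
          Finsupp.supported 𝕜 𝕜 {u : Surj s c | IsCactus u.1} := by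
      intro v hv
      refine linearCombination_mem _ {u : Surj n b | IsCactus u.1} _ (fun u hu => ?_) y hy
      refine Submodule.sum_mem _ fun j hj => zsmul_mem ?_ _
      exact ofWord_mem_supported 𝕜 s c _ (isCactus_substWord v.2 u.2 hv hu ht.1 rfl j
        (Finset.mem_filter.1 hj).2.2.2)
    let F : (SurjMod 𝕜 n b →ₗ[𝕜] SurjMod 𝕜 s c) →ₗ[𝕜] SurjMod 𝕜 s c :=
      LinearMap.applyₗ (R := 𝕜) (show SurjMod 𝕜 n b from y)
    let T : Submodule 𝕜 (SurjMod 𝕜 n b →ₗ[𝕜] SurjMod 𝕜 s c) :=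
      Submodule.comap F (Finsupp.supported 𝕜 𝕜 {u : Surj s c | IsCactus u.1})
    have := linearCombination_mem
      (fun v : Surj m a =>
        Finsupp.linearCombination 𝕜 (fun u : Surj n b => surjCircWord 𝕜 n s c t v.1 u.1))
      {v : Surj m a | IsCactus v.1}
      T (fun v hv => key v hv) x hx
    exact this
  one_mem := by
    refine ofWord_mem_supported 𝕜 1 0 _ fun i j _ h => ?_
    simpa using h.length_le

/-- The operad of spineless cacti `C = F_2 X`. -/
noncomputable def cactusOperad (𝕜 : Type u) [CommRing 𝕜] : DGOperadData 𝕜 :=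
  (cactusSub 𝕜).toData

/-- The linear combination of surjections underlying an element of `C(n)_k`. -/
def cactusVal {𝕜 : Type u} [CommRing 𝕜] {n : ℕ} {k : ℤ} (x : (cactusOperad 𝕜).obj n k) :
    SurjMod 𝕜 n k := x.1

/-! ## The operations `u ↦ u^□` and `u ↦ u^■` -/

/-- The sequence obtained from `u` by replacing `u(j)` with `(u(j), n + 1, u(j))`. -/
def ringWord (n : ℕ) (u : List ℕ) (j : ℕ) : List ℕ :=
  u.take j ++ [u.getD j 0, n + 1, u.getD j 0] ++ u.drop (j + 1)

/-- The cacti of arity `n` and degree `k` in which the value `n` occurs exactly once. -/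
def topOnce (n : ℕ) (k : ℤ) : Set (Surj n k) := {u | IsCactus u.1 ∧ u.1.count n = 1}

open Classical in
/-- The linear operation `u^□ = ∑_{j < i} (-1)^{k + |u|_j} ů_j` on the span of the cacti `u` of
arity `n` and degree `k` with `u^{-1}(n) = {i}`, where `|u|_j` is the relative degree of
`(u(1), …, u(j))`. (It is extended by `0` to the other basis elements.) -/
noncomputable def addWhite (𝕜 : Type u) [CommRing 𝕜] {n : ℕ} {k : ℤ} :
    SurjMod 𝕜 n k →ₗ[𝕜] SurjMod 𝕜 (n + 1) (k + 1) :=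
  Finsupp.linearCombination 𝕜 fun u : Surj n k =>
    if u ∈ topOnce n k then
      ∑ j ∈ Finset.range (u.1.idxOf n),
        Int.negOnePow (k + relDeg u.1 0 j) • ofWord 𝕜 (n + 1) (k + 1) (ringWord n u.1 j)
    else 0

open Classical in
/-- The linear operation `u^■ = -∑_{j > i} (-1)^{k + |u|_j} ů_j`, with the same conventions. -/
noncomputable def addBlack (𝕜 : Type u) [CommRing 𝕜] {n : ℕ} {k : ℤ} :
    SurjMod 𝕜 n k →ₗ[𝕜] SurjMod 𝕜 (n + 1) (k + 1) :=
  Finsupp.linearCombination 𝕜 fun u : Surj n k =>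
    if u ∈ topOnce n k then
      -∑ j ∈ Finset.Ioo (u.1.idxOf n) u.1.length,
        Int.negOnePow (k + relDeg u.1 0 j) • ofWord 𝕜 (n + 1) (k + 1) (ringWord n u.1 j)
    else 0

/-- The cacti of arity `n` and degree `n - 2` without subsequences `(i, j, i)` such that
`j = i + 1` or `j < i`. -/
def cactiPrime (n : ℕ) : Set (Surj n (n - 2)) :=
  {u | IsCactus u.1 ∧ ∀ i j : ℕ, j = i + 1 ∨ j < i → ¬ [i, j, i].Sublist u.1}

instance finiteSurj (n : ℕ) (k : ℤ) : Finite (Surj n k) := by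
  have h : Set.Finite {u : List (Fin (n + 1)) | u.length = (n + k).toNat} :=
    List.finite_length_eq _ _
  have := h.image (List.map Fin.val)
  refine Set.Finite.to_subtype (this.subset ?_)
  rintro u ⟨_, h2, h3, _⟩
  refine ⟨u.map fun x => Fin.ofNat (n + 1) x, by simp; omega, ?_⟩
  rw [List.map_map]
  conv_rhs => rw [← List.map_id u]
  apply List.map_congr_left
  intro x hx
  have := (h3 x).1 hx
  simp only [Function.comp, Fin.ofNat, id]
  exact Nat.mod_eq_of_lt (by omega)

/-! ## Linear combinations of words -/

namespace Finsupp

/-! Surjections are replaced by arbitrary words, so that everything becomes recursive in the first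
letter. A letter has weight 1 if it recurs further on and weight 0 otherwise; relative degrees are
sums of weights. The composition v ∘_t u is then the process `graft`. When the outer word shows t,
the next letter b of the inner word is either written inside the current piece, with the sign for
moving it past the rest of the outer word, or it closes the piece, takes over the weight of t and is
kept as the start of the next piece. The operad axioms follow by induction on total length
(`graft_graft`, `graft_graft_comm`), because the weights carried along are those of the resulting
word (`dec_map_fst_of_mem_graft`). The differential of a word (x, u) deletes x, or acts inside u, or
deletes an x that is the only one in u but not in (x, u); the last is the role of `eraseOnce`. This
gives δ² = 0 (`delL_del`) and the Leibniz rule (`delL_comp`). Degenerate words span a subspace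
stable under all operations, so everything passes to the surjection operad and restricts to the
cacti. Identities of linear maps are checked on the words in a support, where length, letters and
weight are known.

In the quasi-free operads a summand of ∂ m_ξ is a block of consecutive letters of ξ. In ∂² a block
chosen after another one has been removed either contains its place, and then cancels against a
block within a block by the sequential axiom, or is disjoint from it, and then cancels against the
same two blocks removed in the other order by the parallel axiom (`diff_boundary`). A morphism out
of such an operad is a family of elements satisfying the boundary formula (`lift`). For φ, the
strings ξ are, for a fixed block, in bijection with the pairs (ξ', ξ''), so the sums over all
strings satisfy the A_∞ relation.

For μ, let B be the operation □ or ■ without its global sign (-1)^k, let n be the top letter of u,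
occurring once, and let b be (2,1) or (1,2) accordingly. Three facts carry the proof: (i) δB(u) +
B(δu) = b ∘_1 u - u ∘_n b, a telescoping sum (`delL_ringL`); (ii) B(v ∘_t u) = B(v) ∘_t u if t is
not the last input of v (`ringL_compMap_of_lt`); (iii) B(v ∘_m u) = B(v) ∘_m u + (-1)^{|v|} v ∘_m
B(u) at the last input m, if the top letters of v and u occur once (`ringL_compMap_last`). Applying
B to the boundary of μ(m_ξ), a block of ξ ending before the end of ξ gives the same block of ξs by
(ii). A block ending at the end of ξ gives two blocks of ξs by (iii), with s outside or inside. The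
two remaining blocks of ξs, namely ξ and s, are the right side of (i). This is `delL_cactusSum`.

For ψ, the sum of all μ(m_ξ) in arity n + 1 is obtained from that in arity n by putting a bead n + 1
on every letter a ≠ n, up to signs: □ serves the letters before n and ■ those after it. A word (A,
a, n+1, a, B) determines (A, a, B), so no terms are collected and all coefficients are ±1.
Conversely, a word of C'_{n+1} is such a bead on a word of C'_n: its top letter occurs once, and its
two neighbours are equal, since otherwise deleting it would leave a non-degenerate word longer than
`length_le_of_avoids` permits (`IsPrimeCactus.exists_eq_bead`). -/

theorem map_eq_of_forall_support {R : Type*} [CommRing R] {α M : Type*} [AddCommGroup M]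
    [Module R M] (F G : (α →₀ R) →ₗ[R] M) (S : α →₀ R)
    (h : ∀ w ∈ S.support, F (single w 1) = G (single w 1)) : F S = G S := by
  have hS : S = S.sum fun w c => c • single w (1 : R) := by
    conv_lhs => rw [← S.sum_single]
    simp [Finsupp.sum]
  rw [hS, map_finsuppSum, map_finsuppSum]
  refine Finsupp.sum_congr fun w hw => ?_
  rw [map_smul, map_smul, h w hw]

end Finsupp

namespace Words

/-- Prefixing a letter. -/
noncomputable def consL (𝕜 : Type u) [CommRing 𝕜] {α : Type} (x : α) :
    (List α →₀ 𝕜) →ₗ[𝕜] (List α →₀ 𝕜) := Finsupp.lmapDomain 𝕜 𝕜 (List.cons x)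

section

variable {𝕜 : Type u} [CommRing 𝕜]

theorem neg_one_pow_mul_two (n : ℕ) : (-1 : 𝕜) ^ (n * 2) = 1 := by simp [pow_mul']

@[simp] theorem consL_single {α : Type} (x : α) (w : List α) (c : 𝕜) :
    consL 𝕜 x (Finsupp.single w c) = Finsupp.single (x :: w) c := by
  simp [consL]

theorem exists_of_mem_support_consL {α : Type} {x : α} {S : List α →₀ 𝕜} {w : List α}
    (h : w ∈ (consL 𝕜 x S).support) : ∃ w' ∈ S.support, w = x :: w' := by
  classical
  have := Finsupp.mapDomain_support h
  obtain ⟨w', hw', rfl⟩ := Finset.mem_image.1 this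
  exact ⟨w', hw', rfl⟩

theorem mem_support_add {α : Type} {S T : α →₀ 𝕜} {w : α} (h : w ∈ (S + T).support) :
    w ∈ S.support ∨ w ∈ T.support := by
  classical
  exact Finset.mem_union.1 (Finsupp.support_add h)

theorem mem_support_smul {α : Type} {c : 𝕜} {S : α →₀ 𝕜} {w : α} (h : w ∈ (c • S).support) :
    w ∈ S.support := Finsupp.support_smul h

end

/-! ## Grafting of decorated words

A decorated word is a list of pairs of a letter and a weight. -/

/-- The total weight of a decorated word. -/
def weight (X : List (ℕ × ℕ)) : ℕ := (X.map Prod.snd).sum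

@[simp] theorem weight_nil : weight [] = 0 := rfl

@[simp] theorem weight_cons (a : ℕ × ℕ) (X : List (ℕ × ℕ)) :
    weight (a :: X) = a.2 + weight X := by simp [weight]

/-- The signed sum of all words obtained from `X` by substituting pieces of `Y` for the occurrences
of the letter `t`, consecutive pieces sharing a letter; the other letters of `X` are relabelled by
`f`, the letters of `Y` by `g`. -/
noncomputable def graft (𝕜 : Type u) [CommRing 𝕜] (f g : ℕ → ℕ) (t : ℕ) :
    List (ℕ × ℕ) → List (ℕ × ℕ) → (List (ℕ × ℕ) →₀ 𝕜)
  | [], [] => 0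
  | [], [b] => if b.2 = 0 then Finsupp.single [] 1 else 0
  | [], _ :: _ :: _ => 0
  | a :: X, [] => if a.1 = t then 0 else consL 𝕜 (f a.1, a.2) (graft 𝕜 f g t X [])
  | a :: X, b :: Y =>
    if a.1 = t then
      (-1 : 𝕜) ^ (b.2 * (a.2 + weight X)) • consL 𝕜 (g b.1, b.2) (graft 𝕜 f g t (a :: X) Y) +
        consL 𝕜 (g b.1, a.2) (graft 𝕜 f g t X (b :: Y))
    else consL 𝕜 (f a.1, a.2) (graft 𝕜 f g t X (b :: Y))
  termination_by X Y => X.length + Y.length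

section

variable {𝕜 : Type u} [CommRing 𝕜] {f g : ℕ → ℕ} {t : ℕ}

/-- The process ends with the last letter of the inner word still in hand, because closing a piece
keeps the letter. Requiring its weight to be 0 makes the total weight additive for arbitrary
decorated words. -/
theorem graft_nil_singleton (b : ℕ × ℕ) :
    graft 𝕜 f g t [] [b] = if b.2 = 0 then Finsupp.single [] 1 else 0 := by simp [graft]

theorem graft_nil_cons_cons (b b' : ℕ × ℕ) (Y : List (ℕ × ℕ)) :
    graft 𝕜 f g t [] (b :: b' :: Y) = 0 := by simp [graft]

theorem graft_cons_of_ne {a : ℕ × ℕ} (ha : a.1 ≠ t) (X Y : List (ℕ × ℕ)) :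
    graft 𝕜 f g t (a :: X) Y = consL 𝕜 (f a.1, a.2) (graft 𝕜 f g t X Y) := by
  cases Y <;> rw [graft] <;> simp [ha]

/-- In the first summand b lies inside the piece substituted for a and is moved past all the
remaining weight of the outer word. In the second it closes the piece, inherits the weight of a, and
stays available as the first letter of the next piece. -/
theorem graft_cons_cons {a : ℕ × ℕ} (ha : a.1 = t) (b : ℕ × ℕ) (X Y : List (ℕ × ℕ)) :
    graft 𝕜 f g t (a :: X) (b :: Y) =
      (-1 : 𝕜) ^ (b.2 * (a.2 + weight X)) • consL 𝕜 (g b.1, b.2) (graft 𝕜 f g t (a :: X) Y) +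
        consL 𝕜 (g b.1, a.2) (graft 𝕜 f g t X (b :: Y)) := by
  rw [graft, if_pos ha]

@[simp] theorem graft_nil_right (X : List (ℕ × ℕ)) : graft 𝕜 f g t X [] = 0 := by
  induction X with
  | nil => simp [graft]
  | cons a X ih =>
    by_cases ha : a.1 = t
    · rw [graft, if_pos ha]
    · rw [graft_cons_of_ne ha, ih, map_zero]

/-- Each t hands its weight to the letter closing its piece, and the letter discarded at the end has
weight 0. Constancy of the weight allows the sign of `graft_cons_cons` to be taken out of linear
combinations, as in `graftL_consL_cons`. -/
theorem weight_of_mem_graft (X Y : List (ℕ × ℕ)) :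
    ∀ w ∈ (graft 𝕜 f g t X Y).support, weight w = weight X + weight Y := by
  match X, Y with
  | X, [] => simp
  | [], [b] =>
    intro w hw
    rw [graft_nil_singleton] at hw
    split_ifs at hw with h
    · have := Finsupp.support_single_subset hw
      simp_all
    · simp at hw
  | [], b :: b' :: Y => simp [graft_nil_cons_cons]
  | a :: X, b :: Y =>
    intro w hw
    have ih1 := weight_of_mem_graft (a :: X) Y
    have ih2 := weight_of_mem_graft X (b :: Y)
    by_cases ha : a.1 = t
    · rw [graft_cons_cons ha] at hw
      rcases mem_support_add hw with hw | hw
      · obtain ⟨w', hw', rfl⟩ := exists_of_mem_support_consL (mem_support_smul hw)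
        simp [ih1 w' hw']; ring
      · obtain ⟨w', hw', rfl⟩ := exists_of_mem_support_consL hw
        simp [ih2 w' hw']; ring
    · rw [graft_cons_of_ne ha] at hw
      obtain ⟨w', hw', rfl⟩ := exists_of_mem_support_consL hw
      simp [ih2 w' hw']; ring
  termination_by X.length + Y.length

variable (𝕜 f g t) in
/-- The bilinear extension of `graft`. -/
noncomputable def graftL :
    (List (ℕ × ℕ) →₀ 𝕜) →ₗ[𝕜] (List (ℕ × ℕ) →₀ 𝕜) →ₗ[𝕜] (List (ℕ × ℕ) →₀ 𝕜) :=
  Finsupp.linearCombination 𝕜 fun X => Finsupp.linearCombination 𝕜 (graft 𝕜 f g t X)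

@[simp] theorem graftL_single (X Y : List (ℕ × ℕ)) :
    graftL 𝕜 f g t (Finsupp.single X 1) (Finsupp.single Y 1) = graft 𝕜 f g t X Y := by
  simp [graftL]

theorem graftL_consL_of_ne {a : ℕ × ℕ} (ha : a.1 ≠ t) (S T : List (ℕ × ℕ) →₀ 𝕜) :
    graftL 𝕜 f g t (consL 𝕜 a S) T = consL 𝕜 (f a.1, a.2) (graftL 𝕜 f g t S T) := by
  have h : ∀ Y, graftL 𝕜 f g t (consL 𝕜 a S) (Finsupp.single Y 1) =
      consL 𝕜 (f a.1, a.2) (graftL 𝕜 f g t S (Finsupp.single Y 1)) := by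
    intro Y
    have := Finsupp.map_eq_of_forall_support
      (((graftL 𝕜 f g t).flip (Finsupp.single Y 1)).comp (consL 𝕜 a))
      ((consL 𝕜 (f a.1, a.2)).comp ((graftL 𝕜 f g t).flip (Finsupp.single Y 1))) S
      (fun X _ => by simp [graft_cons_of_ne ha])
    simpa using this
  have := Finsupp.map_eq_of_forall_support (graftL 𝕜 f g t (consL 𝕜 a S))
    ((consL 𝕜 (f a.1, a.2)).comp (graftL 𝕜 f g t S)) T (fun Y _ => h Y)
  simpa using this

theorem graftL_nil_right (S : List (ℕ × ℕ) →₀ 𝕜) :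
    graftL 𝕜 f g t S (Finsupp.single [] 1) = 0 := by
  have := Finsupp.map_eq_of_forall_support ((graftL 𝕜 f g t).flip (Finsupp.single [] 1)) 0 S
    (by simp)
  simpa using this

/-- Expansion of a grafting whose left factor starts with the letter `t`. -/
theorem graftL_consL_cons {a : ℕ × ℕ} (ha : a.1 = t) {d : ℕ} {S : List (ℕ × ℕ) →₀ 𝕜}
    (hS : ∀ w ∈ S.support, weight w = d) (b : ℕ × ℕ) (Y : List (ℕ × ℕ)) :
    graftL 𝕜 f g t (consL 𝕜 a S) (Finsupp.single (b :: Y) 1) =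
      (-1 : 𝕜) ^ (b.2 * (a.2 + d)) •
          consL 𝕜 (g b.1, b.2) (graftL 𝕜 f g t (consL 𝕜 a S) (Finsupp.single Y 1)) +
        consL 𝕜 (g b.1, a.2) (graftL 𝕜 f g t S (Finsupp.single (b :: Y) 1)) := by
  have := Finsupp.map_eq_of_forall_support
    (((graftL 𝕜 f g t).flip (Finsupp.single (b :: Y) 1)).comp (consL 𝕜 a))
    ((-1 : 𝕜) ^ (b.2 * (a.2 + d)) •
      ((consL 𝕜 (g b.1, b.2)).comp
        (((graftL 𝕜 f g t).flip (Finsupp.single Y 1)).comp (consL 𝕜 a))) +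
      (consL 𝕜 (g b.1, a.2)).comp ((graftL 𝕜 f g t).flip (Finsupp.single (b :: Y) 1))) S
    (fun w hw => by simp [graft_cons_cons ha, hS w hw])
  simpa using this

/-- Expansion of a grafting in which both factors start with given letters. -/
theorem graftL_cons_consL {a : ℕ × ℕ} (ha : a.1 = t) (X : List (ℕ × ℕ)) (b : ℕ × ℕ)
    (T : List (ℕ × ℕ) →₀ 𝕜) :
    graftL 𝕜 f g t (Finsupp.single (a :: X) 1) (consL 𝕜 b T) =
      (-1 : 𝕜) ^ (b.2 * (a.2 + weight X)) •
          consL 𝕜 (g b.1, b.2) (graftL 𝕜 f g t (Finsupp.single (a :: X) 1) T) +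
        consL 𝕜 (g b.1, a.2) (graftL 𝕜 f g t (Finsupp.single X 1) (consL 𝕜 b T)) := by
  have := Finsupp.map_eq_of_forall_support
    ((graftL 𝕜 f g t (Finsupp.single (a :: X) 1)).comp (consL 𝕜 b))
    ((-1 : 𝕜) ^ (b.2 * (a.2 + weight X)) •
      ((consL 𝕜 (g b.1, b.2)).comp (graftL 𝕜 f g t (Finsupp.single (a :: X) 1))) +
      (consL 𝕜 (g b.1, a.2)).comp ((graftL 𝕜 f g t (Finsupp.single X 1)).comp (consL 𝕜 b))) T
    (fun w _ => by simp [graft_cons_cons ha])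
  simpa using this

theorem graft_nil_left_eq_zero {S : List (ℕ × ℕ) →₀ 𝕜} (h : ∀ w ∈ S.support, 2 ≤ w.length) :
    graftL 𝕜 f g t (Finsupp.single [] 1) S = 0 := by
  have := Finsupp.map_eq_of_forall_support (graftL 𝕜 f g t (Finsupp.single [] 1)) 0 S
    (fun w hw => by
      match w, h w hw with
      | b :: b' :: Y, _ => simp [graft_nil_cons_cons])
  simpa using this

theorem length_of_mem_graft (X Y : List (ℕ × ℕ)) :
    ∀ w ∈ (graft 𝕜 f g t X Y).support, w.length + 1 = X.length + Y.length := by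
  match X, Y with
  | X, [] => simp
  | [], [b] =>
    intro w hw
    rw [graft_nil_singleton] at hw
    split_ifs at hw with h
    · have := Finsupp.support_single_subset hw
      simp_all
    · simp at hw
  | [], b :: b' :: Y => simp [graft_nil_cons_cons]
  | a :: X, b :: Y =>
    intro w hw
    have ih1 := length_of_mem_graft (a :: X) Y
    have ih2 := length_of_mem_graft X (b :: Y)
    by_cases ha : a.1 = t
    · rw [graft_cons_cons ha] at hw
      rcases mem_support_add hw with hw | hw
      · obtain ⟨w', hw', rfl⟩ := exists_of_mem_support_consL (mem_support_smul hw)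
        have := ih1 w' hw'
        simp only [List.length_cons] at this ⊢
        omega
      · obtain ⟨w', hw', rfl⟩ := exists_of_mem_support_consL hw
        have := ih2 w' hw'
        simp only [List.length_cons] at this ⊢
        omega
    · rw [graft_cons_of_ne ha] at hw
      obtain ⟨w', hw', rfl⟩ := exists_of_mem_support_consL hw
      have := ih2 w' hw'
      simp only [List.length_cons] at this ⊢
      omega
  termination_by X.length + Y.length

end

/-- Iterated grafting into a grafted word. -/
theorem graft_graft {𝕜 : Type u} [CommRing 𝕜] {f g f' g' f₁ g₁ f₂ g₂ : ℕ → ℕ} {i j k : ℕ}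
    (X Y Z : List (ℕ × ℕ))
    (hX : ∀ a ∈ X, a.1 ≠ i → f a.1 ≠ j ∧ f' (f a.1) = f₁ a.1)
    (hY : ∀ b ∈ Y, (b.1 = k → g b.1 = j) ∧ (b.1 ≠ k → g b.1 ≠ j ∧ f' (g b.1) = g₁ (f₂ b.1)))
    (hZ : ∀ c ∈ Z, g' c.1 = g₁ (g₂ c.1)) :
    graftL 𝕜 f' g' j (graft 𝕜 f g i X Y) (Finsupp.single Z 1) =
      graftL 𝕜 f₁ g₁ i (Finsupp.single X 1) (graft 𝕜 f₂ g₂ k Y Z) := by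
  match X, Y, Z with
  | X, Y, [] => simp [graftL_nil_right]
  | X, [], c :: Z =>
    simp only [graft_nil_right, map_zero, LinearMap.zero_apply]
    have : graft 𝕜 f₂ g₂ k [] (c :: Z) =
        if Z = [] ∧ c.2 = 0 then Finsupp.single [] 1 else 0 := by
      cases Z <;> simp [graft_nil_singleton, graft_nil_cons_cons]
    rw [this]
    split_ifs
    · rw [graftL_nil_right]
    · simp
  | [], b :: b' :: Y, c :: Z =>
    rw [graft_nil_cons_cons, graft_nil_left_eq_zero]
    · simp
    · intro w hw
      have := length_of_mem_graft _ _ w hw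
      simp only [List.length_cons] at this
      omega
  | [], [b], [c] =>
    rw [graft_nil_singleton]
    by_cases hb : b.1 = k
    · rw [graft_cons_cons hb]
      by_cases h1 : b.2 = 0 <;> by_cases h2 : c.2 = 0 <;>
        simp [graft_nil_singleton, h1, h2]
    · rw [graft_cons_of_ne hb]
      by_cases h1 : b.2 = 0 <;> by_cases h2 : c.2 = 0 <;>
        simp [graft_nil_singleton, h1, h2]
  | [], [b], c :: c' :: Z =>
    rw [graft_nil_singleton, graft_nil_left_eq_zero]
    · split_ifs <;> simp [graft_nil_cons_cons]
    · intro w hw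
      have := length_of_mem_graft _ _ w hw
      simp only [List.length_cons] at this
      omega
  | a :: X, b :: Y, c :: Z =>
    have hX' : ∀ a ∈ X, a.1 ≠ i → f a.1 ≠ j ∧ f' (f a.1) = f₁ a.1 :=
      fun a ha => hX a (List.mem_cons_of_mem _ ha)
    have hY' : ∀ b ∈ Y, (b.1 = k → g b.1 = j) ∧
        (b.1 ≠ k → g b.1 ≠ j ∧ f' (g b.1) = g₁ (f₂ b.1)) :=
      fun b hb => hY b (List.mem_cons_of_mem _ hb)
    have hZ' : ∀ c ∈ Z, g' c.1 = g₁ (g₂ c.1) := fun c hc => hZ c (List.mem_cons_of_mem _ hc)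
    by_cases ha : a.1 = i
    · have ihX := graft_graft (𝕜 := 𝕜) X (b :: Y) (c :: Z) hX' hY hZ
      have ihY := graft_graft (𝕜 := 𝕜) (a :: X) Y (c :: Z) hX hY' hZ
      have ihZ := graft_graft (𝕜 := 𝕜) (a :: X) (b :: Y) Z hX hY hZ'
      rw [graft_cons_cons ha]
      by_cases hb : b.1 = k
      · have hgb : g b.1 = j := (hY b (by simp)).1 hb
        -- All three words can advance here. Expanding both sides gives one term in which Z moves
        -- on, one in which Y does (c takes the weight of b), and one in which X does (c takes the
        -- weight of a); these are the three induction hypotheses.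
        rw [graft_cons_cons hb] at ihX ⊢
        rw [graft_cons_cons ha] at ihZ
        simp only [map_add, map_smul, LinearMap.add_apply, LinearMap.smul_apply] at ihX ihY ihZ ⊢
        rw [graftL_consL_cons (a := (g b.1, b.2)) hgb (weight_of_mem_graft _ _),
          graftL_consL_cons (a := (g b.1, a.2)) hgb (weight_of_mem_graft _ _),
          graftL_cons_consL ha, graftL_cons_consL ha, ihY, ihX]
        rw [← hZ c (by simp), ← ihZ]
        simp only [weight_cons, map_add, map_smul]
        module
      · obtain ⟨hgb, hgb'⟩ := (hY b (by simp)).2 hb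
        rw [graft_cons_of_ne hb] at ihX ⊢
        simp only [map_add, map_smul, LinearMap.add_apply, LinearMap.smul_apply]
        rw [graftL_consL_of_ne (by exact hgb), graftL_consL_of_ne (by exact hgb),
          graftL_cons_consL ha, ihX, ihY]
        simp only [hgb']
    · obtain ⟨h1, h2⟩ := hX a (by simp) ha
      have ih := graft_graft (𝕜 := 𝕜) X (b :: Y) (c :: Z) hX' hY hZ
      rw [graft_cons_of_ne ha, graftL_consL_of_ne (by exact h1), ih, ← consL_single,
        graftL_consL_of_ne ha]
      simp only [h2]
  termination_by X.length + Y.length + Z.length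

/-- Grafting at two different letters. -/
theorem graft_graft_comm {𝕜 : Type u} [CommRing 𝕜] {f g f' g' f₁ g₁ f₁' g₁' : ℕ → ℕ}
    {i j j' k : ℕ} (hij : i ≠ j) (X Y Z : List (ℕ × ℕ)) (hj : f j = j') (hi : f₁ i = k)
    (hX : ∀ a ∈ X, a.1 ≠ i → a.1 ≠ j → f a.1 ≠ j' ∧ f₁ a.1 ≠ k ∧ f' (f a.1) = f₁' (f₁ a.1))
    (hY : ∀ b ∈ Y, g b.1 ≠ j' ∧ f' (g b.1) = g₁' b.1)
    (hZ : ∀ c ∈ Z, g₁ c.1 ≠ k ∧ g' c.1 = f₁' (g₁ c.1)) :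
    graftL 𝕜 f' g' j' (graft 𝕜 f g i X Y) (Finsupp.single Z 1) =
      (-1 : 𝕜) ^ (weight Y * weight Z) •
        graftL 𝕜 f₁' g₁' k (graft 𝕜 f₁ g₁ j X Z) (Finsupp.single Y 1) := by
  match X, Y, Z with
  | X, Y, [] => simp [graftL_nil_right]
  | X, [], c :: Z => simp [graftL_nil_right]
  | [], b :: b' :: Y, c :: Z =>
    have : graft 𝕜 f₁ g₁ j [] (c :: Z) =
        if Z = [] ∧ c.2 = 0 then Finsupp.single [] 1 else 0 := by
      cases Z <;> simp [graft_nil_singleton, graft_nil_cons_cons]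
    rw [this]
    split_ifs <;> simp [graft_nil_cons_cons]
  | [], [b], c :: c' :: Z =>
    rw [graft_nil_singleton]
    split_ifs <;> simp [graft_nil_cons_cons]
  | [], [b], [c] =>
    rw [graft_nil_singleton, graft_nil_singleton]
    by_cases h1 : b.2 = 0 <;> by_cases h2 : c.2 = 0 <;> simp [graft_nil_singleton, h1, h2]
  | a :: X, b :: Y, c :: Z =>
    have hX' : ∀ a ∈ X, a.1 ≠ i → a.1 ≠ j → f a.1 ≠ j' ∧ f₁ a.1 ≠ k ∧
        f' (f a.1) = f₁' (f₁ a.1) := fun a ha => hX a (List.mem_cons_of_mem _ ha)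
    have hY' : ∀ b ∈ Y, g b.1 ≠ j' ∧ f' (g b.1) = g₁' b.1 :=
      fun b hb => hY b (List.mem_cons_of_mem _ hb)
    have hZ' : ∀ c ∈ Z, g₁ c.1 ≠ k ∧ g' c.1 = f₁' (g₁ c.1) :=
      fun c hc => hZ c (List.mem_cons_of_mem _ hc)
    have ihX := graft_graft_comm (𝕜 := 𝕜) hij X (b :: Y) (c :: Z) hj hi hX' hY hZ
    by_cases hai : a.1 = i
    · have ihY := graft_graft_comm (𝕜 := 𝕜) hij (a :: X) Y (c :: Z) hj hi hX hY' hZ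
      have haj : a.1 ≠ j := hai ▸ hij
      have h1 : f₁ a.1 = k := hai ▸ hi
      obtain ⟨hb1, hb2⟩ := hY b (by simp)
      rw [graft_cons_of_ne haj] at ihY ⊢
      -- On the right Z has already been absorbed by the outer word, so writing b costs the
      -- additional exponent `b.2 * weight Z`. The same exponent occurs in the interchange sign as
      -- the contribution of b, and the two cancel.
      rw [graft_cons_cons hai]
      simp only [map_add, map_smul, LinearMap.add_apply, LinearMap.smul_apply]
      rw [graftL_consL_of_ne (a := (g b.1, b.2)) hb1,
        graftL_consL_of_ne (a := (g b.1, a.2)) hb1,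
        graftL_consL_cons (a := (f₁ a.1, a.2)) h1 (weight_of_mem_graft _ _), ihX, ihY]
      simp only [weight_cons, map_smul, hb2]
      match_scalars <;> ring_nf <;> simp only [neg_one_pow_mul_two] <;> ring_nf
    · by_cases haj : a.1 = j
      · have ihZ := graft_graft_comm (𝕜 := 𝕜) hij (a :: X) (b :: Y) Z hj hi hX hY hZ'
        have h1 : f a.1 = j' := haj ▸ hj
        obtain ⟨hc1, hc2⟩ := hZ c (by simp)
        rw [graft_cons_of_ne hai] at ihZ ⊢
        rw [graft_cons_cons haj]
        simp only [map_add, map_smul, LinearMap.add_apply, LinearMap.smul_apply]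
        rw [graftL_consL_of_ne (a := (g₁ c.1, c.2)) hc1,
          graftL_consL_of_ne (a := (g₁ c.1, a.2)) hc1,
          graftL_consL_cons (a := (f a.1, a.2)) h1 (weight_of_mem_graft _ _), ihX, ihZ]
        simp only [weight_cons, map_smul, hc2]
        module
      · obtain ⟨h1, h2, h3⟩ := hX a (by simp) hai haj
        rw [graft_cons_of_ne hai, graft_cons_of_ne haj, graftL_consL_of_ne (a := (f a.1, a.2)) h1,
          graftL_consL_of_ne (a := (f₁ a.1, a.2)) h2, ihX, map_smul]
        simp only [h3]
  termination_by X.length + Y.length + Z.length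

end Words

namespace Words

/-! ## Words and their decorations -/

/-- `1` if the letter `x` occurs in `u`, and `0` otherwise. -/
def rep (x : ℕ) (u : List ℕ) : ℕ := if x ∈ u then 1 else 0

/-- The decoration of a word: occurrences that are not the last ones have weight `1`. -/
def dec : List ℕ → List (ℕ × ℕ)
  | [] => []
  | x :: u => (x, rep x u) :: dec u

/-- The degree of a word, the number of letters that are not last occurrences. -/
def deg (u : List ℕ) : ℕ := weight (dec u)

@[simp] theorem dec_nil : dec [] = [] := rfl

@[simp] theorem dec_cons (x : ℕ) (u : List ℕ) : dec (x :: u) = (x, rep x u) :: dec u := rfl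

@[simp] theorem deg_nil : deg [] = 0 := rfl

@[simp] theorem deg_cons (x : ℕ) (u : List ℕ) : deg (x :: u) = rep x u + deg u := by simp [deg]

@[simp] theorem rep_nil (x : ℕ) : rep x [] = 0 := by simp [rep]

theorem rep_of_mem {x : ℕ} {u : List ℕ} (h : x ∈ u) : rep x u = 1 := if_pos h

theorem rep_of_not_mem {x : ℕ} {u : List ℕ} (h : x ∉ u) : rep x u = 0 := if_neg h

theorem rep_congr {x y : ℕ} {u w : List ℕ} (h : x ∈ u ↔ y ∈ w) : rep x u = rep y w := by
  simp [rep, h]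

theorem map_fst_dec (u : List ℕ) : (dec u).map Prod.fst = u := by
  induction u with
  | nil => rfl
  | cons x u ih => simp [ih]

theorem exists_mem_dec {p : ℕ → Prop} {u : List ℕ} : (∃ a ∈ dec u, p a.1) ↔ ∃ a ∈ u, p a := by
  conv_rhs => rw [← map_fst_dec u]
  simp

theorem forall_mem_dec {p : ℕ → Prop} {u : List ℕ} : (∀ a ∈ dec u, p a.1) ↔ ∀ a ∈ u, p a := by
  conv_rhs => rw [← map_fst_dec u]
  simp

/-- Every value has exactly one last occurrence. Hence the degree depends only on the length and the
set of letters, which is how degrees are compared below. -/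
theorem deg_add_card (u : List ℕ) : deg u + u.toFinset.card = u.length := by
  induction u with
  | nil => simp
  | cons x u ih =>
    by_cases h : x ∈ u
    · simp [rep_of_mem h, h]; omega
    · rw [List.toFinset_cons, Finset.card_insert_of_notMem (by simpa using h)]
      simp [rep_of_not_mem h]; omega

theorem deg_eq_of {u w : List ℕ} {k : ℕ} (hl : u.length = w.length + k)
    (h : ∀ x, x ∈ u ↔ x ∈ w) : deg u = deg w + k := by
  have h1 := deg_add_card u
  have h2 := deg_add_card w
  have : u.toFinset = w.toFinset := by ext x; simp [h]
  rw [this] at h1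
  omega

theorem dec_map {h : ℕ → ℕ} {u : List ℕ} (hu : Set.InjOn h {x | x ∈ u}) :
    dec (u.map h) = (dec u).map (Prod.map h id) := by
  induction u with
  | nil => rfl
  | cons x u ih =>
    have h1 : h x ∈ u.map h ↔ x ∈ u := by
      rw [List.mem_map]
      constructor
      · rintro ⟨y, hy, hxy⟩
        exact hu (by simp) (by simp [hy]) hxy.symm ▸ hy
      · exact fun hx => ⟨x, hx, rfl⟩
    rw [List.map_cons, dec_cons, dec_cons, ih (hu.mono fun y hy => by simp_all), rep_congr h1]
    rfl

section

variable {𝕜 : Type u} [CommRing 𝕜] {f g : ℕ → ℕ} {t : ℕ}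

variable (𝕜) in
/-- Decorating, linearly. -/
noncomputable def decL : (List ℕ →₀ 𝕜) →ₗ[𝕜] (List (ℕ × ℕ) →₀ 𝕜) := Finsupp.lmapDomain 𝕜 𝕜 dec

variable (𝕜) in
/-- Forgetting the weights, linearly. -/
noncomputable def undecL : (List (ℕ × ℕ) →₀ 𝕜) →ₗ[𝕜] (List ℕ →₀ 𝕜) :=
  Finsupp.lmapDomain 𝕜 𝕜 (List.map Prod.fst)

@[simp] theorem decL_single (u : List ℕ) (c : 𝕜) :
    decL 𝕜 (Finsupp.single u c) = Finsupp.single (dec u) c := by simp [decL]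

@[simp] theorem undecL_single (u : List (ℕ × ℕ)) (c : 𝕜) :
    undecL 𝕜 (Finsupp.single u c) = Finsupp.single (u.map Prod.fst) c := by simp [undecL]

theorem undecL_consL (a : ℕ × ℕ) (S : List (ℕ × ℕ) →₀ 𝕜) :
    undecL 𝕜 (consL 𝕜 a S) = consL 𝕜 a.1 (undecL 𝕜 S) := by
  have := Finsupp.map_eq_of_forall_support ((undecL 𝕜).comp (consL 𝕜 a))
    ((consL 𝕜 a.1).comp (undecL 𝕜)) S (by simp)
  simpa using this

theorem graft_of_not_mem {X : List (ℕ × ℕ)} (hX : ∀ a ∈ X, a.1 ≠ t) (b : ℕ × ℕ) (hb : b.2 = 0) :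
    graft 𝕜 f g t X [b] = Finsupp.single (X.map (Prod.map f id)) 1 := by
  induction X with
  | nil => simp [graft_nil_singleton, hb]
  | cons a X ih =>
    rw [graft_cons_of_ne (hX a (by simp)), ih fun a ha => hX a (by simp [ha])]
    simp [Prod.map]

theorem graft_of_not_mem_cons_cons {X : List (ℕ × ℕ)} (hX : ∀ a ∈ X, a.1 ≠ t) (b b' : ℕ × ℕ)
    (Y : List (ℕ × ℕ)) : graft 𝕜 f g t X (b :: b' :: Y) = 0 := by
  induction X with
  | nil => exact graft_nil_cons_cons _ _ _
  | cons a X ih =>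
    rw [graft_cons_of_ne (hX a (by simp)), ih fun a ha => hX a (by simp [ha]), map_zero]

theorem eq_of_mem_graft_of_not_mem {X : List (ℕ × ℕ)} (hX : ∀ a ∈ X, a.1 ≠ t) {Y : List (ℕ × ℕ)}
    {w : List (ℕ × ℕ)} (hw : w ∈ (graft 𝕜 f g t X Y).support) :
    w = X.map (Prod.map f id) ∧ Y.length = 1 := by
  match Y with
  | [] => simp at hw
  | [b] =>
    refine ⟨?_, rfl⟩
    by_cases hb : b.2 = 0
    · rw [graft_of_not_mem hX b hb] at hw
      simpa using Finsupp.support_single_subset hw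
    · have : graft 𝕜 f g t X [b] = 0 := by
        clear hw
        induction X with
        | nil => simp [graft_nil_singleton, hb]
        | cons a X ih =>
          rw [graft_cons_of_ne (hX a (by simp)), ih fun a ha => hX a (by simp [ha]), map_zero]
      simp [this] at hw
  | b :: b' :: Y => simp [graft_of_not_mem_cons_cons hX] at hw

/-- The letter closing a piece is not used up, so one occurrence of t suffices for all of Y to be
written. Without any t nothing of Y would appear. -/
theorem mem_of_mem_graft {X Y : List (ℕ × ℕ)} (ht : ∃ a ∈ X, a.1 = t) {w : List (ℕ × ℕ)}
    (hw : w ∈ (graft 𝕜 f g t X Y).support) (y : ℕ) :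
    (∃ z ∈ w, z.1 = y) ↔ (∃ a ∈ X, a.1 ≠ t ∧ f a.1 = y) ∨ ∃ b ∈ Y, g b.1 = y := by
  match X, Y with
  | [], _ => simp at ht
  | X, [] => simp at hw
  | a :: X, b :: Y =>
    have ih1 := fun w h => mem_of_mem_graft (X := a :: X) (Y := Y)
      (w := w) ht h y
    have ih2 := fun h' w h => mem_of_mem_graft (X := X) (Y := b :: Y)
      (w := w) h' h y
    by_cases ha : a.1 = t
    · rw [graft_cons_cons ha] at hw
      rcases mem_support_add hw with hw | hw
      · obtain ⟨w', hw', rfl⟩ := exists_of_mem_support_consL (mem_support_smul hw)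
        have := ih1 w' hw'
        simp only [List.exists_mem_cons_iff, this]
        clear this
        generalize (∃ a ∈ X, a.1 ≠ t ∧ f a.1 = y) = A
        generalize (∃ b ∈ Y, g b.1 = y) = B
        clear ih1 ih2 ht hw' hw
        tauto
      · obtain ⟨w', hw', rfl⟩ := exists_of_mem_support_consL hw
        by_cases hX : ∃ a ∈ X, a.1 = t
        · have := ih2 hX w' hw'
          simp only [List.exists_mem_cons_iff, this, ha]
          clear this
          generalize (∃ a ∈ X, a.1 ≠ t ∧ f a.1 = y) = A
          generalize (∃ b ∈ Y, g b.1 = y) = B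
          clear ih1 ih2 ht hw' hw
          tauto
        · push Not at hX
          obtain ⟨rfl, hY⟩ := eq_of_mem_graft_of_not_mem hX hw'
          obtain rfl : Y = [] := by simpa using hY
          have h3 : (∃ z ∈ X.map (Prod.map f id), z.1 = y) ↔ ∃ a ∈ X, a.1 ≠ t ∧ f a.1 = y := by
            simp only [List.mem_map, exists_exists_and_eq_and, Prod.map_fst]
            constructor
            · rintro ⟨a, h, h'⟩
              exact ⟨a, h, hX a h, h'⟩
            · rintro ⟨a, h, -, h'⟩
              exact ⟨a, h, h'⟩
          simp only [List.exists_mem_cons_iff, h3, ha]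
          simp only [ne_eq, not_true, false_and, false_or, List.not_mem_nil, exists_false,
            or_false]
          exact or_comm
    · rw [graft_cons_of_ne ha] at hw
      obtain ⟨w', hw', rfl⟩ := exists_of_mem_support_consL hw
      have := ih2 (by simpa [ha] using ht) w' hw'
      simp only [List.exists_mem_cons_iff, this]
      clear this
      generalize (∃ a ∈ X, a.1 ≠ t ∧ f a.1 = y) = A
      generalize (∃ b ∈ Y, g b.1 = y) = B
      clear ih1 ih2 ht hw' hw
      tauto
  termination_by X.length + Y.length

/-- Used to rename the grafted letter to a fresh one (`Compatible.graft_eq`) and to change the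
relabelling on letters that do not occur (`circW_last_congr`). -/
theorem graft_map {f₀ g₀ f' : ℕ → ℕ} {s : ℕ} (X Y : List (ℕ × ℕ))
    (hX : ∀ a ∈ X, (a.1 = t → f₀ a.1 = s) ∧ (a.1 ≠ t → f₀ a.1 ≠ s ∧ f' (f₀ a.1) = f a.1)) :
    graft 𝕜 f' g s (X.map (Prod.map f₀ id)) (Y.map (Prod.map g₀ id)) =
      graft 𝕜 f (g ∘ g₀) t X Y := by
  match X, Y with
  | X, [] => simp
  | [], [b] => simp [graft_nil_singleton]
  | [], b :: b' :: Y => simp [graft_nil_cons_cons]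
  | a :: X, b :: Y =>
    have hX' : ∀ a ∈ X, (a.1 = t → f₀ a.1 = s) ∧ (a.1 ≠ t → f₀ a.1 ≠ s ∧ f' (f₀ a.1) = f a.1) :=
      fun a ha => hX a (List.mem_cons_of_mem _ ha)
    have ih1 := graft_map (g₀ := g₀) (a :: X) Y hX
    have ih2 := graft_map (g₀ := g₀) X (b :: Y) hX'
    have hw : weight (X.map (Prod.map f₀ id)) = weight X := by simp [weight, Function.comp_def]
    by_cases ha : a.1 = t
    · have h1 := (hX a (by simp)).1 ha
      rw [graft_cons_cons ha, ← ih1, ← ih2]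
      simp only [List.map_cons]
      rw [graft_cons_cons (by simpa using h1), hw]
      rfl
    · obtain ⟨h1, h2⟩ := (hX a (by simp)).2 ha
      rw [graft_cons_of_ne ha, ← ih2]
      simp only [List.map_cons]
      rw [graft_cons_of_ne (by simpa using h1)]
      simp [h2]
  termination_by X.length + Y.length

theorem mem_iff_exists_fst {w : List (ℕ × ℕ)} {y : ℕ} :
    y ∈ w.map Prod.fst ↔ ∃ z ∈ w, z.1 = y := by simp

/-- A grafting of decorated words of words is the decoration of its underlying words. -/
theorem dec_map_fst_of_mem_graft (v u : List ℕ) (hu : ∀ x ∈ u, x ∉ v) (w : List (ℕ × ℕ))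
    (hw : w ∈ (graft 𝕜 id id t (dec v) (dec u)).support) : dec (w.map Prod.fst) = w := by
  match v, u with
  | v, [] => simp at hw
  | [], [x] =>
    have := eq_of_mem_graft_of_not_mem (by simp) hw
    simp_all
  | [], x :: x' :: u => simp [graft_nil_cons_cons] at hw
  | a :: v, x :: u =>
    have ih1 := dec_map_fst_of_mem_graft (a :: v) u (fun y hy => hu y (by simp [hy]))
    have ih2 := dec_map_fst_of_mem_graft v (x :: u)
      (fun y hy h => hu y hy (List.mem_cons_of_mem _ h))
    have hxv : x ∉ v := fun h => hu x (by simp) (by simp [h])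
    by_cases ha : a = t
    · simp only [dec_cons] at hw
      rw [graft_cons_cons (by exact ha)] at hw
      rcases mem_support_add hw with hw | hw
      · obtain ⟨w', hw', rfl⟩ := exists_of_mem_support_consL (mem_support_smul hw)
        have h1 := mem_of_mem_graft (by simp [ha]) hw' x
        rw [List.map_cons, dec_cons, ih1 w' hw']
        congr 2
        refine rep_congr ?_
        rw [mem_iff_exists_fst]
        refine Iff.trans h1 ?_
        have h2 := exists_mem_dec (p := fun y => id y = x) (u := u)
        have h3 := exists_mem_dec (p := fun y => y ≠ t ∧ id y = x) (u := a :: v)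
        rw [dec_cons] at h3
        simp only [id] at h2 h3 ⊢
        rw [h2, h3]
        constructor
        · rintro (⟨y, hy, hyt, rfl⟩ | ⟨y, hy, rfl⟩)
          · rw [List.mem_cons] at hy
            rcases hy with rfl | hy
            · exact absurd ha hyt
            · exact absurd hy hxv
          · exact hy
        · exact fun h => Or.inr ⟨x, h, rfl⟩
      · obtain ⟨w', hw', rfl⟩ := exists_of_mem_support_consL hw
        rw [List.map_cons, dec_cons, ih2 w' (by simpa using hw')]
        congr 2
        refine rep_congr ?_
        rw [mem_iff_exists_fst]
        -- The letter x closing the piece carries the weight of t. If t recurs, the next piece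
        -- starts with x again; if not, the rest is v, in which x does not occur. So x recurs
        -- exactly when t does.
        by_cases ht : t ∈ v
        · have ht' : ∃ a ∈ dec v, a.1 = t := (exists_mem_dec (p := fun y => y = t)).2 ⟨t, ht, rfl⟩
          have h1 := mem_of_mem_graft ht' hw' x
          simp only [ha, ht, iff_true]
          exact h1.2 (Or.inr ⟨(x, rep x u), by simp, rfl⟩)
        · have ht' : ∀ a ∈ dec v, a.1 ≠ t :=
            (forall_mem_dec (p := fun y => y ≠ t)).2 fun y hy h => ht (h ▸ hy)
          obtain ⟨rfl, -⟩ := eq_of_mem_graft_of_not_mem ht' hw'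
          have h2 := exists_mem_dec (p := fun y => y = x) (u := v)
          rw [Prod.map_id, List.map_id]
          refine Iff.trans h2 ?_
          simp only [ha, ht, iff_false]
          rintro ⟨y, hy, rfl⟩
          exact hxv hy
    · simp only [dec_cons] at hw
      rw [graft_cons_of_ne (by exact ha)] at hw
      obtain ⟨w', hw', rfl⟩ := exists_of_mem_support_consL hw
      rw [List.map_cons, dec_cons, ih2 w' (by simpa using hw')]
      congr 2
      refine rep_congr ?_
      rw [mem_iff_exists_fst]
      have hau : a ∉ x :: u := fun h => hu a h (by simp)
      by_cases ht : t ∈ v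
      · have ht' : ∃ a ∈ dec v, a.1 = t := (exists_mem_dec (p := fun y => y = t)).2 ⟨t, ht, rfl⟩
        have h1 := mem_of_mem_graft ht' hw' a
        refine Iff.trans h1 ?_
        have h2 := exists_mem_dec (p := fun y => id y = a) (u := x :: u)
        have h3 := exists_mem_dec (p := fun y => y ≠ t ∧ id y = a) (u := v)
        rw [dec_cons] at h2
        simp only [id] at h2 h3 ⊢
        rw [h2, h3]
        constructor
        · rintro (⟨y, hy, hyt, rfl⟩ | ⟨y, hy, rfl⟩)
          · exact hy
          · exact absurd hy hau
        · exact fun h => Or.inl ⟨a, h, ha, rfl⟩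
      · have ht' : ∀ a ∈ dec v, a.1 ≠ t :=
          (forall_mem_dec (p := fun y => y ≠ t)).2 fun y hy h => ht (h ▸ hy)
        obtain ⟨rfl, -⟩ := eq_of_mem_graft_of_not_mem ht' hw'
        have h2 := exists_mem_dec (p := fun y => y = a) (u := v)
        rw [Prod.map_id, List.map_id]
        exact h2.trans (by simp)
  termination_by v.length + u.length

end

end Words

namespace Words

/-! ## Composition of words and the simplicial differential -/

/-- The signed sum of all words obtained from `v` by substituting pieces of `u` for the occurrences
of the letter `t`. -/
noncomputable def comp (𝕜 : Type u) [CommRing 𝕜] (t : ℕ) (v u : List ℕ) : List ℕ →₀ 𝕜 :=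
  undecL 𝕜 (graft 𝕜 id id t (dec v) (dec u))

/-- Erasing the letter `x` if it occurs exactly once; `0` otherwise. -/
noncomputable def eraseOnce (𝕜 : Type u) [CommRing 𝕜] (x : ℕ) : List ℕ → (List ℕ →₀ 𝕜)
  | [] => 0
  | y :: u =>
    if y = x then (if x ∈ u then 0 else Finsupp.single u 1) else consL 𝕜 y (eraseOnce 𝕜 x u)

/-- The differential of a word. -/
noncomputable def del (𝕜 : Type u) [CommRing 𝕜] : List ℕ → (List ℕ →₀ 𝕜)
  | [] => 0
  | x :: u => (if x ∈ u then Finsupp.single u 1 else 0) +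
      (-1 : 𝕜) ^ rep x u • consL 𝕜 x (del 𝕜 u) - consL 𝕜 x (eraseOnce 𝕜 x u)

section

variable {𝕜 : Type u} [CommRing 𝕜] {t : ℕ}

variable (𝕜) in
/-- The bilinear extension of `comp`. -/
noncomputable def compL (t : ℕ) :
    (List ℕ →₀ 𝕜) →ₗ[𝕜] (List ℕ →₀ 𝕜) →ₗ[𝕜] (List ℕ →₀ 𝕜) :=
  Finsupp.linearCombination 𝕜 fun v => Finsupp.linearCombination 𝕜 (comp 𝕜 t v)

variable (𝕜) in
/-- The linear extension of `eraseOnce`. -/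
noncomputable def eraseOnceL (x : ℕ) : (List ℕ →₀ 𝕜) →ₗ[𝕜] (List ℕ →₀ 𝕜) :=
  Finsupp.linearCombination 𝕜 (eraseOnce 𝕜 x)

variable (𝕜) in
/-- The linear extension of `del`. -/
noncomputable def delL : (List ℕ →₀ 𝕜) →ₗ[𝕜] (List ℕ →₀ 𝕜) :=
  Finsupp.linearCombination 𝕜 (del 𝕜)

@[simp] theorem compL_single (v u : List ℕ) :
    compL 𝕜 t (Finsupp.single v 1) (Finsupp.single u 1) = comp 𝕜 t v u := by simp [compL]

@[simp] theorem eraseOnceL_single (x : ℕ) (u : List ℕ) :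
    eraseOnceL 𝕜 x (Finsupp.single u 1) = eraseOnce 𝕜 x u := by simp [eraseOnceL]

@[simp] theorem delL_single (u : List ℕ) : delL 𝕜 (Finsupp.single u 1) = del 𝕜 u := by
  simp [delL]

@[simp] theorem comp_nil_right (v : List ℕ) : comp 𝕜 t v [] = 0 := by simp [comp]

theorem comp_of_not_mem {v : List ℕ} (h : t ∉ v) (x : ℕ) :
    comp 𝕜 t v [x] = Finsupp.single v 1 := by
  have h' : ∀ a ∈ dec v, a.1 ≠ t :=
    (forall_mem_dec (p := fun y => y ≠ t)).2 fun y hy h' => h (h' ▸ hy)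
  rw [comp, dec_cons, dec_nil, graft_of_not_mem h' _ (by simp)]
  simp [map_fst_dec]

theorem comp_of_not_mem_cons_cons {v : List ℕ} (h : t ∉ v) (x y : ℕ) (u : List ℕ) :
    comp 𝕜 t v (x :: y :: u) = 0 := by
  have h' : ∀ a ∈ dec v, a.1 ≠ t :=
    (forall_mem_dec (p := fun y => y ≠ t)).2 fun y hy h' => h (h' ▸ hy)
  rw [comp, dec_cons, dec_cons, graft_of_not_mem_cons_cons h', map_zero]

theorem comp_of_not_mem_eq_zero {v u : List ℕ} (h : t ∉ v) (hu : u.length ≠ 1) :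
    comp 𝕜 t v u = 0 := by
  match u with
  | [] => simp
  | [x] => simp at hu
  | x :: y :: u => exact comp_of_not_mem_cons_cons h _ _ _

theorem comp_cons_of_ne {a : ℕ} (ha : a ≠ t) (v u : List ℕ) :
    comp 𝕜 t (a :: v) u = consL 𝕜 a (comp 𝕜 t v u) := by
  simp only [comp, dec_cons]
  rw [graft_cons_of_ne (by exact ha), undecL_consL]
  rfl

theorem comp_cons_cons (v : List ℕ) (x : ℕ) (u : List ℕ) :
    comp 𝕜 t (t :: v) (x :: u) =
      (-1 : 𝕜) ^ (rep x u * deg (t :: v)) • consL 𝕜 x (comp 𝕜 t (t :: v) u) +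
        consL 𝕜 x (comp 𝕜 t v (x :: u)) := by
  simp only [comp, dec_cons]
  rw [graft_cons_cons (a := (t, rep t v)) rfl, map_add, map_smul, undecL_consL, undecL_consL]
  simp [deg]

theorem exists_of_mem_comp {v u w : List ℕ} (hw : w ∈ (comp 𝕜 t v u).support) :
    ∃ w' ∈ (graft 𝕜 id id t (dec v) (dec u)).support, w = w'.map Prod.fst := by
  classical
  have := Finsupp.mapDomain_support hw
  obtain ⟨w', hw', rfl⟩ := Finset.mem_image.1 this
  exact ⟨w', hw', rfl⟩

theorem mem_of_mem_comp {v u w : List ℕ} (ht : t ∈ v) (hw : w ∈ (comp 𝕜 t v u).support) (y : ℕ) :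
    y ∈ w ↔ (y ≠ t ∧ y ∈ v) ∨ y ∈ u := by
  obtain ⟨w', hw', rfl⟩ := exists_of_mem_comp hw
  have ht' : ∃ a ∈ dec v, a.1 = t := (exists_mem_dec (p := fun y => y = t)).2 ⟨t, ht, rfl⟩
  rw [mem_iff_exists_fst]
  refine (mem_of_mem_graft ht' hw' y).trans (or_congr ?_ ?_)
  · refine (exists_mem_dec (p := fun z => z ≠ t ∧ id z = y)).trans ?_
    constructor
    · rintro ⟨a, h1, h2, rfl⟩; exact ⟨h2, h1⟩
    · rintro ⟨h1, h2⟩; exact ⟨y, h2, h1, rfl⟩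
  · refine (exists_mem_dec (p := fun z => id z = y)).trans ?_
    simp

theorem compL_consL_of_ne {a : ℕ} (ha : a ≠ t) (S T : List ℕ →₀ 𝕜) :
    compL 𝕜 t (consL 𝕜 a S) T = consL 𝕜 a (compL 𝕜 t S T) := by
  have h : ∀ Y, compL 𝕜 t (consL 𝕜 a S) (Finsupp.single Y 1) =
      consL 𝕜 a (compL 𝕜 t S (Finsupp.single Y 1)) := by
    intro Y
    have := Finsupp.map_eq_of_forall_support
      (((compL 𝕜 t).flip (Finsupp.single Y 1)).comp (consL 𝕜 a))
      ((consL 𝕜 a).comp ((compL 𝕜 t).flip (Finsupp.single Y 1))) S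
      (fun X _ => by simp [comp_cons_of_ne ha])
    simpa using this
  have := Finsupp.map_eq_of_forall_support (compL 𝕜 t (consL 𝕜 a S))
    ((consL 𝕜 a).comp (compL 𝕜 t S)) T (fun Y _ => h Y)
  simpa using this

theorem compL_nil_right (S : List ℕ →₀ 𝕜) : compL 𝕜 t S (Finsupp.single [] 1) = 0 := by
  have := Finsupp.map_eq_of_forall_support ((compL 𝕜 t).flip (Finsupp.single [] 1)) 0 S
    (by simp)
  simpa using this

theorem compL_consL_cons {d : ℕ} {S : List ℕ →₀ 𝕜} (hS : ∀ w ∈ S.support, deg (t :: w) = d)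
    (x : ℕ) (u : List ℕ) :
    compL 𝕜 t (consL 𝕜 t S) (Finsupp.single (x :: u) 1) =
      (-1 : 𝕜) ^ (rep x u * d) •
          consL 𝕜 x (compL 𝕜 t (consL 𝕜 t S) (Finsupp.single u 1)) +
        consL 𝕜 x (compL 𝕜 t S (Finsupp.single (x :: u) 1)) := by
  have := Finsupp.map_eq_of_forall_support
    (((compL 𝕜 t).flip (Finsupp.single (x :: u) 1)).comp (consL 𝕜 t))
    ((-1 : 𝕜) ^ (rep x u * d) •
      ((consL 𝕜 x).comp (((compL 𝕜 t).flip (Finsupp.single u 1)).comp (consL 𝕜 t))) +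
      (consL 𝕜 x).comp ((compL 𝕜 t).flip (Finsupp.single (x :: u) 1))) S
    (fun w hw => by simp only [← hS w hw]; simp [comp_cons_cons])
  simpa using this

theorem compL_cons_consL (v : List ℕ) (x : ℕ) {r : ℕ} {T : List ℕ →₀ 𝕜}
    (hT : ∀ w ∈ T.support, rep x w = r) :
    compL 𝕜 t (Finsupp.single (t :: v) 1) (consL 𝕜 x T) =
      (-1 : 𝕜) ^ (r * deg (t :: v)) •
          consL 𝕜 x (compL 𝕜 t (Finsupp.single (t :: v) 1) T) +
        consL 𝕜 x (compL 𝕜 t (Finsupp.single v 1) (consL 𝕜 x T)) := by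
  have := Finsupp.map_eq_of_forall_support
    ((compL 𝕜 t (Finsupp.single (t :: v) 1)).comp (consL 𝕜 x))
    ((-1 : 𝕜) ^ (r * deg (t :: v)) •
      ((consL 𝕜 x).comp (compL 𝕜 t (Finsupp.single (t :: v) 1))) +
      (consL 𝕜 x).comp ((compL 𝕜 t (Finsupp.single v 1)).comp (consL 𝕜 x))) T
    (fun w hw => by simp [comp_cons_cons, hT w hw])
  simpa using this

theorem eraseOnceL_consL_of_ne {x y : ℕ} (h : y ≠ x) (S : List ℕ →₀ 𝕜) :
    eraseOnceL 𝕜 x (consL 𝕜 y S) = consL 𝕜 y (eraseOnceL 𝕜 x S) := by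
  have := Finsupp.map_eq_of_forall_support ((eraseOnceL 𝕜 x).comp (consL 𝕜 y))
    ((consL 𝕜 y).comp (eraseOnceL 𝕜 x)) S (by simp [eraseOnce, h])
  simpa using this

theorem eraseOnceL_consL_of_mem {x : ℕ} {S : List ℕ →₀ 𝕜} (h : ∀ w ∈ S.support, x ∈ w) :
    eraseOnceL 𝕜 x (consL 𝕜 x S) = 0 := by
  have := Finsupp.map_eq_of_forall_support ((eraseOnceL 𝕜 x).comp (consL 𝕜 x)) 0 S
    (fun w hw => by simp [eraseOnce, h w hw])
  simpa using this

theorem eraseOnceL_consL_of_not_mem {x : ℕ} {S : List ℕ →₀ 𝕜} (h : ∀ w ∈ S.support, x ∉ w) :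
    eraseOnceL 𝕜 x (consL 𝕜 x S) = S := by
  have := Finsupp.map_eq_of_forall_support ((eraseOnceL 𝕜 x).comp (consL 𝕜 x)) LinearMap.id S
    (fun w hw => by simp [eraseOnce, h w hw])
  simpa using this

theorem eraseOnce_of_not_mem {x : ℕ} {u : List ℕ} (h : x ∉ u) : eraseOnce 𝕜 x u = 0 := by
  induction u with
  | nil => rfl
  | cons y u ih =>
    rw [List.mem_cons, not_or] at h
    rw [eraseOnce, if_neg (Ne.symm h.1), ih h.2, map_zero]

theorem eraseOnceL_of_not_mem {x : ℕ} {S : List ℕ →₀ 𝕜} (h : ∀ w ∈ S.support, x ∉ w) :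
    eraseOnceL 𝕜 x S = 0 := by
  have := Finsupp.map_eq_of_forall_support (eraseOnceL 𝕜 x) 0 S
    (fun w hw => by simp [eraseOnce_of_not_mem (h w hw)])
  simpa using this

theorem eraseOnce_cons_self {x : ℕ} {u : List ℕ} :
    eraseOnce 𝕜 x (x :: u) = if x ∈ u then 0 else Finsupp.single u 1 := by simp [eraseOnce]

theorem eraseOnce_cons_of_ne {x y : ℕ} (h : y ≠ x) (u : List ℕ) :
    eraseOnce 𝕜 x (y :: u) = consL 𝕜 y (eraseOnce 𝕜 x u) := by simp [eraseOnce, h]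

theorem mem_of_mem_eraseOnce {x : ℕ} {u w : List ℕ} (hw : w ∈ (eraseOnce 𝕜 x u).support) :
    x ∈ u ∧ u.length = w.length + 1 ∧ ∀ y, y ∈ w ↔ y ≠ x ∧ y ∈ u := by
  induction u generalizing w with
  | nil => simp [eraseOnce] at hw
  | cons z u ih =>
    by_cases hz : z = x
    · subst hz
      rw [eraseOnce_cons_self] at hw
      split_ifs at hw with h
      · simp at hw
      · obtain rfl : w = u := by simpa using Finsupp.support_single_subset hw
        refine ⟨by simp, by simp, fun y => ?_⟩
        constructor
        · intro hy
          exact ⟨fun h' => h (h' ▸ hy), List.mem_cons_of_mem _ hy⟩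
        · rintro ⟨h1, h2⟩
          exact (List.mem_cons.1 h2).resolve_left h1
    · rw [eraseOnce_cons_of_ne hz] at hw
      obtain ⟨w', hw', rfl⟩ := exists_of_mem_support_consL hw
      obtain ⟨h1, h2, h3⟩ := ih hw'
      refine ⟨by simp [h1], by simp [h2], fun y => ?_⟩
      simp only [List.mem_cons, h3]
      constructor
      · rintro (rfl | h)
        · exact ⟨hz, Or.inl rfl⟩
        · exact ⟨h.1, Or.inr h.2⟩
      · rintro ⟨h, rfl | h'⟩
        · exact Or.inl rfl
        · exact Or.inr ⟨h, h'⟩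

/-- The length and the number of distinct letters both drop by one. -/
theorem deg_of_mem_eraseOnce {x : ℕ} {u w : List ℕ} (hw : w ∈ (eraseOnce 𝕜 x u).support) :
    deg w = deg u := by
  obtain ⟨h1, h2, h3⟩ := mem_of_mem_eraseOnce hw
  have : u.toFinset = insert x w.toFinset := by
    ext y
    simp only [List.mem_toFinset, Finset.mem_insert, h3]
    constructor
    · intro hy
      by_cases h : y = x
      · exact Or.inl h
      · exact Or.inr ⟨h, hy⟩
    · rintro (rfl | h)
      · exact h1
      · exact h.2
  have h4 := deg_add_card u
  have h5 := deg_add_card w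
  rw [this, Finset.card_insert_of_notMem (by simp [h3])] at h4
  omega

theorem delL_consL_of_mem {x : ℕ} {S : List ℕ →₀ 𝕜} (h : ∀ w ∈ S.support, x ∈ w) :
    delL 𝕜 (consL 𝕜 x S) =
      S - consL 𝕜 x (delL 𝕜 S) - consL 𝕜 x (eraseOnceL 𝕜 x S) := by
  have := Finsupp.map_eq_of_forall_support ((delL 𝕜).comp (consL 𝕜 x))
    (LinearMap.id - (consL 𝕜 x).comp (delL 𝕜) - (consL 𝕜 x).comp (eraseOnceL 𝕜 x)) S
    (fun w hw => by simp [del, h w hw, rep_of_mem (h w hw)]; abel)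
  simpa using this

theorem delL_consL_of_not_mem {x : ℕ} {S : List ℕ →₀ 𝕜} (h : ∀ w ∈ S.support, x ∉ w) :
    delL 𝕜 (consL 𝕜 x S) = consL 𝕜 x (delL 𝕜 S) := by
  have := Finsupp.map_eq_of_forall_support ((delL 𝕜).comp (consL 𝕜 x))
    ((consL 𝕜 x).comp (delL 𝕜)) S
    (fun w hw => by
      simp [del, h w hw, rep_of_not_mem (h w hw), eraseOnce_of_not_mem (h w hw)])
  simpa using this

theorem del_cons_of_mem {x : ℕ} {u : List ℕ} (h : x ∈ u) :
    del 𝕜 (x :: u) =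
      Finsupp.single u 1 - consL 𝕜 x (del 𝕜 u) - consL 𝕜 x (eraseOnce 𝕜 x u) := by
  simp [del, h, rep_of_mem h]; abel

theorem del_cons_of_not_mem {x : ℕ} {u : List ℕ} (h : x ∉ u) :
    del 𝕜 (x :: u) = consL 𝕜 x (del 𝕜 u) := by
  simp [del, h, rep_of_not_mem h, eraseOnce_of_not_mem h]

theorem mem_support_sub {α : Type} {S T : α →₀ 𝕜} {w : α} (h : w ∈ (S - T).support) :
    w ∈ S.support ∨ w ∈ T.support := by
  classical
  exact Finset.mem_union.1 (Finsupp.support_sub h)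

theorem mem_of_mem_del {u w : List ℕ} (hw : w ∈ (del 𝕜 u).support) :
    u.length = w.length + 1 ∧ ∀ y, y ∈ w ↔ y ∈ u := by
  induction u generalizing w with
  | nil => simp [del] at hw
  | cons x u ih =>
    by_cases hx : x ∈ u
    · rw [del_cons_of_mem hx] at hw
      rcases mem_support_sub hw with hw | hw
      · rcases mem_support_sub hw with hw | hw
        · obtain rfl : w = u := by simpa using Finsupp.support_single_subset hw
          refine ⟨by simp, fun y => ?_⟩
          rw [List.mem_cons]
          exact ⟨Or.inr, by rintro (rfl | h) <;> assumption⟩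
        · obtain ⟨w', hw', rfl⟩ := exists_of_mem_support_consL hw
          obtain ⟨h1, h2⟩ := ih hw'
          exact ⟨by simp [h1], fun y => by simp [h2]⟩
      · obtain ⟨w', hw', rfl⟩ := exists_of_mem_support_consL hw
        obtain ⟨h1, h2, h3⟩ := mem_of_mem_eraseOnce hw'
        refine ⟨by simp [h2], fun y => ?_⟩
        simp only [List.mem_cons, h3]
        by_cases h : y = x <;> simp [h]
    · rw [del_cons_of_not_mem hx] at hw
      obtain ⟨w', hw', rfl⟩ := exists_of_mem_support_consL hw
      obtain ⟨h1, h2⟩ := ih hw'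
      exact ⟨by simp [h1], fun y => by simp [h2]⟩

theorem deg_of_mem_del {u w : List ℕ} (hw : w ∈ (del 𝕜 u).support) : deg u = deg w + 1 := by
  obtain ⟨h1, h2⟩ := mem_of_mem_del hw
  exact deg_eq_of h1 fun y => (h2 y).symm

theorem eraseOnceL_comm {x y : ℕ} (h : x ≠ y) (u : List ℕ) :
    eraseOnceL 𝕜 x (eraseOnce 𝕜 y u) = eraseOnceL 𝕜 y (eraseOnce 𝕜 x u) := by
  induction u with
  | nil => simp [eraseOnce]
  | cons z u ih =>
    by_cases hx : z = x
    · subst hx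
      rw [eraseOnce_cons_of_ne h, eraseOnce_cons_self]
      split_ifs with hz
      · rw [map_zero, eraseOnceL_consL_of_mem]
        intro w hw
        exact ((mem_of_mem_eraseOnce hw).2.2 _).2 ⟨h, hz⟩
      · rw [eraseOnceL_single, eraseOnceL_consL_of_not_mem]
        intro w hw hw'
        exact hz (((mem_of_mem_eraseOnce hw).2.2 _).1 hw').2
    · by_cases hy : z = y
      · subst hy
        rw [eraseOnce_cons_of_ne hx, eraseOnce_cons_self]
        split_ifs with hz
        · rw [map_zero, eraseOnceL_consL_of_mem]
          intro w hw
          exact ((mem_of_mem_eraseOnce hw).2.2 _).2 ⟨h.symm, hz⟩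
        · rw [eraseOnceL_single, eraseOnceL_consL_of_not_mem]
          intro w hw hw'
          exact hz (((mem_of_mem_eraseOnce hw).2.2 _).1 hw').2
      · rw [eraseOnce_cons_of_ne hx, eraseOnce_cons_of_ne hy, eraseOnceL_consL_of_ne hx,
          eraseOnceL_consL_of_ne hy, ih]

/-- The only delicate case is a word (x, u) with x in u. If x occurs once in u, deleting either of
the two copies of x makes the other one erasable; the two results agree and have opposite signs. -/
theorem eraseOnceL_del (x : ℕ) (u : List ℕ) :
    eraseOnceL 𝕜 x (del 𝕜 u) = delL 𝕜 (eraseOnce 𝕜 x u) := by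
  induction u with
  | nil => simp [eraseOnce, del]
  | cons y u ih =>
    by_cases hy : y = x
    · subst hy
      rw [eraseOnce_cons_self]
      split_ifs with h
      · rw [del_cons_of_mem h, map_sub, map_sub, eraseOnceL_consL_of_mem, eraseOnceL_single,
          eraseOnceL_consL_of_not_mem]
        · simp
        · intro w hw hw'
          exact (((mem_of_mem_eraseOnce hw).2.2 _).1 hw').1 rfl
        · intro w hw
          exact ((mem_of_mem_del hw).2 _).2 h
      · rw [del_cons_of_not_mem h, eraseOnceL_consL_of_not_mem, delL_single]
        intro w hw hw'
        exact h (((mem_of_mem_del hw).2 _).1 hw')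
    · rw [eraseOnce_cons_of_ne hy]
      by_cases h : y ∈ u
      · rw [del_cons_of_mem h, map_sub, map_sub, eraseOnceL_single, eraseOnceL_consL_of_ne hy,
          eraseOnceL_consL_of_ne hy, ih, eraseOnceL_comm (Ne.symm hy), delL_consL_of_mem]
        intro w hw
        exact ((mem_of_mem_eraseOnce hw).2.2 _).2 ⟨hy, h⟩
      · rw [del_cons_of_not_mem h, eraseOnceL_consL_of_ne hy, ih, delL_consL_of_not_mem]
        intro w hw hw'
        exact h (((mem_of_mem_eraseOnce hw).2.2 _).1 hw').2

/-- Write E for erasing x in u. If x recurs, δ(x, u) = u - xδu - xEu. A second δ gives δu - (δu -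
xδδu - xEδu) - xδEu, which vanishes by induction and because E commutes with δ. -/
theorem delL_del (u : List ℕ) : delL 𝕜 (del 𝕜 u) = 0 := by
  induction u with
  | nil => simp [del]
  | cons x u ih =>
    by_cases h : x ∈ u
    · rw [del_cons_of_mem h, map_sub, map_sub, delL_single, delL_consL_of_mem,
        delL_consL_of_not_mem, ih, eraseOnceL_del]
      · simp
      · intro w hw hw'
        exact (((mem_of_mem_eraseOnce hw).2.2 _).1 hw').1 rfl
      · intro w hw
        exact ((mem_of_mem_del hw).2 _).2 h
    · rw [del_cons_of_not_mem h, delL_consL_of_not_mem, ih, map_zero]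
      intro w hw hw'
      exact h (((mem_of_mem_del hw).2 _).1 hw')

theorem mem_comp_left_iff {v u w : List ℕ} {a : ℕ} (ha : a ≠ t) (hu : a ∉ u)
    (hw : w ∈ (comp 𝕜 t v u).support) : a ∈ w ↔ a ∈ v := by
  by_cases ht : t ∈ v
  · simp [mem_of_mem_comp ht hw, ha, hu]
  · match u with
    | [] => simp at hw
    | [x] =>
      rw [comp_of_not_mem ht] at hw
      obtain rfl : w = v := by simpa using Finsupp.support_single_subset hw
      rfl
    | x :: y :: u => simp [comp_of_not_mem_cons_cons ht] at hw

theorem mem_comp_right_iff {v u w : List ℕ} {x : ℕ} (ht : t ∈ v) (hv : x ∉ v)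
    (hw : w ∈ (comp 𝕜 t v u).support) : x ∈ w ↔ x ∈ u := by
  simp [mem_of_mem_comp ht hw, hv]

/-- A letter a ≠ t not in u is repeated in the composite exactly when it is repeated in v. Erasing
its only occurrence leaves all degrees, hence all grafting signs, unchanged. -/
theorem eraseOnceL_comp_left {t a : ℕ} (ha : a ≠ t) (v u : List ℕ) (hu : a ∉ u) :
    eraseOnceL 𝕜 a (comp 𝕜 t v u) =
      compL 𝕜 t (eraseOnce 𝕜 a v) (Finsupp.single u 1) := by
  match v, u with
  | v, [] => simp [compL_nil_right]
  | [], x :: u =>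
    have : ∀ w ∈ (comp 𝕜 t [] (x :: u)).support, a ∉ w := fun w hw => by
      simp [mem_comp_left_iff ha hu hw]
    rw [eraseOnceL_of_not_mem this]
    simp [eraseOnce]
  | b :: v, x :: u =>
    have hxa : x ≠ a := fun h => hu (by simp [h])
    have hu' : a ∉ u := fun h => hu (by simp [h])
    by_cases hb : b = t
    · subst hb
      have ih1 := eraseOnceL_comp_left ha (b :: v) u hu'
      have ih2 := eraseOnceL_comp_left ha v (x :: u) hu
      rw [eraseOnce_cons_of_ne ha.symm] at ih1 ⊢
      rw [comp_cons_cons, map_add, map_smul, eraseOnceL_consL_of_ne hxa,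
        eraseOnceL_consL_of_ne hxa, ih1, ih2, compL_consL_cons]
      intro w hw
      obtain ⟨h1, h2, h3⟩ := mem_of_mem_eraseOnce hw
      rw [deg_cons, deg_cons, deg_of_mem_eraseOnce hw, rep_congr (y := b) (w := v)]
      simp [h3, ha.symm]
    · rw [comp_cons_of_ne hb]
      by_cases hba : b = a
      · subst hba
        rw [eraseOnce_cons_self]
        split_ifs with h
        · rw [eraseOnceL_consL_of_mem]
          · simp
          · exact fun w hw => (mem_comp_left_iff ha hu hw).2 h
        · rw [eraseOnceL_consL_of_not_mem]
          · simp
          · exact fun w hw hw' => h ((mem_comp_left_iff ha hu hw).1 hw')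
      · rw [eraseOnceL_consL_of_ne hba, eraseOnce_cons_of_ne hba, compL_consL_of_ne hb,
          eraseOnceL_comp_left ha v (x :: u) hu]
  termination_by v.length + u.length

theorem compL_of_not_mem_eq_zero {S : List ℕ →₀ 𝕜} (hS : ∀ w ∈ S.support, t ∉ w) {u : List ℕ}
    (hu : u.length ≠ 1) : compL 𝕜 t S (Finsupp.single u 1) = 0 := by
  have := Finsupp.map_eq_of_forall_support ((compL 𝕜 t).flip (Finsupp.single u 1)) 0 S
    (fun w hw => by simp [comp_of_not_mem_eq_zero (hS w hw) hu])
  simpa using this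

/-- If u has at least two letters, the second summand vanishes because t is gone. Cuts at x
duplicate x and are killed by the erasure, and the other cuts are those of u without x. If u = (x),
the first summand vanishes instead: grafting merely renames t to x, so x is unique in the composite
exactly when t is unique in v. -/
theorem eraseOnceL_comp_right {t : ℕ} (v u : List ℕ) (ht : t ∈ v) (htu : t ∉ u) {x : ℕ} (hx : x ∈ u)
    (hxv : x ∉ v) :
    eraseOnceL 𝕜 x (comp 𝕜 t v u) =
      compL 𝕜 t (Finsupp.single v 1) (eraseOnce 𝕜 x u) +
        compL 𝕜 t (eraseOnce 𝕜 t v) (Finsupp.single u 1) := by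
  match v, u with
  | v, [] => simp at hx
  | [], x :: u => simp at ht
  | b :: v, y :: u =>
    have hxb : x ≠ b := fun h => hxv (by simp [h])
    have hxv' : x ∉ v := fun h => hxv (by simp [h])
    by_cases hb : b = t
    · subst hb
      have hbu : b ∉ u := fun h => htu (by simp [h])
      rw [eraseOnce_cons_self, comp_cons_cons, map_add, map_smul]
      by_cases hy : y = x
      · subst hy
        rw [eraseOnce_cons_self]
        have h2 : eraseOnceL 𝕜 y (consL 𝕜 y (comp 𝕜 b v (y :: u))) =
            compL 𝕜 b (if b ∈ v then 0 else Finsupp.single v 1) (Finsupp.single (y :: u) 1) := by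
          split_ifs with hbv
          · rw [eraseOnceL_consL_of_mem, map_zero, LinearMap.zero_apply]
            exact fun w hw => (mem_comp_right_iff hbv hxv' hw).2 (by simp)
          · rw [compL_single, eraseOnceL_consL_of_not_mem]
            intro w hw
            match u with
            | [] =>
              rw [comp_of_not_mem hbv] at hw
              obtain rfl : w = v := by simpa using Finsupp.support_single_subset hw
              exact hxv'
            | z :: u => simp [comp_of_not_mem_cons_cons hbv] at hw
        rw [h2]
        congr 1
        split_ifs with h
        · rw [eraseOnceL_consL_of_mem]
          · simp
          · exact fun w hw => (mem_comp_right_iff (by simp) hxv hw).2 h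
        · rw [eraseOnceL_consL_of_not_mem]
          · simp [rep_of_not_mem h]
          · exact fun w hw hw' => h ((mem_comp_right_iff (by simp) hxv hw).1 hw')
      · have hxu : x ∈ u := (List.mem_cons.1 hx).resolve_left (Ne.symm hy)
        have ih1 := eraseOnceL_comp_right (b :: v) u ht hbu hxu hxv
        have hr : ∀ w ∈ (eraseOnce 𝕜 x u).support, rep y w = rep y u := fun w hw =>
          rep_congr (by simp [(mem_of_mem_eraseOnce hw).2.2, hy])
        rw [eraseOnceL_consL_of_ne hy, eraseOnceL_consL_of_ne hy, ih1, eraseOnce_cons_of_ne hy,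
          compL_cons_consL _ _ hr, eraseOnce_cons_self]
        have hu1 : (y :: u).length ≠ 1 := by
          intro h
          have : u = [] := by simpa using h
          simp [this] at hxu
        have hl : compL 𝕜 b (if b ∈ v then 0 else Finsupp.single v 1)
            (Finsupp.single (y :: u) 1) = 0 := by
          refine compL_of_not_mem_eq_zero (fun w hw => ?_) hu1
          split_ifs at hw with h
          · simp at hw
          · obtain rfl : w = v := by simpa using Finsupp.support_single_subset hw
            exact h
        rw [hl]
        by_cases hbv : b ∈ v
        · have ih2 := eraseOnceL_comp_right v (y :: u) hbv htu hx hxv'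
          have hl' : compL 𝕜 b (eraseOnce 𝕜 b v) (Finsupp.single (y :: u) 1) = 0 :=
            compL_of_not_mem_eq_zero
              (fun w hw h => ((((mem_of_mem_eraseOnce hw).2.2) b).1 h).1 rfl) hu1
          rw [hl', eraseOnce_cons_of_ne hy] at ih2
          rw [ih2]
          simp [hbv]
        · rw [comp_of_not_mem_eq_zero hbv hu1]
          simp only [hbv, if_false, compL_single, map_zero, add_zero, map_add, smul_add]
          congr 1
          match u with
          | [] => simp at hxu
          | [z] =>
            obtain rfl : x = z := by simpa using hxu
            rw [comp_of_not_mem hbv, eraseOnce_cons_self]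
            simp [comp_of_not_mem hbv, rep, hy]
          | z :: z' :: u =>
            rw [comp_of_not_mem_cons_cons hbv, map_zero, smul_zero]
            have := Finsupp.map_eq_of_forall_support
              ((compL 𝕜 b (Finsupp.single v 1)).comp (consL 𝕜 y)) 0 (eraseOnce 𝕜 x (z :: z' :: u))
              (fun w hw => by
                have := (mem_of_mem_eraseOnce hw).2.1
                simp only [List.length_cons] at this
                simp only [LinearMap.comp_apply, consL_single, compL_single, LinearMap.zero_apply]
                exact comp_of_not_mem_eq_zero hbv (by simp only [List.length_cons]; omega))
            have h0 : compL 𝕜 b (Finsupp.single v 1)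
                (consL 𝕜 y (eraseOnce 𝕜 x (z :: z' :: u))) = 0 := by simpa using this
            rw [h0, map_zero]
    · have ih := eraseOnceL_comp_right v (y :: u) ((List.mem_cons.1 ht).resolve_left (Ne.symm hb))
        htu hx hxv'
      rw [comp_cons_of_ne hb, eraseOnceL_consL_of_ne hxb.symm, ih, eraseOnce_cons_of_ne hb,
        compL_consL_of_ne hb, ← consL_single b v, compL_consL_of_ne hb, map_add]
  termination_by v.length + u.length

theorem compL_single_of_not_mem_eq_zero {v : List ℕ} (hv : t ∉ v) {S : List ℕ →₀ 𝕜}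
    (hS : ∀ w ∈ S.support, w.length ≠ 1) : compL 𝕜 t (Finsupp.single v 1) S = 0 := by
  have := Finsupp.map_eq_of_forall_support (compL 𝕜 t (Finsupp.single v 1)) 0 S
    (fun w hw => by simp [comp_of_not_mem_eq_zero hv (hS w hw)])
  simpa using this

theorem compL_nil_del (u : List ℕ) :
    compL 𝕜 t (Finsupp.single [] 1) (del 𝕜 u) = 0 := by
  match u with
  | [] => simp [del]
  | [x] => simp [del, eraseOnce]
  | [x, y] =>
    by_cases h : x = y
    · subst h
      simp [del, eraseOnce]
    · have h' : y ≠ x := fun h' => h h'.symm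
      simp [del, eraseOnce, h, h']
  | x :: y :: z :: u =>
    refine compL_single_of_not_mem_eq_zero (by simp) fun w hw => ?_
    have := (mem_of_mem_del hw).1
    simp only [List.length_cons] at this
    omega

/-- The differential is a derivation for the composition of words. -/
theorem delL_comp {t : ℕ} (v u : List ℕ) (htu : t ∉ u) (hu : ∀ x ∈ u, x ∉ v) :
    delL 𝕜 (comp 𝕜 t v u) = compL 𝕜 t (del 𝕜 v) (Finsupp.single u 1) +
      (-1 : 𝕜) ^ deg v • compL 𝕜 t (Finsupp.single v 1) (del 𝕜 u) := by
  match v, u with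
  | v, [] => simp [compL_nil_right, del]
  | [], x :: u =>
    rw [compL_nil_del]
    have : delL 𝕜 (comp 𝕜 t [] (x :: u)) = 0 := by
      have := Finsupp.map_eq_of_forall_support (delL 𝕜) 0 (comp 𝕜 t [] (x :: u)) (fun w hw => by
        match u with
        | [] =>
          rw [comp_of_not_mem (by simp)] at hw
          obtain rfl : w = [] := by simpa using Finsupp.support_single_subset hw
          simp [del]
        | y :: u => simp [comp_of_not_mem_cons_cons] at hw)
      simpa using this
    simp [this, del]
  | a :: v, x :: u =>
    have hu' : ∀ y ∈ x :: u, y ∉ v := fun y hy h => hu y hy (by simp [h])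
    have ih2 := delL_comp v (x :: u) htu hu'
    by_cases ha : a = t
    · subst ha
      have hau : a ∉ u := fun h => htu (by simp [h])
      have hxa : x ≠ a := fun h => htu (by simp [h])
      have hxv : x ∉ v := hu' x (by simp)
      have ih1 := delL_comp (a :: v) u hau fun y hy => hu y (by simp [hy])
      have hdel : ∀ w ∈ (del 𝕜 v).support, deg (a :: w) + 1 = deg (a :: v) := fun w hw => by
        rw [deg_cons, deg_cons, deg_of_mem_del hw, rep_congr ((mem_of_mem_del hw).2 a)]
        ring
      have hera : ∀ w ∈ (eraseOnce 𝕜 a v).support, deg (a :: w) + 1 = deg (a :: v) :=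
        fun w hw => by
          obtain ⟨h1, -, h3⟩ := mem_of_mem_eraseOnce hw
          rw [deg_cons, deg_cons, deg_of_mem_eraseOnce hw, rep_of_mem h1, rep_of_not_mem]
          · ring
          · simp [h3]
      have hlast : ∀ w ∈ (comp 𝕜 a v (x :: u)).support, x ∈ w ↔ a ∈ v := by
        intro w hw
        by_cases hav : a ∈ v
        · simp [mem_of_mem_comp hav hw, hav]
        · match u with
          | [] =>
            rw [comp_of_not_mem hav] at hw
            obtain rfl : w = v := by simpa using Finsupp.support_single_subset hw
            simp [hav, hxv]
          | y :: u => simp [comp_of_not_mem_cons_cons hav] at hw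
      have hfirst : ∀ w ∈ (comp 𝕜 a (a :: v) u).support, x ∈ w ↔ x ∈ u := fun w hw =>
        mem_comp_right_iff (by simp) (hu x (by simp)) hw
      have hdelr : ∀ w ∈ (del 𝕜 u).support, rep x w = rep x u := fun w hw =>
        rep_congr ((mem_of_mem_del hw).2 x)
      have herar : ∀ w ∈ (eraseOnce 𝕜 x u).support, rep x w = 0 := fun w hw =>
        rep_of_not_mem fun h => (((mem_of_mem_eraseOnce hw).2.2 x).1 h).1 rfl
      obtain ⟨e, he⟩ : ∃ e, deg v = e := ⟨_, rfl⟩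
      -- The four cases, whether t recurs in v and whether x recurs in u, decide which leading
      -- letters can be deleted. By `hfirst` and `hlast` the leading letter of a composite recurs
      -- like x if it lies inside the first piece and like t if it closes it. The erasures of x in
      -- the tails are rewritten by `eraseOnceL_comp_right`.
      by_cases hav : a ∈ v
      · have hda : deg (a :: v) = e + 1 := by rw [deg_cons, rep_of_mem hav, he, add_comm]
        rw [hda] at ih1 hdel hera
        replace hdel : ∀ w ∈ (del 𝕜 v).support, deg (a :: w) = e := fun w hw => by
          have := hdel w hw; omega
        replace hera : ∀ w ∈ (eraseOnce 𝕜 a v).support, deg (a :: w) = e := fun w hw => by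
          have := hera w hw; omega
        have hE2 := eraseOnceL_comp_right (𝕜 := 𝕜) v (x :: u) hav htu (x := x) (by simp) hxv
        rw [del_cons_of_mem hav] at ih1 ⊢
        rw [comp_cons_cons, map_add, map_smul, delL_consL_of_mem (fun w hw => (hlast w hw).2 hav)]
        simp only [map_sub, LinearMap.sub_apply]
        rw [compL_consL_cons hdel, compL_consL_cons hera, ih2, hE2, hda, he]
        by_cases hx : x ∈ u
        · have hE1 := eraseOnceL_comp_right (𝕜 := 𝕜) (a :: v) u (by simp) hau hx (hu x (by simp))
          rw [delL_consL_of_mem (fun w hw => (hfirst w hw).2 hx), ih1, hE1]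
          rw [rep_of_mem hx] at hdelr ⊢
          rw [del_cons_of_mem hx, eraseOnce_cons_self, eraseOnce_cons_self]
          simp only [map_sub, map_add, map_smul, LinearMap.sub_apply]
          rw [compL_cons_consL _ _ hdelr, compL_cons_consL _ _ herar, hda]
          simp only [hx, hav, if_true, map_zero, LinearMap.zero_apply, compL_single]
          module
        · rw [delL_consL_of_not_mem (fun w hw h => hx ((hfirst w hw).1 h)), ih1]
          rw [rep_of_not_mem hx] at hdelr ⊢
          rw [del_cons_of_not_mem hx, eraseOnce_cons_self]
          simp only [map_sub, map_add, map_smul, LinearMap.sub_apply]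
          rw [compL_cons_consL _ _ hdelr, hda]
          simp only [hx, if_false, compL_single]
          module
      · have hda : deg (a :: v) = e := by rw [deg_cons, rep_of_not_mem hav, he, zero_add]
        rw [hda] at ih1 hdel
        have hcdel : compL 𝕜 a (consL 𝕜 a (del 𝕜 v)) (Finsupp.single (x :: u) 1) =
            (-1 : 𝕜) ^ (rep x u * (e + 1)) •
              consL 𝕜 x (compL 𝕜 a (consL 𝕜 a (del 𝕜 v)) (Finsupp.single u 1)) +
            consL 𝕜 x (compL 𝕜 a (del 𝕜 v) (Finsupp.single (x :: u) 1)) := by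
          -- The words in δv have degree e - 1, which has the parity of the stated e + 1. For e = 0
          -- the subtraction would be truncated, but then δv is zero.
          rcases Nat.eq_zero_or_pos e with h0 | h0
          · have hz : del 𝕜 v = 0 := by
              rw [← Finsupp.support_eq_empty, Finset.eq_empty_iff_forall_notMem]
              intro w hw
              have := hdel w hw
              omega
            simp [hz]
          · rw [compL_consL_cons (d := e - 1) fun w hw => by have := hdel w hw; omega]
            congr 2
            rw [show e + 1 = (e - 1) + 2 by omega, mul_add, pow_add, neg_one_pow_mul_two, mul_one]
        rw [del_cons_of_not_mem hav] at ih1 ⊢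
        rw [comp_cons_cons, map_add, map_smul,
          delL_consL_of_not_mem (fun w hw h => hav ((hlast w hw).1 h)), hcdel, ih2, hda, he]
        by_cases hx : x ∈ u
        · have hE1 := eraseOnceL_comp_right (𝕜 := 𝕜) (a :: v) u (by simp) hau hx (hu x (by simp))
          rw [delL_consL_of_mem (fun w hw => (hfirst w hw).2 hx), ih1, hE1]
          rw [rep_of_mem hx] at hdelr ⊢
          rw [del_cons_of_mem hx, eraseOnce_cons_self]
          simp only [map_sub, map_add, map_smul]
          rw [compL_cons_consL _ _ hdelr, compL_cons_consL _ _ herar, hda]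
          simp only [hav, if_false, compL_single]
          module
        · rw [delL_consL_of_not_mem (fun w hw h => hx ((hfirst w hw).1 h)), ih1]
          rw [rep_of_not_mem hx] at hdelr ⊢
          rw [del_cons_of_not_mem hx]
          simp only [map_add, map_smul]
          rw [compL_cons_consL _ _ hdelr, hda]
          module
    · have hau : a ∉ x :: u := fun h => hu a h (by simp)
      have hmem : ∀ w ∈ (comp 𝕜 t v (x :: u)).support, a ∈ w ↔ a ∈ v := fun w hw =>
        mem_comp_left_iff ha hau hw
      have hr : compL 𝕜 t (Finsupp.single (a :: v) 1) (del 𝕜 (x :: u)) =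
          consL 𝕜 a (compL 𝕜 t (Finsupp.single v 1) (del 𝕜 (x :: u))) := by
        rw [← consL_single, compL_consL_of_ne ha]
      rw [comp_cons_of_ne ha, hr]
      by_cases hav : a ∈ v
      · rw [delL_consL_of_mem fun w hw => (hmem w hw).2 hav, ih2, eraseOnceL_comp_left ha _ _ hau,
          del_cons_of_mem hav]
        simp only [map_sub, LinearMap.sub_apply, map_add, map_smul, compL_consL_of_ne ha,
          deg_cons, rep_of_mem hav, compL_single]
        module
      · rw [delL_consL_of_not_mem fun w hw h => hav ((hmem w hw).1 h), ih2,
          del_cons_of_not_mem hav]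
        simp only [map_add, map_smul, compL_consL_of_ne ha, deg_cons, rep_of_not_mem hav]
        module
  termination_by v.length + u.length

end

end Words

namespace Words

section

variable {𝕜 : Type u} [CommRing 𝕜] {t : ℕ}

/-! ### Degenerate words -/

theorem not_isChain_cons {x : ℕ} {u : List ℕ} :
    ¬ (x :: u).IsChain (· ≠ ·) ↔ (∃ w, u = x :: w) ∨ ¬ u.IsChain (· ≠ ·) := by
  cases u with
  | nil => simp
  | cons y u =>
    rw [List.isChain_cons_cons, not_and_or]
    simp only [ne_eq, not_not, List.cons.injEq, exists_and_left, exists_eq', and_true]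
    rw [eq_comm]

theorem not_isChain_of_mem_eraseOnce {x : ℕ} {u w : List ℕ} (hu : ¬ u.IsChain (· ≠ ·))
    (hw : w ∈ (eraseOnce 𝕜 x u).support) : ¬ w.IsChain (· ≠ ·) := by
  induction u generalizing w with
  | nil => simp at hu
  | cons y u ih =>
    by_cases hy : y = x
    · subst hy
      rw [eraseOnce_cons_self] at hw
      split_ifs at hw with h
      · simp at hw
      · obtain rfl : w = u := by simpa using Finsupp.support_single_subset hw
        rcases not_isChain_cons.1 hu with ⟨w', rfl⟩ | h'
        · simp at h
        · exact h'
    · rw [eraseOnce_cons_of_ne hy] at hw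
      obtain ⟨w', hw', rfl⟩ := exists_of_mem_support_consL hw
      rw [not_isChain_cons]
      rcases not_isChain_cons.1 hu with ⟨u', rfl⟩ | h'
      · rw [eraseOnce_cons_of_ne hy] at hw'
        obtain ⟨w'', -, rfl⟩ := exists_of_mem_support_consL hw'
        exact Or.inl ⟨_, rfl⟩
      · exact Or.inr (ih h' hw')

/-- For a word (x, x, u') the deletions of the two equal neighbours give the same word with opposite
signs; every other term still starts with (x, x). A repetition further on is handled by induction.
-/
theorem not_isChain_of_mem_del {u w : List ℕ} (hu : ¬ u.IsChain (· ≠ ·))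
    (hw : w ∈ (del 𝕜 u).support) : ¬ w.IsChain (· ≠ ·) := by
  induction u generalizing w with
  | nil => simp at hu
  | cons x u ih =>
    by_cases hu' : u.IsChain (· ≠ ·)
    · obtain ⟨u', rfl⟩ := (not_isChain_cons.1 hu).resolve_right (not_not.2 hu')
      have key : ∃ S : List ℕ →₀ 𝕜, del 𝕜 (x :: x :: u') = consL 𝕜 x (consL 𝕜 x S) := by
        by_cases h : x ∈ u'
        · refine ⟨del 𝕜 u' + eraseOnce 𝕜 x u', ?_⟩
          rw [del_cons_of_mem (by simp), del_cons_of_mem h, eraseOnce_cons_self, if_pos h]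
          simp only [map_sub, map_add, consL_single, map_zero]
          abel
        · refine ⟨-del 𝕜 u', ?_⟩
          rw [del_cons_of_mem (by simp), del_cons_of_not_mem h, eraseOnce_cons_self, if_neg h]
          simp
      obtain ⟨S, hS⟩ := key
      rw [hS] at hw
      obtain ⟨w', hw', rfl⟩ := exists_of_mem_support_consL hw
      obtain ⟨w'', -, rfl⟩ := exists_of_mem_support_consL hw'
      simp
    · by_cases hx : x ∈ u
      · rw [del_cons_of_mem hx] at hw
        rcases mem_support_sub hw with hw | hw
        · rcases mem_support_sub hw with hw | hw
          · obtain rfl : w = u := by simpa using Finsupp.support_single_subset hw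
            exact hu'
          · obtain ⟨w', hw', rfl⟩ := exists_of_mem_support_consL hw
            exact not_isChain_cons.2 (Or.inr (ih hu' hw'))
        · obtain ⟨w', hw', rfl⟩ := exists_of_mem_support_consL hw
          exact not_isChain_cons.2 (Or.inr (not_isChain_of_mem_eraseOnce hu' hw'))
      · rw [del_cons_of_not_mem hx] at hw
        obtain ⟨w', hw', rfl⟩ := exists_of_mem_support_consL hw
        exact not_isChain_cons.2 (Or.inr (ih hu' hw'))

end

/-- The composition of words, in which the letters of `v` are relabelled by `f` and those of `u`
by `g`. -/
noncomputable def compMap (𝕜 : Type u) [CommRing 𝕜] (f g : ℕ → ℕ) (t : ℕ) (v u : List ℕ) :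
    List ℕ →₀ 𝕜 :=
  undecL 𝕜 (graft 𝕜 f g t (dec v) (dec u))

section

variable {𝕜 : Type u} [CommRing 𝕜] {f g : ℕ → ℕ} {t : ℕ}

@[simp] theorem compMap_nil_right (v : List ℕ) : compMap 𝕜 f g t v [] = 0 := by simp [compMap]

theorem compMap_of_not_mem {v : List ℕ} (h : t ∉ v) (x : ℕ) :
    compMap 𝕜 f g t v [x] = Finsupp.single (v.map f) 1 := by
  have h' : ∀ a ∈ dec v, a.1 ≠ t :=
    (forall_mem_dec (p := fun y => y ≠ t)).2 fun y hy h' => h (h' ▸ hy)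
  rw [compMap, dec_cons, dec_nil, graft_of_not_mem h' _ (by simp), undecL_single]
  conv_rhs => rw [← map_fst_dec v]
  simp only [List.map_map]
  rfl

theorem compMap_of_not_mem_eq_zero {v u : List ℕ} (h : t ∉ v) (hu : u.length ≠ 1) :
    compMap 𝕜 f g t v u = 0 := by
  match u with
  | [] => simp
  | [x] => simp at hu
  | x :: y :: u =>
    have h' : ∀ a ∈ dec v, a.1 ≠ t :=
      (forall_mem_dec (p := fun y => y ≠ t)).2 fun y hy h' => h (h' ▸ hy)
    rw [compMap, dec_cons, dec_cons, graft_of_not_mem_cons_cons h', map_zero]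

theorem compMap_cons_of_ne {a : ℕ} (ha : a ≠ t) (v u : List ℕ) :
    compMap 𝕜 f g t (a :: v) u = consL 𝕜 (f a) (compMap 𝕜 f g t v u) := by
  simp only [compMap, dec_cons]
  rw [graft_cons_of_ne (by exact ha), undecL_consL]

theorem compMap_cons_cons (v : List ℕ) (x : ℕ) (u : List ℕ) :
    compMap 𝕜 f g t (t :: v) (x :: u) =
      (-1 : 𝕜) ^ (rep x u * deg (t :: v)) • consL 𝕜 (g x) (compMap 𝕜 f g t (t :: v) u) +
        consL 𝕜 (g x) (compMap 𝕜 f g t v (x :: u)) := by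
  simp only [compMap, dec_cons]
  rw [graft_cons_cons (a := (t, rep t v)) rfl, map_add, map_smul, undecL_consL, undecL_consL]
  simp [deg]

theorem head_of_mem_compMap {v u w : List ℕ} {x : ℕ}
    (hw : w ∈ (compMap 𝕜 f g t (t :: v) (x :: u)).support) : ∃ w', w = g x :: w' := by
  rw [compMap_cons_cons] at hw
  rcases mem_support_add hw with hw | hw
  · obtain ⟨w', -, rfl⟩ := exists_of_mem_support_consL (mem_support_smul hw)
    exact ⟨_, rfl⟩
  · obtain ⟨w', -, rfl⟩ := exists_of_mem_support_consL hw
    exact ⟨_, rfl⟩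

/-- If two letters t are adjacent in v, the piece for the first ends with the letter at which the
piece for the second starts. -/
theorem not_isChain_of_mem_compMap_left {v u w : List ℕ} (hv : ¬ v.IsChain (· ≠ ·))
    (hw : w ∈ (compMap 𝕜 f g t v u).support) : ¬ w.IsChain (· ≠ ·) := by
  match v, u with
  | v, [] => simp at hw
  | [], x :: u => simp at hv
  | a :: v, x :: u =>
    by_cases ha : a = t
    · have ih := fun w => not_isChain_of_mem_compMap_left (u := u) (w := w) hv
      rw [ha] at hw ih hv
      rw [compMap_cons_cons] at hw
      rcases mem_support_add hw with hw | hw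
      · obtain ⟨w', hw', rfl⟩ := exists_of_mem_support_consL (mem_support_smul hw)
        exact not_isChain_cons.2 (Or.inr (ih _ hw'))
      · obtain ⟨w', hw', rfl⟩ := exists_of_mem_support_consL hw
        rw [not_isChain_cons]
        rcases not_isChain_cons.1 hv with ⟨v', rfl⟩ | h
        · exact Or.inl (head_of_mem_compMap hw')
        · exact Or.inr (not_isChain_of_mem_compMap_left h hw')
    · rw [compMap_cons_of_ne ha] at hw
      obtain ⟨w', hw', rfl⟩ := exists_of_mem_support_consL hw
      rw [not_isChain_cons]
      rcases not_isChain_cons.1 hv with ⟨v', rfl⟩ | h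
      · rw [compMap_cons_of_ne ha] at hw'
        obtain ⟨w'', -, rfl⟩ := exists_of_mem_support_consL hw'
        exact Or.inl ⟨_, rfl⟩
      · exact Or.inr (not_isChain_of_mem_compMap_left h hw')
  termination_by v.length + u.length

/-- Two equal neighbours of u remain neighbours: after a cut at the first of them, the next piece
begins with that letter followed by the second. -/
theorem not_isChain_of_mem_compMap_right {v u w : List ℕ} (ht : t ∈ v)
    (hu : ¬ u.IsChain (· ≠ ·)) (hw : w ∈ (compMap 𝕜 f g t v u).support) :
    ¬ w.IsChain (· ≠ ·) := by
  match v, u with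
  | v, [] => simp at hw
  | [], x :: u => simp at ht
  | a :: v, x :: u =>
    have h1 : u ≠ [] := by rintro rfl; simp at hu
    by_cases ha : a = t
    · have ih := fun h w => not_isChain_of_mem_compMap_right (u := u) (w := w) ht h
      rw [ha] at hw ih
      rw [compMap_cons_cons] at hw
      rcases mem_support_add hw with hw | hw
      · obtain ⟨w', hw', rfl⟩ := exists_of_mem_support_consL (mem_support_smul hw)
        rw [not_isChain_cons]
        rcases not_isChain_cons.1 hu with ⟨u', rfl⟩ | h
        · exact Or.inl (head_of_mem_compMap hw')
        · exact Or.inr (ih h w' hw')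
      · obtain ⟨w', hw', rfl⟩ := exists_of_mem_support_consL hw
        refine not_isChain_cons.2 (Or.inr ?_)
        by_cases h : t ∈ v
        · exact not_isChain_of_mem_compMap_right h hu hw'
        · rw [compMap_of_not_mem_eq_zero h (by simpa using h1)] at hw'
          simp at hw'
    · rw [compMap_cons_of_ne ha] at hw
      obtain ⟨w', hw', rfl⟩ := exists_of_mem_support_consL hw
      exact not_isChain_cons.2 (Or.inr (not_isChain_of_mem_compMap_right
        ((List.mem_cons.1 ht).resolve_left (Ne.symm ha)) hu hw'))
  termination_by v.length + u.length

theorem length_of_mem_compMap {v u w : List ℕ} (hw : w ∈ (compMap 𝕜 f g t v u).support) :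
    w.length + 1 = v.length + u.length := by
  classical
  obtain ⟨w', hw', rfl⟩ := Finset.mem_image.1 (Finsupp.mapDomain_support hw)
  have h := length_of_mem_graft _ _ w' hw'
  have h1 : ∀ u : List ℕ, (dec u).length = u.length := fun u => by
    conv_rhs => rw [← map_fst_dec u]
    simp
  simpa [h1] using h

theorem mem_of_mem_compMap {v u w : List ℕ} (ht : t ∈ v)
    (hw : w ∈ (compMap 𝕜 f g t v u).support) (y : ℕ) :
    y ∈ w ↔ (∃ x ∈ v, x ≠ t ∧ f x = y) ∨ ∃ x ∈ u, g x = y := by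
  classical
  obtain ⟨w', hw', rfl⟩ := Finset.mem_image.1 (Finsupp.mapDomain_support hw)
  have ht' : ∃ a ∈ dec v, a.1 = t := (exists_mem_dec (p := fun y => y = t)).2 ⟨t, ht, rfl⟩
  rw [mem_iff_exists_fst]
  exact (mem_of_mem_graft ht' hw' y).trans (or_congr
    (exists_mem_dec (p := fun z => z ≠ t ∧ f z = y)) (exists_mem_dec (p := fun z => g z = y)))

/-! ### Comparison with the explicit formulas -/

end

/-- `1` if position `i` of `u` is not a last occurrence, and `0` otherwise. -/
def notLast (u : List ℕ) (i : ℕ) : ℕ :=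
  if ∃ i' ∈ Finset.Ioo i u.length, u[i]? = u[i']? then 1 else 0

theorem relDeg_eq_sum (u : List ℕ) (a b : ℕ) :
    relDeg u a b = ∑ i ∈ Finset.Ico a b, notLast u i := by
  unfold relDeg notLast
  rw [Finset.card_filter]

theorem exists_Ioo_cons (x : ℕ) (u : List ℕ) (i : ℕ) :
    (∃ i' ∈ Finset.Ioo (i + 1) (x :: u).length, (x :: u)[i + 1]? = (x :: u)[i']?) ↔
      ∃ i' ∈ Finset.Ioo i u.length, u[i]? = u[i']? := by
  constructor
  · rintro ⟨i', hi', h⟩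
    rw [Finset.mem_Ioo, List.length_cons] at hi'
    obtain ⟨k, rfl⟩ : ∃ k, i' = k + 1 := ⟨i' - 1, by omega⟩
    refine ⟨k, Finset.mem_Ioo.2 (by omega), by simpa using h⟩
  · rintro ⟨k, hk, h⟩
    rw [Finset.mem_Ioo] at hk
    exact ⟨k + 1, Finset.mem_Ioo.2 (by simp; omega), by simpa using h⟩

theorem exists_Ioo_cons_zero (x : ℕ) (u : List ℕ) :
    (∃ i' ∈ Finset.Ioo 0 (x :: u).length, (x :: u)[0]? = (x :: u)[i']?) ↔ x ∈ u := by
  constructor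
  · rintro ⟨i', hi', h⟩
    rw [Finset.mem_Ioo, List.length_cons] at hi'
    obtain ⟨k, rfl⟩ : ∃ k, i' = k + 1 := ⟨i' - 1, by omega⟩
    exact List.mem_of_getElem? (i := k) (by simpa using h.symm)
  · intro h
    obtain ⟨k, hk, rfl⟩ := List.getElem_of_mem h
    exact ⟨k + 1, Finset.mem_Ioo.2 (by simp; omega), by simp [hk]⟩

theorem notLast_cons_succ (x : ℕ) (u : List ℕ) (i : ℕ) :
    notLast (x :: u) (i + 1) = notLast u i := by
  unfold notLast
  simp only [exists_Ioo_cons]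

theorem notLast_cons_zero (x : ℕ) (u : List ℕ) : notLast (x :: u) 0 = rep x u := by
  unfold notLast rep
  simp only [exists_Ioo_cons_zero]

theorem relDeg_cons_succ (x : ℕ) (u : List ℕ) (a b : ℕ) :
    relDeg (x :: u) (a + 1) (b + 1) = relDeg u a b := by
  rw [relDeg_eq_sum, relDeg_eq_sum, ← Finset.sum_Ico_add']
  simp [notLast_cons_succ]

theorem relDeg_cons_zero_succ (x : ℕ) (u : List ℕ) (b : ℕ) :
    relDeg (x :: u) 0 (b + 1) = rep x u + relDeg u 0 b := by
  rw [← relDeg_cons_succ x u 0 b, relDeg_eq_sum, relDeg_eq_sum,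
    Finset.sum_eq_sum_Ico_succ_bot (by omega), notLast_cons_zero]

theorem relDeg_self (u : List ℕ) (a : ℕ) : relDeg u a a = 0 := by simp [relDeg]

theorem notLast_eq_rep {u : List ℕ} {a : ℕ} (h : a < u.length) :
    notLast u a = rep u[a] (u.drop (a + 1)) := by
  induction u generalizing a with
  | nil => simp at h
  | cons x u ih =>
    cases a with
    | zero => simp [notLast_cons_zero]
    | succ a => simpa [notLast_cons_succ] using ih (by simpa using h)

/-! #### The differential -/

/-- The value at position `i` of `u` occurs at another position. -/
def Repeated (u : List ℕ) (i : ℕ) : Prop := ∃ i' ∈ Finset.range u.length, i' ≠ i ∧ u[i]? = u[i']?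

theorem repeated_cons_zero (x : ℕ) (u : List ℕ) : Repeated (x :: u) 0 ↔ x ∈ u := by
  rw [← exists_Ioo_cons_zero]
  unfold Repeated
  refine exists_congr fun i' => ?_
  rw [← and_assoc]
  refine and_congr ?_ Iff.rfl
  simp only [Finset.mem_range, Finset.mem_Ioo]
  omega

theorem repeated_cons_succ (x : ℕ) (u : List ℕ) {i : ℕ} :
    Repeated (x :: u) (i + 1) ↔ Repeated u i ∨ u[i]? = some x := by
  unfold Repeated
  constructor
  · rintro ⟨i', hi', h1, h2⟩
    cases i' with
    | zero => exact Or.inr (by simpa using h2)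
    | succ k =>
      exact Or.inl ⟨k, by simpa using hi', by omega, by simpa using h2⟩
  · rintro (⟨k, hk, h1, h2⟩ | h)
    · exact ⟨k + 1, by simpa using hk, by omega, by simpa using h2⟩
    · exact ⟨0, by simp, by omega, by simpa using h⟩

theorem prevPos_cons_succ {x : ℕ} {u : List ℕ} {i : ℕ} (h : ∃ k < i, u[k]? = u[i]?) :
    prevPos (x :: u) (i + 1) = prevPos u i + 1 := by
  unfold prevPos
  apply le_antisymm
  · refine Finset.sup_le fun j hj => ?_
    rw [Finset.mem_filter, Finset.mem_range] at hj
    cases j with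
    | zero => simp
    | succ k =>
      simp only [id]
      refine Nat.succ_le_succ (Finset.le_sup (f := id) ?_)
      rw [Finset.mem_filter, Finset.mem_range]
      exact ⟨by omega, by simpa using hj.2⟩
  · obtain ⟨k, hk, hk'⟩ := h
    have hne : ((Finset.range i).filter fun j => u[j]? = u[i]?).Nonempty :=
      ⟨k, by simp [hk, hk']⟩
    obtain ⟨j, hj, hj'⟩ := Finset.exists_mem_eq_sup _ hne id
    rw [hj']
    rw [Finset.mem_filter, Finset.mem_range] at hj
    refine Finset.le_sup (f := id) (b := j + 1) ?_
    rw [Finset.mem_filter, Finset.mem_range]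
    exact ⟨by omega, by simpa using hj.2⟩

theorem prevPos_cons_succ_of_forall {x : ℕ} {u : List ℕ} {i : ℕ} (h : ∀ k < i, u[k]? ≠ u[i]?) :
    prevPos (x :: u) (i + 1) = 0 := by
  unfold prevPos
  refine Nat.le_zero.1 (Finset.sup_le fun j hj => ?_)
  rw [Finset.mem_filter, Finset.mem_range] at hj
  cases j with
  | zero => simp
  | succ k => exact absurd (by simpa using hj.2) (h k (by omega))

theorem exists_lt_of_repeated {u : List ℕ} {i : ℕ} (h : Repeated u i)
    (hl : ¬ ∃ i' ∈ Finset.Ioo i u.length, u[i]? = u[i']?) : ∃ k < i, u[k]? = u[i]? := by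
  obtain ⟨k, hk, hki, hk'⟩ := h
  rw [Finset.mem_range] at hk
  refine ⟨k, ?_, hk'.symm⟩
  by_contra hlt
  exact hl ⟨k, Finset.mem_Ioo.2 (by omega), hk'⟩

theorem diffExp_cons_zero {x : ℕ} {u : List ℕ} (h : x ∈ u) : diffExp (x :: u) 0 = 0 := by
  unfold diffExp
  rw [if_pos ((exists_Ioo_cons_zero x u).2 h), relDeg_self]

theorem diffExp_cons_succ {x : ℕ} {u : List ℕ} {i : ℕ} (h : Repeated u i) :
    diffExp (x :: u) (i + 1) = rep x u + diffExp u i := by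
  unfold diffExp
  simp only [exists_Ioo_cons]
  split_ifs with hl
  · rw [relDeg_cons_zero_succ]
  · rw [prevPos_cons_succ (exists_lt_of_repeated h hl), relDeg_cons_zero_succ]

/-- Position i is a last occurrence in (x, u), and its penultimate occurrence can only be position
0. If there is none, the supremum defining `prevPos` is empty and has the same value 0. -/
theorem diffExp_cons_succ_of_not {x : ℕ} {u : List ℕ} {i : ℕ} (hi : i < u.length)
    (h : ¬ Repeated u i) : diffExp (x :: u) (i + 1) = rep x u := by
  have h' : ∀ k < u.length, k ≠ i → u[k]? ≠ u[i]? :=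
    fun k hk hki e => h ⟨k, Finset.mem_range.2 hk, hki, e.symm⟩
  unfold diffExp
  simp only [exists_Ioo_cons]
  rw [if_neg, prevPos_cons_succ_of_forall, relDeg_cons_zero_succ, relDeg_self, add_zero]
  · intro k hk
    exact h' k (by omega) (by omega)
  · rintro ⟨k, hk, e⟩
    rw [Finset.mem_Ioo] at hk
    exact h' k hk.2 (by omega) e.symm

section

variable {𝕜 : Type u} [CommRing 𝕜]

-- At most one position contributes: the only occurrence of x, if there is exactly one.
open Classical in
theorem sum_eraseIdx_eq_eraseOnce (x : ℕ) (u : List ℕ) :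
    (∑ i ∈ Finset.range u.length,
      if u[i]? = some x ∧ ¬ Repeated u i then Finsupp.single (u.eraseIdx i) (1 : 𝕜) else 0) =
      eraseOnce 𝕜 x u := by
  induction u with
  | nil => simp [eraseOnce]
  | cons y u ih =>
    rw [List.length_cons, Finset.sum_range_succ', eraseOnce]
    simp only [repeated_cons_zero, repeated_cons_succ, List.getElem?_cons_zero, Option.some_inj,
      List.getElem?_cons_succ, List.eraseIdx_cons_zero, List.eraseIdx_cons_succ]
    by_cases hy : y = x
    · subst hy
      rw [Finset.sum_eq_zero]
      · by_cases h : y ∈ u <;> simp [h]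
      · intro i _
        rw [if_neg]
        tauto
    · simp only [hy, false_and, if_false, add_zero]
      rw [← ih, map_sum]
      refine Finset.sum_congr rfl fun i _ => ?_
      by_cases h : u[i]? = some x
      · have : ¬ x = y := fun h => hy h.symm
        by_cases h' : Repeated u i <;> simp [h, h', this]
      · simp [h]

-- Prefixing x shifts the exponents of the positions already repeated in u by `rep x u`. A position
-- unrepeated in u becomes deletable only if it carries x; its penultimate occurrence is then the
-- new first letter, the exponent is 1, and this is the negative `eraseOnce` term of `del`.
open Classical in
theorem sum_eraseIdx_eq_del (u : List ℕ) :
    (∑ i ∈ Finset.range u.length,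
      if Repeated u i then (-1 : 𝕜) ^ diffExp u i • Finsupp.single (u.eraseIdx i) (1 : 𝕜) else 0) =
      del 𝕜 u := by
  induction u with
  | nil => simp [del]
  | cons x u ih =>
    rw [List.length_cons, Finset.sum_range_succ', del, ← ih, ← sum_eraseIdx_eq_eraseOnce, map_sum,
      map_sum, Finset.smul_sum, add_sub_assoc, ← Finset.sum_sub_distrib, add_comm]
    congr 1
    · rw [repeated_cons_zero]
      split_ifs with h
      · simp [diffExp_cons_zero h]
      · rfl
    · refine Finset.sum_congr rfl fun i hi => ?_
      rw [Finset.mem_range] at hi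
      rw [repeated_cons_succ]
      by_cases h : Repeated u i
      · simp [h, diffExp_cons_succ h, pow_add]
      · by_cases h' : u[i]? = some x
        · have hx : x ∈ u := List.mem_of_getElem? h'
          simp [h, h', diffExp_cons_succ_of_not hi h, rep_of_mem hx]
        · simp [h, h']

variable (𝕜) in
/-- The linear extension of `ofWord`. -/
noncomputable def toSurj (n : ℕ) (k : ℤ) : (List ℕ →₀ 𝕜) →ₗ[𝕜] SurjMod 𝕜 n k :=
  Finsupp.linearCombination 𝕜 (ofWord 𝕜 n k)

@[simp] theorem toSurj_single (n : ℕ) (k : ℤ) (w : List ℕ) :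
    toSurj 𝕜 n k (Finsupp.single w 1) = ofWord 𝕜 n k w := by simp [toSurj]

theorem surjDiffWord_eq (n : ℕ) (e : ℤ) (u : List ℕ) :
    surjDiffWord 𝕜 n e u = toSurj 𝕜 n e (del 𝕜 u) := by
  classical
  rw [surjDiffWord, ← sum_eraseIdx_eq_del, map_sum, Finset.sum_filter]
  refine Finset.sum_congr rfl fun i _ => ?_
  by_cases h : Repeated u i
  · refine (if_pos h).trans ?_
    rw [if_pos h, map_smul, toSurj_single, ← Int.cast_smul_eq_zsmul 𝕜]
    simp
  · refine (if_neg h).trans ?_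
    rw [if_neg h, map_zero]

end

end Words

namespace Words

/-! #### The composition -/

/-- For v empty the default value `v.length - 1` is truncated to 0 and the shift by one fails; hence
v must be non-empty. -/
theorem occPos_cons_of_ne {s t : ℕ} (hs : s ≠ t) {v : List ℕ} (hv : v ≠ []) (q : ℕ) :
    occPos (s :: v) t q = occPos v t q + 1 := by
  have h1 : 1 ≤ v.length := List.length_pos_iff.2 hv
  unfold occPos
  rw [List.length_cons, List.range_succ_eq_map, List.filter_cons_of_neg (by simpa using hs),
    List.filter_map]
  have : ((fun i => decide ((s :: v)[i]? = some t)) ∘ Nat.succ) = fun i => decide (v[i]? = some t) := by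
    ext i; simp
  rw [this, show v.length + 1 - 1 = (v.length - 1) + 1 by omega, ← Nat.succ_eq_add_one,
    List.getD_map]

theorem occPos_cons_self_zero (t : ℕ) (v : List ℕ) : occPos (t :: v) t 0 = 0 := by
  unfold occPos
  rw [List.length_cons, List.range_succ_eq_map, List.filter_cons_of_pos (by simp)]
  rfl

theorem occPos_cons_self_succ {t : ℕ} {v : List ℕ} (hv : v ≠ []) (q : ℕ) :
    occPos (t :: v) t (q + 1) = occPos v t q + 1 := by
  have h1 : 1 ≤ v.length := List.length_pos_iff.2 hv
  unfold occPos
  rw [List.length_cons, List.range_succ_eq_map, List.filter_cons_of_pos (by simp),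
    List.filter_map]
  have : ((fun i => decide ((t :: v)[i]? = some t)) ∘ Nat.succ) = fun i => decide (v[i]? = some t) := by
    ext i; simp
  rw [this, show v.length + 1 - 1 = (v.length - 1) + 1 by omega, ← Nat.succ_eq_add_one,
    List.getD_cons_succ, List.getD_map]

/-- The successive occurrences of t, closed off by the last position of v, cut v into consecutive
intervals. The last position of v, counted by none of them, is a last occurrence and has weight 0.
-/
theorem sum_relDeg_occPos (t : ℕ) (v : List ℕ) : ∀ r : ℕ, v.count t = r →
    relDeg v 0 (occPos v t 0) +
      ∑ q ∈ Finset.range r, relDeg v (occPos v t q) (occPos v t (q + 1)) = deg v := by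
  induction v with
  | nil =>
    rintro r rfl
    simp [relDeg]
  | cons s v ih =>
    intro r hr
    rcases eq_or_ne v [] with rfl | hv
    · by_cases hs : s = t
      · subst hs
        obtain rfl : r = 1 := by simpa using hr.symm
        simp [relDeg]
      · obtain rfl : r = 0 := by simpa [hs] using hr.symm
        simp [relDeg]
    · by_cases hs : s = t
      · subst hs
        obtain ⟨r, rfl⟩ : ∃ k, r = k + 1 := ⟨r - 1, by simp at hr; omega⟩
        have := ih r (by simpa using hr)
        rw [Finset.sum_range_succ', occPos_cons_self_zero, relDeg_self, zero_add,
          occPos_cons_self_succ hv, relDeg_cons_zero_succ, deg_cons, ← this]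
        simp only [occPos_cons_self_succ hv, relDeg_cons_succ]
        ring
      · have := ih r (by simpa [hs] using hr)
        rw [occPos_cons_of_ne hs hv, relDeg_cons_zero_succ, deg_cons, ← this]
        simp only [occPos_cons_of_ne hs hv, relDeg_cons_succ]
        ring

theorem koszulExp_cons_of_ne {s t : ℕ} (hs : s ≠ t) {v : List ℕ} (u : List ℕ) {r L : ℕ}
    (hr : v.count t = r) (j : Fin (r + 1) → Fin L) :
    koszulExp (s :: v) u t j = koszulExp v u t j := by
  unfold koszulExp
  refine Finset.sum_congr rfl fun p _ => Finset.sum_congr rfl fun q _ => ?_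
  have hv : v ≠ [] := by
    rintro rfl
    have := q.2
    simp at hr
    omega
  rw [occPos_cons_of_ne hs hv, occPos_cons_of_ne hs hv, relDeg_cons_succ]

/-- The first piece u_1 is moved past all of v_1, …, v_r. Since the outer word starts with t, their
degrees add up to its whole degree. The remaining pieces give the Koszul exponent of the tail. -/
theorem koszulExp_cons_self {t : ℕ} {v : List ℕ} (u : List ℕ) {r L : ℕ}
    (hr : v.count t = r) (a : Fin L) (j : Fin (r + 1) → Fin L) :
    koszulExp (t :: v) u t (Fin.cons a j : Fin (r + 1 + 1) → Fin L) =
      relDeg u a (j 0) * deg (t :: v) + koszulExp v u t j := by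
  unfold koszulExp
  rw [Fin.sum_univ_succ]
  congr 1
  · simp only [Fin.zero_le, if_true, ← Finset.mul_sum]
    congr 1
    have h1 := sum_relDeg_occPos t (t :: v) (r + 1) (by simp [hr])
    rw [occPos_cons_self_zero, relDeg_self, zero_add] at h1
    rw [← h1, Finset.sum_range]
  · refine Finset.sum_congr rfl fun p _ => ?_
    rw [Fin.sum_univ_succ]
    simp only [Fin.succ_le_succ_iff, Fin.cons_succ, Fin.castSucc_succ]
    rw [if_neg (by simp), zero_add]
    refine Finset.sum_congr rfl fun q _ => ?_
    have hv : v ≠ [] := by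
      rintro rfl
      have := q.2
      simp at hr
      omega
    simp only [Fin.val_succ, occPos_cons_self_succ hv, relDeg_cons_succ]

theorem pieces_cons (u : List ℕ) {r L : ℕ} (a : Fin L) (j : Fin (r + 1) → Fin L) :
    pieces u (Fin.cons a j : Fin (r + 1 + 1) → Fin L) = piece u a (j 0) :: pieces u j := by
  simp only [pieces, List.ofFn_succ]
  rfl

theorem piece_self {u : List ℕ} {a : ℕ} (h : a < u.length) : piece u a a = [u[a]] := by
  unfold piece
  rw [List.drop_eq_getElem_cons h, show a + 1 - a = 0 + 1 by omega,
    List.take_succ_cons, List.take_zero]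

theorem piece_of_lt {u : List ℕ} {a b : ℕ} (h : a < u.length) (hab : a < b) :
    piece u a b = u[a] :: piece u (a + 1) b := by
  unfold piece
  rw [List.drop_eq_getElem_cons h, show b + 1 - a = (b + 1 - (a + 1)) + 1 by omega,
    List.take_succ_cons]

section

variable {𝕜 : Type u} [CommRing 𝕜] {f g : ℕ → ℕ} {t : ℕ}

variable (𝕜) in
/-- Prefixing a word. -/
noncomputable def appendL (w : List ℕ) : (List ℕ →₀ 𝕜) →ₗ[𝕜] (List ℕ →₀ 𝕜) :=
  Finsupp.lmapDomain 𝕜 𝕜 (w ++ ·)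

@[simp] theorem appendL_single (w u : List ℕ) (c : 𝕜) :
    appendL 𝕜 w (Finsupp.single u c) = Finsupp.single (w ++ u) c := by simp [appendL]

theorem appendL_cons (x : ℕ) (w : List ℕ) (S : List ℕ →₀ 𝕜) :
    appendL 𝕜 (x :: w) S = consL 𝕜 x (appendL 𝕜 w S) := by
  have := Finsupp.map_eq_of_forall_support (appendL 𝕜 (x :: w))
    ((consL 𝕜 x).comp (appendL 𝕜 w)) S (by simp)
  simpa using this

theorem appendL_singleton (x : ℕ) (S : List ℕ →₀ 𝕜) :
    appendL 𝕜 [x] S = consL 𝕜 x S := by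
  have := Finsupp.map_eq_of_forall_support (appendL 𝕜 [x]) (consL 𝕜 x) S (by simp)
  simpa using this

/-- Iterating the recursion until the piece for the leading t is closed. The index b is the position
where it closes, and the signs of the letters written inside it add up to its relative degree. -/
theorem compMap_cons_drop (v u : List ℕ) (a : ℕ) (ha : a ≤ u.length) :
    compMap 𝕜 f g t (t :: v) (u.drop a) =
      ∑ b ∈ Finset.Ico a u.length, (-1 : 𝕜) ^ (relDeg u a b * deg (t :: v)) •
        appendL 𝕜 ((piece u a b).map g) (compMap 𝕜 f g t v (u.drop b)) := by
  induction h : u.length - a generalizing a with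
  | zero =>
    rw [List.drop_eq_nil_of_le (by omega), Finset.Ico_eq_empty (by omega)]
    simp
  | succ n ih =>
    have ha' : a < u.length := by omega
    rw [List.drop_eq_getElem_cons ha', compMap_cons_cons, ih (a + 1) (by omega) (by omega),
      Finset.sum_eq_sum_Ico_succ_bot ha', relDeg_self, piece_self ha', add_comm,
      ← List.drop_eq_getElem_cons ha', map_sum, Finset.smul_sum]
    simp only [zero_mul, pow_zero, one_smul, List.map_cons, List.map_nil, appendL_singleton]
    congr 1
    refine Finset.sum_congr rfl fun b hb => ?_
    rw [Finset.mem_Ico] at hb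
    rw [piece_of_lt ha' (by omega), List.map_cons, appendL_cons, map_smul, smul_smul, ← pow_add,
      ← notLast_eq_rep ha', relDeg_eq_sum u a b, Finset.sum_eq_sum_Ico_succ_bot (by omega),
      ← relDeg_eq_sum, add_mul]

open Classical in
/-- The sum over all sequences of cutting positions that start at `a`. -/
theorem sum_cuts_eq (n : ℕ) (v u : List ℕ) : ∀ (r : ℕ) (_ : v.count t = r) (a : Fin u.length),
    (∑ j : Fin (r + 1) → Fin u.length,
      if j 0 = a ∧ (j (Fin.last r) : ℕ) + 1 = u.length ∧ ∀ p : Fin r, j p.castSucc ≤ j p.succ then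
        (-1 : 𝕜) ^ koszulExp v u t j • Finsupp.single (substWord t n v (pieces u j)) (1 : 𝕜)
      else 0) =
    compMap 𝕜 (relabelOut t n) (relabelIn t) t v (u.drop a) := by
  induction v with
  | nil =>
    intro r hr a
    obtain rfl : r = 0 := by simpa using hr.symm
    -- Without an occurrence of t the only tuple of cuts is (a). It is admissible exactly when a is
    -- the last position, that is, when one letter of u is left, as in `graft_nil_singleton`.
    rw [Finset.sum_eq_single (fun _ => a)]
    · by_cases h : (a : ℕ) + 1 = u.length
      · rw [if_pos ⟨rfl, h, fun _ => le_rfl⟩, List.drop_eq_getElem_cons a.2,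
          List.drop_eq_nil_of_le (by omega), compMap_of_not_mem (by simp)]
        simp [koszulExp, substWord]
      · rw [if_neg (fun h' => h h'.2.1), compMap_of_not_mem_eq_zero (by simp)]
        have := a.2
        rw [List.length_drop]
        omega
    · intro j _ hj
      rw [if_neg]
      rintro ⟨rfl, -⟩
      exact hj (funext fun p => congrArg j (Fin.fin_one_eq_zero p))
    · simp
  | cons s v ih =>
    intro r hr a
    by_cases hs : s = t
    · subst hs
      obtain ⟨r, rfl⟩ : ∃ k, r = k + 1 := ⟨r - 1, by simp at hr; omega⟩
      have hr' : v.count s = r := by simpa using hr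
      -- Splitting off the first cut a leaves a tuple that begins with the end of the first piece.
      -- Sorting by that position b gives the sum of `compMap_cons_drop`.
      rw [← (Fin.consEquiv fun _ : Fin (r + 1 + 1) => Fin u.length).sum_comp, Fintype.sum_prod_type,
        Finset.sum_eq_single a, compMap_cons_drop _ _ _ a.2.le]
      · have h2 : ∀ j : Fin (r + 1) → Fin u.length,
            (if (Fin.cons a j : Fin (r + 1 + 1) → Fin u.length) 0 = a ∧
              ((Fin.cons a j : Fin (r + 1 + 1) → Fin u.length) (Fin.last (r + 1)) : ℕ) + 1 =
                u.length ∧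
              ∀ p : Fin (r + 1), (Fin.cons a j : Fin (r + 1 + 1) → Fin u.length) p.castSucc ≤
                (Fin.cons a j : Fin (r + 1 + 1) → Fin u.length) p.succ then
            (-1 : 𝕜) ^ koszulExp (s :: v) u s (Fin.cons a j : Fin (r + 1 + 1) → Fin u.length) •
              Finsupp.single (substWord s n (s :: v)
                (pieces u (Fin.cons a j : Fin (r + 1 + 1) → Fin u.length))) (1 : 𝕜)
            else 0) = ∑ b ∈ Finset.Ico (a : ℕ) u.length,
              (-1 : 𝕜) ^ (relDeg u a b * deg (s :: v)) •
                appendL 𝕜 ((piece u a b).map (relabelIn s))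
                  (if (j 0 : ℕ) = b ∧ (j (Fin.last r) : ℕ) + 1 = u.length ∧
                      ∀ p : Fin r, j p.castSucc ≤ j p.succ then
                    (-1 : 𝕜) ^ koszulExp v u s j •
                      Finsupp.single (substWord s n v (pieces u j)) (1 : 𝕜)
                  else 0) := by
          intro j
          have hlast : (Fin.cons a j : Fin (r + 1 + 1) → Fin u.length) (Fin.last (r + 1)) =
              j (Fin.last r) := rfl
          have hmono : (∀ p : Fin (r + 1), (Fin.cons a j : Fin (r + 1 + 1) → Fin u.length)
              p.castSucc ≤ (Fin.cons a j : Fin (r + 1 + 1) → Fin u.length) p.succ) ↔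
              a ≤ j 0 ∧ ∀ p : Fin r, j p.castSucc ≤ j p.succ := by
            rw [Fin.forall_fin_succ]
            rfl
          simp only [hlast, hmono, Fin.cons_zero]
          by_cases ha : (a : ℕ) ≤ j 0
          · rw [Finset.sum_eq_single ((j 0 : Fin u.length) : ℕ)]
            · have ha' : a ≤ j 0 := ha
              simp only [true_and, ha']
              split_ifs with h
              · rw [koszulExp_cons_self u hr', pieces_cons, map_smul, appendL_single, smul_smul,
                  pow_add]
                simp [substWord]
              · simp
            · intro b _ hb
              rw [if_neg (fun h => hb h.1.symm), map_zero, smul_zero]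
            · intro h
              exact absurd (Finset.mem_Ico.2 ⟨ha, (j 0).2⟩) h
          · rw [if_neg (fun h => ha h.2.2.1), Finset.sum_eq_zero]
            intro b hb
            rw [if_neg, map_zero, smul_zero]
            rintro ⟨rfl, -⟩
            exact ha (Finset.mem_Ico.1 hb).1
        refine (Finset.sum_congr rfl fun j _ => h2 j).trans ?_
        rw [Finset.sum_comm]
        refine Finset.sum_congr rfl fun b hb => ?_
        rw [Finset.mem_Ico] at hb
        rw [← ih r hr' ⟨b, hb.2⟩, map_sum, Finset.smul_sum]
        refine Finset.sum_congr rfl fun j _ => ?_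
        simp only [Fin.ext_iff]
      · intro b _ hb
        refine Finset.sum_eq_zero fun j _ => ?_
        rw [if_neg]
        rintro ⟨h, -⟩
        exact hb h
      · simp
    · have hr' : v.count t = r := by simpa [hs] using hr
      rw [compMap_cons_of_ne hs, ← ih r hr' a, map_sum]
      refine Finset.sum_congr rfl fun j _ => ?_
      split_ifs with h
      · rw [koszulExp_cons_of_ne hs u hr', map_smul, consL_single]
        simp [substWord, hs]
      · simp

theorem surjCircWord_eq (n s : ℕ) (c : ℤ) (v u : List ℕ) (hu : u ≠ []) :
    surjCircWord 𝕜 n s c t v u =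
      toSurj 𝕜 s c (compMap 𝕜 (relabelOut t n) (relabelIn t) t v u) := by
  classical
  have hL : 0 < u.length := List.length_pos_iff.2 hu
  have := sum_cuts_eq (𝕜 := 𝕜) (t := t) n v u _ rfl ⟨0, hL⟩
  rw [List.drop_zero] at this
  rw [← this, map_sum, surjCircWord, cuts, Finset.sum_filter]
  refine Finset.sum_congr rfl fun j _ => ?_
  have h0 : (j 0 = ⟨0, hL⟩) ↔ (j 0 : ℕ) = 0 := by rw [Fin.ext_iff]
  simp only [h0]
  split_ifs with h
  · rw [map_smul, toSurj_single, ← Int.cast_smul_eq_zsmul 𝕜]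
    simp
  · simp

end

end Words

/-! ### Words with relabelling, and the passage to surjections -/

namespace Words

/-- Words in the letters `1, …, n`, all of which occur, of length `n + k`. -/
def IsGood (n : ℕ) (k : ℤ) (w : List ℕ) : Prop :=
  1 ≤ n ∧ (w.length : ℤ) = n + k ∧ ∀ x, x ∈ w ↔ 1 ≤ x ∧ x ≤ n

theorem isSurj_iff {n : ℕ} {k : ℤ} {w : List ℕ} :
    IsSurj n k w ↔ IsGood n k w ∧ w.IsChain (· ≠ ·) := by
  unfold IsSurj IsGood; tauto

/-- This identifies the signs computed from word degrees with the signs of the operad axioms, which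
refer to the grading. -/
theorem IsGood.deg_eq {n : ℕ} {k : ℤ} {w : List ℕ} (h : IsGood n k w) : (deg w : ℤ) = k := by
  have h1 := deg_add_card w
  have h2 : w.toFinset = Finset.Icc 1 n := by ext x; simp [h.2.2]
  rw [h2, Nat.card_Icc] at h1
  have := h.2.1
  omega

theorem IsGood.ne_nil {n : ℕ} {k : ℤ} {w : List ℕ} (h : IsGood n k w) : w ≠ [] := by
  rintro rfl
  have := (h.2.2 1).2 ⟨le_rfl, h.1⟩
  simp at this

section

variable {𝕜 : Type u} [CommRing 𝕜] {f g : ℕ → ℕ} {t : ℕ}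

theorem negOnePow_natCast_smul {M : Type*} [AddCommGroup M] [Module 𝕜 M] {n : ℕ} {k : ℤ}
    (h : (n : ℤ) = k) (x : M) : Int.negOnePow k • x = (-1 : 𝕜) ^ n • x := by
  subst h
  rw [← FreeOp.units_smul_eq (𝕜 := 𝕜)]
  congr 1
  rw [Int.negOnePow_def]
  simp

theorem toSurj_eq_zero {n : ℕ} {k : ℤ} {S : List ℕ →₀ 𝕜}
    (h : ∀ w ∈ S.support, ¬ w.IsChain (· ≠ ·)) : toSurj 𝕜 n k S = 0 := by
  have := Finsupp.map_eq_of_forall_support (toSurj 𝕜 n k) 0 S (fun w hw => by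
    rw [toSurj_single, ofWord, dif_neg fun h' => h w hw h'.2.2.2]; rfl)
  simpa using this

variable (f g t) in
/-- The bilinear extension of `compMap`. -/
noncomputable def compMapL :
    (List ℕ →₀ 𝕜) →ₗ[𝕜] (List ℕ →₀ 𝕜) →ₗ[𝕜] (List ℕ →₀ 𝕜) :=
  ((graftL 𝕜 f g t).compl₁₂ (decL 𝕜) (decL 𝕜)).compr₂ (undecL 𝕜)

theorem compMapL_apply (S T : List ℕ →₀ 𝕜) :
    compMapL f g t S T = undecL 𝕜 (graftL 𝕜 f g t (decL 𝕜 S) (decL 𝕜 T)) := rfl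

@[simp] theorem compMapL_single (v u : List ℕ) :
    compMapL f g t (Finsupp.single v (1 : 𝕜)) (Finsupp.single u 1) = compMap 𝕜 f g t v u := by
  simp [compMapL_apply, compMap]

/-- The relabellings `f` on the letters of `v` other than `t` and `g` on the letters of `u` are
injective with disjoint images. -/
structure Compatible (f g : ℕ → ℕ) (t : ℕ) (v u : List ℕ) : Prop where
  left_pos : ∀ a ∈ v, a ≠ t → f a ≠ 0
  right_pos : ∀ x ∈ u, g x ≠ 0
  left_inj : ∀ a ∈ v, ∀ b ∈ v, a ≠ t → b ≠ t → f a = f b → a = b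
  right_inj : Set.InjOn g {x | x ∈ u}
  disj : ∀ a ∈ v, ∀ x ∈ u, a ≠ t → f a ≠ g x

/-- The relabelling of the letters of the outer word, the letter `t` becoming `0`. -/
def outer (f : ℕ → ℕ) (t a : ℕ) : ℕ := if a = t then 0 else f a

theorem Compatible.outer_injOn {v u : List ℕ} (h : Compatible f g t v u) :
    Set.InjOn (outer f t) {x | x ∈ v} := by
  intro a ha b hb hab
  unfold outer at hab
  split_ifs at hab with h1 h2 h2
  · rw [h1, h2]
  · exact absurd hab.symm (h.left_pos b hb h2)
  · exact absurd hab (h.left_pos a ha h1)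
  · exact h.left_inj a ha b hb h1 h2 hab

theorem Compatible.disjoint {v u : List ℕ} (h : Compatible f g t v u) :
    0 ∉ u.map g ∧ ∀ x ∈ u.map g, x ∉ v.map (outer f t) := by
  constructor
  · intro h0
    obtain ⟨x, hx, hx0⟩ := List.mem_map.1 h0
    exact h.right_pos x hx hx0
  · intro y hy hy'
    obtain ⟨x, hx, rfl⟩ := List.mem_map.1 hy
    obtain ⟨a, ha, hax⟩ := List.mem_map.1 hy'
    unfold outer at hax
    split_ifs at hax with h1
    · exact h.right_pos x hx hax.symm
    · exact h.disj a ha x hx h1 hax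

/-- Relabelling first, with the grafted letter renamed 0, reduces the situation to plain grafting of
words without common letters. There the facts about weights and the Leibniz rule are available. -/
theorem Compatible.graft_eq {v u : List ℕ} (h : Compatible f g t v u) :
    graft 𝕜 f g t (dec v) (dec u) =
      graft 𝕜 id id 0 (dec (v.map (outer f t))) (dec (u.map g)) := by
  rw [dec_map h.outer_injOn, dec_map h.right_inj]
  refine (graft_map (𝕜 := 𝕜) (f := f) (f' := id) (g := id) (g₀ := g) (f₀ := outer f t) (dec v) (dec u) ?_).symm
  refine (forall_mem_dec (p := fun a => (a = t → outer f t a = 0) ∧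
    (a ≠ t → outer f t a ≠ 0 ∧ id (outer f t a) = f a))).2 fun a ha => ⟨fun h1 => ?_, fun h1 => ?_⟩
  · simp [outer, h1]
  · simpa [outer, h1] using h.left_pos a ha h1

/-- Forgetting and recomputing the weights changes nothing. Hence a composite may be grafted again
without leaving decorated words, as needed for the axioms on iterated compositions. -/
theorem Compatible.decL_compMap {v u : List ℕ} (h : Compatible f g t v u) :
    decL 𝕜 (compMap 𝕜 f g t v u) = graft 𝕜 f g t (dec v) (dec u) := by
  rw [compMap, h.graft_eq (𝕜 := 𝕜)]
  have := Finsupp.map_eq_of_forall_support ((decL 𝕜).comp (undecL 𝕜)) LinearMap.id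
    (graft 𝕜 id id 0 (dec (v.map (outer f t))) (dec (u.map g))) (fun w hw => by
      simp [dec_map_fst_of_mem_graft _ _ h.disjoint.2 w hw])
  simpa using this

theorem Compatible.compMap_eq {v u : List ℕ} (h : Compatible f g t v u) :
    compMap 𝕜 f g t v u = comp 𝕜 0 (v.map (outer f t)) (u.map g) := by
  rw [compMap, h.graft_eq (𝕜 := 𝕜)]
  rfl

theorem Compatible.congr {v u v' u' : List ℕ} (h : Compatible f g t v u)
    (hv : ∀ x, x ∈ v' ↔ x ∈ v) (hu : ∀ x, x ∈ u' ↔ x ∈ u) : Compatible f g t v' u' := by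
  obtain ⟨h1, h2, h3, h4, h5⟩ := h
  constructor <;> simpa only [hv, hu]

theorem mem_map_iff_of_injOn {h : ℕ → ℕ} {x : ℕ} {u : List ℕ}
    (hu : Set.InjOn h {y | y ∈ x :: u}) : h x ∈ u.map h ↔ x ∈ u := by
  rw [List.mem_map]
  constructor
  · rintro ⟨y, hy, hxy⟩
    exact hu (by simp) (by simp [hy]) hxy.symm ▸ hy
  · exact fun hx => ⟨x, hx, rfl⟩

theorem lmapDomain_map_consL (h : ℕ → ℕ) (x : ℕ) (S : List ℕ →₀ 𝕜) :
    Finsupp.lmapDomain 𝕜 𝕜 (List.map h) (consL 𝕜 x S) =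
      consL 𝕜 (h x) (Finsupp.lmapDomain 𝕜 𝕜 (List.map h) S) := by
  have := Finsupp.map_eq_of_forall_support ((Finsupp.lmapDomain 𝕜 𝕜 (List.map h)).comp (consL 𝕜 x))
    ((consL 𝕜 (h x)).comp (Finsupp.lmapDomain 𝕜 𝕜 (List.map h))) S (by simp)
  simpa using this

theorem eraseOnce_map {h : ℕ → ℕ} {x : ℕ} {u : List ℕ} (hu : Set.InjOn h {y | y ∈ x :: u}) :
    eraseOnce 𝕜 (h x) (u.map h) = Finsupp.lmapDomain 𝕜 𝕜 (List.map h) (eraseOnce 𝕜 x u) := by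
  induction u with
  | nil => simp [eraseOnce]
  | cons y u ih =>
    have hu' : Set.InjOn h {y | y ∈ x :: u} := hu.mono fun z hz => by
      simp only [Set.mem_ofPred_eq, List.mem_cons] at hz ⊢
      tauto
    rw [List.map_cons]
    by_cases hy : y = x
    · subst hy
      rw [eraseOnce_cons_self, eraseOnce_cons_self]
      simp only [mem_map_iff_of_injOn hu']
      split_ifs <;> simp
    · have hy' : h y ≠ h x := fun e => hy (hu (by simp) (by simp) e)
      rw [eraseOnce_cons_of_ne hy, eraseOnce_cons_of_ne hy', ih hu', lmapDomain_map_consL]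

theorem del_map {h : ℕ → ℕ} {u : List ℕ} (hu : Set.InjOn h {y | y ∈ u}) :
    del 𝕜 (u.map h) = Finsupp.lmapDomain 𝕜 𝕜 (List.map h) (del 𝕜 u) := by
  induction u with
  | nil => simp [del]
  | cons x u ih =>
    have hu' : Set.InjOn h {y | y ∈ u} := hu.mono fun z hz => by simp_all
    have hx := mem_map_iff_of_injOn hu
    rw [List.map_cons]
    by_cases h' : x ∈ u
    · rw [del_cons_of_mem h', del_cons_of_mem (hx.2 h'), ih hu', eraseOnce_map hu, map_sub, map_sub,
        lmapDomain_map_consL, lmapDomain_map_consL]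
      simp
    · rw [del_cons_of_not_mem h', del_cons_of_not_mem (fun h'' => h' (hx.1 h'')), ih hu',
        lmapDomain_map_consL]

theorem deg_map {h : ℕ → ℕ} {u : List ℕ} (hu : Set.InjOn h {y | y ∈ u}) :
    deg (u.map h) = deg u := by
  rw [deg, dec_map hu, deg]
  simp [weight, Function.comp_def]

/-- The Leibniz rule `delL_comp` transported along the injective relabellings. Compatibility only
involves the sets of letters, so it persists for the words occurring in a differential. -/
theorem Compatible.delL_compMap {v u : List ℕ} (h : Compatible f g t v u) :
    delL 𝕜 (compMap 𝕜 f g t v u) =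
      compMapL f g t (del 𝕜 v) (Finsupp.single u 1) +
        (-1 : 𝕜) ^ deg v • compMapL f g t (Finsupp.single v 1) (del 𝕜 u) := by
  rw [h.compMap_eq, delL_comp _ _ h.disjoint.1 h.disjoint.2, del_map h.outer_injOn,
    del_map h.right_inj, deg_map h.outer_injOn]
  congr 1
  · have := Finsupp.map_eq_of_forall_support
      (((compL 𝕜 0).flip (Finsupp.single (u.map g) 1)).comp
        (Finsupp.lmapDomain 𝕜 𝕜 (List.map (outer f t))))
      ((compMapL f g t).flip (Finsupp.single u 1)) (del 𝕜 v) (fun w hw => by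
        simp [(h.congr (mem_of_mem_del hw).2 fun _ => Iff.rfl).compMap_eq])
    simpa using this
  · congr 1
    have := Finsupp.map_eq_of_forall_support
      ((compL 𝕜 0 (Finsupp.single (v.map (outer f t)) 1)).comp
        (Finsupp.lmapDomain 𝕜 𝕜 (List.map g)))
      (compMapL f g t (Finsupp.single v 1)) (del 𝕜 u) (fun w hw => by
        simp [(h.congr (fun _ => Iff.rfl) (mem_of_mem_del hw).2).compMap_eq])
    simpa using this

end

theorem compatible_relabel {m n : ℕ} {a b : ℤ} {v u : List ℕ} (hv : IsGood m a v)
    (hu : IsGood n b u) {t : ℕ} (ht : 1 ≤ t ∧ t ≤ m) :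
    Compatible (relabelOut t n) (relabelIn t) t v u := by
  have h1 := hu.1
  constructor
  · intro a ha hat
    have := (hv.2.2 a).1 ha
    unfold relabelOut
    split_ifs <;> omega
  · intro x hx
    have := (hu.2.2 x).1 hx
    unfold relabelIn
    omega
  · intro a ha b hb hat hbt hab
    unfold relabelOut at hab
    split_ifs at hab <;> omega
  · intro x hx y hy hxy
    have := (hu.2.2 x).1 hx
    have := (hu.2.2 y).1 hy
    simp only [relabelIn] at hxy
    omega
  · intro a ha x hx hat
    have := (hv.2.2 a).1 ha
    have := (hu.2.2 x).1 hx
    unfold relabelOut relabelIn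
    split_ifs <;> omega

/-! ### The axioms of the surjection operad -/

section

variable {𝕜 : Type u} [CommRing 𝕜]

theorem isGood_of_mem_compMap {m n s : ℕ} {a b c : ℤ} {v u w : List ℕ} (hv : IsGood m a v)
    (hu : IsGood n b u) {t : ℕ} (ht : 1 ≤ t ∧ t ≤ m) (hs : s + 1 = m + n) (hc : c = a + b)
    (hw : w ∈ (compMap 𝕜 (relabelOut t n) (relabelIn t) t v u).support) : IsGood s c w := by
  have hm := hv.1
  have hn := hu.1
  refine ⟨by omega, ?_, fun y => ?_⟩
  · have h1 := length_of_mem_compMap hw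
    have h2 := hv.2.1
    have h3 := hu.2.1
    omega
  · rw [mem_of_mem_compMap ((hv.2.2 t).2 ht) hw]
    constructor
    · rintro (⟨x, hx, hxt, rfl⟩ | ⟨x, hx, rfl⟩)
      · have := (hv.2.2 x).1 hx
        unfold relabelOut
        split_ifs <;> omega
      · have := (hu.2.2 x).1 hx
        unfold relabelIn
        omega
    · intro hy
      by_cases h1 : y < t
      · exact Or.inl ⟨y, (hv.2.2 y).2 (by omega), by omega, by simp [relabelOut, h1]⟩
      · by_cases h2 : y < t + n
        · exact Or.inr ⟨y + 1 - t, (hu.2.2 _).2 (by omega), by unfold relabelIn; omega⟩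
        · refine Or.inl ⟨y + 1 - n, (hv.2.2 _).2 (by omega), by omega, ?_⟩
          rw [relabelOut, if_neg (by omega)]
          omega

theorem isGood_of_mem_del {n : ℕ} {d e : ℤ} {u w : List ℕ} (hu : IsGood n d u) (he : e + 1 = d)
    (hw : w ∈ (del 𝕜 u).support) : IsGood n e w := by
  obtain ⟨h1, h2⟩ := mem_of_mem_del hw
  have := hu.2.1
  exact ⟨hu.1, by omega, fun x => by rw [h2, hu.2.2]⟩

/-- The differential of the surjection operad. -/
noncomputable def surjDiff (n : ℕ) (d e : ℤ) : SurjMod 𝕜 n d →ₗ[𝕜] SurjMod 𝕜 n e :=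
  Finsupp.linearCombination 𝕜 fun u : Surj n d => surjDiffWord 𝕜 n e u.1

/-- The compositions of the surjection operad. -/
noncomputable def surjCirc (m n s : ℕ) (a b c : ℤ) (t : ℕ) :
    SurjMod 𝕜 m a →ₗ[𝕜] SurjMod 𝕜 n b →ₗ[𝕜] SurjMod 𝕜 s c :=
  Finsupp.linearCombination 𝕜 fun v : Surj m a =>
    Finsupp.linearCombination 𝕜 fun u : Surj n b => surjCircWord 𝕜 n s c t v.1 u.1

theorem ofWord_of_isSurj {n : ℕ} {k : ℤ} {w : List ℕ} (h : IsSurj n k w) :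
    ofWord 𝕜 n k w = Finsupp.single (show Surj n k from ⟨w, h⟩) 1 := dif_pos h

theorem ofWord_of_not {n : ℕ} {k : ℤ} {w : List ℕ} (h : ¬ IsSurj n k w) :
    ofWord 𝕜 n k w = 0 := dif_neg h

/-- On a degenerate word both sides vanish, since its differential is a combination of degenerate
words. This is the well-definedness of δ on the quotient by degenerate words. -/
theorem surjDiff_toSurj {n : ℕ} {d : ℤ} (e : ℤ) {S : List ℕ →₀ 𝕜}
    (hS : ∀ w ∈ S.support, IsGood n d w) :
    surjDiff n d e (toSurj 𝕜 n d S) = toSurj 𝕜 n e (delL 𝕜 S) := by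
  have := Finsupp.map_eq_of_forall_support ((surjDiff n d e).comp (toSurj 𝕜 n d))
    ((toSurj 𝕜 n e).comp (delL 𝕜)) S (fun w hw => by
      simp only [LinearMap.comp_apply, toSurj_single, delL_single]
      by_cases hc : w.IsChain (· ≠ ·)
      · rw [ofWord_of_isSurj (isSurj_iff.2 ⟨hS w hw, hc⟩), surjDiff,
          Finsupp.linearCombination_single, one_smul, surjDiffWord_eq]
      · rw [ofWord_of_not fun h => hc h.2.2.2, map_zero,
          toSurj_eq_zero fun w' hw' => not_isChain_of_mem_del hc hw'])
  simpa using this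

theorem surjCirc_ofWord {m n : ℕ} {a b : ℤ} (s : ℕ) (c : ℤ) {v u : List ℕ} (hv : IsGood m a v)
    (hu : IsGood n b u) {t : ℕ} (ht : 1 ≤ t ∧ t ≤ m) :
    surjCirc m n s a b c t (ofWord 𝕜 m a v) (ofWord 𝕜 n b u) =
      toSurj 𝕜 s c (compMap 𝕜 (relabelOut t n) (relabelIn t) t v u) := by
  by_cases hvc : v.IsChain (· ≠ ·)
  · by_cases huc : u.IsChain (· ≠ ·)
    · rw [ofWord_of_isSurj (isSurj_iff.2 ⟨hv, hvc⟩), ofWord_of_isSurj (isSurj_iff.2 ⟨hu, huc⟩),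
        surjCirc, Finsupp.linearCombination_single, one_smul, Finsupp.linearCombination_single,
        one_smul, surjCircWord_eq _ _ _ _ _ hu.ne_nil]
    · rw [ofWord_of_not (w := u) fun h => huc h.2.2.2, map_zero,
        toSurj_eq_zero fun w hw => not_isChain_of_mem_compMap_right ((hv.2.2 t).2 ht) huc hw]
  · rw [ofWord_of_not (w := v) fun h => hvc h.2.2.2, map_zero, LinearMap.zero_apply,
      toSurj_eq_zero fun w hw => not_isChain_of_mem_compMap_left hvc hw]

theorem surjCirc_toSurj {m n : ℕ} {a b : ℤ} (s : ℕ) (c : ℤ) {S T : List ℕ →₀ 𝕜}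
    (hS : ∀ w ∈ S.support, IsGood m a w) (hT : ∀ w ∈ T.support, IsGood n b w) {t : ℕ}
    (ht : 1 ≤ t ∧ t ≤ m) :
    surjCirc m n s a b c t (toSurj 𝕜 m a S) (toSurj 𝕜 n b T) =
      toSurj 𝕜 s c (compMapL (relabelOut t n) (relabelIn t) t S T) := by
  have h : ∀ v, IsGood m a v →
      surjCirc m n s a b c t (toSurj 𝕜 m a (Finsupp.single v 1)) (toSurj 𝕜 n b T) =
      toSurj 𝕜 s c (compMapL (relabelOut t n) (relabelIn t) t (Finsupp.single v 1) T) := by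
    intro v hv
    have := Finsupp.map_eq_of_forall_support
      ((surjCirc m n s a b c t (toSurj 𝕜 m a (Finsupp.single v 1))).comp (toSurj 𝕜 n b))
      ((toSurj 𝕜 s c).comp (compMapL (relabelOut t n) (relabelIn t) t (Finsupp.single v 1))) T
      (fun u hu => by simp [surjCirc_ofWord s c hv (hT u hu) ht])
    simpa using this
  have := Finsupp.map_eq_of_forall_support
    (((surjCirc m n s a b c t).flip (toSurj 𝕜 n b T)).comp (toSurj 𝕜 m a))
    ((toSurj 𝕜 s c).comp ((compMapL (relabelOut t n) (relabelIn t) t).flip T)) S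
    (fun v hv => by simpa using h v (hS v hv))
  simpa using this

theorem SurjMod.induction {n : ℕ} {k : ℤ} {p : SurjMod 𝕜 n k → Prop} (x : SurjMod 𝕜 n k)
    (zero : p 0) (add : ∀ x y, p x → p y → p (x + y)) (smul : ∀ (c : 𝕜) x, p x → p (c • x))
    (word : ∀ w, IsSurj n k w → p (ofWord 𝕜 n k w)) : p x := by
  induction x using Finsupp.induction_linear with
  | zero => exact zero
  | add x y hx hy => exact add x y hx hy
  | single w c =>
    have := smul c _ (word w.1 w.2)
    rw [ofWord_of_isSurj w.2, Finsupp.smul_single_one] at this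
    exact this

theorem isGood_of_mem_single {n : ℕ} {k : ℤ} {v : List ℕ} (hv : IsGood n k v) :
    ∀ w ∈ (Finsupp.single v (1 : 𝕜)).support, IsGood n k w := by
  intro w hw
  obtain rfl : w = v := by simpa using Finsupp.support_single_subset hw
  exact hv

theorem surjDiff_surjDiff {n : ℕ} {d e f : ℤ} (he : e + 1 = d) (x : SurjMod 𝕜 n d) :
    surjDiff n e f (surjDiff n d e x) = 0 := by
  induction x using SurjMod.induction with
  | zero => simp
  | add x y hx hy => simp [hx, hy]
  | smul c x hx => simp [hx]
  | word w hw =>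
    have hw' := (isSurj_iff.1 hw).1
    rw [← toSurj_single, surjDiff_toSurj e (isGood_of_mem_single hw'), delL_single,
      surjDiff_toSurj f fun w hw => isGood_of_mem_del hw' he hw, delL_del, map_zero]

theorem surjDiff_surjCirc {m n r : ℕ} {a b c a' b' c' : ℤ} {i : ℕ} (hi : 1 ≤ i ∧ i ≤ m)
    (hr : r + 1 = m + n) (hc : c = a + b) (ha' : a' + 1 = a) (hb' : b' + 1 = b)
    (x : SurjMod 𝕜 m a) (y : SurjMod 𝕜 n b) :
    surjDiff r c c' (surjCirc m n r a b c i x y) =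
      surjCirc m n r a' b c' i (surjDiff m a a' x) y +
        Int.negOnePow a • surjCirc m n r a b' c' i x (surjDiff n b b' y) := by
  induction x using SurjMod.induction with
  | zero => simp
  | add x y hx hy => simp only [map_add, LinearMap.add_apply, hx, hy, smul_add]; abel
  | smul t x hx => simp only [map_smul, LinearMap.smul_apply, hx, smul_add, smul_comm t]
  | word v hv =>
    induction y using SurjMod.induction with
    | zero => simp
    | add x y hx hy => simp only [map_add, hx, hy, smul_add]; abel
    | smul t x hx => simp only [map_smul, hx, smul_add, smul_comm t]
    | word u hu =>
      have hv' := (isSurj_iff.1 hv).1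
      have hu' := (isSurj_iff.1 hu).1
      have hvs := isGood_of_mem_single (𝕜 := 𝕜) hv'
      have hus := isGood_of_mem_single (𝕜 := 𝕜) hu'
      have hvd := fun w hw => isGood_of_mem_del (𝕜 := 𝕜) (w := w) hv' ha' hw
      have hud := fun w hw => isGood_of_mem_del (𝕜 := 𝕜) (w := w) hu' hb' hw
      rw [surjCirc_ofWord r c hv' hu' hi, surjDiff_toSurj c'
        (fun w hw => isGood_of_mem_compMap hv' hu' hi hr hc hw),
        (compatible_relabel hv' hu' hi).delL_compMap, negOnePow_natCast_smul (𝕜 := 𝕜) hv'.deg_eq,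
        ← toSurj_single, ← toSurj_single, surjDiff_toSurj a' hvs, surjDiff_toSurj b' hus,
        delL_single, delL_single, surjCirc_toSurj r c' hvd hus hi,
        surjCirc_toSurj r c' hvs hud hi, map_add, map_smul]

/-- Intermediate composites may contain degenerate words, which `toSurj` kills; keeping them inside
`graftL` is harmless and leaves an expression to which the grafting identities apply. -/
theorem surjCirc_surjCirc_ofWord {m n l r : ℕ} {a b c ab : ℤ} (s : ℕ) (abc : ℤ) {i j : ℕ}
    (hi : 1 ≤ i ∧ i ≤ m) (hj : 1 ≤ j ∧ j ≤ r) (hr : r + 1 = m + n) (hab : ab = a + b)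
    {x y z : List ℕ} (hx : IsGood m a x) (hy : IsGood n b y) (hz : IsGood l c z) :
    surjCirc r l s ab c abc j (surjCirc m n r a b ab i (ofWord 𝕜 m a x) (ofWord 𝕜 n b y))
      (ofWord 𝕜 l c z) =
    toSurj 𝕜 s abc (undecL 𝕜 (graftL 𝕜 (relabelOut j l) (relabelIn j) j
      (graft 𝕜 (relabelOut i n) (relabelIn i) i (dec x) (dec y)) (Finsupp.single (dec z) 1))) := by
  rw [surjCirc_ofWord r ab hx hy hi, ← toSurj_single, surjCirc_toSurj s abc
    (fun w hw => isGood_of_mem_compMap hx hy hi hr hab hw) (isGood_of_mem_single hz) hj,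
    compMapL_apply, (compatible_relabel hx hy hi).decL_compMap, decL_single]

theorem surjCirc_ofWord_surjCirc {m n l r : ℕ} {a b c bc : ℤ} (s : ℕ) (abc : ℤ) {i k : ℕ}
    (hi : 1 ≤ i ∧ i ≤ m) (hk : 1 ≤ k ∧ k ≤ n) (hr : r + 1 = n + l) (hbc : bc = b + c)
    {x y z : List ℕ} (hx : IsGood m a x) (hy : IsGood n b y) (hz : IsGood l c z) :
    surjCirc m r s a bc abc i (ofWord 𝕜 m a x)
      (surjCirc n l r b c bc k (ofWord 𝕜 n b y) (ofWord 𝕜 l c z)) =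
    toSurj 𝕜 s abc (undecL 𝕜 (graftL 𝕜 (relabelOut i r) (relabelIn i) i (Finsupp.single (dec x) 1)
      (graft 𝕜 (relabelOut k l) (relabelIn k) k (dec y) (dec z)))) := by
  rw [surjCirc_ofWord r bc hy hz hk, ← toSurj_single, surjCirc_toSurj s abc
    (isGood_of_mem_single hx) (fun w hw => isGood_of_mem_compMap hy hz hk hr hbc hw) hi,
    compMapL_apply, (compatible_relabel hy hz hk).decL_compMap, decL_single]

/-- By trilinearity it suffices to treat words, where this is `graft_graft`. What remains is that
the relabellings on the two sides agree on every letter. -/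
theorem surjCirc_sequential {m n l r r' s : ℕ} {a b c ab bc abc : ℤ} {i j k : ℕ}
    (_ : i ≤ j) (_ : j < i + n) (_ : k + i = j + 1)
    (hi : 1 ≤ i ∧ i ≤ m) (hj : 1 ≤ j ∧ j ≤ r) (hk : 1 ≤ k ∧ k ≤ n)
    (hr : r + 1 = m + n) (hr' : r' + 1 = n + l)
    (hab : ab = a + b) (hbc : bc = b + c)
    (x : SurjMod 𝕜 m a) (y : SurjMod 𝕜 n b) (z : SurjMod 𝕜 l c) :
    surjCirc r l s ab c abc j (surjCirc m n r a b ab i x y) z =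
      surjCirc m r' s a bc abc i x (surjCirc n l r' b c bc k y z) := by
  induction x using SurjMod.induction with
  | zero => simp
  | add x y hx hy => simp only [map_add, LinearMap.add_apply, hx, hy]
  | smul t x hx => simp only [map_smul, LinearMap.smul_apply, hx]
  | word x hx =>
    induction y using SurjMod.induction with
    | zero => simp
    | add x y hx hy => simp only [map_add, LinearMap.add_apply, hx, hy]
    | smul t x hx => simp only [map_smul, LinearMap.smul_apply, hx]
    | word y hy =>
      induction z using SurjMod.induction with
      | zero => simp
      | add x y hx hy => simp only [map_add, hx, hy]
      | smul t x hx => simp only [map_smul, hx]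
      | word z hz =>
        replace hx := (isSurj_iff.1 hx).1
        replace hy := (isSurj_iff.1 hy).1
        replace hz := (isSurj_iff.1 hz).1
        rw [surjCirc_surjCirc_ofWord s abc hi hj hr hab hx hy hz,
          surjCirc_ofWord_surjCirc s abc hi hk hr' hbc hx hy hz, graft_graft (k := k)]
        · refine forall_mem_dec (p := fun a => a ≠ i → relabelOut i n a ≠ j ∧
            relabelOut j l (relabelOut i n a) = relabelOut i r' a) |>.2 fun a ha hai => ?_
          have := hz.1
          have := hy.1
          simp only [relabelOut]
          refine ⟨?_, ?_⟩ <;> grind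
        · refine forall_mem_dec (p := fun b => (b = k → relabelIn i b = j) ∧ (b ≠ k →
            relabelIn i b ≠ j ∧ relabelOut j l (relabelIn i b) = relabelIn i (relabelOut k l b)))
            |>.2 fun b hb => ⟨fun hbk => ?_, fun hbk => ?_⟩
          · simp only [relabelIn]
            omega
          · have := hz.1
            have := (hy.2.2 b).1 hb
            simp only [relabelIn, relabelOut]
            grind
        · refine forall_mem_dec (p := fun c => relabelIn j c = relabelIn i (relabelIn k c))
            |>.2 fun c hc => ?_
          have := (hz.2.2 c).1 hc
          simp only [relabelIn]
          omega

/-- As in the sequential case, now by `graft_graft_comm`, whose sign is the product of the degrees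
of y and z. -/
theorem surjCirc_parallel {m n l r r' s : ℕ} {a b c ab ac abc : ℤ} {i j k : ℕ}
    (_ : j < i) (_ : k + 1 = i + l)
    (hi : 1 ≤ i ∧ i ≤ m) (hj : 1 ≤ j ∧ j ≤ r) (hj' : 1 ≤ j ∧ j ≤ m) (hk : 1 ≤ k ∧ k ≤ r')
    (hr : r + 1 = m + n) (hr' : r' + 1 = m + l) (hab : ab = a + b) (hac : ac = a + c)
    (x : SurjMod 𝕜 m a) (y : SurjMod 𝕜 n b) (z : SurjMod 𝕜 l c) :
    surjCirc r l s ab c abc j (surjCirc m n r a b ab i x y) z =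
      Int.negOnePow (b * c) • surjCirc r' n s ac b abc k (surjCirc m l r' a c ac j x z) y := by
  induction x using SurjMod.induction with
  | zero => simp
  | add x y hx hy => simp only [map_add, LinearMap.add_apply, hx, hy, smul_add]
  | smul t x hx => simp only [map_smul, LinearMap.smul_apply, hx, smul_comm t]
  | word x hx =>
    induction y using SurjMod.induction with
    | zero => simp
    | add x y hx hy => simp only [map_add, LinearMap.add_apply, hx, hy, smul_add]
    | smul t x hx => simp only [map_smul, LinearMap.smul_apply, hx, smul_comm t]
    | word y hy =>
      induction z using SurjMod.induction with
      | zero => simp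
      | add x y hx hy => simp only [map_add, LinearMap.add_apply, hx, hy, smul_add]
      | smul t x hx => simp only [map_smul, LinearMap.smul_apply, hx, smul_comm t]
      | word z hz =>
        replace hx := (isSurj_iff.1 hx).1
        replace hy := (isSurj_iff.1 hy).1
        replace hz := (isSurj_iff.1 hz).1
        have hyz : ((deg y * deg z : ℕ) : ℤ) = b * c := by
          push_cast; rw [hy.deg_eq, hz.deg_eq]
        have hn := hy.1
        have hl := hz.1
        rw [surjCirc_surjCirc_ofWord s abc hi hj hr hab hx hy hz,
          surjCirc_surjCirc_ofWord s abc hj' hk hr' hac hx hz hy,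
          negOnePow_natCast_smul (𝕜 := 𝕜) hyz,
          graft_graft_comm (i := i) (j := j) (k := k) (by omega) (f₁ := relabelOut j l)
            (g₁ := relabelIn j) (f₁' := relabelOut k n) (g₁' := relabelIn k), map_smul, map_smul]
        · rfl
        · simp only [relabelOut]
          grind
        · simp only [relabelOut]
          grind
        · refine forall_mem_dec (p := fun a => a ≠ i → a ≠ j → relabelOut i n a ≠ j ∧
            relabelOut j l a ≠ k ∧ relabelOut j l (relabelOut i n a) =
              relabelOut k n (relabelOut j l a)) |>.2 fun a ha hai haj => ?_
          simp only [relabelOut]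
          grind
        · refine forall_mem_dec (p := fun b => relabelIn i b ≠ j ∧
            relabelOut j l (relabelIn i b) = relabelIn k b) |>.2 fun b hb => ?_
          have := (hy.2.2 b).1 hb
          simp only [relabelIn, relabelOut]
          grind
        · refine forall_mem_dec (p := fun c => relabelIn j c ≠ k ∧
            relabelIn j c = relabelOut k n (relabelIn j c)) |>.2 fun c hc => ?_
          have := (hz.2.2 c).1 hc
          simp only [relabelIn, relabelOut]
          grind

theorem compMap_singleton_left {f g : ℕ → ℕ} {t : ℕ} (u : List ℕ) (hu : u ≠ []) :
    compMap 𝕜 f g t [t] u = Finsupp.single (u.map g) 1 := by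
  induction u with
  | nil => simp at hu
  | cons x u ih =>
    rw [compMap_cons_cons]
    rcases eq_or_ne u [] with rfl | hu'
    · simp [compMap_of_not_mem]
    · rw [ih hu', compMap_of_not_mem_eq_zero (by simp) (by simpa using hu')]
      simp

theorem compMap_singleton_right {f g : ℕ → ℕ} {t x : ℕ} (v : List ℕ) :
    compMap 𝕜 f g t v [x] = Finsupp.single (v.map fun a => if a = t then g x else f a) 1 := by
  induction v with
  | nil => simp [compMap_of_not_mem]
  | cons a v ih =>
    by_cases ha : a = t
    · subst ha
      rw [compMap_cons_cons, ih]
      simp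
    · rw [compMap_cons_of_ne ha, ih]
      simp [ha]

theorem isSurj_one : IsSurj 1 0 [1] :=
  ⟨le_rfl, by simp, fun x => by simp; omega, by simp⟩

theorem surjCirc_one_left {n : ℕ} {d : ℤ} (x : SurjMod 𝕜 n d) :
    surjCirc 1 n n 0 d d 1 (ofWord 𝕜 1 0 [1]) x = x := by
  induction x using SurjMod.induction with
  | zero => simp
  | add x y hx hy => simp only [map_add, hx, hy]
  | smul t x hx => simp only [map_smul, hx]
  | word u hu =>
    have hu' := (isSurj_iff.1 hu).1
    rw [surjCirc_ofWord n d (isSurj_iff.1 isSurj_one).1 hu' ⟨le_rfl, le_rfl⟩,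
      compMap_singleton_left u hu'.ne_nil, toSurj_single]
    congr 1
    conv_rhs => rw [← List.map_id u]
    refine List.map_congr_left fun x hx => ?_
    simp [relabelIn]

theorem surjCirc_one_right {n : ℕ} {d : ℤ} {i : ℕ} (hi : 1 ≤ i ∧ i ≤ n) (x : SurjMod 𝕜 n d) :
    surjCirc n 1 n d 0 d i x (ofWord 𝕜 1 0 [1]) = x := by
  induction x using SurjMod.induction with
  | zero => simp
  | add x y hx hy => simp only [map_add, LinearMap.add_apply, hx, hy]
  | smul t x hx => simp only [map_smul, LinearMap.smul_apply, hx]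
  | word u hu =>
    have hu' := (isSurj_iff.1 hu).1
    rw [surjCirc_ofWord n d hu' (isSurj_iff.1 isSurj_one).1 hi,
      compMap_singleton_right, toSurj_single]
    congr 1
    conv_rhs => rw [← List.map_id u]
    refine List.map_congr_left fun x hx => ?_
    simp only [relabelIn, relabelOut, id]
    split_ifs <;> omega

end

end Words

/-! ### The surjection operad and its suboperads as dg operads -/

theorem isDGOperad_surjOperad (𝕜 : Type u) [CommRing 𝕜] : IsDGOperad (surjOperad 𝕜) where
  circ_parallel h1 h2 hi hj hj' hk hr _ hr' _ hab _ hac _ x y z :=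
    Words.surjCirc_parallel h1 h2 hi hj hj' hk hr hr' hab hac x y z
  circ_sequential h1 h2 h3 hi hj hk hr _ hr' _ hab _ hbc _ x y z :=
    Words.surjCirc_sequential h1 h2 h3 hi hj hk hr hr' hab hbc x y z
  one_circ _ _ _ x := Words.surjCirc_one_left x
  circ_one hi _ _ x := Words.surjCirc_one_right hi x
  diff_diff he _ x := Words.surjDiff_surjDiff he x
  diff_circ hi hr hc ha' hb' _ _ _ x y := Words.surjDiff_surjCirc hi hr hc ha' hb' x y

theorem SubDGOperad.isDGOperad {𝕜 : Type u} [CommRing 𝕜] {O : DGOperadData 𝕜} (hO : IsDGOperad O)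
    (S : SubDGOperad O) : IsDGOperad S.toData where
  circ_parallel h1 h2 hi hj hj' hk hr hs hr' hs' hab habc hac habc' x y z := Subtype.ext <|
    hO.circ_parallel h1 h2 hi hj hj' hk hr hs hr' hs' hab habc hac habc' x.1 y.1 z.1
  circ_sequential h1 h2 h3 hi hj hk hr hs hr' hs' hab habc hbc habc' x y z := Subtype.ext <|
    hO.circ_sequential h1 h2 h3 hi hj hk hr hs hr' hs' hab habc hbc habc' x.1 y.1 z.1
  one_circ hi hr hd x := Subtype.ext <| hO.one_circ hi hr hd x.1
  circ_one hi hr hd x := Subtype.ext <| hO.circ_one hi hr hd x.1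
  diff_diff he hf x := Subtype.ext <| hO.diff_diff he hf x.1
  diff_circ hi hr hc ha' hb' hc' h₁ h₂ x y := Subtype.ext <|
    hO.diff_circ hi hr hc ha' hb' hc' h₁ h₂ x.1 y.1

theorem isDGOperad_cactusOperad (𝕜 : Type u) [CommRing 𝕜] : IsDGOperad (cactusOperad 𝕜) :=
  (cactusSub 𝕜).isDGOperad (isDGOperad_surjOperad 𝕜)

/-! ### Morphisms out of quasi-free operads -/

/-- The Leibniz rule applied to 1 ∘_1 1 = 1 gives ∂1 = ∂1 + ∂1. -/
theorem IsDGOperad.diff_one {𝕜 : Type u} [CommRing 𝕜] {O : DGOperadData 𝕜} (hO : IsDGOperad O)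
    {e : ℤ} (he : e + 1 = 0) : O.diff he O.one = 0 := by
  have h := hO.diff_circ (i := 1) (r := 1) (a := 0) (b := 0) (c := 0) (c' := e) ⟨le_rfl, le_rfl⟩
    rfl rfl he he he (by omega) (by omega) O.one O.one
  rw [hO.one_circ, hO.one_circ, hO.circ_one] at h
  simpa using h

namespace FreeOp

variable {𝕜 : Type u} [CommRing 𝕜] {G : ℕ → ℤ → Type} {O : DGOperadData 𝕜}

/-- The value of a formal expression in an operad, given the values of the generators. -/
def valTree (O : DGOperadData 𝕜) (g : ∀ n d, G n d → O.obj n d) :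
    ∀ {n : ℕ} {d : ℤ}, OpExpr 𝕜 G n d → O.obj n d
  | _, _, .gen x => g _ _ x
  | _, _, .one => O.one
  | _, _, .zero => 0
  | _, _, .add x y => valTree O g x + valTree O g y
  | _, _, .smul t x => t • valTree O g x
  | _, _, .circ i hi hr hc x y => O.circ i hi hr hc (valTree O g x) (valTree O g y)

theorem valTree_rel (hO : IsDGOperad O) (g : ∀ n d, G n d → O.obj n d) {n : ℕ} {d : ℤ}
    {x y : OpExpr 𝕜 G n d} (hxy : OpExpr.Rel 𝕜 G x y) : valTree O g x = valTree O g y := by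
  induction hxy with
  | add_comm x y => exact _root_.add_comm _ _
  | add_assoc x y z => exact _root_.add_assoc _ _ _
  | zero_add x => exact _root_.zero_add _
  | one_smul x => exact _root_.one_smul _ _
  | mul_smul s t x => exact SemigroupAction.mul_smul _ _ _
  | smul_add t x y => exact _root_.smul_add _ _ _
  | add_smul s t x => exact _root_.add_smul _ _ _
  | smul_zero t => exact _root_.smul_zero _
  | zero_smul x => exact _root_.zero_smul _ _
  | circ_add_left i hi hr hc x x' y => simp only [valTree, map_add, LinearMap.add_apply]
  | circ_add_right i hi hr hc x y y' => simp only [valTree, map_add]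
  | circ_smul_left i hi hr hc t x y => simp only [valTree, map_smul, LinearMap.smul_apply]
  | circ_smul_right i hi hr hc t x y => simp only [valTree, map_smul]
  | parallel hji hkl hi hj hj' hk hr hs hr' hs' hab habc hac habc' x y z =>
    simp only [valTree, units_smul_eq]
    exact hO.circ_parallel hji hkl hi hj hj' hk hr hs hr' hs' hab habc hac habc' _ _ _
  | sequential hij hjn hki hi hj hk hr hs hr' hs' hab habc hbc habc' x y z =>
    exact hO.circ_sequential hij hjn hki hi hj hk hr hs hr' hs' hab habc hbc habc' _ _ _
  | one_circ hi hr hd x => exact hO.one_circ hi hr hd _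
  | circ_one hi hr hd x => exact hO.circ_one hi hr hd _
  | congr_add_left x x' y h ih => simp only [valTree, ih]
  | congr_add_right x y y' h ih => simp only [valTree, ih]
  | congr_smul t x x' h ih => simp only [valTree, ih]
  | congr_circ_left i hi hr hc x x' y h ih => simp only [valTree, ih]
  | congr_circ_right i hi hr hc x y y' h ih => simp only [valTree, ih]

/-- The linear maps induced on the components of a free operad by values of the generators. -/
def eval (hO : IsDGOperad O) (g : ∀ n d, G n d → O.obj n d) {n : ℕ} {d : ℤ} :
    FreeOp 𝕜 G n d →ₗ[𝕜] O.obj n d where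
  toFun := Quot.lift (valTree O g) (fun _ _ h => valTree_rel hO g h)
  map_add' := by rintro ⟨x⟩ ⟨y⟩; rfl
  map_smul' := by rintro t ⟨x⟩; rfl

theorem eval_circ (hO : IsDGOperad O) (g : ∀ n d, G n d → O.obj n d) {m n r : ℕ} {a b c : ℤ}
    (i : ℕ) (hi : 1 ≤ i ∧ i ≤ m) (hr : r + 1 = m + n) (hc : c = a + b)
    (x : FreeOp 𝕜 G m a) (y : FreeOp 𝕜 G n b) :
    eval hO g (circ i hi hr hc x y) = O.circ i hi hr hc (eval hO g x) (eval hO g y) := by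
  rcases x with ⟨x⟩; rcases y with ⟨y⟩; rfl

/-- The derivation of a free operad with prescribed values on the generators. -/
def derivation (dg : ∀ {n : ℕ} {d e : ℤ}, e + 1 = d → G n d → FreeOp 𝕜 G n e) {n : ℕ} {d e : ℤ}
    (h : e + 1 = d) : FreeOp 𝕜 G n d →ₗ[𝕜] FreeOp 𝕜 G n e :=
  (quasiFree 𝕜 G dg).diff h

theorem induction {p : ∀ {n : ℕ} {d : ℤ}, FreeOp 𝕜 G n d → Prop}
    (gen : ∀ {n : ℕ} {d : ℤ} (x : G n d), p (gen 𝕜 x)) (one : p (mk (𝕜 := 𝕜) (G := G) .one))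
    (zero : ∀ {n : ℕ} {d : ℤ}, p (0 : FreeOp 𝕜 G n d))
    (add : ∀ {n : ℕ} {d : ℤ} (x y : FreeOp 𝕜 G n d), p x → p y → p (x + y))
    (smul : ∀ {n : ℕ} {d : ℤ} (t : 𝕜) (x : FreeOp 𝕜 G n d), p x → p (t • x))
    (circ : ∀ {m n r : ℕ} {a b c : ℤ} (i : ℕ) (hi : 1 ≤ i ∧ i ≤ m) (hr : r + 1 = m + n)
      (hc : c = a + b) (x : FreeOp 𝕜 G m a) (y : FreeOp 𝕜 G n b), p x → p y →
        p (circ i hi hr hc x y))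
    {n : ℕ} {d : ℤ} (x : FreeOp 𝕜 G n d) : p x := by
  obtain ⟨x, rfl⟩ := Quot.exists_rep x
  induction x with
  | gen x => exact gen x
  | one => exact one
  | zero => exact zero
  | add x y hx hy => exact add _ _ hx hy
  | smul t x hx => exact smul t _ hx
  | circ i hi hr hc x y hx hy => exact circ i hi hr hc _ _ hx hy

variable (dg : ∀ {n : ℕ} {d e : ℤ}, e + 1 = d → G n d → FreeOp 𝕜 G n e)

theorem derivation_circ {m n r : ℕ} {a b c a' b' c' : ℤ} {i : ℕ} (hi : 1 ≤ i ∧ i ≤ m)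
    (hr : r + 1 = m + n) (hc : c = a + b) (ha' : a' + 1 = a) (hb' : b' + 1 = b)
    (hc' : c' + 1 = c) (h₁ : c' = a' + b) (h₂ : c' = a + b')
    (x : FreeOp 𝕜 G m a) (y : FreeOp 𝕜 G n b) :
    derivation dg hc' (circ i hi hr hc x y) =
      circ i hi hr h₁ (derivation dg ha' x) y +
        Int.negOnePow a • circ i hi hr h₂ x (derivation dg hb' y) := by
  obtain rfl : a' = a - 1 := by omega
  obtain rfl : b' = b - 1 := by omega
  rcases x with ⟨x⟩; rcases y with ⟨y⟩
  rfl

/-- For a composition x ∘_i y the two mixed terms ∂x ∘_i ∂y carry the signs (-1)^{|x|-1} and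
(-1)^{|x|} and cancel. So ∂² vanishes everywhere once it vanishes on generators. -/
theorem derivation_derivation
    (h : ∀ {n : ℕ} {d e f : ℤ} (he : e + 1 = d) (hf : f + 1 = e) (x : G n d),
      derivation dg hf (dg he x) = 0) {n : ℕ} {d : ℤ} (x : FreeOp 𝕜 G n d) :
    ∀ {e f : ℤ} (he : e + 1 = d) (hf : f + 1 = e), derivation dg hf (derivation dg he x) = 0 := by
  induction x using FreeOp.induction with
  | gen x => exact fun he hf => h he hf x
  | one => exact fun he hf => map_zero _
  | zero => simp
  | add x y hx hy => intro e f he hf; simp only [map_add, hx he hf, hy he hf, _root_.add_zero]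
  | smul t x hx => intro e f he hf; simp only [map_smul, hx he hf, _root_.smul_zero]
  | @circ m n r a b c i hi hr hc x y hx hy =>
    intro e f he hf
    rw [derivation_circ dg hi hr hc (a' := a - 1) (b' := b - 1) (by omega) (by omega) he
      (by omega) (by omega), map_add, Units.smul_def, map_zsmul, derivation_circ dg hi hr _
      (a' := a - 2) (b' := b - 1) (by omega) (by omega) hf (by omega) (by omega),
      derivation_circ dg hi hr _
      (a' := a - 1) (b' := b - 2) (by omega) (by omega) hf (by omega) (by omega),
      hx, hy, map_zero, LinearMap.zero_apply, map_zero, _root_.smul_zero, _root_.add_zero,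
      _root_.zero_add, ← Units.smul_def, Int.negOnePow_sub]
    simp

end FreeOp

section quasiFree

variable {𝕜 : Type u} [CommRing 𝕜] {G : ℕ → ℤ → Type} {O : DGOperadData 𝕜}
  (dg : ∀ {n : ℕ} {d e : ℤ}, e + 1 = d → G n d → FreeOp 𝕜 G n e)

theorem isDGOperad_quasiFree
    (h : ∀ {n : ℕ} {d e f : ℤ} (he : e + 1 = d) (hf : f + 1 = e) (x : G n d),
      FreeOp.derivation dg hf (dg he x) = 0) : IsDGOperad (quasiFree 𝕜 G dg) where
  circ_parallel := FreeOp.circ_parallel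
  circ_sequential := FreeOp.circ_sequential
  one_circ hi hr hd := by rintro ⟨x⟩; exact Quot.sound (.one_circ hi hr hd x)
  circ_one hi hr hd := by rintro ⟨x⟩; exact Quot.sound (.circ_one hi hr hd x)
  diff_circ := FreeOp.derivation_circ dg
  diff_diff he hf x := FreeOp.derivation_derivation dg h x he hf

/-- Both sides satisfy the same Leibniz rule along the evaluation, so agreement propagates from the
generators to all expressions. -/
theorem eval_derivation (hO : IsDGOperad O) (g : ∀ n d, G n d → O.obj n d)
    (hg : ∀ {n : ℕ} {d e : ℤ} (h : e + 1 = d) (x : G n d),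
      FreeOp.eval hO g (dg h x) = O.diff h (g n d x)) {n : ℕ} {d : ℤ} (x : FreeOp 𝕜 G n d) :
    ∀ {e : ℤ} (h : e + 1 = d),
      FreeOp.eval hO g (FreeOp.derivation dg h x) = O.diff h (FreeOp.eval hO g x) := by
  induction x using FreeOp.induction with
  | gen x => exact fun h => hg h x
  | one => exact fun h => (map_zero _).trans (hO.diff_one h).symm
  | zero => simp
  | add x y hx hy => intro e h; simp only [map_add, hx h, hy h]
  | smul t x hx => intro e h; simp only [map_smul, hx h]
  | @circ m n r a b c i hi hr hc x y hx hy =>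
    intro e h
    rw [FreeOp.derivation_circ dg hi hr hc (a' := a - 1) (b' := b - 1) (by omega) (by omega) h
      (by omega) (by omega), FreeOp.eval_circ, hO.diff_circ hi hr hc (a' := a - 1) (b' := b - 1)
      (by omega) (by omega) h (by omega) (by omega), map_add, Units.smul_def, map_zsmul,
      FreeOp.eval_circ, FreeOp.eval_circ, hx, hy, ← Units.smul_def]

/-- The morphism out of a quasi-free operad given by values on the generators that are compatible
with the differential. -/
def quasiFreeLift (hO : IsDGOperad O) (g : ∀ n d, G n d → O.obj n d)
    (hg : ∀ {n : ℕ} {d e : ℤ} (h : e + 1 = d) (x : G n d),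
      FreeOp.eval hO g (dg h x) = O.diff h (g n d x)) : DGOperadHom (quasiFree 𝕜 G dg) O where
  map := FreeOp.eval hO g
  map_circ := FreeOp.eval_circ hO g
  map_one := rfl
  map_diff h x := eval_derivation dg hO g hg x h

variable {dg}

theorem quasiFree_hom_ext {f f' : DGOperadHom (quasiFree 𝕜 G dg) O}
    (h : ∀ (n : ℕ) (d : ℤ) (x : G n d), f.map (FreeOp.gen 𝕜 x : FreeOp 𝕜 G n d) =
      f'.map (FreeOp.gen 𝕜 x : FreeOp 𝕜 G n d)) : f = f' := by
  apply DGOperadHom.ext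
  funext n d
  apply LinearMap.ext
  intro x
  refine FreeOp.induction (𝕜 := 𝕜) (G := G)
    (p := fun {n d} x => f.map (n := n) (d := d) x = f'.map x) (h _ _)
    (f.map_one.trans f'.map_one.symm) ((map_zero f.map).trans (map_zero f'.map).symm)
    (fun x y hx hy => ?_) (fun t x hx => ?_) (fun i hi hr hc x y hx hy => ?_) x
  · exact ((map_add f.map x y).trans (congrArg₂ _ hx hy)).trans (map_add f'.map x y).symm
  · exact ((map_smul f.map t x).trans (congrArg _ hx)).trans (map_smul f'.map t x).symm
  · refine (f.map_circ i hi hr hc x y).trans (Eq.trans ?_ (f'.map_circ i hi hr hc x y).symm)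
    exact congrArg₂ (fun a b => O.circ i hi hr hc a b) hx hy

end quasiFree

/-! ### Removing blocks from strings -/

namespace StrOp

section lists

variable {Γ : Type}

/-- `ξ` without its entries in the positions `a, …, b - 1`. -/
def cut (a b : ℕ) (ξ : List Γ) : List Γ := ξ.take a ++ ξ.drop b

/-- The entries of `ξ` in the positions `a, …, b - 1`. -/
def block (a b : ℕ) (ξ : List Γ) : List Γ := (ξ.drop a).take (b - a)

theorem getElem?_cut (a b : ℕ) (ξ : List Γ) (ha : a ≤ ξ.length) (k : ℕ) :
    (cut a b ξ)[k]? = if k < a then ξ[k]? else ξ[k - a + b]? := by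
  have h : (ξ.take a).length = a := by simp [ha]
  unfold cut
  split_ifs with hk
  · rw [List.getElem?_append_left (by omega), List.getElem?_take_of_lt hk]
  · rw [List.getElem?_append_right (by omega), List.getElem?_drop, h]
    congr 1; omega

theorem getElem?_block (a b : ℕ) (ξ : List Γ) (k : ℕ) :
    (block a b ξ)[k]? = if k < b - a then ξ[a + k]? else none := by
  unfold block
  rw [List.getElem?_take]
  simp

theorem length_cut {a b : ℕ} {ξ : List Γ} (hab : a ≤ b) (hb : b ≤ ξ.length) :
    (cut a b ξ).length = ξ.length - (b - a) := by
  simp [cut]; omega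

theorem length_block {a b : ℕ} {ξ : List Γ} (hb : b ≤ ξ.length) :
    (block a b ξ).length = b - a := by
  simp [block]; omega

variable {a b c d : ℕ} {ξ : List Γ}

/-- If c ≤ a ≤ d, the block [c, d) of the shortened string surrounds the place of the removed block
[a, b); in ξ it is the block [c, d + (b - a)), which contains [a, b). This and the next two lemmas
are the part of the sequential axiom that concerns strings. -/
theorem cut_cut_nested (hab : a ≤ b) (hb : b ≤ ξ.length) (hca : c ≤ a) (had : a ≤ d) :
    cut c d (cut a b ξ) = cut c (d + (b - a)) ξ := by
  have := length_cut hab hb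
  apply List.ext_getElem?
  intro k
  rw [getElem?_cut _ _ _ (by omega), getElem?_cut _ _ _ (by omega), getElem?_cut _ _ _ (by omega),
    getElem?_cut _ _ _ (by omega)]
  split_ifs <;> first | rfl | omega | (congr 1; omega)

theorem block_cut_nested (hab : a ≤ b) (hb : b ≤ ξ.length) (hca : c ≤ a) (had : a ≤ d)
    (hd : d ≤ ξ.length - (b - a)) :
    block c d (cut a b ξ) = cut (a - c) (b - c) (block c (d + (b - a)) ξ) := by
  have := length_cut hab hb
  have : (block c (d + (b - a)) ξ).length = _ := length_block (by omega)
  apply List.ext_getElem?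
  intro k
  rw [getElem?_cut _ _ _ (by omega), getElem?_block, getElem?_block, getElem?_block,
    getElem?_cut _ _ _ (by omega)]
  split_ifs <;> first | rfl | omega | (congr 1; omega)

theorem block_block_nested (hca : c ≤ a) (hab : a ≤ b) (had : a ≤ d) :
    block (a - c) (b - c) (block c (d + (b - a)) ξ) = block a b ξ := by
  apply List.ext_getElem?
  intro k
  rw [getElem?_block, getElem?_block, getElem?_block]
  split_ifs <;> first | rfl | omega | (congr 1; omega)

/-- Removing the left block first shifts the right one by d - c. This and the next two lemmas are
the part of the parallel axiom that concerns strings. -/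
theorem cut_cut_disjoint (hab : a ≤ b) (hb : b ≤ ξ.length) (hcd : c ≤ d) (hda : d ≤ a) :
    cut (a - (d - c)) (b - (d - c)) (cut c d ξ) = cut c d (cut a b ξ) := by
  have := length_cut hab hb
  have := length_cut (ξ := ξ) hcd (by omega)
  apply List.ext_getElem?
  intro k
  rw [getElem?_cut _ _ _ (by omega), getElem?_cut _ _ _ (by omega), getElem?_cut _ _ _ (by omega),
    getElem?_cut _ _ _ (by omega), getElem?_cut _ _ _ (by omega), getElem?_cut _ _ _ (by omega)]
  split_ifs <;> first | rfl | omega | (congr 1; omega)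

theorem block_cut_disjoint (hab : a ≤ b) (hb : b ≤ ξ.length) (hda : d ≤ a) :
    block c d (cut a b ξ) = block c d ξ := by
  apply List.ext_getElem?
  intro k
  rw [getElem?_block, getElem?_block, getElem?_cut _ _ _ (by omega)]
  split_ifs <;> first | rfl | omega

theorem block_cut_disjoint' (hab : a ≤ b) (hb : b ≤ ξ.length) (hcd : c ≤ d) (hda : d ≤ a) :
    block (a - (d - c)) (b - (d - c)) (cut c d ξ) = block a b ξ := by
  apply List.ext_getElem?
  intro k
  rw [getElem?_block, getElem?_block, getElem?_cut _ _ _ (by omega)]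
  split_ifs <;> first | rfl | omega | (congr 1; omega)

end lists

/-- The pairs `a ≤ b ≤ N`. -/
def pairs (N : ℕ) : Finset (ℕ × ℕ) :=
  (Finset.range (N + 1) ×ˢ Finset.range (N + 1)).filter fun p => p.1 ≤ p.2

theorem mem_pairs {N : ℕ} {p : ℕ × ℕ} : p ∈ pairs N ↔ p.1 ≤ p.2 ∧ p.2 ≤ N := by
  simp only [pairs, Finset.mem_filter, Finset.mem_product, Finset.mem_range]
  omega

/-! ### The boundary of a generator as a sum over blocks -/

section boundary

variable {𝕜 : Type u} [CommRing 𝕜] {Γ : Type} (O : DGOperadData 𝕜)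

/-- The composition `x ∘_i y`, as a function without side conditions. -/
def tcirc {m n : ℕ} {a b : ℤ} (r : ℕ) (c : ℤ) (i : ℕ) (x : O.obj m a) (y : O.obj n b) :
    O.obj r c :=
  if h : (1 ≤ i ∧ i ≤ m) ∧ r + 1 = m + n ∧ c = a + b then O.circ i h.1 h.2.1 h.2.2 x y else 0

variable {O} in
theorem tcirc_of {m n r : ℕ} {a b c : ℤ} {i : ℕ} (hi : 1 ≤ i ∧ i ≤ m) (hr : r + 1 = m + n)
    (hc : c = a + b) (x : O.obj m a) (y : O.obj n b) :
    tcirc O r c i x y = O.circ i hi hr hc x y := dif_pos ⟨hi, hr, hc⟩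

/-- The sign `(-1)^{i-1+q(p-i)}` for `i = a + 1`, `q = b - a + 1`, `p - i = N - b`. -/
def bsign (N a b : ℤ) : ℤˣ := Int.negOnePow (a + (b - a + 1) * (N - b))

/-- A family of elements `M ξ` of arity `|ξ| + 1` and degree `|ξ| - 1`. -/
abbrev Family (Γ : Type) := ∀ (_ : List Γ) (n : ℕ) (d : ℤ), O.obj n d

variable {O} (M : Family O Γ)

/-- The value of the family at a string, in its own arity and degree. -/
abbrev at' (ξ : List Γ) : O.obj (ξ.length + 1) (ξ.length - 1) := M ξ _ _

/-- The summand of the boundary of `m_ξ` belonging to a block. -/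
def term (n : ℕ) (e : ℤ) (ξ : List Γ) (a b : ℕ) : O.obj n e :=
  tcirc O n e (a + 1) (at' M (cut a b ξ)) (at' M (block a b ξ))

/-- The boundary of `m_ξ`, evaluated on the family `M`. -/
def boundary (n : ℕ) (e : ℤ) (ξ : List Γ) : O.obj n e :=
  ∑ p ∈ pairs ξ.length, bsign ξ.length p.1 p.2 • term M n e ξ p.1 p.2

end boundary

open Classical in
/-- The generators of `strOperad 𝕜 Γ` as a family. -/
noncomputable def gens (𝕜 : Type u) [CommRing 𝕜] (Γ : Type) : Family (strOperad 𝕜 Γ) Γ :=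
  fun ξ n d => if h : IsStr ξ n d then mGen 𝕜 ξ h else (0 : FreeOp 𝕜 (StrGen Γ) n d)

section gens

variable {𝕜 : Type u} [CommRing 𝕜] {Γ : Type}

theorem gens_of {ξ : List Γ} {n : ℕ} {d : ℤ} (h : IsStr ξ n d) :
    gens 𝕜 Γ ξ n d = mGen 𝕜 ξ h := dif_pos h

theorem gens_nil {n : ℕ} {d : ℤ} : gens 𝕜 Γ [] n d = 0 :=
  dif_neg fun h => by have := h.1; have := h.2.1; simp at this; omega

theorem tcirc_zero_left {O : DGOperadData 𝕜} {m n r : ℕ} {a b c : ℤ} {i : ℕ} (y : O.obj n b) :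
    tcirc O r c i (0 : O.obj m a) y = 0 := by
  unfold tcirc; split_ifs <;> simp

theorem tcirc_zero_right {O : DGOperadData 𝕜} {m n r : ℕ} {a b c : ℤ} {i : ℕ} (x : O.obj m a) :
    tcirc O r c i x (0 : O.obj n b) = 0 := by
  unfold tcirc; split_ifs <;> simp

theorem circ_mGen_congr {m m' n n' r i : ℕ} {a a' b b' c : ℤ} {ξ ξ' η η' : List Γ}
    (hi : 1 ≤ i ∧ i ≤ m) (hr : r + 1 = m + n) (hc : c = a + b)
    (hi' : 1 ≤ i ∧ i ≤ m') (hr' : r + 1 = m' + n') (hc' : c = a' + b')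
    (h₁ : IsStr ξ m a) (h₂ : IsStr η n b) (h₁' : IsStr ξ' m' a') (h₂' : IsStr η' n' b')
    (hξ : ξ = ξ') (hη : η = η') :
    FreeOp.circ i hi hr hc (mGen 𝕜 ξ h₁) (mGen 𝕜 η h₂) =
      FreeOp.circ i hi' hr' hc' (mGen 𝕜 ξ' h₁') (mGen 𝕜 η' h₂') := by
  subst hξ hη
  obtain ⟨_, rfl, rfl⟩ := id h₁
  obtain ⟨_, rfl, rfl⟩ := id h₂
  obtain ⟨_, rfl, rfl⟩ := id h₁'
  obtain ⟨_, rfl, rfl⟩ := id h₂'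
  rfl

theorem units_smul_congr {n : ℕ} {d : ℤ} {G : ℕ → ℤ → Type} {s : ℤˣ} {t : ℤ}
    {x y : FreeOp 𝕜 G n d} (h : (s : ℤ) = t) (hxy : x = y) : s • x = t • y := by
  rw [Units.smul_def, h, hxy]

/-- The block [a, b) corresponds to i = a + 1, q = b - a + 1 and p = |ξ| - (b - a) + 1. Empty blocks
and the whole string, which would give q = 1 or p = 1, are admitted in `boundary` but contribute
nothing, since the family vanishes at the empty string. This frees the later bijections from side
conditions. -/
theorem mBoundary_eq {ξ : List Γ} {n : ℕ} {d e : ℤ} (he : e + 1 = d) (h : IsStr ξ n d) :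
    mBoundary 𝕜 he ⟨ξ, h⟩ = boundary (gens 𝕜 Γ) n e ξ := by
  obtain ⟨hn, hξ, hd⟩ := id h
  unfold mBoundary boundary
  rw [← Finset.sum_product', ← Finset.sum_product',
    ← Finset.sum_filter_of_ne (s := pairs ξ.length)
      (p := fun p => p.1 < p.2 ∧ p.2 - p.1 < ξ.length)]
  · symm
    refine Finset.sum_of_injOn
      (fun p => ((p.1 + 1, ξ.length - (p.2 - p.1) + 1), p.2 - p.1 + 1)) ?_ ?_ ?_ ?_
    · rintro ⟨a, b⟩ hab ⟨a', b'⟩ hab' heq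
      simp only [Finset.coe_filter, Set.mem_ofPred_eq, mem_pairs, Prod.mk.injEq] at *
      omega
    · rintro ⟨a, b⟩ hab
      simp only [Finset.coe_filter, Set.mem_ofPred_eq, mem_pairs, Finset.coe_product,
        Set.mem_prod, Finset.coe_Icc, Set.mem_Icc] at *
      omega
    · rintro ⟨⟨i, p⟩, q⟩ _ h'
      refine dif_neg fun hpq => h' ⟨(i - 1, i - 1 + (q - 1)), ?_, ?_⟩
      · simp only [Finset.coe_filter, Set.mem_ofPred_eq, mem_pairs] at *
        omega
      · simp only [Prod.mk.injEq] at *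
        omega
    · rintro ⟨a, b⟩ hab
      simp only [Finset.mem_filter, mem_pairs] at hab
      have hc : 1 ≤ a + 1 ∧ a + 1 ≤ ξ.length - (b - a) + 1 ∧ 2 ≤ ξ.length - (b - a) + 1 ∧
        2 ≤ b - a + 1 ∧ ξ.length - (b - a) + 1 + (b - a + 1) = n + 1 := by omega
      have h1 := length_cut (ξ := ξ) hab.1.1 hab.1.2
      have h2 := length_block (a := a) (ξ := ξ) hab.1.2
      have i1 : IsStr (cut a b ξ) ((cut a b ξ).length + 1) ((cut a b ξ).length - 1) :=
        ⟨by omega, rfl, by push_cast; ring⟩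
      have i2 : IsStr (block a b ξ) ((block a b ξ).length + 1) ((block a b ξ).length - 1) :=
        ⟨by omega, rfl, by push_cast; ring⟩
      have key : term (gens 𝕜 Γ) n e ξ a b = FreeOp.circ (a + 1) ⟨by omega, by omega⟩ (by omega)
          (by omega) (mGen 𝕜 (cut a b ξ) i1) (mGen 𝕜 (block a b ξ) i2) :=
        (tcirc_of ⟨by omega, by omega⟩ (by omega) (by omega) _ _).trans
          (congrArg₂ (fun x y => (strOperad 𝕜 Γ).circ (a + 1) _ _ _ x y) (gens_of i1) (gens_of i2))
      rw [dif_pos hc]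
      refine (congrArg (bsign ξ.length a b • ·) key).trans ?_
      have hs : ((bsign ξ.length a b : ℤˣ) : ℤ) =
          (-1) ^ (a + 1 - 1) * (-1) ^ ((b - a + 1) * (ξ.length - (b - a) + 1 - (a + 1))) := by
        rw [← pow_add, ← Int.coe_negOnePow_natCast, bsign]
        congr 2
        have e1 : ξ.length - (b - a) + 1 - (a + 1) = ξ.length - b := by omega
        rw [e1]
        push_cast [Nat.cast_sub hab.1.1, Nat.cast_sub hab.1.2]
        rfl
      have ho : strOuter (a + 1) (b - a + 1) ξ = cut a b ξ := by
        simp only [strOuter, cut, Nat.add_sub_cancel]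
        rw [show a + (b - a) = b by omega]
      exact units_smul_congr hs (circ_mGen_congr _ _ _ _ _ _ _ _ _ _ ho.symm rfl)
  · rintro ⟨a, b⟩ hab hne
    rw [mem_pairs] at hab
    by_contra hcon
    apply hne
    have h1 := length_cut (ξ := ξ) hab.1 hab.2
    have h2 := length_block (a := a) (ξ := ξ) hab.2
    by_cases hlt : a < b
    · rw [term, at', at', List.eq_nil_of_length_eq_zero (l := cut a b ξ) (by grind), gens_nil,
        tcirc_zero_left, smul_zero]
    · rw [term, at', at', List.eq_nil_of_length_eq_zero (l := block a b ξ) (by grind), gens_nil,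
        tcirc_zero_right, smul_zero]

end gens

end StrOp

/-! ### The boundary squares to zero -/

namespace StrOp

/-- The factor with exponent N - (d + (b - a) - c) - 1 is the Leibniz sign for passing the outer
generator. The minus sign makes the nested terms cancel. Everything depends only on the parities of
the five integers. -/
theorem bsign_nested (N a b c d : ℤ) :
    bsign N a b * bsign (N - (b - a)) c d =
      -(bsign N c (d + (b - a)) * (Int.negOnePow (N - (d + (b - a) - c) - 1) *
        bsign (d + (b - a) - c) (a - c) (b - c))) := by
  unfold bsign
  rw [← neg_one_mul, show (-1 : ℤˣ) = Int.negOnePow 1 by simp]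
  simp only [← Int.negOnePow_add]
  rw [Int.negOnePow_eq_iff]
  simp only [Int.even_sub, Int.even_add, Int.even_mul, Int.not_even_one]
  by_cases Even N <;> by_cases Even a <;> by_cases Even b <;> by_cases Even c <;>
    by_cases Even d <;> simp only [*] <;> decide

/-- The factor with exponent (d - c - 1)(b - a - 1) is the sign of the parallel axiom for the two
inserted generators, which have these degrees. -/
theorem bsign_disjoint (N a b c d : ℤ) :
    bsign N a b * bsign (N - (b - a)) c d * Int.negOnePow ((d - c - 1) * (b - a - 1)) =
      -(bsign N c d * bsign (N - (d - c)) (a - (d - c)) (b - (d - c))) := by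
  unfold bsign
  rw [← neg_one_mul, show (-1 : ℤˣ) = Int.negOnePow 1 by simp]
  simp only [← Int.negOnePow_add]
  rw [Int.negOnePow_eq_iff]
  simp only [Int.even_sub, Int.even_add, Int.even_mul, Int.not_even_one]
  by_cases Even N <;> by_cases Even a <;> by_cases Even b <;> by_cases Even c <;>
    by_cases Even d <;> simp only [*] <;> decide

section

variable {𝕜 : Type u} [CommRing 𝕜] {Γ : Type} {O : DGOperadData 𝕜}

theorem tcirc_add_left {m n r : ℕ} {a b c : ℤ} {i : ℕ} (x x' : O.obj m a) (y : O.obj n b) :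
    tcirc O r c i (x + x') y = tcirc O r c i x y + tcirc O r c i x' y := by
  unfold tcirc; split_ifs <;> simp

theorem tcirc_add_right {m n r : ℕ} {a b c : ℤ} {i : ℕ} (x : O.obj m a) (y y' : O.obj n b) :
    tcirc O r c i x (y + y') = tcirc O r c i x y + tcirc O r c i x y' := by
  unfold tcirc; split_ifs <;> simp

theorem tcirc_neg_left {m n r : ℕ} {a b c : ℤ} {i : ℕ} (x : O.obj m a) (y : O.obj n b) :
    tcirc O r c i (-x) y = -tcirc O r c i x y := by
  unfold tcirc; split_ifs <;> simp

theorem tcirc_neg_right {m n r : ℕ} {a b c : ℤ} {i : ℕ} (x : O.obj m a) (y : O.obj n b) :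
    tcirc O r c i x (-y) = -tcirc O r c i x y := by
  unfold tcirc; split_ifs <;> simp

theorem tcirc_units_smul_left {m n r : ℕ} {a b c : ℤ} {i : ℕ} (s : ℤˣ) (x : O.obj m a)
    (y : O.obj n b) : tcirc O r c i (s • x) y = s • tcirc O r c i x y := by
  rcases Int.units_eq_one_or s with rfl | rfl <;> simp [Units.smul_def, tcirc_neg_left]

theorem tcirc_units_smul_right {m n r : ℕ} {a b c : ℤ} {i : ℕ} (s : ℤˣ) (x : O.obj m a)
    (y : O.obj n b) : tcirc O r c i x (s • y) = s • tcirc O r c i x y := by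
  rcases Int.units_eq_one_or s with rfl | rfl <;> simp [Units.smul_def, tcirc_neg_right]

theorem tcirc_sum_left {m n r : ℕ} {a b c : ℤ} {i : ℕ} {ι : Type*} (s : Finset ι)
    (f : ι → O.obj m a) (y : O.obj n b) :
    tcirc O r c i (∑ j ∈ s, f j) y = ∑ j ∈ s, tcirc O r c i (f j) y :=
  map_sum (⟨⟨fun x => tcirc O r c i x y, tcirc_zero_left y⟩, fun x x' => tcirc_add_left x x' y⟩ :
    O.obj m a →+ O.obj r c) f s

theorem tcirc_sum_right {m n r : ℕ} {a b c : ℤ} {i : ℕ} {ι : Type*} (s : Finset ι)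
    (x : O.obj m a) (f : ι → O.obj n b) :
    tcirc O r c i x (∑ j ∈ s, f j) = ∑ j ∈ s, tcirc O r c i x (f j) :=
  map_sum (⟨⟨fun y => tcirc O r c i x y, tcirc_zero_right x⟩, fun y y' => tcirc_add_right x y y'⟩ :
    O.obj n b →+ O.obj r c) f s

theorem boundary_nil {M : Family O Γ} (hM : ∀ n d, M [] n d = 0) (n : ℕ) (e : ℤ) :
    boundary M n e [] = 0 := by
  refine Finset.sum_eq_zero fun p _ => ?_
  rw [term, at', show cut p.1 p.2 ([] : List Γ) = [] by simp [cut], hM, tcirc_zero_left, smul_zero]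

end

section free

variable {𝕜 : Type u} [CommRing 𝕜] {Γ : Type}

theorem tcirc_parallel {m n l r r' s : ℕ} {a b c ab ac abc : ℤ} {i j k : ℕ}
    (hji : j < i) (hkl : k + 1 = i + l) (hj : 1 ≤ j) (hi : i ≤ m)
    (hr : r + 1 = m + n) (hs : s + 1 = r + l) (hr' : r' + 1 = m + l)
    (hab : ab = a + b) (habc : abc = ab + c) (hac : ac = a + c) (x : (strOperad 𝕜 Γ).obj m a)
    (y : (strOperad 𝕜 Γ).obj n b) (z : (strOperad 𝕜 Γ).obj l c) :
    tcirc (strOperad 𝕜 Γ) s abc j (tcirc (strOperad 𝕜 Γ) r ab i x y) z =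
      Int.negOnePow (b * c) •
        tcirc (strOperad 𝕜 Γ) s abc k (tcirc (strOperad 𝕜 Γ) r' ac j x z) y := by
  rw [tcirc_of ⟨by omega, hi⟩ hr hab, tcirc_of ⟨by omega, by omega⟩ hs habc,
    tcirc_of ⟨by omega, by omega⟩ hr' hac, tcirc_of ⟨by omega, by omega⟩ (by omega) (by omega)]
  exact FreeOp.circ_parallel hji hkl _ _ _ _ _ _ _ _ _ _ _ _ x y z

theorem tcirc_sequential {m n l r r' s : ℕ} {a b c ab bc abc : ℤ} {i j k : ℕ}
    (hij : i ≤ j) (hjn : j < i + n) (hki : k + i = j + 1)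
    (hi : 1 ≤ i ∧ i ≤ m) (hr : r + 1 = m + n) (hs : s + 1 = r + l) (hr' : r' + 1 = n + l)
    (hab : ab = a + b) (habc : abc = ab + c) (hbc : bc = b + c) (x : (strOperad 𝕜 Γ).obj m a)
    (y : (strOperad 𝕜 Γ).obj n b) (z : (strOperad 𝕜 Γ).obj l c) :
    tcirc (strOperad 𝕜 Γ) s abc j (tcirc (strOperad 𝕜 Γ) r ab i x y) z =
      tcirc (strOperad 𝕜 Γ) s abc i x (tcirc (strOperad 𝕜 Γ) r' bc k y z) := by
  rw [tcirc_of hi hr hab, tcirc_of ⟨by omega, by omega⟩ hs habc,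
    tcirc_of ⟨by omega, by omega⟩ hr' hbc, tcirc_of ⟨by omega, by omega⟩ (by omega) (by omega)]
  exact FreeOp.circ_sequential hij hjn hki _ _ _ _ _ _ _ _ _ _ _ x y z

theorem diff_tcirc {m n r : ℕ} {a b c a' b' c' : ℤ} {i : ℕ} (hi : 1 ≤ i ∧ i ≤ m)
    (hr : r + 1 = m + n) (hc : c = a + b) (ha' : a' + 1 = a) (hb' : b' + 1 = b)
    (hc' : c' + 1 = c) (x : (strOperad 𝕜 Γ).obj m a) (y : (strOperad 𝕜 Γ).obj n b) :
    (strOperad 𝕜 Γ).diff hc' (tcirc (strOperad 𝕜 Γ) r c i x y) =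
      tcirc (strOperad 𝕜 Γ) r c' i ((strOperad 𝕜 Γ).diff ha' x) y +
        Int.negOnePow a • tcirc (strOperad 𝕜 Γ) r c' i x ((strOperad 𝕜 Γ).diff hb' y) := by
  rw [tcirc_of hi hr hc, tcirc_of hi hr (by omega), tcirc_of hi hr (by omega)]
  exact FreeOp.derivation_circ (mBoundary 𝕜) hi hr hc ha' hb' hc' _ _ x y

theorem diff_at' (ξ : List Γ) {e : ℤ} (he : e + 1 = ξ.length - 1) :
    (strOperad 𝕜 Γ).diff (n := ξ.length + 1) he (at' (gens 𝕜 Γ) ξ) =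
      boundary (gens 𝕜 Γ) (ξ.length + 1) e ξ := by
  rcases eq_or_ne ξ [] with rfl | hξ
  · rw [boundary_nil fun _ _ => gens_nil, at', gens_nil, map_zero]
  · have := List.length_pos_iff.2 hξ
    have h : IsStr ξ (ξ.length + 1) (ξ.length - 1) := ⟨by omega, rfl, by push_cast; ring⟩
    rw [at', gens_of h]
    exact mBoundary_eq he h

/-- The composition `(m ∘ m) ∘ m` for a block of what remains after removing a block. -/
noncomputable def outerTerm (𝕜 : Type u) [CommRing 𝕜] (n : ℕ) (f : ℤ) (ξ : List Γ)
    (a b c d : ℕ) : (strOperad 𝕜 Γ).obj n f :=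
  tcirc (strOperad 𝕜 Γ) n f (a + 1)
    (term (gens 𝕜 Γ) ((cut a b ξ).length + 1) ((cut a b ξ).length - 2) (cut a b ξ) c d)
    (at' (gens 𝕜 Γ) (block a b ξ))

/-- The composition `m ∘ (m ∘ m)` for a block in a block. -/
noncomputable def innerTerm (𝕜 : Type u) [CommRing 𝕜] (n : ℕ) (f : ℤ) (ξ : List Γ)
    (a b c d : ℕ) : (strOperad 𝕜 Γ).obj n f :=
  tcirc (strOperad 𝕜 Γ) n f (a + 1) (at' (gens 𝕜 Γ) (cut a b ξ))
    (term (gens 𝕜 Γ) ((block a b ξ).length + 1) ((block a b ξ).length - 2) (block a b ξ) c d)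

/-- The second block surrounds the place of the first, so the composition is at an input of the
factor just inserted and the sequential axiom applies. -/
theorem outerTerm_nested {n : ℕ} {f : ℤ} {ξ : List Γ} (hn : n = ξ.length + 1)
    (hf : f = ξ.length - 3) {a b c d : ℕ} (hab : a ≤ b) (hb : b ≤ ξ.length) (hca : c ≤ a)
    (had : a ≤ d) (hd : d ≤ ξ.length - (b - a)) :
    outerTerm 𝕜 n f ξ a b c d = innerTerm 𝕜 n f ξ c (d + (b - a)) (a - c) (b - c) := by
  have l1 := length_cut hab hb
  have l2 := length_block (a := a) hb
  have l3 : (cut c (d + (b - a)) ξ).length = _ := length_cut (by omega) (by omega)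
  have l4 : (block c (d + (b - a)) ξ).length = _ := length_block (by omega)
  have l5 : (cut (a - c) (b - c) (block c (d + (b - a)) ξ)).length = _ :=
    length_cut (by omega) (by omega)
  unfold outerTerm innerTerm term
  rw [cut_cut_nested hab hb hca had, block_cut_nested hab hb hca had hd,
    block_block_nested hca hab had]
  apply tcirc_sequential <;> omega

/-- Both blocks are inserted at different inputs of the same outer factor, so the parallel axiom
exchanges them. -/
theorem outerTerm_disjoint {n : ℕ} {f : ℤ} {ξ : List Γ} (hn : n = ξ.length + 1)
    (hf : f = ξ.length - 3) {a b c d : ℕ} (hab : a ≤ b) (hb : b ≤ ξ.length) (hcd : c ≤ d)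
    (hda : d < a) :
    outerTerm 𝕜 n f ξ a b c d = Int.negOnePow ((d - c - 1) * (b - a - 1)) •
      outerTerm 𝕜 n f ξ c d (a - (d - c)) (b - (d - c)) := by
  have l1 := length_cut hab hb
  have l2 := length_block (a := a) hb
  have l3 : (cut c d ξ).length = _ := length_cut hcd (by omega)
  have l4 : (block c d ξ).length = _ := length_block (by omega)
  have l5 : (cut c d (cut a b ξ)).length = _ := length_cut hcd (by omega)
  unfold outerTerm term
  rw [cut_cut_disjoint hab hb hcd hda.le, block_cut_disjoint hab hb hda.le,
    block_cut_disjoint' hab hb hcd hda.le]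
  have e : Int.negOnePow (((d : ℤ) - c - 1) * (b - a - 1)) =
      Int.negOnePow ((((block a b ξ).length : ℤ) - 1) * ((block c d ξ).length - 1)) := by
    rw [l2, l4]; push_cast [Nat.cast_sub hab, Nat.cast_sub hcd]; congr 1; ring
  have key := tcirc_parallel (𝕜 := 𝕜) (Γ := Γ) (i := a - (d - c) + 1) (j := c + 1) (k := a + 1)
    (r := (cut c d ξ).length + 1) (s := n) (r' := (cut a b ξ).length + 1)
    (ab := (cut c d ξ).length - 2) (abc := f) (ac := (cut a b ξ).length - 2)
    (by omega) (by omega) (by omega) (by omega) (by omega) (by omega) (by omega) (by omega)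
    (by omega) (by omega) (at' (gens 𝕜 Γ) (cut c d (cut a b ξ))) (at' (gens 𝕜 Γ) (block a b ξ))
    (at' (gens 𝕜 Γ) (block c d ξ))
  rw [key, e, smul_smul, Int.units_mul_self, one_smul]

/-- The Leibniz rule produces a sum over a block together with a second block, either of the
shortened string (`outerTerm`) or of the first block itself (`innerTerm`). All terms cancel in
pairs. -/
theorem diff_boundary {ξ : List Γ} {n : ℕ} {e f : ℤ} (hn : n = ξ.length + 1)
    (he : e = ξ.length - 2) (hf : f + 1 = e) :
    (strOperad 𝕜 Γ).diff hf (boundary (gens 𝕜 Γ) n e ξ) = 0 := by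
  have h1 : (strOperad 𝕜 Γ).diff hf (boundary (gens 𝕜 Γ) n e ξ) =
      ∑ p ∈ pairs ξ.length, ∑ q ∈ pairs (ξ.length - (p.2 - p.1)),
        (bsign ξ.length p.1 p.2 * bsign (ξ.length - (p.2 - p.1)) q.1 q.2) •
          outerTerm 𝕜 n f ξ p.1 p.2 q.1 q.2 +
      ∑ p ∈ pairs ξ.length, ∑ q ∈ pairs (p.2 - p.1),
        (bsign ξ.length p.1 p.2 * (Int.negOnePow (ξ.length - (p.2 - p.1) - 1) *
          bsign (p.2 - p.1) q.1 q.2)) • innerTerm 𝕜 n f ξ p.1 p.2 q.1 q.2 := by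
    rw [boundary, map_sum, ← Finset.sum_add_distrib]
    refine Finset.sum_congr rfl ?_
    rintro ⟨a, b⟩ hab
    rw [mem_pairs] at hab
    have l1 := length_cut hab.1 hab.2
    have l2 := length_block (a := a) hab.2
    dsimp only at hab l1 l2 ⊢
    have e1 : ((cut a b ξ).length : ℤ) = ξ.length - (b - a) := by omega
    have e2 : ((block a b ξ).length : ℤ) = b - a := by omega
    rw [Units.smul_def, map_zsmul, term, diff_tcirc (a' := (cut a b ξ).length - 2)
      (b' := (block a b ξ).length - 2) ⟨by omega, by omega⟩ (by omega) (by omega) (by omega)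
      (by omega), diff_at', diff_at', ← Units.smul_def, smul_add, boundary, boundary,
      tcirc_sum_left, tcirc_sum_right, Finset.smul_sum, Finset.smul_sum, Finset.smul_sum]
    refine congrArg₂ _ (Finset.sum_congr (congrArg pairs l1) fun q _ => ?_)
      (Finset.sum_congr (congrArg pairs l2) fun q _ => ?_)
    · rw [tcirc_units_smul_left, smul_smul, outerTerm, e1]
    · rw [tcirc_units_smul_right, smul_smul, smul_smul, innerTerm, e2,
        show Int.negOnePow ((cut a b ξ).length - 1) = Int.negOnePow (ξ.length - (b - a) - 1) by
          rw [e1], mul_assoc]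
  -- The outer terms are split according to whether [c, d) surrounds the position a of the removed
  -- block. The surrounding ones cancel against all the inner terms.
  rw [h1, Finset.sum_sigma', Finset.sum_sigma', ← Finset.sum_filter_add_sum_filter_not _
    (fun x => x.2.1 ≤ x.1.1 ∧ x.1.1 ≤ x.2.2), add_right_comm]
  refine (congrArg₂ (· + ·) (x' := 0) (y' := 0) ?_ ?_).trans (add_zero 0)
  · rw [← eq_neg_iff_add_eq_zero, ← Finset.sum_neg_distrib]
    refine Finset.sum_nbij' (fun x => ⟨(x.2.1, x.2.2 + (x.1.2 - x.1.1)), (x.1.1 - x.2.1,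
      x.1.2 - x.2.1)⟩) (fun x => ⟨(x.1.1 + x.2.1, x.1.1 + x.2.2), (x.1.1, x.1.2 -
      (x.2.2 - x.2.1))⟩) ?_ ?_ ?_ ?_ ?_
    · rintro ⟨⟨a, b⟩, ⟨c, d⟩⟩ h
      simp only [Finset.mem_filter, Finset.mem_sigma, mem_pairs] at h ⊢
      omega
    · rintro ⟨⟨a, b⟩, ⟨c, d⟩⟩ h
      simp only [Finset.mem_filter, Finset.mem_sigma, mem_pairs] at h ⊢
      omega
    · rintro ⟨⟨a, b⟩, ⟨c, d⟩⟩ h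
      simp only [Finset.mem_filter, Finset.mem_sigma, mem_pairs] at h
      refine Sigma.ext (Prod.ext ?_ ?_) (heq_of_eq (Prod.ext ?_ ?_)) <;> dsimp only <;> omega
    · rintro ⟨⟨a, b⟩, ⟨c, d⟩⟩ h
      simp only [Finset.mem_sigma, mem_pairs] at h
      refine Sigma.ext (Prod.ext ?_ ?_) (heq_of_eq (Prod.ext ?_ ?_)) <;> dsimp only <;> omega
    · rintro ⟨⟨a, b⟩, ⟨c, d⟩⟩ h
      simp only [Finset.mem_filter, Finset.mem_sigma, mem_pairs] at h
      dsimp only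
      rw [outerTerm_nested hn (by omega) h.1.1.1 h.1.1.2 h.2.1 h.2.2 h.1.2.2, bsign_nested,
        Units.neg_smul]
      push_cast [Nat.cast_sub h.1.1.1, Nat.cast_sub h.2.1, Nat.cast_sub (h.2.1.trans h.1.1.1)]
      rfl
  -- The remaining pairs satisfy d < a or a < c, so the second block lies strictly to the left or to
  -- the right of the first. Exchanging the order of removal is a bijection between the two kinds.
  · rw [← Finset.sum_filter_add_sum_filter_not _ (fun x => x.2.2 < x.1.1),
      ← eq_neg_iff_add_eq_zero, ← Finset.sum_neg_distrib]
    refine Finset.sum_nbij' (fun x => ⟨(x.2.1, x.2.2), (x.1.1 - (x.2.2 - x.2.1),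
      x.1.2 - (x.2.2 - x.2.1))⟩) (fun x => ⟨(x.2.1 + (x.1.2 - x.1.1), x.2.2 + (x.1.2 - x.1.1)),
      (x.1.1, x.1.2)⟩) ?_ ?_ ?_ ?_ ?_
    · rintro ⟨⟨a, b⟩, ⟨c, d⟩⟩ h
      simp only [Finset.mem_filter, Finset.mem_sigma, mem_pairs] at h ⊢
      omega
    · rintro ⟨⟨a, b⟩, ⟨c, d⟩⟩ h
      simp only [Finset.mem_filter, Finset.mem_sigma, mem_pairs] at h ⊢
      omega
    · rintro ⟨⟨a, b⟩, ⟨c, d⟩⟩ h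
      simp only [Finset.mem_filter, Finset.mem_sigma, mem_pairs] at h
      refine Sigma.ext (Prod.ext ?_ ?_) (heq_of_eq (Prod.ext ?_ ?_)) <;> dsimp only <;> omega
    · rintro ⟨⟨a, b⟩, ⟨c, d⟩⟩ h
      simp only [Finset.mem_filter, Finset.mem_sigma, mem_pairs] at h
      refine Sigma.ext (Prod.ext ?_ ?_) (heq_of_eq (Prod.ext ?_ ?_)) <;> dsimp only <;> omega
    · rintro ⟨⟨a, b⟩, ⟨c, d⟩⟩ h
      simp only [Finset.mem_filter, Finset.mem_sigma, mem_pairs] at h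
      dsimp only
      rw [outerTerm_disjoint hn (by omega) h.1.1.1.1 h.1.1.1.2 h.1.1.2.1 h.2, smul_smul,
        bsign_disjoint, Units.neg_smul]
      push_cast [Nat.cast_sub h.1.1.2.1, Nat.cast_sub (show d - c ≤ a by omega),
        Nat.cast_sub (show d - c ≤ b by omega)]
      rfl

end free

end StrOp

/-! ### String operads and the morphisms out of them -/

namespace StrOp

variable {𝕜 : Type u} [CommRing 𝕜] {Γ : Type}

theorem isDGOperad_strOperad (𝕜 : Type u) [CommRing 𝕜] (Γ : Type) :
    IsDGOperad (strOperad 𝕜 Γ) := by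
  refine isDGOperad_quasiFree (mBoundary 𝕜) fun {n d e f} he hf x => ?_
  obtain ⟨ξ, h⟩ := x
  rw [mBoundary_eq he h]
  obtain ⟨h1, h2, h3⟩ := h
  exact diff_boundary h2.symm (by omega) hf

theorem eval_tcirc {O : DGOperadData 𝕜} (hO : IsDGOperad O)
    (g : ∀ n d, StrGen Γ n d → O.obj n d) {m n r : ℕ} {a b c : ℤ} {i : ℕ}
    (x : FreeOp 𝕜 (StrGen Γ) m a) (y : FreeOp 𝕜 (StrGen Γ) n b) :
    FreeOp.eval hO g (tcirc (strOperad 𝕜 Γ) r c i x y) =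
      tcirc O r c i (FreeOp.eval hO g x) (FreeOp.eval hO g y) := by
  unfold tcirc
  split_ifs with h
  · exact FreeOp.eval_circ hO g i h.1 h.2.1 h.2.2 x y
  · exact map_zero _

theorem eval_boundary {O : DGOperadData 𝕜} (hO : IsDGOperad O)
    (g : ∀ n d, StrGen Γ n d → O.obj n d) (M : Family O Γ) (hM0 : ∀ n d, M [] n d = 0)
    (hM : ∀ n d ξ (h : IsStr ξ n d), g n d ⟨ξ, h⟩ = M ξ n d) (n : ℕ) (e : ℤ) (ξ : List Γ) :
    FreeOp.eval hO g (boundary (gens 𝕜 Γ) n e ξ) = boundary M n e ξ := by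
  have h : ∀ η : List Γ, FreeOp.eval hO g (at' (gens 𝕜 Γ) η) = at' M η := by
    intro η
    rcases eq_or_ne η [] with rfl | hη
    · rw [at', at', gens_nil, hM0]
      exact map_zero _
    · have := List.length_pos_iff.2 hη
      have h : IsStr η (η.length + 1) (η.length - 1) := ⟨by omega, rfl, by push_cast; ring⟩
      rw [at', at', gens_of h, ← hM _ _ _ h]
      rfl
  refine (map_sum (FreeOp.eval hO g) _ _).trans (Finset.sum_congr rfl fun p _ => ?_)
  rw [Units.smul_def, Units.smul_def]
  refine (map_zsmul (FreeOp.eval hO g) _ _).trans (congrArg _ ?_)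
  exact (eval_tcirc hO g _ _).trans (congrArg₂ (tcirc O n e (p.1 + 1)) (h _) (h _))

/-- The morphism out of `strOperad 𝕜 Γ` given by a family whose differential is its boundary. -/
def lift {O : DGOperadData 𝕜} (hO : IsDGOperad O) (M : Family O Γ) (hM0 : ∀ n d, M [] n d = 0)
    (hM : ∀ ξ n d e (he : e + 1 = d), IsStr ξ n d → O.diff he (M ξ n d) = boundary M n e ξ) :
    DGOperadHom (strOperad 𝕜 Γ) O :=
  quasiFreeLift (mBoundary 𝕜) hO (fun n d x => M x.1 n d) fun {n d e} he x => by
    obtain ⟨ξ, h⟩ := x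
    rw [mBoundary_eq he h, eval_boundary hO _ M hM0 (fun _ _ _ _ => rfl), hM ξ n d e he h]

theorem lift_mGen {O : DGOperadData 𝕜} (hO : IsDGOperad O) (M : Family O Γ)
    (hM0 : ∀ n d, M [] n d = 0)
    (hM : ∀ ξ n d e (he : e + 1 = d), IsStr ξ n d → O.diff he (M ξ n d) = boundary M n e ξ)
    {ξ : List Γ} {n : ℕ} {d : ℤ} (h : IsStr ξ n d) :
    (lift hO M hM0 hM).map (mGen 𝕜 ξ h : FreeOp 𝕜 (StrGen Γ) n d) = M ξ n d := rfl

/-! ### The morphism from the homotopy associative operad -/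

section sum

variable [Fintype Γ] [DecidableEq Γ]

/-- The strings of length `N`. -/
def strings (Γ : Type) [Fintype Γ] [DecidableEq Γ] (N : ℕ) : Finset (List Γ) :=
  Finset.univ.image fun ξ : Fin N → Γ => List.ofFn ξ

theorem mem_strings {N : ℕ} {ξ : List Γ} : ξ ∈ strings Γ N ↔ ξ.length = N := by
  simp only [strings, Finset.mem_image, Finset.mem_univ, true_and]
  constructor
  · rintro ⟨f, rfl⟩; simp
  · rintro rfl; exact ⟨ξ.get, List.ofFn_get ξ⟩

/-- For a fixed position and length of the block, a string is the same as the pair of its outer and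
inner parts. This unique decomposition is all that φ needs. -/
theorem sum_strings_cut {A : Type*} [AddCommMonoid A] {N a b : ℕ} (hab : a ≤ b) (hb : b ≤ N)
    (F : List Γ → List Γ → A) :
    ∑ ξ ∈ strings Γ N, F (cut a b ξ) (block a b ξ) =
      ∑ ξ' ∈ strings Γ (N - (b - a)), ∑ ξ'' ∈ strings Γ (b - a), F ξ' ξ'' := by
  rw [← Finset.sum_product']
  refine Finset.sum_nbij' (fun ξ => (cut a b ξ, block a b ξ))
    (fun x => x.1.take a ++ (x.2 ++ x.1.drop a)) ?_ ?_ ?_ ?_ ?_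
  · intro ξ hξ
    rw [mem_strings] at hξ
    simp only [Finset.mem_product, mem_strings]
    exact ⟨by rw [length_cut hab (by omega), hξ], length_block (by omega)⟩
  · rintro ⟨ξ', ξ''⟩ h
    simp only [Finset.mem_product, mem_strings, List.length_append, List.length_take,
      List.length_drop] at h ⊢
    omega
  · intro ξ hξ
    rw [mem_strings] at hξ
    have h : (ξ.take a).length = a := by simp; omega
    simp only [cut, block]
    rw [List.take_append_of_le_length h.ge, List.take_of_length_le h.le,
      List.drop_append_of_le_length h.ge, List.drop_eq_nil_of_le h.le, List.nil_append]
    conv_rhs => rw [← List.take_append_drop a ξ, ← List.take_append_drop (b - a) (ξ.drop a),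
      List.drop_drop, show a + (b - a) = b by omega]
  · rintro ⟨ξ', ξ''⟩ h
    simp only [Finset.mem_product, mem_strings] at h
    have h1 : (ξ'.take a).length = a := by simp; omega
    refine Prod.ext ?_ ?_ <;> simp only [cut, block]
    · rw [List.take_append_of_le_length h1.ge, List.take_of_length_le h1.le, List.drop_append,
        List.drop_eq_nil_of_le (by omega), List.nil_append, h1, List.drop_append_of_le_length
        (by omega), List.drop_eq_nil_of_le (by omega), List.nil_append, List.take_append_drop]
    · rw [List.drop_append_of_le_length h1.ge, List.drop_eq_nil_of_le h1.le, List.nil_append,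
        List.take_append_of_le_length (by omega), List.take_of_length_le (by omega)]
  · intro ξ _
    rfl

/-- The sums of the generators over all strings of a given length. -/
noncomputable def sumGens (𝕜 : Type u) [CommRing 𝕜] (Γ : Type) [Fintype Γ] [DecidableEq Γ] :
    Family (strOperad 𝕜 Γ) Unit :=
  fun ξ n d => ∑ η ∈ strings Γ ξ.length, gens 𝕜 Γ η n d

theorem sumGens_nil (n : ℕ) (d : ℤ) : sumGens 𝕜 Γ [] n d = 0 := by
  refine Finset.sum_eq_zero fun η hη => ?_
  rw [List.eq_nil_of_length_eq_zero (mem_strings.1 hη), gens_nil]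

theorem tcirc_family_congr {O : DGOperadData 𝕜} (M : Family O Γ) {m m' n n' r i : ℕ}
    {a a' b b' c : ℤ} (hm : m = m') (hn : n = n') (ha : a = a') (hb : b = b') (ξ η : List Γ) :
    tcirc O r c i (M ξ m a) (M η n b) = tcirc O r c i (M ξ m' a') (M η n' b') := by
  subst hm hn ha hb
  rfl

/-- The signs depend only on the block and not on the string, so the sums over strings and over
blocks can be exchanged. By bilinearity and `sum_strings_cut` the sum over strings then factors
through the two arguments of the composition. -/
theorem diff_sumGens (ξ : List Unit) (n : ℕ) (d e : ℤ) (he : e + 1 = d) (h : IsStr ξ n d) :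
    (strOperad 𝕜 Γ).diff he (sumGens 𝕜 Γ ξ n d) = boundary (sumGens 𝕜 Γ) n e ξ := by
  obtain ⟨h1, h2, h3⟩ := id h
  have h4 : ∀ η ∈ strings Γ ξ.length, (strOperad 𝕜 Γ).diff he (gens 𝕜 Γ η n d) =
      ∑ p ∈ pairs ξ.length, bsign ξ.length p.1 p.2 • term (gens 𝕜 Γ) n e η p.1 p.2 := by
    intro η hη
    rw [mem_strings] at hη
    have hs : IsStr η n d := ⟨h1, by omega, h3⟩
    rw [gens_of hs, ← hη]
    exact mBoundary_eq he hs
  rw [sumGens, map_sum, Finset.sum_congr rfl h4, Finset.sum_comm, boundary]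
  refine Finset.sum_congr rfl ?_
  rintro ⟨a, b⟩ hab
  rw [mem_pairs] at hab
  dsimp only at hab ⊢
  rw [← Finset.smul_sum]
  congr 1
  rw [term, at', at', sumGens, sumGens, tcirc_sum_left]
  simp only [tcirc_sum_right]
  rw [length_cut hab.1 hab.2, length_block hab.2, ← sum_strings_cut hab.1 hab.2 (fun η' η'' =>
    tcirc (strOperad 𝕜 Γ) n e (a + 1)
      (gens 𝕜 Γ η' (ξ.length - (b - a) + 1) ((ξ.length - (b - a) : ℕ) - 1))
      (gens 𝕜 Γ η'' (b - a + 1) ((b - a : ℕ) - 1)))]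
  refine Finset.sum_congr rfl fun η hη => ?_
  rw [mem_strings] at hη
  have l1 : (cut a b η).length = _ := length_cut hab.1 (by omega)
  have l2 : (block a b η).length = b - a := length_block (by omega)
  rw [term]
  exact tcirc_family_congr _ (by omega) (by omega) (by omega) (by omega) _ _

end sum

end StrOp

open StrOp in
/-- The morphism `φ` from the homotopy associative operad to the operad of homotopy matching
dialgebras. -/
noncomputable def diagonalHom (𝕜 : Type u) [CommRing 𝕜] :
    DGOperadHom (assocInfty 𝕜) (matchingInfty 𝕜) :=
  lift (isDGOperad_strOperad 𝕜 Symb) (sumGens 𝕜 Symb) sumGens_nil diff_sumGens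

open StrOp in
theorem diagonalHom_mN (𝕜 : Type u) [CommRing 𝕜] {n : ℕ} (hn : 2 ≤ n) :
    (diagonalHom 𝕜).map (mN 𝕜 hn) =
      ∑ ξ : Fin (n - 1) → Symb, mXi 𝕜 (List.ofFn ξ) (isStr_ofFn hn ξ) := by
  refine (lift_mGen (isDGOperad_strOperad 𝕜 Symb) (sumGens 𝕜 Symb) sumGens_nil diff_sumGens
    _).trans ?_
  rw [sumGens, List.length_replicate, strings, Finset.sum_image fun _ _ _ _ h =>
    List.ofFn_injective h]
  exact Finset.sum_congr rfl fun ξ _ => gens_of (isStr_ofFn hn ξ)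

namespace Words

/-! ## Inserting beads into decorated words -/

/-- The signed sum of the words obtained by replacing a letter `a` of a decorated word by
`(a, y, a)`, over the positions before the first letter satisfying `P`. -/
noncomputable def beadD (𝕜 : Type u) [CommRing 𝕜] (P : ℕ → Prop) [DecidablePred P] (y : ℕ) :
    List (ℕ × ℕ) → (List (ℕ × ℕ) →₀ 𝕜)
  | [] => 0
  | a :: X => if P a.1 then 0 else
      Finsupp.single ((a.1, 1) :: (y, 0) :: a :: X) 1 + (-1 : 𝕜) ^ a.2 • consL 𝕜 a (beadD 𝕜 P y X)

/-- The signed sum of the words obtained by replacing a letter `a` of a decorated word by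
`(a, y, a)`, over the positions after the first letter satisfying `P`. -/
noncomputable def beadAfterD (𝕜 : Type u) [CommRing 𝕜] (P : ℕ → Prop) [DecidablePred P] (y : ℕ) :
    List (ℕ × ℕ) → (List (ℕ × ℕ) →₀ 𝕜)
  | [] => 0
  | a :: X => (-1 : 𝕜) ^ a.2 •
      consL 𝕜 a (if P a.1 then beadD 𝕜 (fun _ => False) y X else beadAfterD 𝕜 P y X)

section

variable {𝕜 : Type u} [CommRing 𝕜] {P P' : ℕ → Prop} [DecidablePred P] [DecidablePred P']
  {f g : ℕ → ℕ} {t y y' : ℕ}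

variable (𝕜 P y) in
/-- The linear extension of `beadD`. -/
noncomputable def beadDL : (List (ℕ × ℕ) →₀ 𝕜) →ₗ[𝕜] (List (ℕ × ℕ) →₀ 𝕜) :=
  Finsupp.linearCombination 𝕜 (beadD 𝕜 P y)

variable (𝕜 P y) in
/-- The linear extension of `beadAfterD`. -/
noncomputable def beadAfterDL : (List (ℕ × ℕ) →₀ 𝕜) →ₗ[𝕜] (List (ℕ × ℕ) →₀ 𝕜) :=
  Finsupp.linearCombination 𝕜 (beadAfterD 𝕜 P y)

@[simp] theorem beadDL_single (X : List (ℕ × ℕ)) :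
    beadDL 𝕜 P y (Finsupp.single X 1) = beadD 𝕜 P y X := by simp [beadDL]

@[simp] theorem beadAfterDL_single (X : List (ℕ × ℕ)) :
    beadAfterDL 𝕜 P y (Finsupp.single X 1) = beadAfterD 𝕜 P y X := by simp [beadAfterDL]

@[simp] theorem beadD_nil : beadD 𝕜 P y [] = 0 := rfl

theorem beadD_cons_of {a : ℕ × ℕ} (ha : P a.1) (X : List (ℕ × ℕ)) :
    beadD 𝕜 P y (a :: X) = 0 := if_pos ha

theorem beadD_cons_of_not {a : ℕ × ℕ} (ha : ¬ P a.1) (X : List (ℕ × ℕ)) :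
    beadD 𝕜 P y (a :: X) =
      Finsupp.single ((a.1, 1) :: (y, 0) :: a :: X) 1 +
        (-1 : 𝕜) ^ a.2 • consL 𝕜 a (beadD 𝕜 P y X) := if_neg ha

theorem beadDL_consL_of {a : ℕ × ℕ} (ha : P a.1) (S : List (ℕ × ℕ) →₀ 𝕜) :
    beadDL 𝕜 P y (consL 𝕜 a S) = 0 := by
  have := Finsupp.map_eq_of_forall_support ((beadDL 𝕜 P y).comp (consL 𝕜 a)) 0 S
    (by simp [beadD_cons_of ha])
  simpa using this

theorem beadDL_consL_of_not {a : ℕ × ℕ} (ha : ¬ P a.1) (S : List (ℕ × ℕ) →₀ 𝕜) :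
    beadDL 𝕜 P y (consL 𝕜 a S) =
      consL 𝕜 (a.1, 1) (consL 𝕜 (y, 0) (consL 𝕜 a S)) +
        (-1 : 𝕜) ^ a.2 • consL 𝕜 a (beadDL 𝕜 P y S) := by
  have := Finsupp.map_eq_of_forall_support ((beadDL 𝕜 P y).comp (consL 𝕜 a))
    ((consL 𝕜 (a.1, 1)).comp ((consL 𝕜 (y, 0)).comp (consL 𝕜 a)) +
      (-1 : 𝕜) ^ a.2 • (consL 𝕜 a).comp (beadDL 𝕜 P y)) S (by simp [beadD_cons_of_not ha])
  simpa using this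

theorem beadAfterDL_consL (a : ℕ × ℕ) (S : List (ℕ × ℕ) →₀ 𝕜) :
    beadAfterDL 𝕜 P y (consL 𝕜 a S) = (-1 : 𝕜) ^ a.2 •
      consL 𝕜 a (if P a.1 then beadDL 𝕜 (fun _ => False) y S else beadAfterDL 𝕜 P y S) := by
  have := Finsupp.map_eq_of_forall_support ((beadAfterDL 𝕜 P y).comp (consL 𝕜 a))
    ((-1 : 𝕜) ^ a.2 • (consL 𝕜 a).comp
      (if P a.1 then beadDL 𝕜 (fun _ => False) y else beadAfterDL 𝕜 P y)) S
    (fun w _ => by split_ifs with h <;> simp [beadAfterD, h])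
  split_ifs with h <;> simpa [h] using this

theorem of_mem_beadD {X w : List (ℕ × ℕ)} (hw : w ∈ (beadD 𝕜 P y X).support) :
    weight w = weight X + 1 ∧ 2 ≤ w.length ∧ ∀ a ∈ w, a.1 = y ∨ ∃ b ∈ X, a.1 = b.1 := by
  induction X generalizing w with
  | nil => simp at hw
  | cons a X ih =>
    by_cases ha : P a.1
    · simp [beadD_cons_of ha] at hw
    · rw [beadD_cons_of_not ha] at hw
      rcases mem_support_add hw with hw | hw
      · obtain rfl : w = _ := by simpa using Finsupp.support_single_subset hw
        refine ⟨by simp; ring, by simp, ?_⟩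
        simp only [List.mem_cons]
        rintro b (rfl | rfl | rfl | hb)
        · exact Or.inr ⟨a, by simp⟩
        · exact Or.inl rfl
        · exact Or.inr ⟨b, by simp⟩
        · exact Or.inr ⟨b, by simp [hb]⟩
      · obtain ⟨w', hw', rfl⟩ := exists_of_mem_support_consL (mem_support_smul hw)
        obtain ⟨h1, h2, h3⟩ := ih hw'
        refine ⟨by simp [h1]; ring, by simp; omega, ?_⟩
        simp only [List.mem_cons]
        rintro b (rfl | hb)
        · exact Or.inr ⟨b, by simp⟩
        · rcases h3 b hb with h | ⟨c, hc, h⟩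
          · exact Or.inl h
          · exact Or.inr ⟨c, by simp [hc], h⟩

theorem weight_of_mem_beadAfterD {X w : List (ℕ × ℕ)} (hw : w ∈ (beadAfterD 𝕜 P y X).support) :
    weight w = weight X + 1 := by
  induction X generalizing w with
  | nil => simp [beadAfterD] at hw
  | cons a X ih =>
    rw [beadAfterD] at hw
    obtain ⟨w', hw', rfl⟩ := exists_of_mem_support_consL (mem_support_smul hw)
    split_ifs at hw' with h
    · simp [(of_mem_beadD hw').1]; ring
    · simp [ih hw']; ring

/-- Beads before a letter of the outer word other than the one substituted for. -/
theorem beadDL_graft (hy : y ≠ t) (hfy : f y = y') (ht : ¬ P t) (X Y : List (ℕ × ℕ))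
    (hX : ∀ a ∈ X, a.1 ≠ t → (P' (f a.1) ↔ P a.1)) (hY : ∀ b ∈ Y, ¬ P' (g b.1)) :
    beadDL 𝕜 P' y' (graft 𝕜 f g t X Y) =
      graftL 𝕜 f g t (beadD 𝕜 P y X) (Finsupp.single Y 1) := by
  match X, Y with
  | X, [] => simp [graftL_nil_right]
  | [], b :: Y =>
    have : beadDL 𝕜 P' y' (graft 𝕜 f g t [] (b :: Y)) = 0 := by
      cases Y with
      | nil => rw [graft_nil_singleton]; split_ifs <;> simp
      | cons b' Y => simp [graft_nil_cons_cons]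
    simp [this]
  | a :: X, b :: Y =>
    have hX' : ∀ a ∈ X, a.1 ≠ t → (P' (f a.1) ↔ P a.1) := fun c hc => hX c (by simp [hc])
    have ih2 := beadDL_graft hy hfy ht X (b :: Y) hX' hY
    by_cases ha : a.1 = t
    · have ih1 := beadDL_graft hy hfy ht (a :: X) Y hX (fun c hc => hY c (by simp [hc]))
      have hb : ¬ P' (g b.1) := hY b (by simp)
      have hPa : ¬ P a.1 := ha ▸ ht
      rw [beadD_cons_of_not hPa, map_add, LinearMap.add_apply, map_smul, LinearMap.smul_apply]
        at ih1 ⊢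
      -- A bead on the letter b of the piece replacing t amounts to cutting that piece at b, with
      -- the new letter between the two parts. It is thus a term of the grafting into (t, y, t), and
      -- the beads on all letters of the piece make up this grafting.
      rw [graft_cons_cons ha, map_add, map_smul, beadDL_consL_of_not hb, beadDL_consL_of_not hb,
        ih1, ih2, graftL_single, graftL_single, graft_cons_cons (a := (a.1, 1)) ha,
        graft_cons_of_ne (a := (y, 0)) hy, graft_cons_cons ha, graftL_consL_cons ha
        (d := weight X + 1) (fun w hw => (of_mem_beadD hw).1), hfy]
      simp only [map_add, map_smul, smul_add, weight_cons, zero_add]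
      have e1 : (-1 : 𝕜) ^ (b.2 * (1 + (a.2 + weight X))) =
          (-1) ^ (b.2 * (a.2 + weight X)) * (-1) ^ b.2 := by rw [← pow_add]; ring_nf
      have e2 : (-1 : 𝕜) ^ (b.2 * (a.2 + (weight X + 1))) =
          (-1) ^ (b.2 * (a.2 + weight X)) * (-1) ^ b.2 := by rw [← pow_add]; ring_nf
      rw [e1, e2]
      simp only [smul_smul]
      rw [mul_comm ((-1 : 𝕜) ^ a.2)]
      simp only [mul_assoc]
      abel
    · rw [graft_cons_of_ne ha]
      by_cases hPa : P a.1
      · rw [beadDL_consL_of (by exact (hX a (by simp) ha).2 hPa), beadD_cons_of hPa]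
        simp
      · rw [beadDL_consL_of_not (by exact fun h => hPa ((hX a (by simp) ha).1 h)),
          beadD_cons_of_not hPa, ih2, map_add, LinearMap.add_apply, map_smul, LinearMap.smul_apply,
          graftL_consL_of_ne ha, graftL_single, graft_cons_of_ne (a := (a.1, 1)) ha,
          graft_cons_of_ne (a := (y, 0)) hy, graft_cons_of_ne ha, hfy]
  termination_by X.length + Y.length

/-- Beads after a letter of the outer word other than the one substituted for. -/
theorem beadAfterDL_graft (hy : y ≠ t) (hfy : f y = y') (ht : ¬ P t) (X Y : List (ℕ × ℕ))
    (hX : ∀ a ∈ X, a.1 ≠ t → (P' (f a.1) ↔ P a.1)) (hY : ∀ b ∈ Y, ¬ P' (g b.1)) :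
    beadAfterDL 𝕜 P' y' (graft 𝕜 f g t X Y) =
      graftL 𝕜 f g t (beadAfterD 𝕜 P y X) (Finsupp.single Y 1) := by
  match X, Y with
  | X, [] => simp [graftL_nil_right]
  | [], b :: Y =>
    have : beadAfterDL 𝕜 P' y' (graft 𝕜 f g t [] (b :: Y)) = 0 := by
      cases Y with
      | nil => rw [graft_nil_singleton]; split_ifs <;> simp [beadAfterD]
      | cons b' Y => simp [graft_nil_cons_cons]
    simp [this, beadAfterD]
  | a :: X, b :: Y =>
    have hX' : ∀ a ∈ X, a.1 ≠ t → (P' (f a.1) ↔ P a.1) := fun c hc => hX c (by simp [hc])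
    have ih2 := beadAfterDL_graft hy hfy ht X (b :: Y) hX' hY
    by_cases ha : a.1 = t
    · have ih1 := beadAfterDL_graft hy hfy ht (a :: X) Y hX (fun c hc => hY c (by simp [hc]))
      have hb : ¬ P' (g b.1) := hY b (by simp)
      have hPa : ¬ P a.1 := ha ▸ ht
      rw [beadAfterD, if_neg hPa, map_smul, LinearMap.smul_apply] at ih1 ⊢
      rw [graft_cons_cons ha, map_add, map_smul, beadAfterDL_consL, beadAfterDL_consL,
        if_neg (by exact hb), if_neg (by exact hb), ih1, ih2, graftL_consL_cons ha
        (d := weight X + 1) (fun w hw => weight_of_mem_beadAfterD hw)]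
      simp only [map_smul, smul_add]
      have e2 : (-1 : 𝕜) ^ (b.2 * (a.2 + (weight X + 1))) =
          (-1) ^ (b.2 * (a.2 + weight X)) * (-1) ^ b.2 := by rw [← pow_add]; ring_nf
      rw [e2]
      simp only [smul_smul]
      congr 2
      ring
    · rw [graft_cons_of_ne ha, beadAfterDL_consL, beadAfterD, map_smul, LinearMap.smul_apply,
        graftL_consL_of_ne ha]
      by_cases hPa : P a.1
      · rw [if_pos hPa, if_pos (by exact (hX a (by simp) ha).2 hPa),
          beadDL_graft hy hfy (P := fun _ => False) (by simp) X (b :: Y) (by simp) (by simp)]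
      · rw [if_neg hPa, if_neg (by exact fun h => hPa ((hX a (by simp) ha).1 h)), ih2]
  termination_by X.length + Y.length

theorem graft_self_cons (X : List (ℕ × ℕ)) (b : ℕ × ℕ) (Y : List (ℕ × ℕ)) :
    graft 𝕜 f g t ((t, 0) :: X) (b :: Y) =
      (-1 : 𝕜) ^ (b.2 * weight X) • consL 𝕜 (g b.1, b.2) (graft 𝕜 f g t ((t, 0) :: X) Y) +
        consL 𝕜 (g b.1, 0) (graft 𝕜 f g t X (b :: Y)) := by
  simpa using graft_cons_cons (𝕜 := 𝕜) (f := f) (g := g) (a := (t, 0)) rfl b X Y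

theorem graftL_consL_self {S : List (ℕ × ℕ) →₀ 𝕜} {d : ℕ}
    (hS : ∀ w ∈ S.support, weight w = d) (b : ℕ × ℕ) (Y : List (ℕ × ℕ)) :
    graftL 𝕜 f g t (consL 𝕜 (t, 0) S) (Finsupp.single (b :: Y) 1) =
      (-1 : 𝕜) ^ (b.2 * d) • consL 𝕜 (g b.1, b.2)
        (graftL 𝕜 f g t (consL 𝕜 (t, 0) S) (Finsupp.single Y 1)) +
      consL 𝕜 (g b.1, 0) (graftL 𝕜 f g t S (Finsupp.single (b :: Y) 1)) := by
  simpa using graftL_consL_cons (𝕜 := 𝕜) (f := f) (g := g) (a := (t, 0)) rfl hS b Y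

theorem graftL_self_consL (X : List (ℕ × ℕ)) (b : ℕ × ℕ) (T : List (ℕ × ℕ) →₀ 𝕜) :
    graftL 𝕜 f g t (Finsupp.single ((t, 0) :: X) 1) (consL 𝕜 b T) =
      (-1 : 𝕜) ^ (b.2 * weight X) • consL 𝕜 (g b.1, b.2)
        (graftL 𝕜 f g t (Finsupp.single ((t, 0) :: X) 1) T) +
      consL 𝕜 (g b.1, 0) (graftL 𝕜 f g t (Finsupp.single X 1) (consL 𝕜 b T)) := by
  simpa using graftL_cons_consL (𝕜 := 𝕜) (f := f) (g := g) (a := (t, 0)) rfl X b T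

theorem graftL_of_not_mem_consL_eq_zero {X : List (ℕ × ℕ)} (hX : ∀ a ∈ X, a.1 ≠ t) {b : ℕ × ℕ}
    {S : List (ℕ × ℕ) →₀ 𝕜} (hS : ∀ w ∈ S.support, w ≠ []) :
    graftL 𝕜 f g t (Finsupp.single X 1) (consL 𝕜 b S) = 0 := by
  have := Finsupp.map_eq_of_forall_support
    ((graftL 𝕜 f g t (Finsupp.single X 1)).comp (consL 𝕜 b)) 0 S (fun w hw => by
      obtain ⟨c, w, rfl⟩ := List.exists_cons_of_ne_nil (hS w hw)
      simp [graft_of_not_mem_cons_cons hX])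
  simpa using this

theorem graftL_of_forall_not_mem_eq_zero {S : List (ℕ × ℕ) →₀ 𝕜}
    (hS : ∀ w ∈ S.support, ∀ a ∈ w, a.1 ≠ t) {b : ℕ × ℕ} {Y : List (ℕ × ℕ)} (hY : Y ≠ []) :
    graftL 𝕜 f g t S (Finsupp.single (b :: Y) 1) = 0 := by
  have := Finsupp.map_eq_of_forall_support
    ((graftL 𝕜 f g t).flip (Finsupp.single (b :: Y) 1)) 0 S (fun w hw => by
      obtain ⟨c, Y, rfl⟩ := List.exists_cons_of_ne_nil hY
      simp [graft_of_not_mem_cons_cons (hS w hw)])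
  simpa using this

/-- All beads, the letter substituted for being at the beginning of the outer word and occurring
nowhere else. -/
theorem beadDL_graft_cons {z : ℕ} (hy : y ≠ t) (hfy : f y = y') (hgz : g z = y')
    {X : List (ℕ × ℕ)} (hX : ∀ a ∈ X, a.1 ≠ t) (Y : List (ℕ × ℕ)) :
    beadDL 𝕜 (fun _ => False) y' (graft 𝕜 f g t ((t, 0) :: X) Y) =
      graftL 𝕜 f g t (consL 𝕜 (t, 0) (beadD 𝕜 (fun _ => False) y X)) (Finsupp.single Y 1) +
        (-1 : 𝕜) ^ weight X • graftL 𝕜 f g t (Finsupp.single ((t, 0) :: X) 1)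
          (beadD 𝕜 (fun _ => False) z Y) := by
  induction Y with
  | nil => simp [graftL_nil_right]
  | cons b Y ih =>
    rw [graft_self_cons, map_add, map_smul, beadDL_consL_of_not (by simp),
      beadDL_consL_of_not (by simp), ih, beadDL_graft hy hfy (P := fun _ => False) (by simp) X
      (b :: Y) (by simp) (by simp), graftL_consL_self (d := weight X + 1)
      (fun w hw => (of_mem_beadD hw).1), beadD_cons_of_not (by simp), map_add (graftL 𝕜 f g t _), map_smul (graftL 𝕜 f g t _),
      graftL_single, graft_self_cons, graft_self_cons, graft_self_cons _ b,
      graftL_self_consL, graft_of_not_mem_cons_cons hX, graft_of_not_mem_cons_cons hX,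
      graftL_of_not_mem_consL_eq_zero hX (fun w hw => by
        have := (of_mem_beadD hw).2.1
        rintro rfl
        simp at this), hgz]
    simp only [map_add, map_smul, smul_add, map_zero, add_zero, one_mul, zero_mul,
      pow_zero, one_smul, smul_smul, ← pow_add]
    -- A bead raises the weight of the inner word by one, and all of that weight is moved past X.
    -- The factor (-1)^{|X|} of the statement compensates for this.
    have e1 : (-1 : 𝕜) ^ (b.2 * (weight X + 1)) = (-1) ^ (b.2 * weight X + b.2) := by ring_nf
    have e2 : (-1 : 𝕜) ^ (b.2 * weight X + (b.2 + weight X)) =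
      (-1) ^ (weight X + (b.2 + b.2 * weight X)) := by ring_nf
    have e3 : (-1 : 𝕜) ^ (weight X + (weight X + b.2 * weight X)) = (-1) ^ (b.2 * weight X) := by
      rw [← add_assoc, ← two_mul, pow_add, pow_mul]; simp
    have e4 : (-1 : 𝕜) ^ (weight X + weight X) = 1 := by
      rw [← two_mul, pow_mul]; simp
    rw [e1, e2]
    simp only [add_assoc, e3, e4, one_smul]
    abel

/-- Beads before a letter of the inner word, at the beginning of the outer word. -/
theorem beadDL_graft_cons_inner {z : ℕ} (hgz : g z = y')
    {X : List (ℕ × ℕ)} (hX : ∀ a ∈ X, a.1 ≠ t) (Y : List (ℕ × ℕ)) (hY : ∃ b ∈ Y, P b.1)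
    (hP : ∀ b ∈ Y, (P' (g b.1) ↔ P b.1)) :
    beadDL 𝕜 P' y' (graft 𝕜 f g t ((t, 0) :: X) Y) =
      (-1 : 𝕜) ^ weight X • graftL 𝕜 f g t (Finsupp.single ((t, 0) :: X) 1) (beadD 𝕜 P z Y) := by
  induction Y with
  | nil => simp at hY
  | cons b Y ih =>
    rw [graft_self_cons, map_add, map_smul]
    by_cases hb : P b.1
    · rw [beadDL_consL_of (by exact (hP b (by simp)).2 hb),
        beadDL_consL_of (by exact (hP b (by simp)).2 hb), beadD_cons_of hb]
      simp
    · have hb' : ¬ P' (g b.1) := fun h => hb ((hP b (by simp)).1 h)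
      have hY' : ∃ b ∈ Y, P b.1 := by
        obtain ⟨c, hc, hPc⟩ := hY
        rcases List.mem_cons.1 hc with rfl | hc
        · exact absurd hPc hb
        · exact ⟨c, hc, hPc⟩
      obtain ⟨c, Y, rfl⟩ : ∃ c Y', Y = c :: Y' := List.exists_cons_of_ne_nil (by
        rintro rfl; simp at hY')
      rw [beadDL_consL_of_not hb', ih hY' (fun c hc => hP c (by simp [hc])),
        graft_of_not_mem_cons_cons hX, beadD_cons_of_not hb, map_add (graftL 𝕜 f g t _),
        map_smul (graftL 𝕜 f g t _), map_zero, map_zero,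
        graftL_single, graft_self_cons _ (b.1, 1),
        graft_self_cons _ (z, 0), graft_self_cons _ b,
        graftL_self_consL, graft_of_not_mem_cons_cons hX, graft_of_not_mem_cons_cons hX,
        graft_of_not_mem_cons_cons hX,
        graftL_of_not_mem_consL_eq_zero hX (fun w hw => by
          have := (of_mem_beadD hw).2.1
          rintro rfl
          simp at this), hgz]
      have e3 : (-1 : 𝕜) ^ (weight X + (weight X + b.2 * weight X)) = (-1) ^ (b.2 * weight X) := by
        rw [← add_assoc, ← two_mul, pow_add, pow_mul]; simp
      simp only [map_smul, smul_add, map_zero, add_zero, one_mul, zero_mul,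
        pow_zero, smul_smul, ← pow_add, e3]
      congr 3
      ring

/-- Beads after a letter of the inner word, at the beginning of the outer word. -/
theorem beadAfterDL_graft_cons_inner {z : ℕ} (hy : y ≠ t) (hfy : f y = y') (hgz : g z = y')
    {X : List (ℕ × ℕ)} (hX : ∀ a ∈ X, a.1 ≠ t) (Y : List (ℕ × ℕ)) (hY : ∃ b ∈ Y, P b.1)
    (hY0 : ∀ b ∈ Y, P b.1 → b.2 = 0) (hP : ∀ b ∈ Y, (P' (g b.1) ↔ P b.1)) :
    beadAfterDL 𝕜 P' y' (graft 𝕜 f g t ((t, 0) :: X) Y) =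
      graftL 𝕜 f g t (consL 𝕜 (t, 0) (beadD 𝕜 (fun _ => False) y X)) (Finsupp.single Y 1) +
      (-1 : 𝕜) ^ weight X •
        graftL 𝕜 f g t (Finsupp.single ((t, 0) :: X) 1) (beadAfterD 𝕜 P z Y) := by
  induction Y with
  | nil => simp at hY
  | cons b Y ih =>
    have hl : ∀ w ∈ (beadD 𝕜 (fun _ => False) y X).support, ∀ a ∈ w, a.1 ≠ t := by
      intro w hw a ha
      rcases (of_mem_beadD hw).2.2 a ha with h | ⟨c, hc, h⟩
      · rwa [h]
      · rw [h]; exact hX c hc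
    rw [graft_self_cons, map_add, map_smul, beadAfterDL_consL, beadAfterDL_consL,
      graftL_consL_self (d := weight X + 1) (fun w hw => (of_mem_beadD hw).1), beadAfterD,
      map_smul (graftL 𝕜 f g t _), graftL_self_consL]
    by_cases hb : P b.1
    · have hb0 := hY0 b (by simp) hb
      rw [if_pos (by exact (hP b (by simp)).2 hb), if_pos (by exact (hP b (by simp)).2 hb),
        if_pos hb, beadDL_graft_cons hy hfy hgz hX, hb0,
        beadDL_graft hy hfy (P := fun _ => False) (by simp) X (b :: Y) (by simp) (by simp),
        graftL_of_not_mem_consL_eq_zero hX (fun w hw => by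
          have := (of_mem_beadD hw).2.1
          rintro rfl
          simp at this)]
      simp only [map_add, map_smul, map_zero, add_zero, zero_mul, pow_zero, one_smul]
      abel
    · have hb' : ¬ P' (g b.1) := fun h => hb ((hP b (by simp)).1 h)
      have hY' : ∃ b ∈ Y, P b.1 := by
        obtain ⟨c, hc, hPc⟩ := hY
        rcases List.mem_cons.1 hc with rfl | hc
        · exact absurd hPc hb
        · exact ⟨c, hc, hPc⟩
      have hne : Y ≠ [] := by rintro rfl; simp at hY'
      have hz : ∀ w ∈ (beadAfterD 𝕜 P z Y).support, w ≠ [] := by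
        intro w hw
        have := weight_of_mem_beadAfterD hw
        rintro rfl
        simp at this
      rw [if_neg (by exact hb'), if_neg (by exact hb'), if_neg hb,
        ih hY' (fun c hc => hY0 c (by simp [hc])) (fun c hc => hP c (by simp [hc])),
        graftL_of_not_mem_consL_eq_zero hX hz, graftL_of_forall_not_mem_eq_zero hl hne]
      obtain ⟨c, Y, rfl⟩ := List.exists_cons_of_ne_nil hne
      rw [graft_of_not_mem_cons_cons hX]
      simp only [map_add, map_smul, smul_add, map_zero, add_zero, smul_zero, smul_smul, ← pow_add]
      congr 3; ring

/-- Beads before a letter of the inner word. -/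
theorem beadDL_graft_inner {z : ℕ} (hy : y ≠ t) (hfy : f y = y') (hgz : g z = y')
    (X Y : List (ℕ × ℕ)) (hX : (X.map Prod.fst).count t = 1) (hX0 : ∀ a ∈ X, a.1 = t → a.2 = 0)
    (hP' : ∀ a ∈ X, a.1 ≠ t → ¬ P' (f a.1)) (hY : ∃ b ∈ Y, P b.1)
    (hP : ∀ b ∈ Y, (P' (g b.1) ↔ P b.1)) :
    beadDL 𝕜 P' y' (graft 𝕜 f g t X Y) =
      graftL 𝕜 f g t (beadD 𝕜 (· = t) y X) (Finsupp.single Y 1) +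
        (-1 : 𝕜) ^ weight X •
          graftL 𝕜 f g t (Finsupp.single X 1) (beadD 𝕜 P z Y) := by
  induction X with
  | nil => simp at hX
  | cons a X ih =>
    rw [List.map_cons] at hX
    by_cases ha : a.1 = t
    · obtain ⟨a1, a2⟩ := a
      obtain rfl : a2 = 0 := hX0 _ (by simp) ha
      dsimp only at ha
      subst ha
      rw [List.count_cons_self, Nat.add_eq_right, List.count_eq_zero, List.mem_map] at hX
      have hX' : ∀ a ∈ X, a.1 ≠ a1 := fun a ha h => hX ⟨a, ha, h⟩
      -- At the single occurrence of t the beads of the outer word before t are exhausted. Those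
      -- left over lie in the inserted copy of the inner word, before its distinguished letter.
      rw [beadDL_graft_cons_inner hgz hX' Y hY hP, beadD_cons_of (P := (· = a1)) (a := (a1, 0)) rfl]
      simp
    · rw [List.count_cons_of_ne ha] at hX
      have ih := ih hX (fun c hc => hX0 c (by simp [hc])) (fun c hc => hP' c (by simp [hc]))
      rw [graft_cons_of_ne ha, beadDL_consL_of_not (by exact hP' a (by simp) ha), ih,
        beadD_cons_of_not (P := (· = t)) ha, map_add (graftL 𝕜 f g t), LinearMap.add_apply,
        map_smul (graftL 𝕜 f g t), LinearMap.smul_apply,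
        graftL_consL_of_ne ha, ← consL_single, graftL_consL_of_ne (by exact ha),
        ← consL_single, graftL_consL_of_ne hy, ← consL_single, graftL_consL_of_ne ha,
        graftL_consL_of_ne ha, graftL_single, hfy]
      simp only [map_add, map_smul, smul_add, smul_smul, ← pow_add, weight_cons]
      abel

/-- Beads after a letter of the inner word. -/
theorem beadAfterDL_graft_inner {z : ℕ} (hy : y ≠ t) (hfy : f y = y') (hgz : g z = y')
    (X Y : List (ℕ × ℕ)) (hX : (X.map Prod.fst).count t = 1) (hX0 : ∀ a ∈ X, a.1 = t → a.2 = 0)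
    (hP' : ∀ a ∈ X, a.1 ≠ t → ¬ P' (f a.1)) (hY : ∃ b ∈ Y, P b.1)
    (hY0 : ∀ b ∈ Y, P b.1 → b.2 = 0) (hP : ∀ b ∈ Y, (P' (g b.1) ↔ P b.1)) :
    beadAfterDL 𝕜 P' y' (graft 𝕜 f g t X Y) =
      graftL 𝕜 f g t (beadAfterD 𝕜 (· = t) y X) (Finsupp.single Y 1) +
        (-1 : 𝕜) ^ weight X •
          graftL 𝕜 f g t (Finsupp.single X 1) (beadAfterD 𝕜 P z Y) := by
  induction X with
  | nil => simp at hX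
  | cons a X ih =>
    rw [List.map_cons] at hX
    by_cases ha : a.1 = t
    · obtain ⟨a1, a2⟩ := a
      obtain rfl : a2 = 0 := hX0 _ (by simp) ha
      dsimp only at ha
      subst ha
      rw [List.count_cons_self, Nat.add_eq_right, List.count_eq_zero, List.mem_map] at hX
      have hX' : ∀ a ∈ X, a.1 ≠ a1 := fun a ha h => hX ⟨a, ha, h⟩
      rw [beadAfterDL_graft_cons_inner hy hfy hgz hX' Y hY hY0 hP, beadAfterD, if_pos rfl]
      simp
    · rw [List.count_cons_of_ne ha] at hX
      have ih := ih hX (fun c hc => hX0 c (by simp [hc])) (fun c hc => hP' c (by simp [hc]))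
      rw [graft_cons_of_ne ha, beadAfterDL_consL, if_neg (by exact hP' a (by simp) ha), ih,
        beadAfterD, if_neg ha, map_smul, LinearMap.smul_apply,
        graftL_consL_of_ne ha, ← consL_single, graftL_consL_of_ne (by exact ha)]
      simp only [map_add, map_smul, smul_add, smul_smul, ← pow_add, weight_cons]

end

end Words

namespace Words

/-! ## Inserting beads into words -/

/-- The signed sum of the words obtained by replacing a letter `a` by `(a, y, a)`, over the
positions before the first letter satisfying `P`. -/
noncomputable def bead (𝕜 : Type u) [CommRing 𝕜] (P : ℕ → Prop) [DecidablePred P] (y : ℕ) :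
    List ℕ → (List ℕ →₀ 𝕜)
  | [] => 0
  | a :: u => if P a then 0 else
      Finsupp.single (a :: y :: a :: u) 1 + (-1 : 𝕜) ^ rep a u • consL 𝕜 a (bead 𝕜 P y u)

/-- The signed sum of the words obtained by replacing a letter `a` by `(a, y, a)`, over the
positions after the first letter satisfying `P`. -/
noncomputable def beadAfter (𝕜 : Type u) [CommRing 𝕜] (P : ℕ → Prop) [DecidablePred P] (y : ℕ) :
    List ℕ → (List ℕ →₀ 𝕜)
  | [] => 0
  | a :: u => (-1 : 𝕜) ^ rep a u •
      consL 𝕜 a (if P a then bead 𝕜 (fun _ => False) y u else beadAfter 𝕜 P y u)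

/-- Inserting `y` before the first letter satisfying `P`. -/
def insBefore (P : ℕ → Prop) [DecidablePred P] (y : ℕ) : List ℕ → List ℕ
  | [] => [y]
  | a :: u => if P a then y :: a :: u else a :: insBefore P y u

/-- Inserting `y` after the first letter satisfying `P`. -/
def insAfter (P : ℕ → Prop) [DecidablePred P] (y : ℕ) : List ℕ → List ℕ
  | [] => []
  | a :: u => if P a then a :: y :: u else a :: insAfter P y u

section

variable {𝕜 : Type u} [CommRing 𝕜] {P : ℕ → Prop} [DecidablePred P] {y : ℕ}

theorem insBefore_false (u : List ℕ) : insBefore (fun _ => False) y u = u ++ [y] := by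
  induction u with
  | nil => rfl
  | cons a u ih => simp [insBefore, ih]

variable (𝕜 P y) in
/-- The linear extension of `bead`. -/
noncomputable def beadL : (List ℕ →₀ 𝕜) →ₗ[𝕜] (List ℕ →₀ 𝕜) :=
  Finsupp.linearCombination 𝕜 (bead 𝕜 P y)

variable (𝕜 P y) in
/-- The linear extension of `beadAfter`. -/
noncomputable def beadAfterL : (List ℕ →₀ 𝕜) →ₗ[𝕜] (List ℕ →₀ 𝕜) :=
  Finsupp.linearCombination 𝕜 (beadAfter 𝕜 P y)

@[simp] theorem beadL_single (u : List ℕ) :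
    beadL 𝕜 P y (Finsupp.single u 1) = bead 𝕜 P y u := by simp [beadL]

@[simp] theorem beadAfterL_single (u : List ℕ) :
    beadAfterL 𝕜 P y (Finsupp.single u 1) = beadAfter 𝕜 P y u := by simp [beadAfterL]

theorem bead_cons_of {a : ℕ} (ha : P a) (u : List ℕ) : bead 𝕜 P y (a :: u) = 0 := if_pos ha

theorem bead_cons_of_not {a : ℕ} (ha : ¬ P a) (u : List ℕ) :
    bead 𝕜 P y (a :: u) = Finsupp.single (a :: y :: a :: u) 1 +
      (-1 : 𝕜) ^ rep a u • consL 𝕜 a (bead 𝕜 P y u) := if_neg ha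

theorem beadL_consL_of {a : ℕ} (ha : P a) (S : List ℕ →₀ 𝕜) :
    beadL 𝕜 P y (consL 𝕜 a S) = 0 := by
  have := Finsupp.map_eq_of_forall_support ((beadL 𝕜 P y).comp (consL 𝕜 a)) 0 S
    (by simp [bead_cons_of ha])
  simpa using this

theorem beadL_consL_of_not {a r : ℕ} (ha : ¬ P a) {S : List ℕ →₀ 𝕜}
    (hS : ∀ w ∈ S.support, rep a w = r) :
    beadL 𝕜 P y (consL 𝕜 a S) = consL 𝕜 a (consL 𝕜 y (consL 𝕜 a S)) +
      (-1 : 𝕜) ^ r • consL 𝕜 a (beadL 𝕜 P y S) := by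
  have := Finsupp.map_eq_of_forall_support ((beadL 𝕜 P y).comp (consL 𝕜 a))
    ((consL 𝕜 a).comp ((consL 𝕜 y).comp (consL 𝕜 a)) +
      (-1 : 𝕜) ^ r • (consL 𝕜 a).comp (beadL 𝕜 P y)) S
    (fun w hw => by simp [bead_cons_of_not ha, hS w hw])
  simpa using this

theorem beadAfterL_consL {a r : ℕ} {S : List ℕ →₀ 𝕜} (hS : ∀ w ∈ S.support, rep a w = r) :
    beadAfterL 𝕜 P y (consL 𝕜 a S) = (-1 : 𝕜) ^ r •
      consL 𝕜 a (if P a then beadL 𝕜 (fun _ => False) y S else beadAfterL 𝕜 P y S) := by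
  have := Finsupp.map_eq_of_forall_support ((beadAfterL 𝕜 P y).comp (consL 𝕜 a))
    ((-1 : 𝕜) ^ r • (consL 𝕜 a).comp
      (if P a then beadL 𝕜 (fun _ => False) y else beadAfterL 𝕜 P y)) S
    (fun w hw => by split_ifs with h <;> simp [beadAfter, h, hS w hw])
  split_ifs with h <;> simpa [h] using this

theorem exists_of_mem_bead {u w : List ℕ} (hw : w ∈ (bead 𝕜 P y u).support) :
    ∃ A a B, u = A ++ a :: B ∧ w = A ++ a :: y :: a :: B ∧ ¬ P a ∧ ∀ x ∈ A, ¬ P x := by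
  induction u generalizing w with
  | nil => simp [bead] at hw
  | cons a u ih =>
    by_cases ha : P a
    · simp [bead_cons_of ha] at hw
    · rw [bead_cons_of_not ha] at hw
      rcases mem_support_add hw with hw | hw
      · obtain rfl : w = _ := by simpa using Finsupp.support_single_subset hw
        exact ⟨[], a, u, rfl, rfl, ha, by simp⟩
      · obtain ⟨w', hw', rfl⟩ := exists_of_mem_support_consL (mem_support_smul hw)
        obtain ⟨A, b, B, rfl, rfl, hb, hA⟩ := ih hw'
        exact ⟨a :: A, b, B, rfl, rfl, hb, by simpa using ⟨ha, hA⟩⟩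

theorem exists_of_mem_beadAfter {u w : List ℕ} (hw : w ∈ (beadAfter 𝕜 P y u).support) :
    ∃ A a B, u = A ++ a :: B ∧ w = A ++ a :: y :: a :: B ∧ ∃ x ∈ A, P x := by
  induction u generalizing w with
  | nil => simp [beadAfter] at hw
  | cons a u ih =>
    rw [beadAfter] at hw
    obtain ⟨w', hw', rfl⟩ := exists_of_mem_support_consL (mem_support_smul hw)
    split_ifs at hw' with ha
    · obtain ⟨A, b, B, rfl, rfl, -⟩ := exists_of_mem_bead hw'
      exact ⟨a :: A, b, B, rfl, rfl, a, by simp, ha⟩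
    · obtain ⟨A, b, B, rfl, rfl, x, hx, hPx⟩ := ih hw'
      exact ⟨a :: A, b, B, rfl, rfl, x, by simp [hx], hPx⟩

theorem mem_iff_of_mem_bead {u w : List ℕ} (hw : w ∈ (bead 𝕜 P y u).support) (x : ℕ) :
    x ∈ w ↔ x = y ∨ x ∈ u := by
  obtain ⟨A, a, B, rfl, rfl, -⟩ := exists_of_mem_bead hw
  simp; tauto

theorem mem_iff_of_mem_beadAfter {u w : List ℕ} (hw : w ∈ (beadAfter 𝕜 P y u).support) (x : ℕ) :
    x ∈ w ↔ x = y ∨ x ∈ u := by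
  obtain ⟨A, a, B, rfl, rfl, -⟩ := exists_of_mem_beadAfter hw
  simp; tauto

/-- A bead on x itself doubles x, so the erasure kills it. Any other bead leaves the number of
occurrences of x unchanged. -/
theorem eraseOnceL_bead {x : ℕ} (hx : ¬ P x) (hxy : x ≠ y) (u : List ℕ) :
    eraseOnceL 𝕜 x (bead 𝕜 P y u) = beadL 𝕜 P y (eraseOnce 𝕜 x u) := by
  induction u with
  | nil => simp [bead, eraseOnce]
  | cons b u ih =>
    by_cases hb : b = x
    · subst hb
      rw [bead_cons_of_not hx, map_add, map_smul, eraseOnceL_single, eraseOnce_cons_self,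
        if_pos (by simp), zero_add, eraseOnce_cons_self]
      split_ifs with hu
      · rw [eraseOnceL_consL_of_mem fun w hw => (mem_iff_of_mem_bead hw b).2 (Or.inr hu)]
        simp
      · rw [eraseOnceL_consL_of_not_mem fun w hw h => by
          rcases (mem_iff_of_mem_bead hw b).1 h with h | h
          · exact hxy h
          · exact hu h]
        simp [rep_of_not_mem hu]
    · rw [eraseOnce_cons_of_ne hb]
      by_cases hPb : P b
      · rw [bead_cons_of hPb, beadL_consL_of hPb, map_zero]
      · rw [bead_cons_of_not hPb, beadL_consL_of_not (r := rep b u) hPb (fun w hw =>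
          rep_congr (by simp [(mem_of_mem_eraseOnce hw).2.2, hb])), map_add, map_smul,
          eraseOnceL_single, eraseOnce_cons_of_ne hb, eraseOnce_cons_of_ne (Ne.symm hxy),
          eraseOnce_cons_of_ne hb, eraseOnceL_consL_of_ne hb, ih]

theorem eraseOnceL_beadAfter {x : ℕ} (hx : ¬ P x) (hxy : x ≠ y) (u : List ℕ) :
    eraseOnceL 𝕜 x (beadAfter 𝕜 P y u) = beadAfterL 𝕜 P y (eraseOnce 𝕜 x u) := by
  induction u with
  | nil => simp [beadAfter, eraseOnce]
  | cons b u ih =>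
    by_cases hb : b = x
    · subst hb
      rw [beadAfter, if_neg hx, map_smul, eraseOnce_cons_self]
      split_ifs with hu
      · rw [eraseOnceL_consL_of_mem fun w hw => (mem_iff_of_mem_beadAfter hw b).2 (Or.inr hu)]
        simp
      · rw [eraseOnceL_consL_of_not_mem fun w hw h => by
          rcases (mem_iff_of_mem_beadAfter hw b).1 h with h | h
          · exact hxy h
          · exact hu h]
        simp [rep_of_not_mem hu]
    · rw [eraseOnce_cons_of_ne hb, beadAfterL_consL (r := rep b u) (fun w hw =>
        rep_congr (by simp [(mem_of_mem_eraseOnce hw).2.2, hb])), beadAfter, map_smul,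
        eraseOnceL_consL_of_ne hb]
      split_ifs with hPb
      · rw [eraseOnceL_bead (by simp) hxy]
      · rw [ih]

/-- The differential and the insertion of beads. -/
theorem delL_bead_add (u : List ℕ) (hy : y ∉ u) (hu : ∀ a ∈ u, P a → u.count a = 1) :
    delL 𝕜 (bead 𝕜 P y u) + beadL 𝕜 P y (del 𝕜 u) =
      Finsupp.single (y :: u) 1 - Finsupp.single (insBefore P y u) 1 := by
  induction u with
  | nil => simp [bead, del, insBefore]
  | cons a u ih =>
    have hya : a ≠ y := fun h => hy (by simp [h])
    have hyu : y ∉ u := fun h => hy (by simp [h])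
    have hu' : ∀ b ∈ u, P b → u.count b = 1 := by
      intro b hb hPb
      have h1 := hu b (by simp [hb]) hPb
      have h2 := List.count_pos_iff.2 hb
      rw [List.count_cons] at h1
      omega
    have ih := ih hyu hu'
    by_cases hPa : P a
    · have ha : a ∉ u := by
        have := hu a (by simp) hPa
        rwa [List.count_cons_self, Nat.add_eq_right, List.count_eq_zero] at this
      rw [bead_cons_of hPa, del_cons_of_not_mem ha, beadL_consL_of hPa, insBefore, if_pos hPa]
      simp
    -- Deleting the first of the two copies of a leaves (y, a, u), deleting the second one leaves
    -- (a, y, u). Consecutive beads therefore telescope, from y at the very front to y just before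
    -- the first letter satisfying P.
    · have h2 : delL 𝕜 (Finsupp.single (a :: y :: a :: u) 1) =
          Finsupp.single (y :: a :: u) 1 - consL 𝕜 a (consL 𝕜 y (del 𝕜 (a :: u))) -
            consL 𝕜 a (consL 𝕜 y (eraseOnce 𝕜 a (a :: u))) := by
        rw [delL_single, del_cons_of_mem (by simp), del_cons_of_not_mem (by simp [hya.symm, hyu]),
          eraseOnce_cons_of_ne hya.symm]
      rw [bead_cons_of_not hPa, map_add, h2, map_smul, insBefore, if_neg hPa]
      have e : delL 𝕜 (bead 𝕜 P y u) = Finsupp.single (y :: u) 1 -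
          Finsupp.single (insBefore P y u) 1 - beadL 𝕜 P y (del 𝕜 u) := by
        rw [← ih]; abel
      by_cases ha : a ∈ u
      · rw [delL_consL_of_mem fun w hw => (mem_iff_of_mem_bead hw a).2 (Or.inr ha), e,
          eraseOnceL_bead hPa hya, eraseOnce_cons_self, if_pos ha, del_cons_of_mem ha,
          map_sub (beadL 𝕜 P y), map_sub (beadL 𝕜 P y), beadL_single, beadL_consL_of_not (r := 1) hPa (fun w hw =>
          rep_of_mem (((mem_of_mem_del hw).2 a).2 ha)), beadL_consL_of_not (r := 0) hPa
          (fun w hw => rep_of_not_mem fun h => (((mem_of_mem_eraseOnce hw).2.2 a).1 h).1 rfl),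
          rep_of_mem ha]
        simp only [map_sub, consL_single, pow_zero, pow_one, one_smul, neg_smul, map_zero]
        abel
      · rw [delL_consL_of_not_mem fun w hw h => by
            rcases (mem_iff_of_mem_bead hw a).1 h with h | h
            · exact hya h
            · exact ha h, e, eraseOnce_cons_self, if_neg ha, del_cons_of_not_mem ha,
          beadL_consL_of_not (r := 0) hPa (fun w hw =>
          rep_of_not_mem fun h => ha (((mem_of_mem_del hw).2 a).1 h)), rep_of_not_mem ha]
        simp only [map_sub, consL_single, pow_zero, one_smul]
        abel

/-- The differential and the insertion of beads. -/
theorem delL_beadAfter_add (u : List ℕ) (hy : y ∉ u) (hu : ∀ a ∈ u, P a → u.count a = 1)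
    (hP : ∃ a ∈ u, P a) :
    delL 𝕜 (beadAfter 𝕜 P y u) + beadAfterL 𝕜 P y (del 𝕜 u) =
      Finsupp.single (insAfter P y u) 1 - Finsupp.single (u ++ [y]) 1 := by
  induction u with
  | nil => simp at hP
  | cons a u ih =>
    have hya : a ≠ y := fun h => hy (by simp [h])
    have hyu : y ∉ u := fun h => hy (by simp [h])
    have hu' : ∀ b ∈ u, P b → u.count b = 1 := by
      intro b hb hPb
      have h1 := hu b (by simp [hb]) hPb
      have h2 := List.count_pos_iff.2 hb
      rw [List.count_cons] at h1
      omega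
    by_cases hPa : P a
    · have ha : a ∉ u := by
        have := hu a (by simp) hPa
        rwa [List.count_cons_self, Nat.add_eq_right, List.count_eq_zero] at this
      -- Behind the distinguished letter the beads run over all of u, so the telescoping goes from y
      -- directly after that letter to y at the end of the word.
      have e := delL_bead_add (𝕜 := 𝕜) (P := fun _ => False) (y := y) u hyu (by simp)
      rw [insBefore_false] at e
      rw [beadAfter, if_pos hPa, del_cons_of_not_mem ha, beadAfterL_consL (r := 0) (fun w hw =>
        rep_of_not_mem fun h => ha (((mem_of_mem_del hw).2 a).1 h)), if_pos hPa, insAfter,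
        if_pos hPa, rep_of_not_mem ha, pow_zero, one_smul, one_smul, delL_consL_of_not_mem
        (fun w hw h => by
          rcases (mem_iff_of_mem_bead hw a).1 h with h | h
          · exact hya h
          · exact ha h), ← map_add, e]
      simp
    · have hP' : ∃ a ∈ u, P a := by
        obtain ⟨c, hc, hPc⟩ := hP
        rcases List.mem_cons.1 hc with rfl | hc
        · exact absurd hPc hPa
        · exact ⟨c, hc, hPc⟩
      have ih := ih hyu hu' hP'
      have e : delL 𝕜 (beadAfter 𝕜 P y u) = Finsupp.single (insAfter P y u) 1 -
          Finsupp.single (u ++ [y]) 1 - beadAfterL 𝕜 P y (del 𝕜 u) := by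
        rw [← ih]; abel
      rw [beadAfter, if_neg hPa, map_smul, insAfter, if_neg hPa]
      by_cases ha : a ∈ u
      · rw [delL_consL_of_mem fun w hw => (mem_iff_of_mem_beadAfter hw a).2 (Or.inr ha), e,
          eraseOnceL_beadAfter hPa hya, del_cons_of_mem ha, map_sub (beadAfterL 𝕜 P y),
          map_sub (beadAfterL 𝕜 P y), beadAfterL_single, beadAfterL_consL (r := 1) (fun w hw =>
          rep_of_mem (((mem_of_mem_del hw).2 a).2 ha)), beadAfterL_consL (r := 0)
          (fun w hw => rep_of_not_mem fun h => (((mem_of_mem_eraseOnce hw).2.2 a).1 h).1 rfl),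
          rep_of_mem ha, if_neg hPa, if_neg hPa]
        simp only [map_sub, consL_single, pow_zero, pow_one, one_smul, neg_smul, List.cons_append]
        abel
      · rw [delL_consL_of_not_mem fun w hw h => by
            rcases (mem_iff_of_mem_beadAfter hw a).1 h with h | h
            · exact hya h
            · exact ha h, e, del_cons_of_not_mem ha,
          beadAfterL_consL (r := 0) (fun w hw =>
          rep_of_not_mem fun h => ha (((mem_of_mem_del hw).2 a).1 h)), rep_of_not_mem ha,
          if_neg hPa]
        simp only [map_sub, consL_single, pow_zero, one_smul, List.cons_append]
        abel

theorem decL_consL {a r : ℕ} {S : List ℕ →₀ 𝕜} (hS : ∀ w ∈ S.support, rep a w = r) :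
    decL 𝕜 (consL 𝕜 a S) = consL 𝕜 (a, r) (decL 𝕜 S) := by
  have := Finsupp.map_eq_of_forall_support ((decL 𝕜).comp (consL 𝕜 a))
    ((consL 𝕜 (a, r)).comp (decL 𝕜)) S (fun w hw => by simp [hS w hw])
  simpa using this

/-- The letter y is new, so its weight is 0; the first of the two copies of a recurs and has weight
1, the second keeps the weight of the original a. -/
theorem decL_bead {u : List ℕ} (hy : y ∉ u) :
    decL 𝕜 (bead 𝕜 P y u) = beadD 𝕜 P y (dec u) := by
  induction u with
  | nil => simp [bead]
  | cons a u ih =>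
    have hya : a ≠ y := fun h => hy (by simp [h])
    have hyu : y ∉ u := fun h => hy (by simp [h])
    by_cases hPa : P a
    · rw [bead_cons_of hPa, dec_cons, beadD_cons_of (by exact hPa), map_zero]
    · rw [bead_cons_of_not hPa, dec_cons, beadD_cons_of_not (by exact hPa), map_add, map_smul,
        decL_consL (r := rep a u) (fun w hw => rep_congr (by
          simp [mem_iff_of_mem_bead hw, hya])), ih hyu, decL_single]
      simp [rep, hya.symm, hyu]

theorem decL_beadAfter {u : List ℕ} (hy : y ∉ u) :
    decL 𝕜 (beadAfter 𝕜 P y u) = beadAfterD 𝕜 P y (dec u) := by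
  induction u with
  | nil => simp [beadAfter, beadAfterD]
  | cons a u ih =>
    have hya : a ≠ y := fun h => hy (by simp [h])
    have hyu : y ∉ u := fun h => hy (by simp [h])
    rw [beadAfter, dec_cons, beadAfterD, map_smul]
    split_ifs with hPa
    · rw [decL_consL (r := rep a u) (fun w hw => rep_congr (by
          simp [mem_iff_of_mem_bead hw, hya])), decL_bead hyu]
    · rw [decL_consL (r := rep a u) (fun w hw => rep_congr (by
          simp [mem_iff_of_mem_beadAfter hw, hya])), ih hyu]

theorem decL_beadL {S : List ℕ →₀ 𝕜} (hS : ∀ w ∈ S.support, y ∉ w) :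
    decL 𝕜 (beadL 𝕜 P y S) = beadDL 𝕜 P y (decL 𝕜 S) := by
  have := Finsupp.map_eq_of_forall_support ((decL 𝕜).comp (beadL 𝕜 P y))
    ((beadDL 𝕜 P y).comp (decL 𝕜)) S (fun w hw => by simp [decL_bead (hS w hw)])
  simpa using this

theorem decL_beadAfterL {S : List ℕ →₀ 𝕜} (hS : ∀ w ∈ S.support, y ∉ w) :
    decL 𝕜 (beadAfterL 𝕜 P y S) = beadAfterDL 𝕜 P y (decL 𝕜 S) := by
  have := Finsupp.map_eq_of_forall_support ((decL 𝕜).comp (beadAfterL 𝕜 P y))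
    ((beadAfterDL 𝕜 P y).comp (decL 𝕜)) S (fun w hw => by simp [decL_beadAfter (hS w hw)])
  simpa using this

theorem undecL_decL (S : List ℕ →₀ 𝕜) : undecL 𝕜 (decL 𝕜 S) = S := by
  have := Finsupp.map_eq_of_forall_support ((undecL 𝕜).comp (decL 𝕜)) LinearMap.id S
    (fun w _ => by simp [map_fst_dec])
  simpa using this

end

end Words

namespace Words

theorem fst_mem_of_mem_dec {u : List ℕ} {a : ℕ × ℕ} (ha : a ∈ dec u) : a.1 ∈ u :=
  (forall_mem_dec (p := (· ∈ u))).2 (fun _ h => h) a ha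

theorem snd_eq_zero_of_mem_dec {t : ℕ} {u : List ℕ} (hu : u.count t = 1) {a : ℕ × ℕ}
    (ha : a ∈ dec u) (hat : a.1 = t) : a.2 = 0 := by
  induction u with
  | nil => simp at ha
  | cons x u ih =>
    rw [dec_cons, List.mem_cons] at ha
    by_cases hx : x = t
    · subst hx
      rw [List.count_cons_self, Nat.add_eq_right, List.count_eq_zero] at hu
      rcases ha with rfl | ha
      · exact rep_of_not_mem hu
      · exact absurd (hat ▸ fst_mem_of_mem_dec ha) hu
    · rw [List.count_cons_of_ne hx] at hu
      rcases ha with rfl | ha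
      · exact absurd hat hx
      · exact ih hu ha

/-! ## The words of `m_ξ` -/

section

variable {𝕜 : Type u} [CommRing 𝕜]

variable (𝕜) in
/-- The unsigned operations `□` and `■` on words. -/
noncomputable def ringL (s : Symb) (n : ℕ) : (List ℕ →₀ 𝕜) →ₗ[𝕜] (List ℕ →₀ 𝕜) :=
  match s with
  | Symb.white => beadL 𝕜 (· = n) (n + 1)
  | Symb.black => -beadAfterL 𝕜 (· = n) (n + 1)

/-- The word of `m_□` and of `m_■`. -/
def base : Symb → List ℕ
  | Symb.white => [2, 1]
  | Symb.black => [1, 2]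

/-- Composition of words. -/
noncomputable abbrev circW (n t : ℕ) :
    (List ℕ →₀ 𝕜) →ₗ[𝕜] (List ℕ →₀ 𝕜) →ₗ[𝕜] (List ℕ →₀ 𝕜) :=
  compMapL (relabelOut t n) (relabelIn t) t

theorem not_mem_of_isGood {n : ℕ} {k : ℤ} {w : List ℕ} (h : IsGood n k w) : n + 1 ∉ w := by
  intro h'
  have := ((h.2.2 _).1 h').2
  omega

theorem decL_ringL {s : Symb} {n : ℕ} {k : ℤ} {S : List ℕ →₀ 𝕜}
    (hS : ∀ w ∈ S.support, IsGood n k w) :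
    decL 𝕜 (ringL 𝕜 s n S) =
      match s with
      | Symb.white => beadDL 𝕜 (· = n) (n + 1) (decL 𝕜 S)
      | Symb.black => -beadAfterDL 𝕜 (· = n) (n + 1) (decL 𝕜 S) := by
  cases s
  · exact decL_beadL fun w hw => not_mem_of_isGood (hS w hw)
  · simp only [ringL, LinearMap.neg_apply, map_neg,
      decL_beadAfterL fun w hw => not_mem_of_isGood (hS w hw)]

section comp

variable {m n r : ℕ} {a b : ℤ} {v u : List ℕ}

/-- For t < m the top letter of the composite is the image of m, a letter of v other than t. Thus
the beads are placed relative to a letter of the outer word, and inserting them commutes with the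
grafting (`beadDL_graft`, `beadAfterDL_graft`). -/
theorem ringL_compMap_of_lt (s : Symb) (hv : IsGood m a v) (hu : IsGood n b u) {t : ℕ}
    (ht : 1 ≤ t) (htm : t < m) (hr : r + 1 = m + n) :
    ringL 𝕜 s r (compMap 𝕜 (relabelOut t n) (relabelIn t) t v u) =
      circW n t (ringL 𝕜 s m (Finsupp.single v 1)) (Finsupp.single u 1) := by
  have hn := hu.1
  rw [← undecL_decL (ringL 𝕜 s r _), decL_ringL fun w hw => isGood_of_mem_compMap hv hu
    ⟨ht, htm.le⟩ hr rfl hw, circW, compMapL_apply, decL_ringL (isGood_of_mem_single hv),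
    (compatible_relabel hv hu ⟨ht, htm.le⟩).decL_compMap, decL_single, decL_single]
  have hX : ∀ c ∈ dec v, c.1 ≠ t → (relabelOut t n c.1 = r ↔ c.1 = m) := by
    intro c hc hct
    have := (hv.2.2 _).1 (fst_mem_of_mem_dec hc)
    unfold relabelOut
    split_ifs <;> omega
  have hY : ∀ c ∈ dec u, ¬ relabelIn t c.1 = r := by
    intro c hc
    have := (hu.2.2 _).1 (fst_mem_of_mem_dec hc)
    unfold relabelIn
    omega
  have hf : relabelOut t n (m + 1) = r + 1 := by
    unfold relabelOut
    split_ifs <;> omega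
  cases s
  · dsimp only
    rw [beadDL_graft (P := (· = m)) (P' := (· = r)) (y := m + 1) (by omega) hf (by omega) _ _ hX hY,
      beadDL_single]
  · dsimp only
    rw [beadAfterDL_graft (P := (· = m)) (P' := (· = r)) (y := m + 1) (by omega) hf (by omega) _ _
      hX hY, beadAfterDL_single, map_neg (graftL 𝕜 _ _ _), LinearMap.neg_apply]

/-- For t = m the top letter of the composite comes from the top letter of u, which is inserted as a
whole because m occurs once in v. Before it lie the letters of v before m and the letters of u
before n, and similarly after it; hence the two summands. -/
theorem ringL_compMap_last (s : Symb) (hv : IsGood m a v) (hu : IsGood n b u)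
    (hvm : v.count m = 1) (hun : u.count n = 1) (hr : r + 1 = m + n) :
    ringL 𝕜 s r (compMap 𝕜 (relabelOut m n) (relabelIn m) m v u) =
      circW n m (ringL 𝕜 s m (Finsupp.single v 1)) (Finsupp.single u 1) +
      (-1 : 𝕜) ^ deg v • circW n m (Finsupp.single v 1) (ringL 𝕜 s n (Finsupp.single u 1)) := by
  have hn := hu.1
  have hm := hv.1
  rw [← undecL_decL (ringL 𝕜 s r _), decL_ringL fun w hw => isGood_of_mem_compMap hv hu
    ⟨hm, le_rfl⟩ hr rfl hw, circW, compMapL_apply, compMapL_apply,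
    decL_ringL (isGood_of_mem_single hv), decL_ringL (isGood_of_mem_single hu),
    (compatible_relabel hv hu ⟨hm, le_rfl⟩).decL_compMap, decL_single, decL_single]
  have hX : ((dec v).map Prod.fst).count m = 1 := by rw [map_fst_dec, hvm]
  have hX' : ∀ c ∈ dec v, c.1 ≠ m → ¬ relabelOut m n c.1 = r := by
    intro c hc hct
    have := (hv.2.2 _).1 (fst_mem_of_mem_dec hc)
    unfold relabelOut
    split_ifs <;> omega
  have hY : ∃ c ∈ dec u, c.1 = n :=
    (exists_mem_dec (p := (· = n))).2 ⟨n, List.count_pos_iff.1 (by omega : 0 < u.count n), rfl⟩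
  have hP : ∀ c ∈ dec u, (relabelIn m c.1 = r ↔ c.1 = n) := by
    intro c hc
    have := (hu.2.2 _).1 (fst_mem_of_mem_dec hc)
    unfold relabelIn
    omega
  have hf : relabelOut m n (m + 1) = r + 1 := by
    unfold relabelOut
    split_ifs <;> omega
  have hg : relabelIn m (n + 1) = r + 1 := by
    unfold relabelIn
    omega
  cases s
  · dsimp only
    rw [beadDL_graft_inner (P := (· = n)) (P' := (· = r)) (y := m + 1) (by omega) hf hg _ _ hX
      (fun c hc hct => snd_eq_zero_of_mem_dec hvm hc hct) hX' hY hP, beadDL_single, beadDL_single,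
      map_add, map_smul]
    rfl
  · dsimp only
    rw [beadAfterDL_graft_inner (P := (· = n)) (P' := (· = r)) (y := m + 1) (by omega) hf hg _ _ hX
      (fun c hc hct => snd_eq_zero_of_mem_dec hvm hc hct) hX' hY
      (fun c hc hct => snd_eq_zero_of_mem_dec hun hc hct) hP, beadAfterDL_single,
      beadAfterDL_single, map_neg (graftL 𝕜 _ _ _), LinearMap.neg_apply, map_neg (graftL 𝕜 _ _ _ _),
      neg_add, map_add, map_neg (undecL 𝕜), map_neg (undecL 𝕜), map_neg (undecL 𝕜), map_smul,
      smul_neg]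
    rfl

theorem bilinear_ext_support {α β M : Type*} [AddCommGroup M] [Module 𝕜 M]
    {F G : (α →₀ 𝕜) →ₗ[𝕜] (β →₀ 𝕜) →ₗ[𝕜] M} {S : α →₀ 𝕜} {T : β →₀ 𝕜}
    (h : ∀ v ∈ S.support, ∀ u ∈ T.support,
      F (Finsupp.single v 1) (Finsupp.single u 1) = G (Finsupp.single v 1) (Finsupp.single u 1)) :
    F S T = G S T :=
  Finsupp.map_eq_of_forall_support (F.flip T) (G.flip T) S fun v hv =>
    Finsupp.map_eq_of_forall_support (F (Finsupp.single v 1)) (G (Finsupp.single v 1)) T (h v hv)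

variable {S T : List ℕ →₀ 𝕜}

theorem ringL_circW_of_lt (s : Symb) (hS : ∀ v ∈ S.support, IsGood m a v)
    (hT : ∀ u ∈ T.support, IsGood n b u) {t : ℕ}
    (ht : 1 ≤ t) (htm : t < m) (hr : r + 1 = m + n) :
    ringL 𝕜 s r (circW n t S T) = circW n t (ringL 𝕜 s m S) T :=
  bilinear_ext_support (F := (circW n t).compr₂ (ringL 𝕜 s r)) (G := (circW n t).comp (ringL 𝕜 s m))
    fun v hv u hu => by
      simpa [circW] using ringL_compMap_of_lt (𝕜 := 𝕜) s (hS v hv) (hT u hu) ht htm hr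

theorem ringL_circW_last (s : Symb) {d : ℕ}
    (hS : ∀ v ∈ S.support, IsGood m d v ∧ v.count m = 1)
    (hT : ∀ u ∈ T.support, IsGood n b u ∧ u.count n = 1) (hr : r + 1 = m + n) :
    ringL 𝕜 s r (circW n m S T) =
      circW n m (ringL 𝕜 s m S) T + (-1 : 𝕜) ^ d • circW n m S (ringL 𝕜 s n T) :=
  bilinear_ext_support (F := (circW n m).compr₂ (ringL 𝕜 s r))
    (G := (circW n m).comp (ringL 𝕜 s m) + (-1 : 𝕜) ^ d • (circW n m).compl₂ (ringL 𝕜 s n))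
    fun v hv u hu => by
      have h : deg v = d := by exact_mod_cast (hS v hv).1.deg_eq
      simpa [circW, h] using ringL_compMap_last (𝕜 := 𝕜) s (hS v hv).1 (hT u hu).1 (hS v hv).2
        (hT u hu).2 hr

end comp

/-! ### The differential of `m_ξ` -/

/-- The words (n+1, u) and (u, n+1) are outer ends of the telescoping sums `delL_bead_add` and
`delL_beadAfter_add`. The inner ends, with n + 1 next to n, are identified in `compMap_base_right`.
-/
theorem compMap_base_left (s : Symb) {n : ℕ} {k : ℤ} {u : List ℕ} (hu : IsGood n k u) :
    compMap 𝕜 (relabelOut 1 n) (relabelIn 1) 1 (base s) u =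
      Finsupp.single (match s with
        | Symb.white => (n + 1) :: u
        | Symb.black => u ++ [n + 1]) 1 := by
  have h1 : relabelIn 1 = id := by funext x; simp [relabelIn]
  have h2 : relabelOut 1 n 2 = n + 1 := by simp [relabelOut]; omega
  cases s
  · rw [base, compMap_cons_of_ne (by omega), compMap_singleton_left _ hu.ne_nil, consL_single, h1,
      h2, List.map_id]
  · have key : ∀ w : List ℕ, w ≠ [] →
        compMap 𝕜 (relabelOut 1 n) (relabelIn 1) 1 [1, 2] w = Finsupp.single (w ++ [n + 1]) 1 := by
      intro w hw
      induction w with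
      | nil => exact absurd rfl hw
      | cons x w ih =>
        rw [compMap_cons_cons, h1]
        rw [h1] at ih
        by_cases hw' : w = []
        · subst hw'
          rw [compMap_nil_right, compMap_of_not_mem (by simp)]
          simp [h2]
        · rw [ih hw', compMap_of_not_mem_eq_zero (by simp) (by simpa using hw')]
          simp [deg, rep]
    exact key u hu.ne_nil

theorem compMap_pair {f g : ℕ → ℕ} {t b c : ℕ} (hbc : b ≠ c) (A B : List ℕ) (hA : t ∉ A)
    (hB : t ∉ B) :
    compMap 𝕜 f g t (A ++ t :: B) [b, c] =
      Finsupp.single (A.map f ++ g b :: g c :: B.map f) 1 := by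
  induction A with
  | nil =>
    rw [List.nil_append, compMap_cons_cons, compMap_cons_cons, compMap_nil_right,
      compMap_of_not_mem hB, compMap_of_not_mem_eq_zero hB (by simp)]
    simp [rep, hbc]
  | cons a A ih =>
    rw [List.cons_append, compMap_cons_of_ne (by rintro rfl; simp at hA),
      ih fun h => hA (by simp [h])]
    simp

theorem insBefore_append {P : ℕ → Prop} [DecidablePred P] {y t : ℕ} {A B : List ℕ}
    (hA : ∀ a ∈ A, ¬ P a) (ht : P t) : insBefore P y (A ++ t :: B) = A ++ y :: t :: B := by
  induction A with
  | nil => simp [insBefore, ht]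
  | cons a A ih =>
    simp [insBefore, hA a (by simp), ih fun b hb => hA b (by simp [hb])]

theorem insAfter_append {P : ℕ → Prop} [DecidablePred P] {y t : ℕ} {A B : List ℕ}
    (hA : ∀ a ∈ A, ¬ P a) (ht : P t) : insAfter P y (A ++ t :: B) = A ++ t :: y :: B := by
  induction A with
  | nil => simp [insAfter, ht]
  | cons a A ih =>
    simp [insAfter, hA a (by simp), ih fun b hb => hA b (by simp [hb])]

theorem exists_split_of_count {n : ℕ} {u : List ℕ} (h : u.count n = 1) :
    ∃ A B, u = A ++ n :: B ∧ n ∉ A ∧ n ∉ B := by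
  obtain ⟨A, B, rfl⟩ := List.append_of_mem (List.count_pos_iff.1 (by omega : 0 < u.count n))
  rw [List.count_append, List.count_cons_self] at h
  exact ⟨A, B, rfl, List.count_eq_zero.1 (by omega), List.count_eq_zero.1 (by omega)⟩

theorem compMap_base_right (s : Symb) {n : ℕ} {k : ℤ} {u : List ℕ} (hu : IsGood n k u)
    (hn : u.count n = 1) :
    compMap 𝕜 (relabelOut n 2) (relabelIn n) n u (base s) =
      Finsupp.single (match s with
        | Symb.white => insBefore (· = n) (n + 1) u
        | Symb.black => insAfter (· = n) (n + 1) u) 1 := by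
  obtain ⟨A, B, rfl, hA, hB⟩ := exists_split_of_count hn
  have hmap : ∀ C : List ℕ, (∀ x ∈ C, x ∈ A ++ n :: B) → n ∉ C → C.map (relabelOut n 2) = C := by
    intro C hC hnC
    conv_rhs => rw [← List.map_id C]
    refine List.map_congr_left fun x hx => ?_
    have h1 := (hu.2.2 x).1 (hC x hx)
    have h2 : x ≠ n := by rintro rfl; exact hnC hx
    simp only [relabelOut, id]
    split_ifs <;> omega
  have h1 : relabelIn n 1 = n := by simp [relabelIn]
  have h2 : relabelIn n 2 = n + 1 := by simp [relabelIn]; omega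
  have hA' : ∀ a ∈ A, ¬ a = n := fun a ha h => hA (h ▸ ha)
  cases s
  · rw [base, compMap_pair (by omega) A B hA hB, hmap A (by simp +contextual) hA,
      hmap B (by simp +contextual) hB, h1, h2, insBefore_append hA' rfl]
  · rw [base, compMap_pair (by omega) A B hA hB, hmap A (by simp +contextual) hA,
      hmap B (by simp +contextual) hB, h1, h2, insAfter_append hA' rfl]

/-- The operation is a homotopy between composing with the product on one side and on the other: the
telescoping sums have exactly these two composites as their ends. The single occurrence of n keeps
the differential from deleting the letter that bounds the beads. -/
theorem delL_ringL (s : Symb) {n : ℕ} {k : ℤ} {S : List ℕ →₀ 𝕜}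
    (hS : ∀ u ∈ S.support, IsGood n k u ∧ u.count n = 1) :
    delL 𝕜 (ringL 𝕜 s n S) = -ringL 𝕜 s n (delL 𝕜 S) +
      circW n 1 (Finsupp.single (base s) 1) S - circW 2 n S (Finsupp.single (base s) 1) := by
  have := Finsupp.map_eq_of_forall_support ((delL 𝕜).comp (ringL 𝕜 s n))
    (-(ringL 𝕜 s n).comp (delL 𝕜) + circW n 1 (Finsupp.single (base s) 1) -
      (circW 2 n).flip (Finsupp.single (base s) 1)) S (fun u hu => by
      obtain ⟨hg, hc⟩ := hS u hu
      have h1 : ∀ a ∈ u, a = n → u.count a = 1 := by rintro a - rfl; exact hc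
      have h2 := delL_bead_add (𝕜 := 𝕜) (P := (· = n)) (y := n + 1) u (not_mem_of_isGood hg) h1
      have h3 := delL_beadAfter_add (𝕜 := 𝕜) (P := (· = n)) (y := n + 1) u (not_mem_of_isGood hg) h1
        ⟨n, List.count_pos_iff.1 (by omega), rfl⟩
      have h4 := compMap_base_left (𝕜 := 𝕜) s hg
      have h5 := compMap_base_right (𝕜 := 𝕜) s hg hc
      simp only [LinearMap.comp_apply, LinearMap.add_apply, LinearMap.sub_apply,
        LinearMap.neg_apply, LinearMap.flip_apply, circW, compMapL_single, delL_single, h4, h5]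
      cases s
      · simp only [ringL, beadL_single]
        rw [add_sub_assoc, ← h2]
        abel
      · simp only [ringL, beadAfterL_single, LinearMap.neg_apply, map_neg, neg_neg]
        rw [add_sub_assoc, ← neg_sub, ← h3]
        abel)
  simpa using this

end

end Words

/-! ### The linear combinations of words that represent the images of the generators -/

namespace Words

open StrOp

section

variable {𝕜 : Type u} [CommRing 𝕜]

variable (𝕜) in
/-- The linear combination of words `μ(m_ξ)`, the string `ξ` being read from right to left. -/
noncomputable def cactusRev : List Symb → (List ℕ →₀ 𝕜)
  | [] => 0
  | [s] => Finsupp.single (base s) 1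
  | s :: t :: ξ => (-1 : 𝕜) ^ (ξ.length + 2) • ringL 𝕜 s (ξ.length + 2) (cactusRev (t :: ξ))

variable (𝕜) in
/-- The linear combination of words `μ(m_ξ)`. -/
noncomputable def cactusSum (ξ : List Symb) : List ℕ →₀ 𝕜 := cactusRev 𝕜 ξ.reverse

@[simp] theorem cactusSum_nil : cactusSum 𝕜 [] = 0 := rfl

@[simp] theorem cactusSum_singleton (s : Symb) : cactusSum 𝕜 [s] = Finsupp.single (base s) 1 := rfl

/-- All words of μ(m_ξ) have degree k = n - 2 with n = |ξ| + 1, so the global sign (-1)^k of □ and ■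
is (-1)^n and can be taken out. -/
theorem cactusSum_append {ξ : List Symb} (hξ : ξ ≠ []) (s : Symb) :
    cactusSum 𝕜 (ξ ++ [s]) =
      (-1 : 𝕜) ^ (ξ.length + 1) • ringL 𝕜 s (ξ.length + 1) (cactusSum 𝕜 ξ) := by
  obtain ⟨t, η, h⟩ := List.exists_cons_of_ne_nil (mt List.reverse_eq_nil_iff.1 hξ)
  have hl : ξ.length = η.length + 1 := by rw [← List.length_reverse, h, List.length_cons]
  rw [cactusSum, cactusSum, List.reverse_append, List.reverse_singleton, List.singleton_append, h,
    cactusRev, hl]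

/-- The words that are cacti of arity `n` and degree `n - 2` in which `n` occurs once. -/
structure IsTopCactus (n : ℕ) (w : List ℕ) : Prop where
  isSurj : IsSurj n (n - 2) w
  isCactus : IsCactus w
  count_eq : w.count n = 1

theorem IsTopCactus.isGood {n : ℕ} {w : List ℕ} (h : IsTopCactus n w) : IsGood n (n - 2) w :=
  (isSurj_iff.1 h.isSurj).1

theorem filter_ne_of_not_mem {y : ℕ} {C : List ℕ} (hC : y ∉ C) : C.filter (· ≠ y) = C :=
  List.filter_eq_self.2 fun x hx => by
    have : x ≠ y := by rintro rfl; exact hC hx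
    simpa using this

theorem filter_ne_append_bead {y a : ℕ} {A B : List ℕ} (hA : y ∉ A) (hB : y ∉ B) (ha : a ≠ y) :
    (A ++ a :: y :: a :: B).filter (· ≠ y) = (A ++ [a]) ++ (a :: B) := by
  rw [List.filter_append, filter_ne_of_not_mem hA, List.filter_cons_of_pos (by simpa using ha),
    List.filter_cons_of_neg (by simp), List.filter_cons_of_pos (by simpa using ha),
    filter_ne_of_not_mem hB]
  simp

/-- A subword avoiding the inserted letter. -/
theorem sublist_of_sublist_bead {y a : ℕ} {A B p : List ℕ} (hA : y ∉ A) (hB : y ∉ B) (ha : a ≠ y)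
    (hp : p.IsChain (· ≠ ·)) (hyp : y ∉ p) (h : p.Sublist (A ++ a :: y :: a :: B)) :
    p.Sublist (A ++ a :: B) := by
  have h1 := h.filter (· ≠ y)
  rw [filter_ne_append_bead hA hB ha, filter_ne_of_not_mem hyp] at h1
  exact sublist_of_dup hp h1

/-- The inserted letter occurs once and cannot take part in (i, j, i, j). A subsequence avoiding it
lives in (A, a, a, B), and having no equal neighbours it lives in (A, a, B). -/
theorem isCactus_bead {y a : ℕ} {A B : List ℕ} (hA : y ∉ A) (hB : y ∉ B) (ha : a ≠ y)
    (h : IsCactus (A ++ a :: B)) : IsCactus (A ++ a :: y :: a :: B) := by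
  intro i j hij hs
  have hc : (A ++ a :: y :: a :: B).count y = 1 := by
    simp [List.count_append, List.count_eq_zero_of_not_mem hA, List.count_eq_zero_of_not_mem hB, ha]
  have hcount := hs.count_le y
  rw [hc] at hcount
  by_cases hi : i = y
  · subst hi
    simp [hij.symm] at hcount
  · by_cases hj : j = y
    · subst hj
      simp [hij] at hcount
    · exact h i j hij (sublist_of_sublist_bead hA hB ha (by simp [hij, hij.symm])
        (by simp [Ne.symm hi, Ne.symm hj]) hs)

theorem isChain_bead {y a : ℕ} {A B : List ℕ} (ha : a ≠ y) :
    (A ++ a :: y :: a :: B).IsChain (· ≠ ·) ↔ (A ++ a :: B).IsChain (· ≠ ·) := by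
  rw [List.isChain_split, List.isChain_split (l₁ := A) (l₂ := B)]
  simp [ha, ha.symm]

theorem isTopCactus_bead {n a : ℕ} {A B : List ℕ} 
    (h : IsTopCactus n (A ++ a :: B)) : IsTopCactus (n + 1) (A ++ a :: (n + 1) :: a :: B) := by
  have hny := not_mem_of_isGood h.isGood
  have hA : n + 1 ∉ A := fun h' => hny (by simp [h'])
  have hB : n + 1 ∉ B := fun h' => hny (by simp [h'])
  have ha : a ≠ n + 1 := fun h' => hny (by simp [h'])
  obtain ⟨h1, h2, h3, h4⟩ := h.isSurj
  refine ⟨⟨by omega, ?_, fun x => ?_, (isChain_bead ha).2 h4⟩, isCactus_bead hA hB ha h.isCactus, ?_⟩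
  · simp only [List.length_append, List.length_cons] at h2 ⊢
    push_cast at h2 ⊢
    omega
  · have := h3 x
    simp only [List.mem_append, List.mem_cons] at this ⊢
    by_cases hx : x = n + 1
    · simp [hx]
    · have : 1 ≤ x ∧ x ≤ n + 1 ↔ 1 ≤ x ∧ x ≤ n := by omega
      tauto
  · simp [List.count_append, List.count_eq_zero_of_not_mem hA, List.count_eq_zero_of_not_mem hB, ha]

theorem exists_of_mem_ringL {s : Symb} {n : ℕ} {S : List ℕ →₀ 𝕜}
    (hS : ∀ u ∈ S.support, u.count n = 1) {w : List ℕ} (hw : w ∈ (ringL 𝕜 s n S).support) :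
    ∃ A a B, A ++ a :: B ∈ S.support ∧ w = A ++ a :: (n + 1) :: a :: B ∧ a ≠ n := by
  have key : ∀ f : List ℕ → (List ℕ →₀ 𝕜), w ∈ (Finsupp.linearCombination 𝕜 f S).support →
      ∃ u ∈ S.support, w ∈ (f u).support := by
    intro f hw
    rw [Finsupp.linearCombination_apply, Finsupp.sum] at hw
    obtain ⟨u, hu, hwu⟩ := Finset.mem_biUnion.1 (Finsupp.support_finsetSum hw)
    exact ⟨u, hu, mem_support_smul hwu⟩
  cases s
  · obtain ⟨u, hu, hwu⟩ := key _ hw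
    obtain ⟨A, a, B, rfl, rfl, ha, -⟩ := exists_of_mem_bead hwu
    exact ⟨A, a, B, hu, rfl, ha⟩
  · simp only [ringL, LinearMap.neg_apply, Finsupp.support_neg] at hw
    obtain ⟨u, hu, hwu⟩ := key _ hw
    obtain ⟨A, a, B, rfl, rfl, x, hx, rfl⟩ := exists_of_mem_beadAfter hwu
    refine ⟨A, a, B, hu, rfl, ?_⟩
    rintro rfl
    have h1 := hS _ hu
    have h2 := List.count_pos_iff.2 hx
    rw [List.count_append, List.count_cons_self] at h1
    omega

theorem isTopCactus_base (s : Symb) : IsTopCactus 2 (base s) := by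
  have h : ∀ i j, i ≠ j → ∀ w : List ℕ, w.length = 2 → ¬ [i, j, i, j].Sublist w := by
    intro i j _ w hw h
    have := h.length_le
    simp [hw] at this
  cases s <;> refine ⟨⟨by omega, by simp [base], fun x => ?_, by simp [base]⟩,
    fun i j hij => h i j hij _ rfl, by simp [base]⟩ <;> simp [base] <;> omega

theorem isTopCactus_of_mem (ξ : List Symb) :
    ∀ w ∈ (cactusSum 𝕜 ξ).support, IsTopCactus (ξ.length + 1) w := by
  induction ξ using List.reverseRecOn with
  | nil => simp
  | append_singleton ξ s ih =>
    intro w hw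
    by_cases hξ : ξ = []
    · subst hξ
      obtain rfl : w = _ := by simpa using Finsupp.support_single_subset hw
      exact isTopCactus_base s
    · rw [cactusSum_append hξ] at hw
      have hw' : w ∈ (ringL 𝕜 s (ξ.length + 1) (cactusSum 𝕜 ξ)).support :=
        Finsupp.support_smul hw
      obtain ⟨A, a, B, h, rfl, ha⟩ := exists_of_mem_ringL (fun u hu => (ih u hu).count_eq) hw'
      simpa using isTopCactus_bead (ih _ h)

theorem isGood_of_mem_cactusSum (ξ : List Symb) {w : List ℕ}
    (hw : w ∈ (cactusSum 𝕜 ξ).support) : IsGood (ξ.length + 1) (ξ.length - 1) w := by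
  have := (isTopCactus_of_mem ξ w hw).isGood
  have e : ((ξ.length + 1 : ℕ) : ℤ) - 2 = ξ.length - 1 := by push_cast; ring
  rwa [e] at this

/-! ### The differential of `μ(m_ξ)` -/

variable (𝕜) in
/-- The summand of the boundary of `μ(m_ξ)` belonging to a block. -/
noncomputable def wordTerm (ξ : List Symb) (a b : ℕ) : List ℕ →₀ 𝕜 :=
  circW (b - a + 1) (a + 1) (cactusSum 𝕜 (cut a b ξ)) (cactusSum 𝕜 (block a b ξ))

theorem wordTerm_of_cut_eq_nil {ξ : List Symb} {a b : ℕ} (h : cut a b ξ = []) :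
    wordTerm 𝕜 ξ a b = 0 := by simp [wordTerm, h]

theorem wordTerm_of_block_eq_nil {ξ : List Symb} {a b : ℕ} (h : block a b ξ = []) :
    wordTerm 𝕜 ξ a b = 0 := by simp [wordTerm, h]

theorem cut_append {Γ : Type} {ξ : List Γ} {a b : ℕ} (ha : a ≤ b) (hb : b ≤ ξ.length) (s : Γ) :
    cut a b (ξ ++ [s]) = cut a b ξ ++ [s] := by
  rw [cut, cut, List.take_append_of_le_length (by omega), List.drop_append_of_le_length hb,
    List.append_assoc]

theorem block_append {Γ : Type} {ξ : List Γ} {a b : ℕ} (ha : a ≤ b) (hb : b ≤ ξ.length) (s : Γ) :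
    block a b (ξ ++ [s]) = block a b ξ := by
  rw [block, block, List.drop_append_of_le_length (by omega), List.take_append_of_le_length
    (by rw [List.length_drop]; omega)]

theorem cut_append_last {Γ : Type} {ξ : List Γ} {a : ℕ} (ha : a ≤ ξ.length) (s : Γ) :
    cut a (ξ.length + 1) (ξ ++ [s]) = cut a ξ.length ξ := by
  rw [cut, cut, List.take_append_of_le_length ha, List.drop_of_length_le (by simp),
    List.drop_of_length_le le_rfl]

theorem block_append_last {Γ : Type} {ξ : List Γ} {a : ℕ} (ha : a ≤ ξ.length) (s : Γ) :
    block a (ξ.length + 1) (ξ ++ [s]) = block a ξ.length ξ ++ [s] := by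
  rw [block, block, List.drop_append_of_le_length ha, List.take_of_length_le (by simp; omega),
    List.take_of_length_le (by simp)]

theorem sum_pairs {M : Type*} [AddCommMonoid M] (N : ℕ) (F : ℕ → ℕ → M) :
    ∑ p ∈ pairs N, F p.1 p.2 =
      ∑ b ∈ Finset.range (N + 1), ∑ a ∈ Finset.range (b + 1), F a b := by
  rw [Finset.sum_sigma']
  refine Finset.sum_nbij' (fun p => ⟨p.2, p.1⟩) (fun q => (q.2, q.1)) ?_ ?_ ?_ ?_ ?_
  · intro p hp
    have := mem_pairs.1 hp
    simp only [Finset.mem_sigma, Finset.mem_range]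
    omega
  · intro q hq
    simp only [Finset.mem_sigma, Finset.mem_range] at hq
    rw [mem_pairs]
    dsimp only
    omega
  all_goals simp

theorem length_cut_add {ξ : List Symb} {a c d : ℕ} (h : ξ.length = a + c + d) :
    (cut a (a + c) ξ).length = a + d := by
  rw [length_cut (by omega) (by omega)]; omega

theorem length_block_add {ξ : List Symb} {a c d : ℕ} (h : ξ.length = a + c + d) :
    (block a (a + c) ξ).length = c := by
  rw [length_block (by omega)]; omega

theorem sum_triangle_succ_succ {M : Type*} [AddCommMonoid M] (N : ℕ) (G : ℕ → ℕ → M)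
    (hG : G (N + 1) (N + 1) = 0) :
    ∑ b ∈ Finset.range (N + 1 + 1), ∑ a ∈ Finset.range (b + 1), G a b =
      ∑ b ∈ Finset.range N, ∑ a ∈ Finset.range (b + 1), G a b +
        ∑ a ∈ Finset.range (N + 1), (G a N + G a (N + 1)) := by
  rw [Finset.sum_range_succ, Finset.sum_range_succ, Finset.sum_range_succ _ (N + 1), hG, add_zero,
    add_assoc, Finset.sum_add_distrib]

theorem neg_neg_one_pow_smul {M : Type*} [AddCommGroup M] [Module 𝕜 M] (k : ℕ) (x : M) :
    -((-1 : 𝕜) ^ k • x) = (-1 : 𝕜) ^ (k + 1) • x := by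
  rw [pow_succ, mul_neg_one, neg_smul]

/-- The block stops before the end of ξ, so the composition is not at the last input of the outer
factor and only that factor is changed. The sign is the one of `cactusSum_append` for the outer
factor, whose arity is a + d + 2. -/
theorem ringL_wordTerm_of_lt (s : Symb) (ξ : List Symb) {a c d : ℕ}
    (h : ξ.length = a + c + (d + 1)) :
    ringL 𝕜 s (ξ.length + 1) (wordTerm 𝕜 ξ a (a + c)) =
      (-1 : 𝕜) ^ (a + d + 2) • wordTerm 𝕜 (ξ ++ [s]) a (a + c) := by
  have hl := length_cut_add h
  have hl' := length_block_add h
  have hne : cut a (a + c) ξ ≠ [] := by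
    intro h0; rw [h0] at hl; simp at hl
  rw [wordTerm, wordTerm, cut_append (by omega) (by omega), block_append (by omega) (by omega),
    cactusSum_append hne, map_smul (circW _ _), LinearMap.smul_apply, smul_smul, hl,
    Nat.add_sub_cancel_left,
    ringL_circW_of_lt (m := a + d + 2) s (fun v hv => by
      have := isGood_of_mem_cactusSum _ hv; rwa [hl] at this)
    (fun u hu => by have := isGood_of_mem_cactusSum _ hu; rwa [hl'] at this)
    (by omega) (by omega) (by omega)]
  rw [← pow_add, show a + d + 2 + (a + (d + 1) + 1) = (a + d + 2) * 2 by ring,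
    neg_one_pow_mul_two, one_smul]
  rfl

/-- At the last input every other letter of v is smaller than m and is not shifted, so the arity of
the inner word plays no role. This is needed because appending s to the inner string raises that
arity. -/
theorem circW_last_congr {m n n' : ℕ} {k : ℤ} {S T : List ℕ →₀ 𝕜}
    (hS : ∀ v ∈ S.support, IsGood m k v) : circW n m S T = circW n' m S T :=
  bilinear_ext_support fun v hv u _ => by
    simp only [circW, compMapL_single, compMap]
    have h1 : ∀ X : List (ℕ × ℕ), X.map (Prod.map id id) = X := by simp
    have := graft_map (𝕜 := 𝕜) (f := relabelOut m n') (g := relabelIn m) (t := m) (f₀ := id)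
      (g₀ := id) (f' := relabelOut m n) (s := m) (dec v) (dec u) (fun a ha => by
        have := ((hS v hv).2.2 _).1 (fst_mem_of_mem_dec ha)
        refine ⟨id, fun h => ⟨h, ?_⟩⟩
        simp only [relabelOut, id]
        split_ifs <;> omega)
    rw [h1, h1] at this
    rw [this]
    rfl

/-- The block reaches the end of ξ, so the composition is at the last input and the Leibniz-like
formula `ringL_circW_last` applies. Its first term appends s to the outer string, so the block of ξs
stops before s; its second appends s to the inner string, so the block includes s. -/
theorem ringL_wordTerm_last (s : Symb) (ξ : List Symb) {a c : ℕ}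
    (h : ξ.length = a + 1 + (c + 1)) :
    ringL 𝕜 s (ξ.length + 1) (wordTerm 𝕜 ξ (a + 1) ξ.length) =
      (-1 : 𝕜) ^ a • wordTerm 𝕜 (ξ ++ [s]) (a + 1) ξ.length +
      (-1 : 𝕜) ^ (a + c) • wordTerm 𝕜 (ξ ++ [s]) (a + 1) (ξ.length + 1) := by
  have hl : (cut (a + 1) ξ.length ξ).length = a + 1 := by
    rw [length_cut (by omega) (by omega)]; omega
  have hl' : (block (a + 1) ξ.length ξ).length = c + 1 := by
    rw [length_block (by omega)]; omega
  have hne : cut (a + 1) ξ.length ξ ≠ [] := by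
    intro h0; rw [h0] at hl; simp at hl
  have hne' : block (a + 1) ξ.length ξ ≠ [] := by
    intro h0; rw [h0] at hl'; simp at hl'
  have e1 : ξ.length - (a + 1) + 1 = c + 2 := by omega
  have e2 : ξ.length + 1 - (a + 1) + 1 = c + 3 := by omega
  rw [wordTerm, wordTerm, wordTerm, cut_append (by omega) (by omega),
    block_append (by omega) (by omega), cut_append_last (by omega), block_append_last (by omega),
    cactusSum_append hne, cactusSum_append hne', map_smul (circW _ _),
    map_smul (circW _ _ _), LinearMap.smul_apply, smul_smul, smul_smul, hl, hl', e1, e2,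
    ringL_circW_last (m := a + 1 + 1) (d := a) s (fun v hv => by
      have h1 := isGood_of_mem_cactusSum _ hv
      have h2 := (isTopCactus_of_mem _ v hv).count_eq
      rw [hl] at h1 h2
      exact ⟨by simpa using h1, h2⟩)
    (fun u hu => by
      have h1 := isGood_of_mem_cactusSum _ hu
      have h2 := (isTopCactus_of_mem _ u hu).count_eq
      rw [hl'] at h1 h2
      exact ⟨h1, h2⟩) (by omega), ← pow_add, ← pow_add,
    show a + (a + 1 + 1) = (a + 1) * 2 by ring, neg_one_pow_mul_two, one_smul,
    show a + c + (c + 1 + 1) = a + (c + 1) * 2 by ring, pow_add, neg_one_pow_mul_two, mul_one,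
    circW_last_congr (S := cactusSum 𝕜 (cut (a + 1) ξ.length ξ)) (n := c + 2) (n' := c + 3) (k := a) (fun v hv => by
      have h1 := isGood_of_mem_cactusSum _ hv
      rw [hl] at h1
      simpa using h1)]

/-- The boundary of `μ(m_ξ)`. -/
theorem delL_cactusSum (ξ : List Symb) :
    delL 𝕜 (cactusSum 𝕜 ξ) = ∑ p ∈ pairs ξ.length,
      (-1 : 𝕜) ^ (p.1 + (p.2 - p.1 + 1) * (ξ.length - p.2)) • wordTerm 𝕜 ξ p.1 p.2 := by
  induction ξ using List.reverseRecOn with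
  | nil =>
    rw [cactusSum_nil, map_zero]
    exact (Finset.sum_eq_zero fun p _ => by rw [wordTerm_of_cut_eq_nil (by simp [cut]), smul_zero]).symm
  | append_singleton ξ s ih =>
    by_cases hξ : ξ = []
    · subst hξ
      rw [List.nil_append, cactusSum_singleton, delL_single]
      have h1 : del 𝕜 (base s) = 0 := by cases s <;> simp [base, del, eraseOnce]
      rw [h1]
      refine (Finset.sum_eq_zero fun p hp => ?_).symm
      obtain ⟨a, b⟩ := p
      have := mem_pairs.1 hp
      simp only [List.length_singleton] at this
      rcases (by omega : b = a ∨ a = 0 ∧ b = 1) with rfl | ⟨rfl, rfl⟩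
      · rw [wordTerm_of_block_eq_nil (by simp [block]), smul_zero]
      · rw [wordTerm_of_cut_eq_nil (by simp [cut]), smul_zero]
    have hN : 0 < ξ.length := List.length_pos_iff.2 hξ
    rw [sum_pairs ξ.length (fun a b => (-1 : 𝕜) ^ (a + (b - a + 1) * (ξ.length - b)) •
      wordTerm 𝕜 ξ a b)] at ih
    rw [sum_pairs _ (fun a b => (-1 : 𝕜) ^ (a + (b - a + 1) * ((ξ ++ [s]).length - b)) •
      wordTerm 𝕜 (ξ ++ [s]) a b), cactusSum_append hξ, map_smul, delL_ringL s (fun u hu =>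
        ⟨isGood_of_mem_cactusSum _ hu, (isTopCactus_of_mem _ u hu).count_eq⟩), ih,
      List.length_append, List.length_singleton]
    generalize hNN : ξ.length = N at *
    set L := circW (N + 1) 1 (Finsupp.single (base s) (1 : 𝕜)) (cactusSum 𝕜 ξ) with hL
    set R := circW 2 (N + 1) (cactusSum 𝕜 ξ) (Finsupp.single (base s) (1 : 𝕜)) with hR
    -- Blocks of ξs that end before position N come one to one from the same blocks of ξ.
    have hlt : ∀ b ∈ Finset.range N, ∀ a ∈ Finset.range (b + 1),
        (-1 : 𝕜) ^ (a + (b - a + 1) * (N + 1 - b)) • wordTerm 𝕜 (ξ ++ [s]) a b =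
        -((-1 : 𝕜) ^ (N + 1) • (-1 : 𝕜) ^ (a + (b - a + 1) * (N - b)) •
          ringL 𝕜 s (N + 1) (wordTerm 𝕜 ξ a b)) := by
      intro b hb a ha
      rw [Finset.mem_range] at hb ha
      obtain ⟨c, rfl⟩ := Nat.exists_eq_add_of_le (Nat.lt_succ_iff.1 ha)
      obtain ⟨d, rfl⟩ := Nat.exists_eq_add_of_lt hb
      rw [← hNN, ringL_wordTerm_of_lt s ξ (by omega), smul_smul, smul_smul, ← pow_add, ← pow_add,
        neg_neg_one_pow_smul, hNN]
      congr 1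
      rw [show a + c + d + 1 + 1 - (a + c) = d + 2 by omega,
        show a + c + d + 1 - (a + c) = d + 1 by omega, Nat.add_sub_cancel_left,
        show a + c + d + 1 + 1 + (a + (c + 1) * (d + 1)) + (a + d + 2) + 1 =
          (a + (c + 1) * (d + 2)) + (a + d + 2) * 2 by ring, pow_add _ _ ((a + d + 2) * 2),
        neg_one_pow_mul_two, mul_one]
    -- Blocks ending at N and at N + 1 are taken together, as both come from the block of ξ ending
    -- at N. The exceptions are a = 0, where the block ξ with outer string s gives the new term L,
    -- and a = N, where the block s with outer string ξ gives R. The corresponding terms of ξ are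
    -- zero, the outer or inner string being empty.
    have hlast : ∀ a ∈ Finset.range (N + 1),
        (-1 : 𝕜) ^ (a + (N - a + 1) * (N + 1 - N)) • wordTerm 𝕜 (ξ ++ [s]) a N +
        (-1 : 𝕜) ^ (a + (N + 1 - a + 1) * (N + 1 - (N + 1))) •
          wordTerm 𝕜 (ξ ++ [s]) a (N + 1) =
        -((-1 : 𝕜) ^ (N + 1) • (-1 : 𝕜) ^ (a + (N - a + 1) * (N - N)) •
          ringL 𝕜 s (N + 1) (wordTerm 𝕜 ξ a N)) +
        ((if a = 0 then (-1 : 𝕜) ^ (N + 1) • L else 0) -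
          (if a = N then (-1 : 𝕜) ^ (N + 1) • R else 0)) := by
      intro a ha
      rw [Finset.mem_range] at ha
      simp only [Nat.sub_self, Nat.add_sub_cancel_left, mul_zero, add_zero, mul_one]
      rcases Nat.eq_zero_or_pos a with rfl | ha0
      · rw [if_pos rfl, if_neg (by omega), wordTerm_of_cut_eq_nil (ξ := ξ ++ [s]) (b := N + 1)
          (by simp [cut, hNN]), wordTerm_of_cut_eq_nil (ξ := ξ) (by simp [cut, ← hNN]),
          wordTerm, cut_append (by omega) (by omega), block_append (by omega) (by omega)]
        simp [cut, block, ← hNN, hL]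
      · rcases (by omega : a = N ∨ a < N) with rfl | haN
        · rw [if_neg (by omega), if_pos rfl, wordTerm_of_block_eq_nil (ξ := ξ ++ [s]) (b := a)
            (by simp [block]), wordTerm_of_block_eq_nil (ξ := ξ) (by simp [block]), wordTerm]
          have e1 : cut a (a + 1) (ξ ++ [s]) = ξ := by simp [cut, ← hNN]
          have e2 : block a (a + 1) (ξ ++ [s]) = [s] := by simp [block, ← hNN]
          rw [e1, e2, cactusSum_singleton, Nat.add_sub_cancel_left, ← hR]
          simp [pow_succ]
        · rw [if_neg (by omega), if_neg (by omega), sub_zero, add_zero]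
          obtain ⟨a, rfl⟩ : ∃ a', a = a' + 1 := ⟨a - 1, by omega⟩
          obtain ⟨c, hc⟩ := Nat.exists_eq_add_of_lt haN
          have := ringL_wordTerm_last (𝕜 := 𝕜) s ξ (a := a) (c := c) (by omega)
          rw [hNN] at this
          rw [this, smul_add, smul_add, smul_smul, smul_smul, smul_smul, smul_smul, neg_add,
            ← pow_add, ← pow_add, ← pow_add, neg_neg_one_pow_smul, neg_neg_one_pow_smul]
          have e1 : (-1 : 𝕜) ^ (a + 1 + (N - (a + 1) + 1)) =
              (-1) ^ (N + 1 + (a + 1) + a + 1) := by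
            rw [show N + 1 + (a + 1) + a + 1 = a + 1 + (N - (a + 1) + 1) + (a + 1) * 2 by omega,
              pow_add _ _ ((a + 1) * 2), neg_one_pow_mul_two, mul_one]
          have e2 : (-1 : 𝕜) ^ (a + 1) = (-1) ^ (N + 1 + (a + 1) + (a + c) + 1) := by
            rw [show N + 1 + (a + 1) + (a + c) + 1 = a + 1 + (a + c + 2) * 2 by omega,
              pow_add _ _ ((a + c + 2) * 2), neg_one_pow_mul_two, mul_one]
          rw [e1, e2]
    rw [sum_triangle_succ_succ N (fun a b => (-1 : 𝕜) ^ (a + (b - a + 1) * (N + 1 - b)) •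
      wordTerm 𝕜 (ξ ++ [s]) a b) (by
        rw [wordTerm_of_block_eq_nil (by simp [block]), smul_zero]),
      Finset.sum_congr rfl hlast,
      Finset.sum_congr rfl fun b hb => Finset.sum_congr rfl (hlt b hb),
      Finset.sum_add_distrib, Finset.sum_sub_distrib, Finset.sum_ite_eq', Finset.sum_ite_eq',
      if_pos (by simp), if_pos (by simp), Finset.sum_range_succ _ N]
    simp only [map_add, map_sum, map_smul, smul_add, smul_sub, smul_neg, Finset.smul_sum,
      Finset.sum_neg_distrib]
    abel

end

end Words

/-! ## The morphism `μ` -/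

namespace Words

open StrOp

variable {𝕜 : Type u} [CommRing 𝕜]

theorem toSurj_mem_supported {n : ℕ} {k : ℤ} {Q : Set (Surj n k)} {S : List ℕ →₀ 𝕜}
    (hS : ∀ w ∈ S.support, ∀ h : IsSurj n k w, (show Surj n k from ⟨w, h⟩) ∈ Q) :
    toSurj 𝕜 n k S ∈ Finsupp.supported 𝕜 𝕜 Q := by
  rw [toSurj, Finsupp.linearCombination_apply]
  refine Submodule.sum_mem _ fun w hw => Submodule.smul_mem _ _ ?_
  by_cases h : IsSurj n k w
  · rw [ofWord_of_isSurj h]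
    exact Finsupp.single_mem_supported 𝕜 1 (hS w hw h)
  · rw [ofWord_of_not h]
    exact Submodule.zero_mem _

variable (𝕜) in
/-- The elements `μ(m_ξ)` of the operad of cacti. -/
noncomputable def cactusFamily : Family (cactusOperad 𝕜) Symb := fun ξ n d =>
  ⟨toSurj 𝕜 n d (cactusSum 𝕜 ξ), toSurj_mem_supported (Q := {u : Surj n d | IsCactus u.1})
    fun w hw _ => (isTopCactus_of_mem ξ w hw).isCactus⟩

theorem cactusVal_cactusFamily (ξ : List Symb) (n : ℕ) (d : ℤ) :
    cactusVal (cactusFamily 𝕜 ξ n d) = toSurj 𝕜 n d (cactusSum 𝕜 ξ) := rfl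

theorem cactusVal_injective {n : ℕ} {d : ℤ} :
    Function.Injective (cactusVal : (cactusOperad 𝕜).obj n d → SurjMod 𝕜 n d) :=
  Subtype.val_injective

theorem cactusVal_diff {n : ℕ} {d e : ℤ} (he : e + 1 = d) (x : (cactusOperad 𝕜).obj n d) :
    cactusVal ((cactusOperad 𝕜).diff he x) = surjDiff n d e (cactusVal x) := rfl

theorem cactusVal_circ {m n r : ℕ} {a b c : ℤ} (i : ℕ) (hi : 1 ≤ i ∧ i ≤ m) (hr : r + 1 = m + n)
    (hc : c = a + b) (x : (cactusOperad 𝕜).obj m a) (y : (cactusOperad 𝕜).obj n b) :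
    cactusVal ((cactusOperad 𝕜).circ i hi hr hc x y) =
      surjCirc m n r a b c i (cactusVal x) (cactusVal y) := rfl

theorem cactusVal_sum {n : ℕ} {d : ℤ} {ι : Type*} (s : Finset ι)
    (F : ι → (cactusOperad 𝕜).obj n d) :
    cactusVal (∑ i ∈ s, F i) = ∑ i ∈ s, cactusVal (F i) :=
  map_sum ((cactusSub 𝕜).carrier n d).subtype F s

theorem cactusVal_units_smul {n : ℕ} {d : ℤ} (ε : ℤˣ) (x : (cactusOperad 𝕜).obj n d) :
    cactusVal (ε • x) = ε • cactusVal x :=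
  map_zsmul ((cactusSub 𝕜).carrier n d).subtype (ε : ℤ) x

theorem cactusVal_term {ξ : List Symb} {n a b : ℕ} {e : ℤ} (hn : ξ.length + 1 = n)
    (he : e = n - 3) (hab : a ≤ b) (hb : b ≤ ξ.length) :
    cactusVal (term (cactusFamily 𝕜) n e ξ a b) = toSurj 𝕜 n e (wordTerm 𝕜 ξ a b) := by
  have h1 := length_cut hab hb
  have h2 := length_block (a := a) hb
  rw [term, tcirc_of (by omega) (by omega) (by omega), cactusVal_circ, cactusVal_cactusFamily,
    cactusVal_cactusFamily, surjCirc_toSurj _ _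
      (fun w hw => by simpa using isGood_of_mem_cactusSum _ hw)
      (fun w hw => by simpa using isGood_of_mem_cactusSum _ hw) (by omega), wordTerm, h2]

theorem diff_cactusFamily (ξ : List Symb) (n : ℕ) (d e : ℤ) (he : e + 1 = d) (h : IsStr ξ n d) :
    (cactusOperad 𝕜).diff he (cactusFamily 𝕜 ξ n d) = boundary (cactusFamily 𝕜) n e ξ := by
  obtain ⟨hn, hl, hd⟩ := h
  apply cactusVal_injective
  rw [cactusVal_diff, cactusVal_cactusFamily, surjDiff_toSurj _ (fun w hw => by
    have := isGood_of_mem_cactusSum ξ hw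
    rw [hl] at this
    rwa [show d = (ξ.length : ℤ) - 1 by omega]), delL_cactusSum, boundary, cactusVal_sum, map_sum]
  refine Finset.sum_congr rfl fun p hp => ?_
  obtain ⟨a, b⟩ := p
  obtain ⟨hab, hb⟩ := mem_pairs.1 hp
  dsimp only at hab hb ⊢
  rw [cactusVal_units_smul, cactusVal_term hl (by omega) hab hb, map_smul, bsign]
  refine (negOnePow_natCast_smul (𝕜 := 𝕜) ?_ _).symm
  push_cast [Nat.cast_sub hab, Nat.cast_sub hb]
  ring

variable (𝕜) in
/-- The morphism from the operad of homotopy matching dialgebras to the operad of cacti. -/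
noncomputable def cactusHom : DGOperadHom (matchingInfty 𝕜) (cactusOperad 𝕜) :=
  lift (isDGOperad_cactusOperad 𝕜) (cactusFamily 𝕜)
    (fun n d => cactusVal_injective (map_zero (toSurj 𝕜 n d))) diff_cactusFamily

theorem cactusVal_cactusHom {ξ : List Symb} {n : ℕ} {d : ℤ} (h : IsStr ξ n d) :
    cactusVal ((cactusHom 𝕜).map (mXi 𝕜 ξ h)) = toSurj 𝕜 n d (cactusSum 𝕜 ξ) := rfl

/-! ### The recursion for `μ(m_ξ)` -/

theorem ringWord_cons_succ (n x : ℕ) (u : List ℕ) (j : ℕ) :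
    ringWord n (x :: u) (j + 1) = x :: ringWord n u j := by
  simp [ringWord]

theorem bead_eq_sum (m n : ℕ) {u : List ℕ} (hu : m ∈ u) :
    bead 𝕜 (· = m) (n + 1) u = ∑ j ∈ Finset.range (u.idxOf m),
      (-1 : 𝕜) ^ relDeg u 0 j • Finsupp.single (ringWord n u j) 1 := by
  induction u with
  | nil => simp at hu
  | cons a u ih =>
    by_cases ha : a = m
    · subst ha
      rw [bead_cons_of (P := (· = a)) rfl, List.idxOf_cons_self, Finset.range_zero, Finset.sum_empty]
    · have hu' : m ∈ u := by
        rcases List.mem_cons.1 hu with rfl | h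
        · exact absurd rfl ha
        · exact h
      rw [bead_cons_of_not (P := (· = m)) ha, ih hu', List.idxOf_cons_ne _ ha,
        Finset.sum_range_succ', add_comm, relDeg_self, pow_zero, one_smul, map_sum, Finset.smul_sum]
      congr 1
      refine Finset.sum_congr rfl fun j _ => ?_
      rw [relDeg_cons_zero_succ, ringWord_cons_succ, map_smul, consL_single, smul_smul, pow_add]

theorem bead_false_eq_sum (n : ℕ) (u : List ℕ) :
    bead 𝕜 (fun _ => False) (n + 1) u = ∑ j ∈ Finset.range u.length,
      (-1 : 𝕜) ^ relDeg u 0 j • Finsupp.single (ringWord n u j) 1 := by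
  induction u with
  | nil => simp [bead]
  | cons a u ih =>
    rw [bead_cons_of_not (by simp), ih, List.length_cons,
      Finset.sum_range_succ', add_comm, relDeg_self, pow_zero, one_smul, map_sum, Finset.smul_sum]
    congr 1
    refine Finset.sum_congr rfl fun j _ => ?_
    rw [relDeg_cons_zero_succ, ringWord_cons_succ, map_smul, consL_single, smul_smul, pow_add]

theorem beadAfter_eq_sum (m n : ℕ) {u : List ℕ} (hu : m ∈ u) :
    beadAfter 𝕜 (· = m) (n + 1) u = ∑ j ∈ Finset.Ioo (u.idxOf m) u.length,
      (-1 : 𝕜) ^ relDeg u 0 j • Finsupp.single (ringWord n u j) 1 := by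
  induction u with
  | nil => simp at hu
  | cons a u ih =>
    have shift : ∀ (F : ℕ → (List ℕ →₀ 𝕜)) (b c : ℕ),
        ∑ j ∈ Finset.Ico (b + 1) (c + 1), F j = ∑ j ∈ Finset.Ico b c, F (j + 1) := fun F b c =>
      (Finset.sum_Ico_add' F b c 1).symm
    have hIoo : ∀ b c : ℕ, Finset.Ioo b c = Finset.Ico (b + 1) c := fun b c => by
      ext; simp
    have key : ∀ j, (-1 : 𝕜) ^ relDeg (a :: u) 0 (j + 1) •
        Finsupp.single (ringWord n (a :: u) (j + 1)) (1 : 𝕜) = (-1 : 𝕜) ^ rep a u •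
        consL 𝕜 a ((-1 : 𝕜) ^ relDeg u 0 j • Finsupp.single (ringWord n u j) 1) := fun j => by
      rw [relDeg_cons_zero_succ, ringWord_cons_succ, map_smul, consL_single, smul_smul, pow_add]
    rw [List.length_cons, hIoo, shift, Finset.sum_congr rfl fun j _ => key j, ← Finset.smul_sum,
      ← map_sum, beadAfter]
    by_cases ha : a = m
    · subst ha
      rw [if_pos rfl, List.idxOf_cons_self, bead_false_eq_sum, Finset.range_eq_Ico]
    · have hu' : m ∈ u := by
        rcases List.mem_cons.1 hu with rfl | h
        · exact absurd rfl ha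
        · exact h
      rw [if_neg ha, List.idxOf_cons_ne _ ha, ih hu', hIoo]

theorem addWhite_ofWord {n : ℕ} {w : List ℕ} (hw : IsTopCactus n w) :
    addWhite 𝕜 (ofWord 𝕜 n (n - 2) w) =
      toSurj 𝕜 (n + 1) (n - 2 + 1) ((-1 : 𝕜) ^ n • ringL 𝕜 Symb.white n (Finsupp.single w 1)) := by
  have h : (show Surj n (n - 2) from ⟨w, hw.isSurj⟩) ∈ topOnce n (n - 2) :=
    ⟨hw.isCactus, hw.count_eq⟩
  have hn : n ∈ w := List.count_pos_iff.1 (by rw [hw.count_eq]; omega)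
  rw [ofWord_of_isSurj hw.isSurj, addWhite, Finsupp.linearCombination_single, one_smul, if_pos h]
  simp only [ringL, beadL_single, bead_eq_sum n n hn, map_smul, map_sum, toSurj_single,
    Finset.smul_sum, smul_smul, ← pow_add]
  refine Finset.sum_congr rfl fun j _ => ?_
  rw [← negOnePow_natCast_smul rfl]
  congr 1
  -- The degree is k = n - 2 while the sign on words uses n; the exponents differ by -2 = -1 + -1.
  rw [Int.negOnePow_eq_iff]
  exact ⟨-1, by push_cast; ring⟩

theorem addBlack_ofWord {n : ℕ} {w : List ℕ} (hw : IsTopCactus n w) :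
    addBlack 𝕜 (ofWord 𝕜 n (n - 2) w) =
      toSurj 𝕜 (n + 1) (n - 2 + 1) ((-1 : 𝕜) ^ n • ringL 𝕜 Symb.black n (Finsupp.single w 1)) := by
  have h : (show Surj n (n - 2) from ⟨w, hw.isSurj⟩) ∈ topOnce n (n - 2) :=
    ⟨hw.isCactus, hw.count_eq⟩
  have hn : n ∈ w := List.count_pos_iff.1 (by rw [hw.count_eq]; omega)
  rw [ofWord_of_isSurj hw.isSurj, addBlack, Finsupp.linearCombination_single, one_smul, if_pos h]
  simp only [ringL, LinearMap.neg_apply, beadAfterL_single, beadAfter_eq_sum n n hn, map_smul,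
    map_neg, map_sum, toSurj_single, smul_neg, Finset.smul_sum, smul_smul, ← pow_add]
  congr 1
  refine Finset.sum_congr rfl fun j _ => ?_
  rw [← negOnePow_natCast_smul rfl]
  congr 1
  rw [Int.negOnePow_eq_iff]
  exact ⟨-1, by push_cast; ring⟩

/-- The operations `□` and `■` on the span of the cacti. -/
noncomputable def addSymb (𝕜 : Type u) [CommRing 𝕜] (s : Symb) {n : ℕ} {k : ℤ} :
    SurjMod 𝕜 n k →ₗ[𝕜] SurjMod 𝕜 (n + 1) (k + 1) :=
  match s with
  | Symb.white => addWhite 𝕜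
  | Symb.black => addBlack 𝕜

theorem addSymb_cactusSum (s : Symb) {ξ : List Symb} {n : ℕ} {d : ℤ} (h : IsStr ξ n d) :
    toSurj 𝕜 (n + 1) (d + 1) (cactusSum 𝕜 (ξ ++ [s])) =
      addSymb 𝕜 s (toSurj 𝕜 n d (cactusSum 𝕜 ξ)) := by
  obtain ⟨hn, hl, rfl⟩ := h
  have hξ : ξ ≠ [] := by rintro rfl; simp at hl; omega
  rw [cactusSum_append hξ, hl]
  exact (Finsupp.map_eq_of_forall_support ((addSymb 𝕜 s).comp (toSurj 𝕜 n (n - 2)))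
    ((toSurj 𝕜 (n + 1) (n - 2 + 1)).comp ((-1 : 𝕜) ^ n • ringL 𝕜 s n)) (cactusSum 𝕜 ξ)
    (fun w hw => by
      have := isTopCactus_of_mem ξ w hw
      rw [hl] at this
      cases s
      · simpa [addSymb] using addWhite_ofWord this
      · simpa [addSymb] using addBlack_ofWord this)).symm

theorem cactusVal_cactusHom_mem {ξ : List Symb} {n : ℕ} {d : ℤ} (h : IsStr ξ n d) :
    cactusVal ((cactusHom 𝕜).map (mXi 𝕜 ξ h)) ∈ Finsupp.supported 𝕜 𝕜 (topOnce n d) := by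
  rw [cactusVal_cactusHom]
  refine toSurj_mem_supported fun w hw _ => ?_
  have := isTopCactus_of_mem ξ w hw
  rw [h.2.1] at this
  exact ⟨this.isCactus, this.count_eq⟩

/-- The formulas determine the values on generators by induction on the string, removing its last
symbol; a morphism out of a quasi-free operad is determined by these values. -/
theorem cactusHom_unique (f : DGOperadHom (matchingInfty 𝕜) (cactusOperad 𝕜))
    (hw : cactusVal (f.map (mXi 𝕜 [Symb.white] (isStr_singleton _))) = ofWord 𝕜 2 0 [2, 1])
    (hb : cactusVal (f.map (mXi 𝕜 [Symb.black] (isStr_singleton _))) = ofWord 𝕜 2 0 [1, 2])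
    (h : ∀ (ξ : List Symb) (n : ℕ) (d : ℤ) (h : IsStr ξ n d) (s : Symb),
      cactusVal (f.map (mXi 𝕜 (ξ ++ [s]) (isStr_append h _))) =
        addSymb 𝕜 s (cactusVal (f.map (mXi 𝕜 ξ h)))) : f = cactusHom 𝕜 := by
  have key : ∀ (ξ : List Symb) (n : ℕ) (d : ℤ) (h : IsStr ξ n d),
      cactusVal (f.map (mXi 𝕜 ξ h)) = toSurj 𝕜 n d (cactusSum 𝕜 ξ) := by
    intro ξ
    induction ξ using List.reverseRecOn with
    | nil =>
      intro n d h'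
      have := h'.1
      have := h'.2.1
      simp at this
      omega
    | append_singleton ξ s ih =>
      intro n d h'
      have hn := h'.1
      have hl := h'.2.1
      have hd := h'.2.2
      by_cases hξ : ξ = []
      · subst hξ
        obtain rfl : n = 2 := by simpa using hl.symm
        obtain rfl : d = 0 := by simpa using hd
        refine Eq.trans ?_ (toSurj_single (𝕜 := 𝕜) 2 0 (base s)).symm
        cases s
        · exact hw
        · exact hb
      · have hpos := List.length_pos_iff.2 hξ
        rw [List.length_append, List.length_singleton] at hl
        obtain ⟨n, rfl⟩ : ∃ n', n = n' + 1 := ⟨n - 1, by omega⟩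
        obtain ⟨d, rfl⟩ : ∃ d', d = d' + 1 := ⟨d - 1, by omega⟩
        have hs : IsStr ξ n d := ⟨by omega, by omega, by push_cast at hd; omega⟩
        rw [addSymb_cactusSum s hs, ← ih n d hs]
        exact h ξ n d hs s
  refine quasiFree_hom_ext fun n d x => cactusVal_injective ?_
  exact key x.1 n d x.2

end Words

/-! ## The composite `ψ` -/

namespace Words

/-- There is no subsequence `(i, j, i)` with `j = i + 1` or `j < i`. -/
def Avoids (w : List ℕ) : Prop := ∀ i j : ℕ, j = i + 1 ∨ j < i → ¬ [i, j, i].Sublist w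

theorem Avoids.sublist {w w' : List ℕ} (h : Avoids w) (hw : w'.Sublist w) : Avoids w' :=
  fun i j hij h' => h i j hij (h'.trans hw)

/-- If n occurred twice, the letter following the first of these would be some c < n by
non-degeneracy, giving the forbidden subsequence (n, c, n). -/
theorem count_top_of_avoids {n : ℕ} {w : List ℕ} (hc : w.IsChain (· ≠ ·)) (ha : Avoids w)
    (hn : n ∈ w) (hw : ∀ x ∈ w, x ≤ n) : w.count n = 1 := by
  obtain ⟨A, B, rfl⟩ := List.append_of_mem hn
  have key : ∀ C D : List ℕ, A ++ n :: B = C ++ n :: D → n ∉ D := by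
    intro C D h hD
    rw [h] at hc ha hw
    obtain ⟨E, F, rfl⟩ := List.append_of_mem hD
    rcases E with _ | ⟨c, E⟩
    · have := (List.isChain_append.1 hc).2.1
      simp at this
    · have h1 : n ≠ c := (List.isChain_cons_cons.1 (List.isChain_append.1 hc).2.1).1
      have h2 := hw c (by simp)
      refine ha n c (Or.inr (by omega)) (List.Sublist.trans ?_ (List.sublist_append_right C _))
      exact ((List.singleton_sublist.2 (by simp : n ∈ E ++ n :: F)).cons_cons c).cons_cons n
  have hA : n ∉ A := by
    intro h
    obtain ⟨E, F, rfl⟩ := List.append_of_mem h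
    exact key E (F ++ n :: B) (by simp) (by simp)
  simp [List.count_append, List.count_eq_zero_of_not_mem hA,
    List.count_eq_zero_of_not_mem (key A B rfl)]

/-- Deleting the single top letter leaves a non-degenerate word unless its two neighbours are equal.
-/
theorem exists_split_top {n : ℕ} {w : List ℕ} (hc : w.IsChain (· ≠ ·)) (ha : Avoids w)
    (hn : n ∈ w) (hw : ∀ x ∈ w, x ≤ n) :
    ∃ A B, w = A ++ n :: B ∧ n ∉ A ∧ n ∉ B ∧
      ((A ++ B).IsChain (· ≠ ·) ∨ ∃ A' a B', A = A' ++ [a] ∧ B = a :: B') := by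
  obtain ⟨A, B, rfl, hA, hB⟩ := exists_split_of_count (count_top_of_avoids hc ha hn hw)
  refine ⟨A, B, rfl, hA, hB, ?_⟩
  obtain ⟨h1, h2, -⟩ := List.isChain_append.1 hc
  rcases List.eq_nil_or_concat A with rfl | ⟨A', a, hA'⟩
  · exact Or.inl (List.IsChain.tail h2)
  · rw [List.concat_eq_append] at hA'
    subst hA'
    rcases B with _ | ⟨b, B'⟩
    · exact Or.inl (by simpa using h1)
    · by_cases hab : a = b
      · subst hab
        exact Or.inr ⟨A', a, B', rfl, rfl⟩
      · refine Or.inl (List.isChain_append.2 ⟨h1, List.IsChain.tail h2, ?_⟩)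
        simpa using hab

/-- Removing the top letter, together with one of its neighbours if they are equal, leaves a word of
the same kind on one letter fewer. So each new letter adds at most two to the length. The word (1)
exceeds the bound and is listed separately. -/
theorem length_le_of_avoids {n : ℕ} (hn : 1 ≤ n) {w : List ℕ} (hc : w.IsChain (· ≠ ·))
    (ha : Avoids w) (hw : ∀ x, x ∈ w ↔ 1 ≤ x ∧ x ≤ n) :
    w.length + 2 ≤ 2 * n ∨ n = 1 ∧ w.length = 1 := by
  induction n, hn using Nat.le_induction generalizing w with
  | base =>
    obtain ⟨A, B, rfl, hA, hB⟩ := exists_split_of_count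
      (count_top_of_avoids hc ha ((hw 1).2 (by omega)) fun x hx => ((hw x).1 hx).2)
    have h1 : ∀ C : List ℕ, (∀ x ∈ C, x ∈ A ++ 1 :: B) → 1 ∉ C → C = [] := by
      intro C hC h1
      refine List.eq_nil_iff_forall_not_mem.2 fun x hx => h1 ?_
      obtain rfl : x = 1 := by have := (hw x).1 (hC x hx); omega
      exact hx
    obtain rfl := h1 A (by simp +contextual) hA
    obtain rfl := h1 B (by simp +contextual) hB
    exact Or.inr ⟨rfl, rfl⟩
  | succ n hn ih =>
    obtain ⟨A, B, rfl, hA, hB, h⟩ := exists_split_top hc ha ((hw (n + 1)).2 (by omega))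
      fun x hx => ((hw x).1 hx).2
    have hAB : ∀ x, x ∈ A ++ B ↔ 1 ≤ x ∧ x ≤ n := by
      intro x
      have := hw x
      simp only [List.mem_append, List.mem_cons] at this ⊢
      by_cases hx : x = n + 1
      · subst hx; simp [hA, hB]
      · have : 1 ≤ x ∧ x ≤ n ↔ 1 ≤ x ∧ x ≤ n + 1 := by omega
        tauto
    have hsub : (A ++ B).Sublist (A ++ (n + 1) :: B) :=
      (List.Sublist.refl A).append (List.sublist_cons_self _ _)
    rcases h with h | ⟨A', a, B', rfl, rfl⟩
    · have := ih h (ha.sublist hsub) hAB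
      simp only [List.length_append, List.length_cons] at this ⊢
      omega
    · have e : A' ++ [a] ++ (n + 1) :: a :: B' = A' ++ a :: (n + 1) :: a :: B' := by simp
      have hsub' : (A' ++ a :: B').Sublist (A' ++ [a] ++ a :: B') := by
        rw [List.append_assoc]
        exact (List.Sublist.refl A').append (by simp)
      have hay : a ≠ n + 1 := by rintro rfl; simp at hA
      rw [e, isChain_bead hay] at hc
      have := ih hc (ha.sublist (hsub'.trans hsub)) (fun x => by rw [← hAB]; simp)
      simp only [List.length_append, List.length_cons, List.length_nil] at this ⊢
      rcases this with h | ⟨rfl, h⟩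
      · omega
      -- Only the exceptional word (1) could break the induction, but a bead on it gives (1, 2, 1),
      -- which is forbidden.
      · exfalso
        have h2 := (hAB a).1 (by simp)
        obtain rfl : a = 1 := by omega
        refine ha 1 2 (Or.inl rfl) ?_
        rw [e]
        exact List.Sublist.trans (by simp) (List.sublist_append_right A' _)

/-- The words in `C'_n`. -/
structure IsPrimeCactus (n : ℕ) (w : List ℕ) : Prop where
  isSurj : IsSurj n (n - 2) w
  isCactus : IsCactus w
  avoids : Avoids w

theorem IsPrimeCactus.isTopCactus {n : ℕ} {w : List ℕ} (h : IsPrimeCactus n w) :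
    IsTopCactus n w :=
  ⟨h.isSurj, h.isCactus, count_top_of_avoids h.isSurj.2.2.2 h.avoids
    ((h.isSurj.2.2.1 n).2 ⟨h.isSurj.1, le_rfl⟩) fun x hx => ((h.isSurj.2.2.1 x).1 hx).2⟩

/-- A forbidden subsequence (i, j, i) not already present involves the new letter. That letter
occurs once, so it is j, and j = i + 1 forces i = n; but n occurs only once, as a ≠ n. -/
theorem isPrimeCactus_bead {n a : ℕ} {A B : List ℕ} (ha : a ≠ n)
    (h : IsPrimeCactus n (A ++ a :: B)) : IsPrimeCactus (n + 1) (A ++ a :: (n + 1) :: a :: B) := by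
  have h1 := isTopCactus_bead h.isTopCactus
  refine ⟨h1.isSurj, h1.isCactus, fun i j hij hs => ?_⟩
  have hlet := fun x => (h1.isSurj.2.2.1 x).1
  have hi := hlet i (hs.subset (by simp))
  have hj := hlet j (hs.subset (by simp))
  have hcount := hs.count_le i
  rw [List.count_cons_self] at hcount
  have hij' : j ≠ i := by omega
  simp only [List.count_cons_of_ne hij', List.count_cons_self, List.count_nil] at hcount
  have hc1 := h1.count_eq
  have hi' : i ≠ n + 1 := by rintro rfl; omega
  have hny := not_mem_of_isGood h.isTopCactus.isGood
  have hay : a ≠ n + 1 := by rintro rfl; simp at hny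
  have hA : n + 1 ∉ A := fun h' => hny (by simp [h'])
  have hB : n + 1 ∉ B := fun h' => hny (by simp [h'])
  by_cases hj' : j = n + 1
  · obtain rfl : i = n := by omega
    have hc := h.isTopCactus.count_eq
    simp only [List.count_append, List.count_cons_of_ne ha, List.count_cons_of_ne
      (Nat.succ_ne_self i)] at hc hcount
    omega
  · exact h.avoids i j hij (sublist_of_sublist_bead hA hB hay (by simp [hij', hij'.symm])
      (by simp [Ne.symm hi', Ne.symm hj']) hs)

/-- The word has length 2n. If the neighbours of the top letter differed, deleting it would leave an
admissible word of length 2n - 1 on n letters, against the bound 2n - 2. Hence they are both some a,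
and a ≠ n because (n, n+1, n) is forbidden. -/
theorem IsPrimeCactus.exists_eq_bead {n : ℕ} (hn : 2 ≤ n) {w : List ℕ}
    (h : IsPrimeCactus (n + 1) w) :
    ∃ A a B, w = A ++ a :: (n + 1) :: a :: B ∧ a ≠ n ∧ IsPrimeCactus n (A ++ a :: B) := by
  obtain ⟨⟨-, hl, hw, hc⟩, hcac, ha⟩ := h
  obtain ⟨A, B, rfl, hA, hB, h⟩ := exists_split_top hc ha ((hw (n + 1)).2 (by omega))
    fun x hx => ((hw x).1 hx).2
  have hAB : ∀ x, x ∈ A ++ B ↔ 1 ≤ x ∧ x ≤ n := by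
    intro x
    have := hw x
    simp only [List.mem_append, List.mem_cons] at this ⊢
    by_cases hx : x = n + 1
    · subst hx; simp [hA, hB]
    · have : 1 ≤ x ∧ x ≤ n ↔ 1 ≤ x ∧ x ≤ n + 1 := by omega
      tauto
  have hsub : (A ++ B).Sublist (A ++ (n + 1) :: B) :=
    (List.Sublist.refl A).append (List.sublist_cons_self _ _)
  rcases h with h | ⟨A', a, B', rfl, rfl⟩
  · exfalso
    have := length_le_of_avoids (by omega) h (ha.sublist hsub) hAB
    simp only [List.length_append, List.length_cons] at this hl
    push_cast at hl
    omega
  · have e : A' ++ [a] ++ (n + 1) :: a :: B' = A' ++ a :: (n + 1) :: a :: B' := by simp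
    have hsub' : (A' ++ a :: B').Sublist (A' ++ [a] ++ (n + 1) :: a :: B') := by
      refine List.Sublist.trans ?_ hsub
      rw [List.append_assoc]
      exact (List.Sublist.refl A').append (by simp)
    have hay : a ≠ n + 1 := by rintro rfl; simp at hA
    refine ⟨A', a, B', e, ?_, ⟨by omega, ?_, fun x => by rw [← hAB]; simp, ?_⟩,
      hcac.sublist hsub', ha.sublist hsub'⟩
    · rintro rfl
      refine ha a (a + 1) (Or.inl rfl) ?_
      rw [e]
      exact List.Sublist.trans (by simp) (List.sublist_append_right A' _)
    · simp only [List.length_append, List.length_cons, List.length_nil] at hl ⊢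
      push_cast at hl ⊢
      omega
    · rwa [e, isChain_bead hay] at hc

theorem isPrimeCactus_two_iff {w : List ℕ} : IsPrimeCactus 2 w ↔ w = [2, 1] ∨ w = [1, 2] := by
  constructor
  · rintro ⟨⟨-, hl, hw, hc⟩, -, -⟩
    have hl2 : w.length = 2 := by push_cast at hl; omega
    obtain ⟨a, b, rfl⟩ := List.length_eq_two.1 hl2
    have ha := (hw a).1 (by simp)
    have hb := (hw b).1 (by simp)
    have hab : a ≠ b := by simpa using hc
    have : a = 2 ∧ b = 1 ∨ a = 1 ∧ b = 2 := by omega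
    simpa using this
  · have key : ∀ s, IsPrimeCactus 2 (base s) := fun s =>
      ⟨(isTopCactus_base s).isSurj, (isTopCactus_base s).isCactus, fun i j _ h => by
        have := h.length_le
        cases s <;> simp [base] at this⟩
    rintro (rfl | rfl)
    · exact key Symb.white
    · exact key Symb.black

/-! ### Coefficients -/

section

variable {𝕜 : Type u} [CommRing 𝕜]

theorem consL_apply_cons (x : ℕ) (S : List ℕ →₀ 𝕜) (w : List ℕ) :
    consL 𝕜 x S (x :: w) = S w :=
  Finsupp.mapDomain_apply (List.cons_injective) S w

variable {P : ℕ → Prop} [DecidablePred P] {y : ℕ}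

/-- The bead y occurs once, so its position and hence the word it was inserted into can be read off.
This excludes cancellations in ψ. -/
theorem split_bead_unique {A A' B B' : List ℕ} {a a' : ℕ} (hA : y ∉ A) (ha : a ≠ y) (hB : y ∉ B)
    (h : A ++ a :: y :: a :: B = A' ++ a' :: y :: a' :: B') : A = A' ∧ a = a' ∧ B = B' := by
  have e : ∀ (A B : List ℕ) (a : ℕ), A ++ a :: y :: a :: B = (A ++ [a]) ++ y :: (a :: B) := by
    simp
  rw [e, e, List.append_cons_inj_of_notMem (by simp [hA, ha.symm]) (by simp [hB, ha.symm])] at h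
  obtain ⟨h1, -, h2⟩ := h
  obtain ⟨rfl, h3⟩ := List.append_inj' h1 rfl
  simp_all

section

variable {A B u : List ℕ} {a : ℕ} (hyA : y ∉ A) (hya : a ≠ y) (hyB : y ∉ B)
include hyA hya hyB

theorem eq_of_bead_apply_ne_zero (h : bead 𝕜 P y u (A ++ a :: y :: a :: B) ≠ 0) :
    u = A ++ a :: B ∧ ∀ x ∈ A, ¬ P x := by
  obtain ⟨A', a', B', rfl, hw, ha, hA⟩ := exists_of_mem_bead (Finsupp.mem_support_iff.2 h)
  obtain ⟨rfl, rfl, rfl⟩ := split_bead_unique hyA hya hyB hw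
  exact ⟨rfl, hA⟩

theorem eq_of_beadAfter_apply_ne_zero (h : beadAfter 𝕜 P y u (A ++ a :: y :: a :: B) ≠ 0) :
    u = A ++ a :: B ∧ ∃ x ∈ A, P x := by
  obtain ⟨A', a', B', rfl, hw, hA⟩ := exists_of_mem_beadAfter (Finsupp.mem_support_iff.2 h)
  obtain ⟨rfl, rfl, rfl⟩ := split_bead_unique hyA hya hyB hw
  exact ⟨rfl, hA⟩

theorem bead_apply (hA : ∀ x ∈ A, ¬ P x) (ha : ¬ P a) :
    ∃ e : ℕ, bead 𝕜 P y (A ++ a :: B) (A ++ a :: y :: a :: B) = (-1) ^ e := by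
  induction A with
  | nil =>
    refine ⟨0, ?_⟩
    have : bead 𝕜 P y B (y :: a :: B) = 0 := by
      by_contra h
      obtain ⟨A', a', B', hB, hw, -⟩ := exists_of_mem_bead (Finsupp.mem_support_iff.2 h)
      rcases A' with _ | ⟨c, A'⟩
      · simp only [List.nil_append, List.cons.injEq] at hw
        exact hyB (by rw [hB, hw.1]; simp)
      · simp only [List.cons_append, List.cons.injEq] at hw
        exact hyB (by rw [hB, hw.1]; simp)
    rw [List.nil_append, List.nil_append, bead_cons_of_not ha, Finsupp.add_apply,
      Finsupp.single_eq_same, Finsupp.smul_apply, consL_apply_cons, this]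
    simp
  | cons x A ih =>
    have hyA' : y ∉ A := fun h => hyA (by simp [h])
    obtain ⟨e, he⟩ := ih hyA' fun z hz => hA z (by simp [hz])
    refine ⟨rep x (A ++ a :: B) + e, ?_⟩
    rw [List.cons_append, List.cons_append, bead_cons_of_not (hA x (by simp)), Finsupp.add_apply,
      Finsupp.smul_apply, consL_apply_cons, he, Finsupp.single_apply, if_neg, zero_add, smul_eq_mul,
      pow_add]
    intro h
    rcases A with _ | ⟨c, A⟩
    · simp only [List.cons.injEq, List.nil_append] at h
      exact hya h.2.1.symm
    · simp only [List.cons.injEq, List.cons_append] at h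
      exact hyA' (by rw [h.2.1]; simp)

theorem beadAfter_apply (hA : ∃ x ∈ A, P x) :
    ∃ e : ℕ, beadAfter 𝕜 P y (A ++ a :: B) (A ++ a :: y :: a :: B) = (-1) ^ e := by
  induction A with
  | nil => simp at hA
  | cons x A ih =>
    have hyA' : y ∉ A := fun h => hyA (by simp [h])
    obtain ⟨e, he⟩ : ∃ e : ℕ, (if P x then bead 𝕜 (fun _ => False) y (A ++ a :: B) else
        beadAfter 𝕜 P y (A ++ a :: B)) (A ++ a :: y :: a :: B) = (-1) ^ e := by
      split_ifs with hx
      · exact bead_apply hyA' hya hyB (by simp) (by simp)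
      · refine ih hyA' ?_
        obtain ⟨z, hz, hPz⟩ := hA
        rcases List.mem_cons.1 hz with rfl | hz
        · exact absurd hPz hx
        · exact ⟨z, hz, hPz⟩
    refine ⟨rep x (A ++ a :: B) + e, ?_⟩
    rw [List.cons_append, List.cons_append, beadAfter, Finsupp.smul_apply, consL_apply_cons, he,
      smul_eq_mul, pow_add]

end

variable (𝕜) in
/-- The sum of the unsigned operations `□` and `■` on words. -/
noncomputable def ringSumL (n : ℕ) : (List ℕ →₀ 𝕜) →ₗ[𝕜] (List ℕ →₀ 𝕜) :=
  ringL 𝕜 Symb.white n + ringL 𝕜 Symb.black n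

/-- A beaded word has a unique parent, and exactly one of the two operations produces it from there:
■ if n lies in A, and □ otherwise, because a ≠ n. -/
theorem ringSumL_apply {n a : ℕ} {A B : List ℕ} (hA : n + 1 ∉ A) (ha : a ≠ n + 1) (hB : n + 1 ∉ B)
    (han : a ≠ n) (T : List ℕ →₀ 𝕜) :
    ∃ e : ℕ, ringSumL 𝕜 n T (A ++ a :: (n + 1) :: a :: B) = (-1) ^ e * T (A ++ a :: B) := by
  have hsingle : ∀ u : List ℕ, ringSumL 𝕜 n (Finsupp.single u 1) =
      bead 𝕜 (· = n) (n + 1) u - beadAfter 𝕜 (· = n) (n + 1) u := fun u => by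
    simp [ringSumL, ringL, sub_eq_add_neg]
  have h0 : ∀ u, u ≠ A ++ a :: B →
      ringSumL 𝕜 n (Finsupp.single u 1) (A ++ a :: (n + 1) :: a :: B) = 0 := by
    intro u hu
    rw [hsingle, Finsupp.sub_apply]
    have h1 : bead 𝕜 (· = n) (n + 1) u (A ++ a :: (n + 1) :: a :: B) = 0 :=
      by_contra fun h => hu (eq_of_bead_apply_ne_zero hA ha hB h).1
    have h2 : beadAfter 𝕜 (· = n) (n + 1) u (A ++ a :: (n + 1) :: a :: B) = 0 :=
      by_contra fun h => hu (eq_of_beadAfter_apply_ne_zero hA ha hB h).1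
    rw [h1, h2, sub_zero]
  obtain ⟨e, he⟩ : ∃ e : ℕ, ringSumL 𝕜 n (Finsupp.single (A ++ a :: B) 1)
      (A ++ a :: (n + 1) :: a :: B) = (-1) ^ e := by
    rw [hsingle, Finsupp.sub_apply]
    by_cases hn : n ∈ A
    · obtain ⟨e, he⟩ := beadAfter_apply (𝕜 := 𝕜) (P := (· = n)) hA ha hB ⟨n, hn, rfl⟩
      have h1 : bead 𝕜 (· = n) (n + 1) (A ++ a :: B) (A ++ a :: (n + 1) :: a :: B) = 0 :=
        by_contra fun h => (eq_of_bead_apply_ne_zero hA ha hB h).2 n hn rfl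
      exact ⟨e + 1, by rw [he, h1, pow_succ]; ring⟩
    · obtain ⟨e, he⟩ := bead_apply (𝕜 := 𝕜) (P := (· = n)) hA ha hB
        (fun x hx h => hn (h ▸ hx)) han
      have h1 : beadAfter 𝕜 (· = n) (n + 1) (A ++ a :: B) (A ++ a :: (n + 1) :: a :: B) = 0 :=
        by_contra fun h => by
          obtain ⟨x, hx, rfl⟩ := (eq_of_beadAfter_apply_ne_zero hA ha hB h).2
          exact hn hx
      exact ⟨e, by rw [he, h1, sub_zero]⟩
  refine ⟨e, ?_⟩
  have := Finsupp.map_eq_of_forall_support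
    ((Finsupp.lapply (A ++ a :: (n + 1) :: a :: B)).comp (ringSumL 𝕜 n))
    ((-1 : 𝕜) ^ e • Finsupp.lapply (A ++ a :: B)) T (fun u _ => by
      by_cases hu : u = A ++ a :: B
      · subst hu
        simp [he]
      · simp [h0 u hu, hu])
  simpa using this

/-! ### The sum of all `μ(m_ξ)` -/

open StrOp

theorem sum_strings_succ {M : Type*} [AddCommMonoid M] (N : ℕ) (F : List Symb → M) :
    ∑ ξ ∈ strings Symb (N + 1), F ξ =
      ∑ ξ ∈ strings Symb N, (F (ξ ++ [Symb.white]) + F (ξ ++ [Symb.black])) := by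
  have h : ∀ ξ, F (ξ ++ [Symb.white]) + F (ξ ++ [Symb.black]) = ∑ s : Symb, F (ξ ++ [s]) :=
    fun ξ => by simp [Finset.univ, Fintype.elems]
  simp only [h]
  rw [← Finset.sum_product']
  symm
  refine Finset.sum_bij (fun p _ => p.1 ++ [p.2]) ?_ ?_ ?_ (fun _ _ => rfl)
  · intro p hp
    rw [mem_strings, List.length_append, List.length_singleton,
      mem_strings.1 (Finset.mem_product.1 hp).1]
  · rintro ⟨ξ, s⟩ - ⟨ξ', s'⟩ - h
    have := List.append_inj' h rfl
    simp_all
  · intro ξ hξ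
    rw [mem_strings] at hξ
    rcases List.eq_nil_or_concat ξ with rfl | ⟨η, s, rfl⟩
    · simp at hξ
    · rw [List.concat_eq_append] at *
      exact ⟨(η, s), by simp [mem_strings] at hξ ⊢; exact hξ, rfl⟩

theorem strings_zero : strings Symb 0 = {[]} := by
  ext ξ
  simp [mem_strings]

variable (𝕜) in
/-- The sum of the `μ(m_ξ)` over the strings `ξ` of length `N`. -/
noncomputable def cactusTotal (N : ℕ) : List ℕ →₀ 𝕜 := ∑ ξ ∈ strings Symb N, cactusSum 𝕜 ξ

theorem cactusTotal_one :
    cactusTotal 𝕜 1 = Finsupp.single [2, 1] 1 + Finsupp.single [1, 2] 1 := by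
  rw [cactusTotal, sum_strings_succ, strings_zero, Finset.sum_singleton]
  rfl

theorem cactusTotal_succ (N : ℕ) :
    cactusTotal 𝕜 (N + 2) = (-1 : 𝕜) ^ (N + 2) • ringSumL 𝕜 (N + 2) (cactusTotal 𝕜 (N + 1)) := by
  rw [cactusTotal, sum_strings_succ, cactusTotal, map_sum, Finset.smul_sum]
  refine Finset.sum_congr rfl fun ξ hξ => ?_
  have hl := mem_strings.1 hξ
  have hne : ξ ≠ [] := by rintro rfl; simp at hl
  rw [cactusSum_append hne, cactusSum_append hne, hl, ringSumL, LinearMap.add_apply, smul_add]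

theorem count_of_mem_cactusTotal {N : ℕ} {w : List ℕ} (hw : w ∈ (cactusTotal 𝕜 N).support) :
    w.count (N + 1) = 1 := by
  obtain ⟨ξ, hξ, hw⟩ := Finset.mem_biUnion.1 (Finsupp.support_finsetSum hw)
  have := (isTopCactus_of_mem ξ w hw).count_eq
  rwa [mem_strings.1 hξ] at this

/-- By `ringSumL_apply` the coefficient of a bead is, up to sign, the coefficient of its parent.
Beads on words of C'_n belong to C'_{n+1} and every word of C'_{n+1} is of this form, so both claims
pass from one arity to the next. -/
theorem cactusTotal_apply (N : ℕ) (w : List ℕ) :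
    (IsPrimeCactus (N + 2) w → ∃ e : ℕ, cactusTotal 𝕜 (N + 1) w = (-1) ^ e) ∧
      (¬ IsPrimeCactus (N + 2) w → cactusTotal 𝕜 (N + 1) w = 0) := by
  induction N generalizing w with
  | zero =>
    rw [zero_add, zero_add, cactusTotal_one, isPrimeCactus_two_iff]
    constructor
    · rintro (rfl | rfl) <;> exact ⟨0, by simp⟩
    · intro h
      rw [not_or] at h
      simp [Ne.symm h.1, Ne.symm h.2]
  | succ N ih =>
    rw [cactusTotal_succ]
    constructor
    · intro h
      obtain ⟨A, a, B, rfl, ha, hu⟩ := h.exists_eq_bead (by omega)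
      obtain ⟨e, he⟩ := (ih _).1 hu
      have hny := not_mem_of_isGood hu.isTopCactus.isGood
      obtain ⟨e', he'⟩ := ringSumL_apply (𝕜 := 𝕜) (n := N + 2) (A := A) (B := B) (a := a)
        (fun h' => hny (by simp [h'])) (fun h' => hny (by simp [h']))
        (fun h' => hny (by simp [h'])) ha (cactusTotal 𝕜 (N + 1))
      refine ⟨N + 2 + (e' + e), ?_⟩
      rw [Finsupp.smul_apply, smul_eq_mul, pow_add _ (N + 2), pow_add _ e', ← he, ← he']
    · intro h
      by_contra h0
      rw [Finsupp.smul_apply] at h0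
      have h1 : ringSumL 𝕜 (N + 2) (cactusTotal 𝕜 (N + 1)) w ≠ 0 := fun h => h0 (by simp [h])
      obtain ⟨A, a, B, hu, rfl, ha⟩ : ∃ A a B, A ++ a :: B ∈ (cactusTotal 𝕜 (N + 1)).support ∧
          w = A ++ a :: (N + 2 + 1) :: a :: B ∧ a ≠ N + 2 := by
        rcases mem_support_add (Finsupp.mem_support_iff.2 h1) with h2 | h2
        · exact exists_of_mem_ringL (fun u hu => count_of_mem_cactusTotal hu) h2
        · exact exists_of_mem_ringL (fun u hu => count_of_mem_cactusTotal hu) h2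
      refine h (isPrimeCactus_bead ha ?_)
      by_contra hp
      exact Finsupp.mem_support_iff.1 hu ((ih _).2 hp)

theorem toSurj_apply {n : ℕ} {k : ℤ} (S : List ℕ →₀ 𝕜) (u : Surj n k) :
    toSurj 𝕜 n k S u = S u.1 := by
  classical
  have := Finsupp.map_eq_of_forall_support ((Finsupp.lapply u).comp (toSurj 𝕜 n k))
    (Finsupp.lapply u.1) S (fun w _ => by
      simp only [LinearMap.comp_apply, toSurj_single, Finsupp.lapply_apply]
      by_cases h : IsSurj n k w
      · rw [ofWord_of_isSurj h, Finsupp.single_apply, Finsupp.single_apply]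
        by_cases e : w = u.1
        · exact (if_pos (Subtype.ext e)).trans (if_pos e).symm
        · exact (if_neg (fun e' : (⟨w, h⟩ : {v // IsSurj n k v}) = u =>
            e (congrArg Subtype.val e'))).trans (if_neg e).symm
      · rw [ofWord_of_not h, Finsupp.single_apply, if_neg]
        · rfl
        · rintro rfl
          exact h u.2)
  simpa using this

theorem cactusVal_psi {n : ℕ} (hn : 2 ≤ n) :
    cactusVal (((cactusHom 𝕜).comp (diagonalHom 𝕜)).map (mN 𝕜 hn)) =
      toSurj 𝕜 n (n - 2) (cactusTotal 𝕜 (n - 1)) := by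
  have h1 : ((cactusHom 𝕜).comp (diagonalHom 𝕜)).map (mN 𝕜 hn) =
      (cactusHom 𝕜).map ((diagonalHom 𝕜).map (mN 𝕜 hn)) := rfl
  rw [h1, diagonalHom_mN, map_sum, cactusVal_sum, cactusTotal, map_sum, strings,
    Finset.sum_image fun _ _ _ _ h => List.ofFn_injective h]
  rfl

open Classical in
variable (𝕜) in
/-- The exponent of the sign of a word in `ψ(m_n)`. -/
noncomputable def psiExp (w : List ℕ) : ℕ :=
  if h : ∃ e : ℕ, cactusTotal 𝕜 (w.toFinset.card - 1) w = (-1) ^ e then h.choose else 0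

theorem cactusVal_psi_eq_sum {n : ℕ} (hn : 2 ≤ n) :
    cactusVal (((cactusHom 𝕜).comp (diagonalHom 𝕜)).map (mN 𝕜 hn)) =
      ∑ u ∈ (Set.toFinite (cactiPrime n)).toFinset,
        Finsupp.single u ((-1 : 𝕜) ^ psiExp 𝕜 u.1) := by
  classical
  rw [cactusVal_psi hn]
  ext u
  rw [toSurj_apply, Finsupp.finsetSum_apply]
  simp only [Finsupp.single_apply]
  rw [Finset.sum_ite_eq']
  obtain ⟨N, rfl⟩ := Nat.exists_eq_add_of_le' hn
  -- The exponent is a function of the word alone and must recover the arity, which is the number of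
  -- distinct letters. Its value is obtained by choice from the existence statement in
  -- `cactusTotal_apply`.
  have hcard : u.1.toFinset.card - 1 = N + 1 := by
    have : u.1.toFinset = Finset.Icc 1 (N + 2) := by ext x; simp [u.2.2.2.1]
    rw [this, Nat.card_Icc]
    omega
  have hiff : u ∈ (Set.toFinite (cactiPrime (N + 2))).toFinset ↔ IsPrimeCactus (N + 2) u.1 := by
    rw [Set.Finite.mem_toFinset]
    exact ⟨fun h => ⟨u.2, h.1, h.2⟩, fun h => ⟨h.isCactus, h.avoids⟩⟩
  split_ifs with h
  · have he := (cactusTotal_apply (𝕜 := 𝕜) N u.1).1 (hiff.1 h)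
    rw [← hcard] at he
    rw [psiExp, dif_pos he, ← he.choose_spec, hcard]
    rfl
  · exact (cactusTotal_apply (𝕜 := 𝕜) N u.1).2 (mt hiff.2 h)

end

end Words

/-- `C` denotes the operad of spineless cacti `cactusOperad 𝕜`, a suboperad of the surjection
operad; `cactusVal` is the inclusion of its elements into the span of all surjections. -/
theorem theorem2 (𝕜 : Type u) [CommRing 𝕜] :
    -- the structures involved are dg operads
    IsDGOperad (matchingInfty 𝕜) ∧ IsDGOperad (assocInfty 𝕜) ∧ IsDGOperad (cactusOperad 𝕜) ∧
    -- the morphism `μ`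
    ∃ μ : DGOperadHom (matchingInfty 𝕜) (cactusOperad 𝕜),
      (cactusVal (μ.map (mXi 𝕜 [Symb.white] (isStr_singleton _))) = ofWord 𝕜 2 0 [2, 1] ∧
        cactusVal (μ.map (mXi 𝕜 [Symb.black] (isStr_singleton _))) = ofWord 𝕜 2 0 [1, 2] ∧
        ∀ (ξ : List Symb) (n : ℕ) (d : ℤ) (h : IsStr ξ n d),
          -- `μ(m_ξ)` is in the domain of the operations `□` and `■`
          cactusVal (μ.map (mXi 𝕜 ξ h)) ∈ Finsupp.supported 𝕜 𝕜 (topOnce n d) ∧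
          cactusVal (μ.map (mXi 𝕜 (ξ ++ [Symb.white]) (isStr_append h _))) =
            addWhite 𝕜 (cactusVal (μ.map (mXi 𝕜 ξ h))) ∧
          cactusVal (μ.map (mXi 𝕜 (ξ ++ [Symb.black]) (isStr_append h _))) =
            addBlack 𝕜 (cactusVal (μ.map (mXi 𝕜 ξ h)))) ∧
      -- `μ` is determined by these formulas
      (∀ μ' : DGOperadHom (matchingInfty 𝕜) (cactusOperad 𝕜),
        cactusVal (μ'.map (mXi 𝕜 [Symb.white] (isStr_singleton _))) = ofWord 𝕜 2 0 [2, 1] →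
        cactusVal (μ'.map (mXi 𝕜 [Symb.black] (isStr_singleton _))) = ofWord 𝕜 2 0 [1, 2] →
        (∀ (ξ : List Symb) (n : ℕ) (d : ℤ) (h : IsStr ξ n d),
          cactusVal (μ'.map (mXi 𝕜 (ξ ++ [Symb.white]) (isStr_append h _))) =
            addWhite 𝕜 (cactusVal (μ'.map (mXi 𝕜 ξ h))) ∧
          cactusVal (μ'.map (mXi 𝕜 (ξ ++ [Symb.black]) (isStr_append h _))) =
            addBlack 𝕜 (cactusVal (μ'.map (mXi 𝕜 ξ h)))) →
        μ' = μ) ∧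
      -- the morphism `φ`, and the composite `ψ = μ ∘ φ`
      ∃ φ : DGOperadHom (assocInfty 𝕜) (matchingInfty 𝕜),
        (∀ (n : ℕ) (hn : 2 ≤ n),
          φ.map (mN 𝕜 hn) =
            ∑ ξ : Fin (n - 1) → Symb, mXi 𝕜 (List.ofFn ξ) (isStr_ofFn hn ξ)) ∧
        cactusVal ((μ.comp φ).map (mN 𝕜 (le_refl 2))) =
          ofWord 𝕜 2 _ [2, 1] + ofWord 𝕜 2 _ [1, 2] ∧
        ∃ p : List ℕ → ℕ, ∀ (n : ℕ) (hn : 3 ≤ n),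
          cactusVal ((μ.comp φ).map (mN 𝕜 (le_trans (by decide) hn))) =
            ∑ u ∈ (Set.toFinite (cactiPrime n)).toFinset,
              Finsupp.single u ((-1 : 𝕜) ^ p u.1) := by
  refine ⟨StrOp.isDGOperad_strOperad 𝕜 Symb, StrOp.isDGOperad_strOperad 𝕜 Unit,
    isDGOperad_cactusOperad 𝕜, Words.cactusHom 𝕜,
    ⟨?_, ?_, fun ξ n d h => ⟨Words.cactusVal_cactusHom_mem h,
      Words.addSymb_cactusSum Symb.white h, Words.addSymb_cactusSum Symb.black h⟩⟩,
    fun f hw hb h => Words.cactusHom_unique f hw hb fun ξ n d h' s => ?_,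
    diagonalHom 𝕜, fun n hn => diagonalHom_mN 𝕜 hn, ?_, Words.psiExp 𝕜,
    fun n hn => Words.cactusVal_psi_eq_sum _⟩
  · rw [Words.cactusVal_cactusHom, Words.cactusSum_singleton, Words.toSurj_single]
    rfl
  · rw [Words.cactusVal_cactusHom, Words.cactusSum_singleton, Words.toSurj_single]
    rfl
  · cases s
    · exact (h ξ n d h').1
    · exact (h ξ n d h').2
  · rw [Words.cactusVal_psi, Words.cactusTotal_one, map_add, Words.toSurj_single,
      Words.toSurj_single]
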